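/- Let $\mathfrak g$ be a finite-dimensional simple complex Lie algebra with Cartan subalgebra $\mathfrak h$, a choice of simple roots, positive roots $\Delta_+=\{\beta_1,\dots,\beta_s\}$ (in any order), and non-zero root vectors $e_\alpha\in\mathfrak g_\alpha$ ($\alpha\in\Delta_+$). Let $N_+$ be the unipotent group of $\mathfrak n_+=\bigoplus_{\alpha\in\Delta_+}\mathfrak g_\alpha$, with coordinates $x=(x^\alpha)_{\alpha\in\Delta_+}\mapsto \exp(x^{\beta_1}e_{\beta_1})\cdots\exp(x^{\beta_s}e_{\beta_s})$, and let $$S_\alpha=\sum_{\beta\in\Delta_+}S_\alpha^\beta(x)\,\frac{\partial}{\partial x^\beta},\qquad (S_\alpha P)(a)=\frac{d}{dr}\Big|_{r=0}P(\exp(-re_\alpha)\,a),$$ be the polynomial vector field on $N_+$ given by the infinitesimal left action of $e_\alpha$. Let $\beta_\alpha[n],\gamma^\alpha[n]$ ($\alpha\in\Delta_+$, $n\in\mathbb Z$) be the bosonic ghosts, $[\beta_\alpha[m],\gamma^{\alpha'}[n]]=\delta_{\alpha,\alpha'}\delta_{m+n,0}$ (all other commutators being $0$), let $\mathcal F$ be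 their Fock space, generated by a vacuum annihilated by $\beta_\alpha[n]$ ($n\ge 0$) and $\gamma^\alpha[n]$ ($n>0$), and put $\beta_\alpha(z)=\sum_n z^{-n-1}\beta_\alpha[n]$, $\gamma^\alpha(z)=\sum_n z^{-n}\gamma^\alpha[n]$, $S_\alpha(z)=\sum_\beta {:}S_\alpha^\beta(\gamma(z))\,\beta_\beta(z){:}$. For $q\in\mathbb C$ with $0<|q|<1$ and $H\in\mathfrak h$ put $\langle A\rangle=\operatorname{Tr}_{\mathcal F}(A\,q^{T[0]}e^{H[0]})$, where $T[0]$ and $H[0]$ are the zero modes (the coefficients of $z^{-2}$ and of $z^{-1}$) of $\sum_\alpha{:}\partial\gamma^\alpha(z)\beta_\alpha(z){:}$ and of $-\sum_\alpha\alpha(H){:}\gamma^\alpha(z)\beta_\alpha(z){:}$. For $c\in\mathbb C$ with $e^{c}\notin q^{\mathbb Z}$ let $$w_c(w,z)=\frac{\theta_{11}'(1;q)}{\theta_{11}(e^{-c};q)}\,\frac{\theta_{11}(e^{-c}z/w;q)}{w\,\theta_{11}(z/w;q)},\qquad \theta_{11}(e^{2\pi i x};e^{2\pi i\tau})=\sum_{n\in\mathbb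 Z}e^{\pi i(n+1/2)^2\tau+2\pi i(n+1/2)(x+1/2)},$$ where $\theta_{11}'(z;q)=\frac{d}{dz}\theta_{11}(z;q)$. Then for every polynomial $P\in\mathbb C[x^\alpha;\alpha\in\Delta_+]$, every $m\ge 0$ and all positive roots $\alpha(1),\dots,\alpha(m)$ such that $e^{\sum_{i\in I}\alpha(i)(H)}\notin q^{\mathbb Z}$ for every non-empty $I\subseteq\{1,\dots,m\}$ (so that all kernels below are defined), $$\langle P(\gamma(z))\,S_{\alpha(1)}(t_1)\cdots S_{\alpha(m)}(t_m)\rangle=\sum_{\sigma\in\mathfrak S_m}\ \prod_{j=1}^{m}\bigl(-w_{c_{\sigma,j}}(t_{\sigma(j)},t_{\sigma(j+1)})\bigr)\cdot\langle (S_{\alpha(\sigma(1))}\cdots S_{\alpha(\sigma(m))}P)(\gamma(z))\rangle,$$ where $t_{\sigma(m+1)}:=z$ and $c_{\sigma,j}=\bigl(\alpha(\sigma(1))+\cdots+\alpha(\sigma(j))\bigr)(H)$. The identity holds in the following two senses. (1) If $z\ne 0$, $|qz|<|t_m|<\cdots<|t_1|<|z|$ (no condition on the $t_i$ when $m=0$)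 and $|q|<|e^{-\alpha(H)}|<1$ for all $\alpha\in\Delta_+$, then all the traces, expanded into modes of the fields and diagonal matrix coefficients, converge absolutely, and the identity holds. (2) It persists under analytic continuation: let $(q,H,z,t)$ depend holomorphically on a point of a connected open subset $U$ of a complex normed space, such that everywhere on $U$ one has $0<|q|<1$, the points $t_1,\dots,t_m,z$ are non-zero and pairwise distinct modulo $q^{\mathbb Z}$, and the above condition on the $\alpha(i)(H)$ holds; let $F$ and $G_\sigma$ ($\sigma\in\mathfrak S_m$) be holomorphic functions on $U$ that coincide with the correlators on the left and on the right, respectively, near a point of $U$ whose parameters satisfy the conditions in (1). Then the identity, with the correlators replaced by $F$ and $G_\sigma$, holds on all of $U$. -/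

import Mathlib

open scoped Topology
open MvPolynomial

noncomputable section

/-! ### The bosonic ghost system

`Δ` is the (finite) set of positive roots. The Fock space is realised as the polynomial ring in
the creation operators: the variable `Sum.inl (a, n)` is `γ^a[-n]` (`n ≥ 0`) and the variable
`Sum.inr (a, n)` is `β_a[-n-1]` (`n ≥ 0`); the vacuum vector is `1`. -/

abbrev GhostOsc (Δ : Type*) : Type _ := (Δ × ℕ) ⊕ (Δ × ℕ)

abbrev GhostFock (Δ : Type*) : Type _ := MvPolynomial (GhostOsc Δ) ℂ

/-- Multiplication by a creation operator. -/
def ghostCreate {Δ : Type*} (o : GhostOsc Δ) : Module.End ℂ (GhostFock Δ) :=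
  LinearMap.mulLeft ℂ (X o)

/-- Partial derivative with respect to a creation operator. -/
def ghostDeriv {Δ : Type*} (o : GhostOsc Δ) : Module.End ℂ (GhostFock Δ) :=
  (pderiv o : Derivation ℂ (GhostFock Δ) (GhostFock Δ)).toLinearMap

/-- The operator `γ^a[n]` on the Fock space. -/
def ghostGamma {Δ : Type*} (a : Δ) (n : ℤ) : Module.End ℂ (GhostFock Δ) :=
  if 0 < n then -ghostDeriv (Sum.inr (a, (n - 1).toNat))
  else ghostCreate (Sum.inl (a, (-n).toNat))

/-- The operator `β_a[n]` on the Fock space. -/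
def ghostBeta {Δ : Type*} (a : Δ) (n : ℤ) : Module.End ℂ (GhostFock Δ) :=
  if 0 ≤ n then ghostDeriv (Sum.inl (a, n.toNat))
  else ghostCreate (Sum.inr (a, (-n - 1).toNat))

/-- Modes of the elementary fields: `Sum.inl a` stands for `γ^a`, `Sum.inr a` for `β_a`. -/
def ghostMode {Δ : Type*} : Δ ⊕ Δ → ℤ → Module.End ℂ (GhostFock Δ)
  | Sum.inl a, n => ghostGamma a n
  | Sum.inr a, n => ghostBeta a n

/-- Whether the mode annihilates the vacuum: `γ^a[n]` with `n > 0`, `β_a[n]` with `n ≥ 0`. -/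
def isAnnihilation {Δ : Type*} : Δ ⊕ Δ → ℤ → Bool
  | Sum.inl _, n => decide (0 < n)
  | Sum.inr _, n => decide (0 ≤ n)

/-- The conformal spin `h` of `x(z) = ∑ n, z ^ (-n - h) x[n]`. -/
def ghostSpin {Δ : Type*} : Δ ⊕ Δ → ℤ
  | Sum.inl _ => 0
  | Sum.inr _ => 1

/-- The normal ordered product of a list of modes: annihilation operators to the right. -/
def normalOrdered {Δ : Type*} (L : List ((Δ ⊕ Δ) × ℤ)) : Module.End ℂ (GhostFock Δ) :=
  ((L.filter (fun p => !isAnnihilation p.1 p.2) ++ L.filter (fun p => isAnnihilation p.1 p.2)).map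
    (fun p => ghostMode p.1 p.2)).prod

/-- The coefficient of `z ^ (-N)` in the normal ordered product of the fields in the list `L`,
applied to `v`. For fixed `v` only finitely many terms of the sum are non-zero. -/
def normalOrderedMode {Δ : Type*} (L : List (Δ ⊕ Δ)) (N : ℤ) (v : GhostFock Δ) : GhostFock Δ :=
  ∑ᶠ n : {n : Fin L.length → ℤ // ∑ i, (n i + ghostSpin (L.get i)) = N},
    normalOrdered (List.ofFn fun i => (L.get i, n.1 i)) v

/-- For a symbol `F(x, ξ)` (with `x_a = X (Sum.inl a)`, `ξ_a = X (Sum.inr a)`), the coefficient of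
`z ^ (-N)` in the normal ordered field `:F(γ(z), β(z)):`, applied to `v`. -/
def fieldMode {Δ : Type*} (F : MvPolynomial (Δ ⊕ Δ) ℂ) (N : ℤ) (v : GhostFock Δ) : GhostFock Δ :=
  ∑ d ∈ F.support, F.coeff d • normalOrderedMode (Finsupp.toMultiset d).toList N v

/-- The zero mode of `∑_a :∂γ^a(z) β_a(z):`. -/
def ghostT0 {Δ : Type*} (v : GhostFock Δ) : GhostFock Δ :=
  ∑ᶠ p : Δ × ℤ, (-(p.2 : ℂ)) • normalOrdered [(Sum.inl p.1, p.2), (Sum.inr p.1, -p.2)] v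

/-- The zero mode of `-∑_a c_a :γ^a(z) β_a(z):`, where `c_a = a(H)`. -/
def ghostH0 {Δ : Type*} (c : Δ → ℂ) (v : GhostFock Δ) : GhostFock Δ :=
  ∑ᶠ p : Δ × ℤ, (-c p.1) • normalOrdered [(Sum.inl p.1, p.2), (Sum.inr p.1, -p.2)] v

/-- Eigenvalue of `ghostT0` on a monomial. -/
def ghostEnergy {Δ : Type*} (d : GhostOsc Δ →₀ ℕ) : ℕ :=
  d.sum fun o k => k * Sum.elim (fun p => p.2) (fun p => p.2 + 1) o

/-- Eigenvalue of `ghostH0 c` on a monomial. -/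
def ghostCharge {Δ : Type*} (c : Δ → ℂ) (d : GhostOsc Δ →₀ ℕ) : ℂ :=
  d.sum fun o k => (k : ℂ) * Sum.elim (fun p => -c p.1) (fun p => c p.1) o

/-- The operator `q ^ T[0] * e ^ H[0]`, diagonal in the basis of monomials. -/
def ghostTwist {Δ : Type*} (q : ℂ) (c : Δ → ℂ) (v : GhostFock Δ) : GhostFock Δ :=
  ∑ d ∈ v.support,
    monomial d (q ^ ghostEnergy d * Complex.exp (ghostCharge c d) * v.coeff d)

/-- One term of the trace of `F_1(u_1) ⋯ F_k(u_k) q ^ T[0] e ^ H[0]` over the Fock space: a mode is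
chosen in each of the (normal ordered) fields, and `p.2` is the basis vector whose diagonal
coefficient is taken. -/
def ghostTraceTerm {Δ : Type*} (q : ℂ) (c : Δ → ℂ) {k : ℕ}
    (F : Fin k → MvPolynomial (Δ ⊕ Δ) ℂ) (u : Fin k → ℂ)
    (p : (Fin k → ℤ) × (GhostOsc Δ →₀ ℕ)) : ℂ :=
  (∏ i, u i ^ (-p.1 i)) *
    coeff p.2 ((List.ofFn fun i => fieldMode (F i) (p.1 i)).foldr (fun f v => f v)
      (ghostTwist q c (monomial p.2 1)))

/-- The one-loop correlation function
`Tr (F_1(u_1) ⋯ F_k(u_k) q ^ T[0] e ^ H[0])` of normal ordered ghost fields. -/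
def ghostCorr {Δ : Type*} (q : ℂ) (c : Δ → ℂ) {k : ℕ}
    (F : Fin k → MvPolynomial (Δ ⊕ Δ) ℂ) (u : Fin k → ℂ) : ℂ :=
  ∑' p, ghostTraceTerm q c F u p

theorem ghostDeriv_comm {Δ : Type*} (o o' : GhostOsc Δ) :
    ⁅ghostDeriv o, ghostDeriv o'⁆ = 0 := by
  have h : ⁅(pderiv o : Derivation ℂ (GhostFock Δ) (GhostFock Δ)),
      (pderiv o' : Derivation ℂ (GhostFock Δ) (GhostFock Δ))⁆ = 0 := by
    classical
    apply MvPolynomial.derivation_ext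
    intro i
    simp [Derivation.commutator_apply, pderiv_X, Pi.single_apply, apply_ite]
  apply LinearMap.ext
  intro v
  have := congrArg (fun D => D v) h
  simpa [Derivation.commutator_apply, Ring.lie_def, ghostDeriv] using this

theorem ghostDeriv_create {Δ : Type*} [DecidableEq Δ] (o o' : GhostOsc Δ) :
    ⁅ghostDeriv o, ghostCreate o'⁆ = if o = o' then 1 else 0 := by
  apply LinearMap.ext
  intro v
  rcases eq_or_ne o o' with h | h
  · subst h
    simp [Ring.lie_def, ghostDeriv, ghostCreate]
  · simp [Ring.lie_def, ghostDeriv, ghostCreate, pderiv_X_of_ne h.symm, h]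

theorem ghostCreate_comm {Δ : Type*} (o o' : GhostOsc Δ) :
    ⁅ghostCreate o, ghostCreate o'⁆ = 0 := by
  apply LinearMap.ext
  intro v
  simp only [Ring.lie_def, ghostCreate, LinearMap.sub_apply, Module.End.mul_apply,
    LinearMap.mulLeft_apply, LinearMap.zero_apply]
  ring

/-- The canonical commutation relations. -/
theorem ghostBeta_gamma_comm {Δ : Type*} [DecidableEq Δ] (a b : Δ) (m n : ℤ) :
    ⁅ghostBeta a m, ghostGamma b n⁆ =
      (if a = b ∧ m + n = 0 then 1 else 0 : Module.End ℂ (GhostFock Δ)) := by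
  unfold ghostBeta ghostGamma
  by_cases hm : 0 ≤ m <;> by_cases hn : 0 < n
  · have h : ¬ (a = b ∧ m + n = 0) := by omega
    have := ghostDeriv_comm (Sum.inl (a, m.toNat)) (Sum.inr (b, (n - 1).toNat))
    rw [Ring.lie_def, sub_eq_zero] at this
    rw [if_pos hm, if_pos hn, if_neg h, Ring.lie_def]
    apply LinearMap.ext
    intro v
    have hv := LinearMap.congr_fun this v
    simp only [Module.End.mul_apply] at hv
    simp only [Module.End.mul_apply, LinearMap.sub_apply, LinearMap.neg_apply, map_neg, hv,
      sub_self, LinearMap.zero_apply]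
  · have h : (Sum.inl (a, m.toNat) : GhostOsc Δ) = Sum.inl (b, (-n).toNat) ↔
        a = b ∧ m + n = 0 := by
      rw [Sum.inl.injEq, Prod.mk.injEq]
      refine and_congr_right fun _ => ?_
      omega
    rw [if_pos hm, if_neg hn, ghostDeriv_create]
    simp only [h]
  · have h : (Sum.inr (b, (n - 1).toNat) : GhostOsc Δ) = Sum.inr (a, (-m - 1).toNat) ↔
        a = b ∧ m + n = 0 := by
      simp only [Sum.inr.injEq, Prod.mk.injEq, eq_comm (a := b)]
      refine and_congr_right fun _ => ?_
      omega
    have := ghostDeriv_create (Sum.inr (b, (n - 1).toNat)) (Sum.inr (a, (-m - 1).toNat))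
    simp only [h] at this
    rw [if_neg hm, if_pos hn, ← this, Ring.lie_def, Ring.lie_def]
    apply LinearMap.ext
    intro v
    simp only [Module.End.mul_apply, LinearMap.sub_apply, LinearMap.neg_apply, map_neg]
    abel
  · have h : ¬ (a = b ∧ m + n = 0) := by omega
    rw [if_neg hm, if_neg hn, if_neg h, ghostCreate_comm]

theorem ghost_pair_monomial {Δ : Type*} (a : Δ) (n : ℤ) (d : GhostOsc Δ →₀ ℕ) :
    normalOrdered [(Sum.inl a, n), (Sum.inr a, -n)] (monomial d 1 : GhostFock Δ) =
      monomial d (if 0 < n then -(d (Sum.inr (a, (n - 1).toNat)) : ℂ)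
        else (d (Sum.inl (a, (-n).toNat)) : ℂ)) := by
  by_cases h : 0 < n
  · have h1 : ¬ (0 ≤ -n) := by omega
    have h2 : (- -n - 1) = n - 1 := by omega
    have e1 : normalOrdered [(Sum.inl a, n), (Sum.inr a, -n)] (monomial d 1 : GhostFock Δ) =
        X (Sum.inr (a, (n - 1).toNat)) *
          -(pderiv (Sum.inr (a, (n - 1).toNat)) (monomial d (1 : ℂ))) := by
      simp only [normalOrdered, isAnnihilation, ghostMode, ghostGamma, ghostBeta, h, h1, h2,
        List.filter, decide_true, decide_false, Bool.not_true, Bool.not_false, if_true, if_false,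
        List.map, List.prod_cons, List.prod_nil, mul_one, List.cons_append, List.nil_append]
      rfl
    rw [e1, mul_neg, X_mul_pderiv_monomial, if_pos h, map_neg, smul_monomial, nsmul_one]
  · have h1 : 0 ≤ -n := by omega
    have e1 : normalOrdered [(Sum.inl a, n), (Sum.inr a, -n)] (monomial d 1 : GhostFock Δ) =
        X (Sum.inl (a, (-n).toNat)) * pderiv (Sum.inl (a, (-n).toNat)) (monomial d (1 : ℂ)) := by
      simp only [normalOrdered, isAnnihilation, ghostMode, ghostGamma, ghostBeta, h, h1,
        List.filter, decide_true, decide_false, Bool.not_true, Bool.not_false, if_true, if_false,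
        List.map, List.prod_cons, List.prod_nil, mul_one, List.cons_append, List.nil_append]
      rfl
    rw [e1, X_mul_pderiv_monomial, if_neg h, smul_monomial, nsmul_one]

/-- Enumeration of the oscillators by pairs (root, mode of `γ`). -/
def oscEquiv (Δ : Type*) : Δ × ℤ ≃ GhostOsc Δ where
  toFun p := if 0 < p.2 then Sum.inr (p.1, (p.2 - 1).toNat) else Sum.inl (p.1, (-p.2).toNat)
  invFun o := Sum.elim (fun p => (p.1, -(p.2 : ℤ))) (fun p => (p.1, (p.2 : ℤ) + 1)) o
  left_inv := by
    rintro ⟨a, n⟩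
    by_cases h : 0 < n
    · simp [h]
    · have h' : n ≤ 0 := by omega
      simp [h, h']
  right_inv := by
    rintro (⟨a, n⟩ | ⟨a, n⟩)
    · simp
    · have : (0 : ℤ) < n + 1 := by omega
      simp [this]

theorem ghost_finsum_monomial {Δ : Type*} (w : Δ × ℤ → ℂ) (d : GhostOsc Δ →₀ ℕ) :
    ∑ᶠ p : Δ × ℤ, w p • normalOrdered [(Sum.inl p.1, p.2), (Sum.inr p.1, -p.2)]
        (monomial d 1 : GhostFock Δ) =
      monomial d (d.sum fun o k =>
        (k : ℂ) * (w ((oscEquiv Δ).symm o) * Sum.elim (fun _ => 1) (fun _ => -1) o)) := by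
  rw [← finsum_comp_equiv (oscEquiv Δ).symm, Finsupp.sum, map_sum]
  have key : ∀ o : GhostOsc Δ, w ((oscEquiv Δ).symm o) •
      normalOrdered [(Sum.inl ((oscEquiv Δ).symm o).1, ((oscEquiv Δ).symm o).2),
        (Sum.inr ((oscEquiv Δ).symm o).1, -((oscEquiv Δ).symm o).2)]
        (monomial d 1 : GhostFock Δ) =
      monomial d ((d o : ℂ) *
        (w ((oscEquiv Δ).symm o) * Sum.elim (fun _ => 1) (fun _ => -1) o)) := by
    intro o
    rw [ghost_pair_monomial, smul_monomial, smul_eq_mul]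
    congr 1
    rcases o with ⟨a, n⟩ | ⟨a, n⟩
    · have h0 : ¬ ((0 : ℤ) < -(n : ℤ)) := by omega
      simp only [oscEquiv, Equiv.coe_fn_symm_mk, Sum.elim_inl, h0, if_false, neg_neg,
        Int.toNat_natCast, mul_one]
      ring
    · have : (0 : ℤ) < n + 1 := by omega
      simp [oscEquiv, this]; ring
  simp_rw [key]
  apply finsum_eq_sum_of_support_subset
  intro o ho
  simp only [Function.mem_support] at ho
  simp only [Finset.mem_coe, Finsupp.mem_support_iff]
  rintro h
  exact ho (by simp [h])

theorem ghostT0_monomial {Δ : Type*} (d : GhostOsc Δ →₀ ℕ) :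
    ghostT0 (monomial d 1 : GhostFock Δ) = monomial d (ghostEnergy d : ℂ) := by
  unfold ghostT0
  rw [ghost_finsum_monomial (fun p => -(p.2 : ℂ)) d, ghostEnergy, Finsupp.sum, Finsupp.sum,
    Nat.cast_sum]
  congr 1
  refine Finset.sum_congr rfl fun o _ => ?_
  rcases o with ⟨a, n⟩ | ⟨a, n⟩ <;> simp [oscEquiv]

theorem ghostH0_monomial {Δ : Type*} (c : Δ → ℂ) (d : GhostOsc Δ →₀ ℕ) :
    ghostH0 c (monomial d 1 : GhostFock Δ) = monomial d (ghostCharge c d) := by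
  unfold ghostH0
  rw [ghost_finsum_monomial (fun p => -c p.1) d, ghostCharge, Finsupp.sum, Finsupp.sum]
  congr 1
  refine Finset.sum_congr rfl fun o _ => ?_
  rcases o with ⟨a, n⟩ | ⟨a, n⟩ <;> simp [oscEquiv]

/-! ### The elliptic kernel -/

/-- The single-valued part of the theta function with characteristic `(1/2, 1/2)`:
`θ₁₁(z; q) = i q^(1/8) z^(1/2) thetaRed q z`. -/
def thetaRed (q z : ℂ) : ℂ := ∑' n : ℤ, (-1) ^ n * q ^ (n * (n + 1) / 2) * z ^ n

/-- `w_c(w, z) = θ₁₁'(1) θ₁₁(e^{-c} z / w) / (θ₁₁(e^{-c}) w θ₁₁(z / w))`; the factors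
`i q^(1/8)` and the square roots `z^(1/2)` of `θ₁₁` cancel in this quotient. -/
def wKernel (q c w z : ℂ) : ℂ :=
  deriv (thetaRed q) 1 / thetaRed q (Complex.exp (-c)) *
    (thetaRed q (Complex.exp (-c) * (z / w)) / (w * thetaRed q (z / w)))

/-- The additive theta function `θ₁₁(x; τ)`. -/
def theta11 (x τ : ℂ) : ℂ :=
  ∑' n : ℤ, Complex.exp (((n : ℂ) + 1 / 2) ^ 2 * Real.pi * Complex.I * τ
    + 2 * Real.pi * Complex.I * ((n : ℂ) + 1 / 2) * (x + 1 / 2))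

theorem theta11_eq (x τ : ℂ) :
    theta11 x τ = Complex.I * Complex.exp (Real.pi * Complex.I * τ / 4)
      * Complex.exp (Real.pi * Complex.I * x)
      * thetaRed (Complex.exp (2 * Real.pi * Complex.I * τ))
          (Complex.exp (2 * Real.pi * Complex.I * x)) := by
  unfold theta11 thetaRed
  rw [← tsum_mul_left]
  refine tsum_congr fun n => ?_
  obtain ⟨k, hk⟩ := Int.even_mul_succ_self n
  have hk' : n * (n + 1) / 2 = k := by omega
  have hkc : (n : ℂ) * (n + 1) = k + k := by exact_mod_cast hk
  have e1 : Complex.exp (Real.pi * Complex.I * n) = (-1) ^ n := by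
    rw [mul_comm, Complex.exp_int_mul, Complex.exp_pi_mul_I]
  have e2 : Complex.exp (Real.pi * Complex.I / 2) = Complex.I := by
    rw [mul_div_right_comm, Complex.exp_pi_div_two_mul_I]
  rw [hk', ← e1, ← Complex.exp_int_mul, ← Complex.exp_int_mul]
  conv_rhs => enter [1, 1, 1]; rw [← e2]
  simp only [← Complex.exp_add]
  congr 1
  linear_combination (Real.pi * Complex.I * τ) * hkc

/-- The product of the kernels `-w` along `t_{σ(1)}, …, t_{σ(m)}, z`, the parameter of the `j`-th
kernel being `c_{σ(1)} + ⋯ + c_{σ(j)}`. -/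
def kernelChain {m : ℕ} (q : ℂ) (c t : Fin m → ℂ) (z : ℂ) (σ : Equiv.Perm (Fin m)) : ℂ :=
  ∏ j : Fin m, -wKernel q (∑ k ∈ Finset.Iic j, c (σ k)) (t (σ j))
    ((Fin.snoc (fun k => t (σ k)) z : Fin (m + 1) → ℂ) j.succ)

/-! ### The left action of the unipotent group on the big cell -/

/-- The exponential of a nilpotent endomorphism of a finite dimensional space. -/
def nilExp {V : Type*} [AddCommGroup V] [Module ℂ V] (f : Module.End ℂ V) : Module.End ℂ V :=
  ∑ k ∈ Finset.range (Module.finrank ℂ V), ((k.factorial : ℂ)⁻¹) • f ^ k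

/-- The coordinates `x ↦ exp (x_1 e_1) ⋯ exp (x_s e_s)` on the unipotent group `N₊`, realised in
the (faithful) adjoint representation; `ord` enumerates the positive roots. -/
def bigCell {𝔤 : Type*} [LieRing 𝔤] [LieAlgebra ℂ 𝔤] {Δ : Type*} {s : ℕ}
    (ord : Fin s ≃ Δ) (e : Δ → 𝔤) (x : Δ → ℂ) : Module.End ℂ 𝔤 :=
  (List.ofFn fun i => nilExp (x (ord i) • LieAlgebra.ad ℂ 𝔤 (e (ord i)))).prod

/-- The polynomial vector field `∑_a v_a(x) ∂/∂x_a` is the infinitesimal action of `ξ ∈ 𝔫₊` induced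
by left multiplication on `N₊`: at every point `x` the curves `r ↦ bigCell (x + r v(x))` and
`r ↦ exp (-r ξ) · bigCell x` have the same velocity at `r = 0`. (The sign makes the action on
functions, `(n · P)(a) = P(n⁻¹ a)`, a left action and `ξ ↦ v` a Lie algebra homomorphism.) -/
def IsInfinitesimalLeftAction {𝔤 : Type*} [LieRing 𝔤] [LieAlgebra ℂ 𝔤] {Δ : Type*} {s : ℕ}
    (ord : Fin s ≃ Δ) (e : Δ → 𝔤) (ξ : 𝔤) (v : Δ → MvPolynomial Δ ℂ) : Prop :=
  ∀ (x : Δ → ℂ) (y : 𝔤) (l : Module.Dual ℂ 𝔤),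
    HasDerivAt (fun r : ℂ =>
      l (bigCell ord e (fun a => x a + r * eval x (v a)) y)
        - l (nilExp (-r • LieAlgebra.ad ℂ 𝔤 ξ) (bigCell ord e x y))) 0 0

open Classical in
/-- The coefficients of the vector field `S(ξ; x, ∂_x)` (unique when they exist). -/
def leftField {𝔤 : Type*} [LieRing 𝔤] [LieAlgebra ℂ 𝔤] {Δ : Type*} {s : ℕ}
    (ord : Fin s ≃ Δ) (e : Δ → 𝔤) (ξ : 𝔤) : Δ → MvPolynomial Δ ℂ :=
  if h : ∃ v, IsInfinitesimalLeftAction ord e ξ v then h.choose else 0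

/-- The operator `S_a = S(e_a; x, ∂_x)` on polynomials. -/
def scrOp {𝔤 : Type*} [LieRing 𝔤] [LieAlgebra ℂ 𝔤] {Δ : Type*} [Fintype Δ] {s : ℕ}
    (ord : Fin s ≃ Δ) (e : Δ → 𝔤) (a : Δ) (P : MvPolynomial Δ ℂ) : MvPolynomial Δ ℂ :=
  ∑ b, leftField ord e (e a) b * pderiv b P

/-- The symbol `S(e_a; x, ξ)`; its normal ordered field is the ghost sector `S_a(z)` of the
screening current. -/
def scrSymbol {𝔤 : Type*} [LieRing 𝔤] [LieAlgebra ℂ 𝔤] {Δ : Type*} [Fintype Δ] {s : ℕ}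
    (ord : Fin s ≃ Δ) (e : Δ → 𝔤) (a : Δ) : MvPolynomial (Δ ⊕ Δ) ℂ :=
  ∑ b, rename Sum.inl (leftField ord e (e a) b) * X (Sum.inr b)

/-- The fields in `P(γ(z)) S_{α(1)}(t_1) ⋯ S_{α(m)}(t_m)`, from left to right. -/
def scrFields {𝔤 : Type*} [LieRing 𝔤] [LieAlgebra ℂ 𝔤] {Δ : Type*} [Fintype Δ] {s : ℕ}
    (ord : Fin s ≃ Δ) (e : Δ → 𝔤) (P : MvPolynomial Δ ℂ) {m : ℕ} (α : Fin m → Δ) :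
    Fin (m + 1) → MvPolynomial (Δ ⊕ Δ) ℂ :=
  Fin.cons (rename Sum.inl P) fun i => scrSymbol ord e (α i)

/-! ### Positive roots, domains of the parameters -/

/-- The positive roots with respect to a base of the root system of `(𝔤, 𝔥)`. -/
abbrev PosRoot {𝔤 : Type*} [LieRing 𝔤] [LieAlgebra ℂ 𝔤] [FiniteDimensional ℂ 𝔤]
    [LieAlgebra.IsKilling ℂ 𝔤] {𝔥 : LieSubalgebra ℂ 𝔤} [𝔥.IsCartanSubalgebra]
    (b : (LieAlgebra.IsKilling.rootSystem 𝔥).Base) : Type _ :=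
  {a : 𝔥.root // b.IsPos a}

instance {𝔤 : Type*} [LieRing 𝔤] [LieAlgebra ℂ 𝔤] [FiniteDimensional ℂ 𝔤]
    [LieAlgebra.IsKilling ℂ 𝔤] {𝔥 : LieSubalgebra ℂ 𝔤} [𝔥.IsCartanSubalgebra]
    (b : (LieAlgebra.IsKilling.rootSystem 𝔥).Base) : Fintype (PosRoot b) :=
  Fintype.ofFinite _

/-- The value `α(H)`. -/
def rootVal {𝔤 : Type*} [LieRing 𝔤] [LieAlgebra ℂ 𝔤] [FiniteDimensional ℂ 𝔤]
    [LieAlgebra.IsKilling ℂ 𝔤] {𝔥 : LieSubalgebra ℂ 𝔤} [𝔥.IsCartanSubalgebra]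
    (b : (LieAlgebra.IsKilling.rootSystem 𝔥).Base) (H : 𝔥) (a : PosRoot b) : ℂ :=
  (a.1.1 : 𝔥 → ℂ) H

/-- The domain in which the trace is an (absolutely) convergent series: `0 < |q| < 1`,
`|q| < |e^{-α(H)}| < 1` for all positive roots, and `|q z| < |t_m| < ⋯ < |t_1| < |z|`. -/
def TraceDomain {Δ : Type*} {m : ℕ} (q : ℂ) (c : Δ → ℂ) (z : ℂ) (t : Fin m → ℂ) : Prop :=
  q ≠ 0 ∧ ‖q‖ < 1 ∧ z ≠ 0 ∧
  (∀ a, ‖q‖ < ‖Complex.exp (-c a)‖ ∧ ‖Complex.exp (-c a)‖ < 1) ∧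
  (∀ i, ‖q * z‖ < ‖t i‖ ∧ ‖t i‖ < ‖z‖) ∧
  ∀ i j, i < j → ‖t j‖ < ‖t i‖

/-- None of the parameters `c` of the kernels `w_c` is a pole of `w_c`: the exponential of no
non-empty partial sum of the `c_i` is an integral power of `q`. -/
def KernelParamsRegular {m : ℕ} (q : ℂ) (c : Fin m → ℂ) : Prop :=
  ∀ I : Finset (Fin m), I.Nonempty → ∀ k : ℤ, Complex.exp (∑ i ∈ I, c i) ≠ q ^ k

/-- The points `t_1, …, t_m, z` are non-zero and pairwise distinct on the curve `ℂˣ / q^ℤ`. -/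
def DistinctOnCurve {m : ℕ} (q z : ℂ) (t : Fin m → ℂ) : Prop :=
  z ≠ 0 ∧ (∀ i, t i ≠ 0) ∧ (∀ i, ∀ k : ℤ, t i ≠ q ^ k * z) ∧
  ∀ i j, i ≠ j → ∀ k : ℤ, t i ≠ q ^ k * t j

end

/-! Everything rests on one Ward identity. A mode `γ^a[n]` can be carried once around a trace: it
returns multiplied by `q^n e^{c_a}` (`opTrace_ghostGamma`), and on its way it commutes with all
polynomials in `γ` and meets the currents, where `[γ^a[n], S[N]] = -S^a(γ)[N + n - 1]`
(`ghostGamma_commutator_current`). As `q^n e^{c_a} ≠ 1`, the trace is a sum of traces with one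
current fewer, in which the current at `t_j` has become the polynomial `S_j^a(γ(t_j))`. Summed over
the modes, the coefficients form Kronecker's series `ellKern` in the annulus selected by the radial
ordering of the points (`tsum_contractCoeff`).

No contraction occurs inside a current. The coefficients of the vector field of `e_a` are
homogeneous for the torus action, since the equation defining them is torus equivariant and has at
most one solution at each point (`isWeightedHomogeneous_leftField`, `cellVelocity_injective`). For
the grading by height this excludes the variable `x^b` from `S^b`, so all factors of one monomial
commute and normal ordering is harmless.

The rearrangements need absolute convergence. It is obtained by running the same Ward argument on
matrices of absolute values, where it becomes an inequality `x ≤ y + r x` with `r < 1`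
(`kernTrace_create_ward`, `kernTrace_deriv_ward`); truncation to finitely many basis vectors makes
`x` finite, so that it can be absorbed.

For the induction, polynomials in `γ` must be allowed at all points. Correlators with currents at
`J` and polynomials elsewhere are determined by `ContractionRules` (`stateCorr_eq`): values on
constants, charge conservation, additivity and the Ward identity. The right side of the theorem
generalizes to `forestSum`, in which the currents are distributed over chains ending in the points
outside `J`. Forest sums obey the same rules. The Ward identity for them (`forestSum_ward`) reduces
to the multiplicativity of chain sums (`chainSum_mul`), which follows from the Leibniz rule and the
Fay identity; the latter holds coefficient by coefficient in the Laurent expansions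
(`ellKern_mul_ellKern`). With `z` as the only point without a current, the forest sum is a sum over
permutations, and `⟨Q(γ(z))⟩` is the partition function times `Q(0)`.

Kronecker's formula (`thetaRed_mul_ellKern`, `kroneckerCoeff_mul_thetaRed`) identifies the series
with the quotient of theta functions. The continued identity then follows from the holomorphy of the
kernels off their poles and the identity theorem. -/

/-! ### Modes of normal ordered products without contractions -/

/-- Any two of the elementary fields in the list commute. -/
def NonContracting {Δ : Type*} (L : List (Δ ⊕ Δ)) : Prop :=
  ∀ x ∈ L, ∀ y ∈ L, ∀ n k : ℤ, Commute (ghostMode x n) (ghostMode y k)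

theorem NonContracting.tail {Δ : Type*} {x : Δ ⊕ Δ} {L : List (Δ ⊕ Δ)}
    (h : NonContracting (x :: L)) : NonContracting L :=
  fun y hy z hz => h y (List.mem_cons_of_mem _ hy) z (List.mem_cons_of_mem _ hz)

theorem NonContracting.perm {Δ : Type*} {L L' : List (Δ ⊕ Δ)} (hp : L.Perm L')
    (h : NonContracting L) : NonContracting L' :=
  fun x hx y hy => h x (hp.mem_iff.2 hx) y (hp.mem_iff.2 hy)

/-- A polynomial involves finitely many variables, and a mode of large index is, up to sign, the
derivative in a variable of large index. The bound depends on the vector only, not on the field, so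
it serves products of any length. -/
theorem ghostMode_bound {Δ : Type*} (v : GhostFock Δ) :
    ∃ B : ℕ, ∀ (x : Δ ⊕ Δ) (n : ℤ), (B : ℤ) < n → ghostMode x n v = 0 := by
  classical
  -- The `+ 1` is for `γ^a[n]` with `n > 0`, which differentiates in the variable of index `n - 1`.
  refine ⟨v.vars.sup (fun o => Sum.elim (fun p => p.2) (fun p => p.2) o) + 1, ?_⟩
  intro x n hn
  have key : ∀ o : GhostOsc Δ,
      v.vars.sup (fun o => Sum.elim (fun p => p.2) (fun p => p.2) o) <
        Sum.elim (fun p => p.2) (fun p => p.2) o → ghostDeriv o v = 0 := by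
    intro o ho
    refine pderiv_eq_zero_of_notMem_vars fun hmem => ?_
    exact absurd (Finset.le_sup (f := fun o : GhostOsc Δ =>
      Sum.elim (fun p => p.2) (fun p => p.2) o) hmem) (not_le.2 ho)
  generalize v.vars.sup (fun o : GhostOsc Δ =>
    Sum.elim (fun p => p.2) (fun p => p.2) o) = B at hn key
  rcases x with a | a
  · have h0 : 0 < n := by push_cast at hn; omega
    simp only [ghostMode, ghostGamma, h0, if_true, LinearMap.neg_apply]
    rw [key, neg_zero]
    simp only [Sum.elim_inr]
    push_cast at hn
    omega
  · have h0 : 0 ≤ n := by push_cast at hn; omega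
    simp only [ghostMode, ghostBeta, h0, if_true]
    rw [key]
    simp only [Sum.elim_inl]
    push_cast at hn
    omega

/-- The product of modes of the fields in a list. -/
noncomputable def prodMode {Δ : Type*} (L : List (Δ ⊕ Δ)) (n : Fin L.length → ℤ) :
    Module.End ℂ (GhostFock Δ) :=
  (List.ofFn fun i => ghostMode (L.get i) (n i)).prod

theorem prodMode_cons {Δ : Type*} (x : Δ ⊕ Δ) (L : List (Δ ⊕ Δ)) (k : ℤ)
    (n : Fin L.length → ℤ) :
    prodMode (x :: L) (Fin.cons k n : Fin (L.length + 1) → ℤ) = ghostMode x k * prodMode L n := by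
  simp [prodMode, List.ofFn_succ]

/-- Normal ordering only permutes the factors, and here the factors commute. -/
theorem normalOrdered_eq_prodMode {Δ : Type*} {L : List (Δ ⊕ Δ)} (h : NonContracting L)
    (n : Fin L.length → ℤ) :
    normalOrdered (List.ofFn fun i => (L.get i, n i)) = prodMode L n := by
  unfold normalOrdered prodMode
  have e : (List.ofFn fun i => ghostMode (L.get i) (n i)) =
      (List.ofFn fun i => (L.get i, n i)).map (fun p => ghostMode p.1 p.2) := by
    rw [List.map_ofFn]; rfl
  rw [e]
  refine List.Perm.prod_eq' (List.Perm.map _ ?_) ?_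
  · have := List.filter_append_perm (fun p : (Δ ⊕ Δ) × ℤ => !isAnnihilation p.1 p.2)
      (List.ofFn fun i => (L.get i, n i))
    simpa using this
  · refine List.pairwise_of_forall_mem_list ?_
    intro a ha b hb
    simp only [List.mem_map, List.mem_append, List.mem_filter, List.mem_ofFn] at ha hb
    obtain ⟨p, hp, rfl⟩ := ha
    obtain ⟨p', hp', rfl⟩ := hb
    have h1 : p.1 ∈ L := by
      rcases hp with ⟨⟨i, rfl⟩, -⟩ | ⟨⟨i, rfl⟩, -⟩ <;> exact List.get_mem _ _
    have h2 : p'.1 ∈ L := by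
      rcases hp' with ⟨⟨i, rfl⟩, -⟩ | ⟨⟨i, rfl⟩, -⟩ <;> exact List.get_mem _ _
    exact h _ h1 _ h2 _ _

theorem commute_prodMode {Δ : Type*} {x : Δ ⊕ Δ} {L : List (Δ ⊕ Δ)}
    (h : NonContracting (x :: L)) (k : ℤ) (n : Fin L.length → ℤ) :
    Commute (ghostMode x k) (prodMode L n) := by
  unfold prodMode
  refine Commute.list_prod_right _ _ fun y hy => ?_
  rw [List.mem_ofFn] at hy
  obtain ⟨i, rfl⟩ := hy
  exact h x List.mem_cons_self _ (List.mem_cons_of_mem _ (List.get_mem _ _)) _ _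

/-- The mode of large index can be moved to the right, next to the vector that it kills. -/
theorem prodMode_eq_zero {Δ : Type*} {v : GhostFock Δ} {B : ℕ}
    (hB : ∀ (x : Δ ⊕ Δ) (n : ℤ), (B : ℤ) < n → ghostMode x n v = 0) {L : List (Δ ⊕ Δ)}
    (h : NonContracting L) (n : Fin L.length → ℤ) (hn : ∃ i, (B : ℤ) < n i) :
    prodMode L n v = 0 := by
  induction L with
  | nil => exact hn.choose.elim0
  | cons x L ih =>
    obtain ⟨k, n', rfl⟩ : ∃ k n', n = (Fin.cons k n' : Fin (L.length + 1) → ℤ) :=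
      ⟨n 0, Fin.tail n, (Fin.cons_self_tail n).symm⟩
    rw [prodMode_cons]
    obtain ⟨i, hi⟩ := hn
    revert hi
    refine Fin.cases (fun hi => ?_) (fun i hi => ?_) i
    · rw [(commute_prodMode h k n').eq, Module.End.mul_apply, hB x k hi, map_zero]
    · rw [Module.End.mul_apply, ih h.tail n' ⟨i, hi⟩, map_zero]

/-- Each index is bounded above by `ghostMode_bound`, and the sum of the indices is prescribed, so
each index is bounded below as well. -/
theorem prodMode_support_finite {Δ : Type*} {L : List (Δ ⊕ Δ)} (h : NonContracting L)
    (v : GhostFock Δ) (N : ℤ) :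
    {n : Fin L.length → ℤ |
      ∑ i, (n i + ghostSpin (L.get i)) = N ∧ prodMode L n v ≠ 0}.Finite := by
  obtain ⟨B, hB⟩ := ghostMode_bound v
  set M : ℤ := N - ∑ i, ghostSpin (L.get i)
  refine Set.Finite.subset (Set.finite_Icc (fun _ => M - L.length * B) (fun _ => (B : ℤ))) ?_
  rintro n ⟨hN, hv⟩
  have hle : ∀ i, n i ≤ B := fun i => by
    by_contra hi
    exact hv (prodMode_eq_zero hB h n ⟨i, not_le.1 hi⟩)
  refine ⟨fun i => ?_, hle⟩
  have hM : M = ∑ i, n i := by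
    simp only [M, ← hN, Finset.sum_add_distrib, add_sub_cancel_right]
  classical
  have h2 : ∑ j ∈ Finset.univ.erase i, n j ≤ ∑ j ∈ (Finset.univ.erase i), (B : ℤ) :=
    Finset.sum_le_sum fun j _ => hle j
  have h3 : n i + ∑ j ∈ Finset.univ.erase i, n j = ∑ j, n j :=
    Finset.add_sum_erase _ _ (Finset.mem_univ i)
  have h4 : ∑ j ∈ (Finset.univ.erase i), (B : ℤ) ≤ L.length * B := by
    rw [Finset.sum_const, nsmul_eq_mul]
    refine mul_le_mul_of_nonneg_right ?_ (by positivity)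
    exact_mod_cast (Finset.card_erase_le).trans (by simp)
  simp only [hM]
  linarith

theorem normalOrderedMode_eq {Δ : Type*} {L : List (Δ ⊕ Δ)} (h : NonContracting L)
    (v : GhostFock Δ) (N : ℤ) :
    normalOrderedMode L N v = ∑ᶠ n : Fin L.length → ℤ,
      if ∑ i, (n i + ghostSpin (L.get i)) = N then prodMode L n v else 0 := by
  unfold normalOrderedMode
  simp only [normalOrdered_eq_prodMode h]
  refine (finsum_set_coe_eq_finsum_mem (f := fun n : Fin L.length → ℤ => prodMode L n v)
    {n | ∑ i, (n i + ghostSpin (L.get i)) = N}).trans ?_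
  refine finsum_congr fun n => ?_
  simp only [Set.mem_ofPred_eq]
  rw [finsum_eq_if]

theorem normalOrderedMode_summand_finite {Δ : Type*} {L : List (Δ ⊕ Δ)} (h : NonContracting L)
    (v : GhostFock Δ) (N : ℤ) :
    (Function.support fun n : Fin L.length → ℤ =>
      if ∑ i, (n i + ghostSpin (L.get i)) = N then prodMode L n v else 0).Finite := by
  refine (prodMode_support_finite h v N).subset fun n hn => ?_
  simp only [Function.mem_support, ne_eq, ite_eq_right_iff, Classical.not_imp] at hn
  exact hn

theorem normalOrderedMode_bound {Δ : Type*} {L : List (Δ ⊕ Δ)} (h : NonContracting L)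
    (v : GhostFock Δ) : ∃ C : ℤ, ∀ N, C < N → normalOrderedMode L N v = 0 := by
  obtain ⟨B, hB⟩ := ghostMode_bound v
  refine ⟨∑ i, ((B : ℤ) + ghostSpin (L.get i)), fun N hN => ?_⟩
  rw [normalOrderedMode_eq h]
  refine finsum_eq_zero_of_forall_eq_zero fun n => ?_
  split_ifs with hn
  · refine prodMode_eq_zero hB h n ?_
    by_contra hcon
    push Not at hcon
    have : ∑ i, (n i + ghostSpin (L.get i)) ≤ ∑ i, ((B : ℤ) + ghostSpin (L.get i)) :=
      Finset.sum_le_sum fun i _ => by linarith [hcon i]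
    omega
  · rfl

theorem normalOrderedMode_add {Δ : Type*} {L : List (Δ ⊕ Δ)} (h : NonContracting L) (N : ℤ)
    (v w : GhostFock Δ) :
    normalOrderedMode L N (v + w) = normalOrderedMode L N v + normalOrderedMode L N w := by
  simp only [normalOrderedMode_eq h]
  rw [← finsum_add_distrib (normalOrderedMode_summand_finite h v N)
    (normalOrderedMode_summand_finite h w N)]
  refine finsum_congr fun n => ?_
  split_ifs <;> simp

theorem normalOrderedMode_smul {Δ : Type*} {L : List (Δ ⊕ Δ)} (h : NonContracting L) (N : ℤ)
    (r : ℂ) (v : GhostFock Δ) :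
    normalOrderedMode L N (r • v) = r • normalOrderedMode L N v := by
  simp only [normalOrderedMode_eq h]
  rw [smul_finsum]
  refine finsum_congr fun n => ?_
  split_ifs <;> simp

theorem ghostMode_normalOrderedMode {Δ : Type*} {x : Δ ⊕ Δ} {L : List (Δ ⊕ Δ)}
    (h : NonContracting (x :: L)) (k N : ℤ) (v : GhostFock Δ) :
    ghostMode x k (normalOrderedMode L N v) = normalOrderedMode L N (ghostMode x k v) := by
  rw [normalOrderedMode_eq h.tail, normalOrderedMode_eq h.tail,
    map_finsum _ (normalOrderedMode_summand_finite h.tail v N)]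
  refine finsum_congr fun n => ?_
  split_ifs
  · exact LinearMap.congr_fun (commute_prodMode h k n) v
  · simp

theorem ghostMode_normalOrderedMode_support {Δ : Type*} {x : Δ ⊕ Δ} {L : List (Δ ⊕ Δ)}
    (h : NonContracting (x :: L)) (N : ℤ) (v : GhostFock Δ) :
    (Function.support fun k : ℤ => ghostMode x k (normalOrderedMode L (N - k) v)).Finite := by
  obtain ⟨B, hB⟩ := ghostMode_bound v
  obtain ⟨C, hC⟩ := normalOrderedMode_bound h.tail v
  refine (Set.finite_Icc (N - C) (B : ℤ)).subset fun k hk => ?_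
  rw [Function.mem_support] at hk
  refine ⟨?_, ?_⟩
  · by_contra hlt
    exact hk (by rw [hC (N - k) (by omega), map_zero])
  · by_contra hlt
    refine hk ?_
    rw [ghostMode_normalOrderedMode h, hB x k (not_le.1 hlt)]
    simpa using normalOrderedMode_smul h.tail (N - k) 0 (0 : GhostFock Δ)

/-- Peeling off one field replaces normal ordering by an iterated convolution. Independence of the
order, charge counting and the splitting off of one `γ` all rest on this recursion. -/
theorem normalOrderedMode_cons {Δ : Type*} {x : Δ ⊕ Δ} {L : List (Δ ⊕ Δ)}
    (h : NonContracting (x :: L)) (N : ℤ) (v : GhostFock Δ) :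
    normalOrderedMode (x :: L) N v =
      ∑ᶠ k : ℤ, ghostMode x k (normalOrderedMode L (N - ghostSpin x - k) v) := by
  have hfin := normalOrderedMode_summand_finite h v N
  rw [normalOrderedMode_eq h]
  change (∑ᶠ n : Fin (L.length + 1) → ℤ, _) = _
  rw [← finsum_comp_equiv (Fin.consEquiv fun _ => ℤ), finsum_curry]
  · refine finsum_congr fun k => ?_
    rw [normalOrderedMode_eq h.tail, map_finsum _ (normalOrderedMode_summand_finite h.tail v _)]
    refine finsum_congr fun n => ?_
    have e1 := LinearMap.congr_fun (prodMode_cons x L k n) v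
    have e2 : (∑ i, ((Fin.cons k n : Fin (L.length + 1) → ℤ) i + ghostSpin ((x :: L).get i)) = N) ↔
        (∑ i, (n i + ghostSpin (L.get i)) = N - ghostSpin x - k) := by
      rw [Fin.sum_univ_succ]
      simp only [Fin.cons_zero, Fin.cons_succ]
      change k + ghostSpin x + ∑ i, (n i + ghostSpin (L.get i)) = N ↔ _
      constructor <;> intro h <;> linarith
    simp only [Fin.consEquiv_apply]
    rw [apply_ite (ghostMode x k), map_zero]
    exact if_congr e2 e1 rfl
  · exact hfin.preimage (Equiv.injective _).injOn

theorem normalOrderedMode_nil {Δ : Type*} (N : ℤ) (v : GhostFock Δ) :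
    normalOrderedMode ([] : List (Δ ⊕ Δ)) N v = if N = 0 then v else 0 := by
  have h : NonContracting ([] : List (Δ ⊕ Δ)) := fun x hx => by simp at hx
  rw [normalOrderedMode_eq h, finsum_eq_single _ (fun i => i.elim0)
    (fun n hn => absurd (funext fun i => i.elim0) hn)]
  simp [prodMode, eq_comm]

theorem finsum_comm_of_finite {α β M : Type*} [AddCommMonoid M] (f : α → β → M)
    (hf : (Function.support fun p : α × β => f p.1 p.2).Finite) :
    ∑ᶠ (a : α) (b : β), f a b = ∑ᶠ (b : β) (a : α), f a b := by
  rw [← finsum_curry (fun p : α × β => f p.1 p.2) hf,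
    ← finsum_comp_equiv (Equiv.prodComm β α), finsum_curry]
  · rfl
  · exact hf.preimage (Equiv.injective _).injOn

/-- The factors of a monomial carry no order, and `fieldMode` lists them by the choice made in
`Multiset.toList`; this makes the choice irrelevant. A transposition is an interchange of two sums
of finite support. -/
theorem normalOrderedMode_perm {Δ : Type*} {L L' : List (Δ ⊕ Δ)} (hp : L.Perm L')
    (h : NonContracting L) (N : ℤ) (v : GhostFock Δ) :
    normalOrderedMode L N v = normalOrderedMode L' N v := by
  induction hp generalizing N with
  | nil => rfl
  | cons x hp ih =>
    rw [normalOrderedMode_cons h, normalOrderedMode_cons (h.perm (hp.cons x))]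
    simp only [ih h.tail]
  | swap x y l =>
    have h' := h.perm (List.Perm.swap x y l)
    rw [normalOrderedMode_cons h, normalOrderedMode_cons h']
    simp only [normalOrderedMode_cons h.tail, normalOrderedMode_cons h'.tail]
    obtain ⟨B, hB⟩ := ghostMode_bound v
    obtain ⟨C, hC⟩ := normalOrderedMode_bound h.tail.tail v
    have hz : ∀ N, normalOrderedMode l N (0 : GhostFock Δ) = 0 := fun N => by
      simpa using normalOrderedMode_smul h.tail.tail N 0 (0 : GhostFock Δ)
    have fin : (Function.support fun p : ℤ × ℤ => ghostMode y p.1 (ghostMode x p.2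
        (normalOrderedMode l (N - ghostSpin y - ghostSpin x - p.1 - p.2) v))).Finite := by
      set M := N - ghostSpin y - ghostSpin x
      refine ((Set.finite_Icc (M - C - B) (B : ℤ)).prod
        (Set.finite_Icc (M - C - B) (B : ℤ))).subset fun p hk => ?_
      rw [Function.mem_support] at hk
      -- Both indices and the remaining one are bounded above; as they add up to `M`, the first two
      -- are bounded below too.
      have h1 : p.1 ≤ B := by
        by_contra hlt
        refine hk ?_
        rw [← Module.End.mul_apply, (h y (by simp) x (by simp) p.1 p.2).eq,
          Module.End.mul_apply, ghostMode_normalOrderedMode h'.tail, hB y p.1 (not_le.1 hlt), hz,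
          map_zero]
      have h2 : p.2 ≤ B := by
        by_contra hlt
        refine hk ?_
        rw [ghostMode_normalOrderedMode h.tail, hB x p.2 (not_le.1 hlt), hz, map_zero]
      have h3 : M - p.1 - p.2 ≤ C := by
        by_contra hlt
        refine hk ?_
        rw [hC _ (not_le.1 hlt), map_zero, map_zero]
      refine ⟨⟨?_, ?_⟩, ?_, ?_⟩ <;> omega
    have s1 : ∀ k, ghostMode y k (∑ᶠ j, ghostMode x j
          (normalOrderedMode l (N - ghostSpin y - k - ghostSpin x - j) v)) =
        ∑ᶠ j, ghostMode y k (ghostMode x j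
          (normalOrderedMode l (N - ghostSpin y - ghostSpin x - k - j) v)) := fun k => by
      rw [map_finsum]
      · refine finsum_congr fun j => ?_
        rw [show N - ghostSpin y - k - ghostSpin x - j = N - ghostSpin y - ghostSpin x - k - j by
          ring]
      · exact ghostMode_normalOrderedMode_support h.tail (N - ghostSpin y - k - ghostSpin x) v
    have s2 : ∀ k, ghostMode x k (∑ᶠ j, ghostMode y j
          (normalOrderedMode l (N - ghostSpin x - k - ghostSpin y - j) v)) =
        ∑ᶠ j, ghostMode y j (ghostMode x k
          (normalOrderedMode l (N - ghostSpin y - ghostSpin x - j - k) v)) := fun k => by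
      rw [map_finsum]
      · refine finsum_congr fun j => ?_
        rw [show N - ghostSpin x - k - ghostSpin y - j = N - ghostSpin y - ghostSpin x - j - k by
          ring, ← Module.End.mul_apply, ← Module.End.mul_apply,
          (h x (by simp) y (by simp) k j).eq]
      · exact ghostMode_normalOrderedMode_support h'.tail (N - ghostSpin x - k - ghostSpin y) v
    simp only [s1, s2]
    exact finsum_comm_of_finite _ fin
  | trans h1 _ ih1 ih2 => rw [ih1 h, ih2 (h.perm h1)]


/-! ### Commutation relations of the elementary fields -/

theorem commute_ghostDeriv {Δ : Type*} (o o' : GhostOsc Δ) :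
    Commute (ghostDeriv o) (ghostDeriv o') := by
  have := ghostDeriv_comm o o'
  rwa [Ring.lie_def, sub_eq_zero] at this

theorem commute_ghostCreate {Δ : Type*} (o o' : GhostOsc Δ) :
    Commute (ghostCreate o) (ghostCreate o') := by
  have := ghostCreate_comm o o'
  rwa [Ring.lie_def, sub_eq_zero] at this

theorem commute_ghostDeriv_create {Δ : Type*} {o o' : GhostOsc Δ} (h : o ≠ o') :
    Commute (ghostDeriv o) (ghostCreate o') := by
  classical
  have := ghostDeriv_create o o'
  rwa [if_neg h, Ring.lie_def, sub_eq_zero] at this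

theorem commute_neg_left {Δ : Type*} {A B : Module.End ℂ (GhostFock Δ)} (h : Commute A B) :
    Commute (-A) B := by
  refine LinearMap.ext fun v => ?_
  have := LinearMap.congr_fun h.eq v
  simp only [Module.End.mul_apply] at this
  simp only [Module.End.mul_apply, LinearMap.neg_apply, map_neg, this]

theorem commute_ghostGamma {Δ : Type*} (a b : Δ) (n k : ℤ) :
    Commute (ghostGamma a n) (ghostGamma b k) := by
  unfold ghostGamma
  split_ifs
  · exact commute_neg_left (commute_neg_left (commute_ghostDeriv _ _)).symm |>.symm
  · exact commute_neg_left (commute_ghostDeriv_create Sum.inr_ne_inl)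
  · exact (commute_neg_left (commute_ghostDeriv_create Sum.inr_ne_inl)).symm
  · exact commute_ghostCreate _ _

theorem commute_ghostGamma_beta {Δ : Type*} {a b : Δ} (hab : a ≠ b) (n k : ℤ) :
    Commute (ghostGamma a n) (ghostBeta b k) := by
  classical
  have := ghostBeta_gamma_comm b a k n
  rw [if_neg (fun h => hab h.1.symm), Ring.lie_def, sub_eq_zero] at this
  exact this.symm

theorem commute_ghostBeta {Δ : Type*} (a b : Δ) (n k : ℤ) :
    Commute (ghostBeta a n) (ghostBeta b k) := by
  unfold ghostBeta
  split_ifs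
  · exact commute_ghostDeriv _ _
  · exact commute_ghostDeriv_create (by simp)
  · exact (commute_ghostDeriv_create (by simp)).symm
  · exact commute_ghostCreate _ _

/-! ### The modes of a field as linear operators -/

/-- The mode `normalOrderedMode L N` as a linear operator, for a list without contractions. -/
noncomputable def listOp {Δ : Type*} (L : List (Δ ⊕ Δ)) (N : ℤ) : Module.End ℂ (GhostFock Δ) :=
  open Classical in
  if h : NonContracting L then
    { toFun := normalOrderedMode L N
      map_add' := normalOrderedMode_add h N
      map_smul' := normalOrderedMode_smul h N }
  else 0

theorem listOp_apply {Δ : Type*} {L : List (Δ ⊕ Δ)} (h : NonContracting L) (N : ℤ)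
    (v : GhostFock Δ) : listOp L N v = normalOrderedMode L N v := by
  simp [listOp, h]

theorem listOp_perm {Δ : Type*} {L L' : List (Δ ⊕ Δ)} (hp : L.Perm L') (h : NonContracting L)
    (N : ℤ) : listOp L N = listOp L' N := by
  refine LinearMap.ext fun v => ?_
  rw [listOp_apply h, listOp_apply (h.perm hp), normalOrderedMode_perm hp h]

theorem listOp_cons {Δ : Type*} {x : Δ ⊕ Δ} {L : List (Δ ⊕ Δ)}
    (h : NonContracting (x :: L)) (N : ℤ) (v : GhostFock Δ) :
    listOp (x :: L) N v = ∑ᶠ k : ℤ, ghostMode x k (listOp L (N - ghostSpin x - k) v) := by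
  simp only [listOp_apply h, listOp_apply h.tail, normalOrderedMode_cons h]

theorem listOp_cons_support {Δ : Type*} {x : Δ ⊕ Δ} {L : List (Δ ⊕ Δ)}
    (h : NonContracting (x :: L)) (N : ℤ) (v : GhostFock Δ) :
    (Function.support fun k : ℤ => ghostMode x k (listOp L (N - k) v)).Finite := by
  have := ghostMode_normalOrderedMode_support h N v
  simp only [← listOp_apply h.tail] at this
  exact this

theorem listOp_commute {Δ : Type*} {x : Δ ⊕ Δ} {L : List (Δ ⊕ Δ)}
    (h : NonContracting (x :: L)) (k N : ℤ) : Commute (ghostMode x k) (listOp L N) := by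
  refine LinearMap.ext fun v => ?_
  simp only [Module.End.mul_apply, listOp_apply h.tail]
  exact ghostMode_normalOrderedMode h k N v

/-- The operator of a monomial symbol. -/
noncomputable def monoOp {Δ : Type*} (N : ℤ) (d : Δ ⊕ Δ →₀ ℕ) : Module.End ℂ (GhostFock Δ) :=
  listOp (Finsupp.toMultiset d).toList N

/-- The mode `fieldMode F N` as a linear operator depending linearly on the symbol `F`. -/
noncomputable def fieldOp {Δ : Type*} (N : ℤ) :
    MvPolynomial (Δ ⊕ Δ) ℂ →ₗ[ℂ] Module.End ℂ (GhostFock Δ) :=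
  (basisMonomials (Δ ⊕ Δ) ℂ).constr ℂ (monoOp N)

theorem fieldOp_monomial {Δ : Type*} (N : ℤ) (d : Δ ⊕ Δ →₀ ℕ) (r : ℂ) :
    fieldOp N (monomial d r) = r • monoOp N d := by
  have h : (monomial d r : MvPolynomial (Δ ⊕ Δ) ℂ) = r • basisMonomials (Δ ⊕ Δ) ℂ d := by
    simp [smul_monomial]
  rw [h, map_smul, fieldOp, Module.Basis.constr_basis]

/-- Every monomial of the symbol is free of contractions. -/
def RegularSymbol {Δ : Type*} (F : MvPolynomial (Δ ⊕ Δ) ℂ) : Prop :=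
  ∀ d ∈ F.support, NonContracting (Finsupp.toMultiset d).toList

theorem fieldMode_eq_fieldOp {Δ : Type*} {F : MvPolynomial (Δ ⊕ Δ) ℂ} (h : RegularSymbol F)
    (N : ℤ) (v : GhostFock Δ) : fieldMode F N v = fieldOp N F v := by
  conv_rhs => rw [F.as_sum, map_sum]
  rw [LinearMap.sum_apply, fieldMode]
  refine Finset.sum_congr rfl fun d hd => ?_
  rw [fieldOp_monomial, LinearMap.smul_apply, monoOp, listOp_apply (h d hd)]

theorem toList_single_add {σ : Type*} (x : σ) (d : σ →₀ ℕ) :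
    (Finsupp.toMultiset (Finsupp.single x 1 + d)).toList.Perm
      (x :: (Finsupp.toMultiset d).toList) := by
  rw [← Multiset.coe_eq_coe, Multiset.coe_toList, map_add, Finsupp.toMultiset_single, one_nsmul,
    ← Multiset.cons_coe, Multiset.coe_toList, Multiset.singleton_add]

theorem mem_toList_toMultiset {σ : Type*} (x : σ) (d : σ →₀ ℕ) :
    x ∈ (Finsupp.toMultiset d).toList ↔ d x ≠ 0 := by
  rw [Multiset.mem_toList, Finsupp.mem_toMultiset, Finsupp.mem_support_iff]

theorem monoOp_single_add {Δ : Type*} {x : Δ ⊕ Δ} {d : Δ ⊕ Δ →₀ ℕ}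
    (h : NonContracting (x :: (Finsupp.toMultiset d).toList)) (N : ℤ) (v : GhostFock Δ) :
    monoOp N (Finsupp.single x 1 + d) v =
      ∑ᶠ k : ℤ, ghostMode x k (monoOp (N - ghostSpin x - k) d v) := by
  unfold monoOp
  rw [listOp_perm (toList_single_add x d) (h.perm (toList_single_add x d).symm), listOp_cons h]

theorem mapDomain_inl_inr {Δ : Type*} (d : Δ →₀ ℕ) (b : Δ) :
    (d.mapDomain (Sum.inl : Δ → Δ ⊕ Δ)) (Sum.inr b) = 0 :=
  Finsupp.mapDomain_of_notMem_range _ _ (by simp)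

theorem mapDomain_inl_inl {Δ : Type*} (d : Δ →₀ ℕ) (b : Δ) :
    (d.mapDomain (Sum.inl : Δ → Δ ⊕ Δ)) (Sum.inl b) = d b :=
  Finsupp.mapDomain_apply Sum.inl_injective _ _

/-- Modes of the `γ`'s commute, modes of a single `β` commute, and `β_b` fails to commute only with
`γ^b`, which the hypothesis keeps out of the monomial. -/
theorem nonContracting_gamma {Δ : Type*} {x : Δ ⊕ Δ} {d : Δ →₀ ℕ}
    (hx : ∀ b, x = Sum.inr b → d b = 0) :
    NonContracting (x :: (Finsupp.toMultiset (d.mapDomain (Sum.inl : Δ → Δ ⊕ Δ))).toList) := by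
  intro y hy z hz n k
  have key : ∀ w ∈ (Finsupp.toMultiset (d.mapDomain (Sum.inl : Δ → Δ ⊕ Δ))).toList,
      ∃ a, w = Sum.inl a ∧ d a ≠ 0 := by
    intro w hw
    rw [mem_toList_toMultiset] at hw
    rcases w with a | b
    · exact ⟨a, rfl, by rwa [mapDomain_inl_inl] at hw⟩
    · exact absurd (mapDomain_inl_inr d b) hw
  have cross : ∀ w ∈ (Finsupp.toMultiset (d.mapDomain (Sum.inl : Δ → Δ ⊕ Δ))).toList,
      ∀ n k : ℤ, Commute (ghostMode x n) (ghostMode w k) := by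
    intro w hw n k
    obtain ⟨a, rfl, ha⟩ := key w hw
    rcases x with c | c
    · exact commute_ghostGamma _ _ _ _
    · refine (commute_ghostGamma_beta ?_ _ _).symm
      rintro rfl
      exact ha (hx _ rfl)
  rw [List.mem_cons] at hy hz
  rcases hy with rfl | hy <;> rcases hz with rfl | hz
  · rcases z with c | c
    · exact commute_ghostGamma _ _ _ _
    · exact commute_ghostBeta _ _ _ _
  · exact cross z hz n k
  · exact (cross y hy k n).symm
  · obtain ⟨a, rfl, -⟩ := key y hy
    obtain ⟨b, rfl, -⟩ := key z hz
    exact commute_ghostGamma _ _ _ _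

/-! ### Polynomials in `γ` and currents -/

/-- The modes of `Q(γ(z))`. -/
noncomputable def gammaOp {Δ : Type*} (Q : MvPolynomial Δ ℂ) (N : ℤ) :
    Module.End ℂ (GhostFock Δ) :=
  fieldOp N (rename Sum.inl Q)

/-- The symbol of the vector field with coefficients `S`. -/
noncomputable def currentSymbol {Δ : Type*} [Fintype Δ] (S : Δ → MvPolynomial Δ ℂ) :
    MvPolynomial (Δ ⊕ Δ) ℂ :=
  ∑ b, rename Sum.inl (S b) * X (Sum.inr b)

/-- The modes of the current of a vector field. -/
noncomputable def currentOp {Δ : Type*} [Fintype Δ] (S : Δ → MvPolynomial Δ ℂ) (N : ℤ) :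
    Module.End ℂ (GhostFock Δ) :=
  fieldOp N (currentSymbol S)

theorem gammaOp_monomial {Δ : Type*} (d : Δ →₀ ℕ) (r : ℂ) (N : ℤ) :
    gammaOp (monomial d r) N = r • monoOp N (d.mapDomain (Sum.inl : Δ → Δ ⊕ Δ)) := by
  rw [gammaOp, rename_monomial, fieldOp_monomial]

theorem gammaOp_add {Δ : Type*} (Q Q' : MvPolynomial Δ ℂ) (N : ℤ) :
    gammaOp (Q + Q') N = gammaOp Q N + gammaOp Q' N := by
  simp [gammaOp]

theorem gammaOp_C {Δ : Type*} (r : ℂ) (N : ℤ) :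
    gammaOp (C r : MvPolynomial Δ ℂ) N = if N = 0 then r • 1 else 0 := by
  rw [C_apply, gammaOp_monomial]
  have hnil : NonContracting ([] : List (Δ ⊕ Δ)) := fun x hx => by simp at hx
  have h : monoOp N ((0 : Δ →₀ ℕ).mapDomain (Sum.inl : Δ → Δ ⊕ Δ)) = if N = 0 then 1 else 0 := by
    refine LinearMap.ext fun v => ?_
    rw [monoOp, Finsupp.mapDomain_zero, Finsupp.toMultiset_zero, Multiset.toList_zero,
      listOp_apply hnil, normalOrderedMode_nil]
    split_ifs <;> rfl
  rw [h]
  split_ifs <;> simp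

theorem gammaOp_single_add {Δ : Type*} (a : Δ) (d : Δ →₀ ℕ) (r : ℂ) (N : ℤ) (v : GhostFock Δ) :
    gammaOp (monomial (Finsupp.single a 1 + d) r) N v =
      ∑ᶠ k : ℤ, ghostGamma a k (gammaOp (monomial d r) (N - k) v) := by
  rw [gammaOp_monomial, Finsupp.mapDomain_add, Finsupp.mapDomain_single, LinearMap.smul_apply,
    monoOp_single_add (nonContracting_gamma (by simp)), smul_finsum]
  refine finsum_congr fun k => ?_
  rw [gammaOp_monomial, LinearMap.smul_apply, map_smul]
  simp [ghostSpin, ghostMode]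

theorem gammaOp_single_add_support {Δ : Type*} (a : Δ) (d : Δ →₀ ℕ) (r : ℂ) (N : ℤ)
    (v : GhostFock Δ) :
    (Function.support fun k : ℤ =>
      ghostGamma a k (gammaOp (monomial d r) (N - k) v)).Finite := by
  refine (listOp_cons_support (nonContracting_gamma (x := Sum.inl a) (d := d) (by simp)) N
    v).subset ?_
  intro k hk
  rw [Function.mem_support] at hk ⊢
  intro h0
  refine hk ?_
  rw [gammaOp_monomial, LinearMap.smul_apply, map_smul]
  exact (congrArg (r • ·) h0).trans (smul_zero r)

theorem commute_ghostGamma_gammaOp {Δ : Type*} (a : Δ) (n : ℤ) (Q : MvPolynomial Δ ℂ) (N : ℤ) :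
    Commute (ghostGamma a n) (gammaOp Q N) := by
  induction Q using MvPolynomial.induction_on' with
  | monomial d r =>
    rw [gammaOp_monomial]
    refine Commute.smul_right ?_ r
    exact listOp_commute (nonContracting_gamma (x := Sum.inl a) (d := d) (by simp)) n N
  | add p q hp hq =>
    rw [gammaOp_add]
    exact hp.add_right hq

theorem currentSymbol_term {Δ : Type*} (d : Δ →₀ ℕ) (r : ℂ) (b : Δ) :
    rename (Sum.inl : Δ → Δ ⊕ Δ) (monomial d r) * X (Sum.inr b) =
      monomial (Finsupp.single (Sum.inr b) 1 + d.mapDomain (Sum.inl : Δ → Δ ⊕ Δ)) r := by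
  rw [rename_monomial, X, monomial_mul, mul_one, add_comm]

/-- The only factor that `γ^a[n]` does not commute with is `β_b[k]` for `a = b` and `k = -n`.
Removing it leaves the mode `N - 1 - (-n)`, where the `1` is the spin of `β`. -/
theorem ghostGamma_commutator_term {Δ : Type*} [DecidableEq Δ] (a b : Δ) (n N : ℤ) (d : Δ →₀ ℕ)
    (r : ℂ) (hd : d b = 0) :
    ghostGamma a n * fieldOp N (rename Sum.inl (monomial d r) * X (Sum.inr b)) -
        fieldOp N (rename Sum.inl (monomial d r) * X (Sum.inr b)) * ghostGamma a n =
      if a = b then -gammaOp (monomial d r) (N + n - 1) else 0 := by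
  have hnc := nonContracting_gamma (x := Sum.inr b) (d := d) (by simpa using hd)
  have hop : ∀ v, fieldOp N (rename Sum.inl (monomial d r) * X (Sum.inr b)) v =
      ∑ᶠ k : ℤ, ghostBeta b k (gammaOp (monomial d r) (N - 1 - k) v) := by
    intro v
    rw [currentSymbol_term, fieldOp_monomial, LinearMap.smul_apply, monoOp_single_add hnc,
      smul_finsum]
    refine finsum_congr fun k => ?_
    rw [gammaOp_monomial, LinearMap.smul_apply, map_smul]
    simp [ghostSpin, ghostMode]
  have hfin : ∀ v, (Function.support fun k : ℤ =>
      ghostBeta b k (gammaOp (monomial d r) (N - 1 - k) v)).Finite := by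
    intro v
    refine (listOp_cons_support hnc (N - 1) v).subset ?_
    intro k hk
    rw [Function.mem_support] at hk ⊢
    intro h0
    refine hk ?_
    rw [gammaOp_monomial, LinearMap.smul_apply, map_smul]
    exact (congrArg (r • ·) h0).trans (smul_zero r)
  refine LinearMap.ext fun v => ?_
  rw [LinearMap.sub_apply, Module.End.mul_apply, Module.End.mul_apply, hop, hop,
    map_finsum _ (hfin v)]
  have hfin1 : (Function.support fun k : ℤ =>
      ghostGamma a n (ghostBeta b k (gammaOp (monomial d r) (N - 1 - k) v))).Finite := by
    refine (hfin v).subset fun k hk h0 => hk ?_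
    change ghostGamma a n (ghostBeta b k (gammaOp (monomial d r) (N - 1 - k) v)) = 0
    have h0' : ghostBeta b k (gammaOp (monomial d r) (N - 1 - k) v) = 0 := h0
    rw [h0', map_zero]
  rw [← finsum_sub_distrib hfin1 (hfin _)]
  have hterm : ∀ k, ghostGamma a n (ghostBeta b k (gammaOp (monomial d r) (N - 1 - k) v)) -
      ghostBeta b k (gammaOp (monomial d r) (N - 1 - k) (ghostGamma a n v)) =
      if b = a ∧ k + n = 0 then -gammaOp (monomial d r) (N - 1 - k) v else 0 := by
    intro k
    have h1 := LinearMap.congr_fun (commute_ghostGamma_gammaOp a n (monomial d r) (N - 1 - k)).eq v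
    rw [Module.End.mul_apply, Module.End.mul_apply] at h1
    have h2 := LinearMap.congr_fun (ghostBeta_gamma_comm b a k n)
      (gammaOp (monomial d r) (N - 1 - k) v)
    rw [Ring.lie_def, LinearMap.sub_apply, Module.End.mul_apply, Module.End.mul_apply] at h2
    rw [← h1, ← neg_sub, h2]
    split_ifs <;> simp
  simp only [hterm]
  rw [finsum_eq_single _ (-n) (fun k hk => if_neg (fun h => hk (by omega)))]
  have e : N - 1 - -n = N + n - 1 := by ring
  by_cases hab : a = b
  · simp [hab, e]
  · simp [hab, Ne.symm hab]

theorem ghostGamma_commutator_current {Δ : Type*} [Fintype Δ] (S : Δ → MvPolynomial Δ ℂ)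
    (hS : ∀ b, ∀ d ∈ (S b).support, d b = 0) (a : Δ) (n N : ℤ) :
    ghostGamma a n * currentOp S N - currentOp S N * ghostGamma a n =
      -gammaOp (S a) (N + n - 1) := by
  classical
  have key : ∀ b, ghostGamma a n * fieldOp N (rename Sum.inl (S b) * X (Sum.inr b)) -
        fieldOp N (rename Sum.inl (S b) * X (Sum.inr b)) * ghostGamma a n =
      if a = b then -gammaOp (S b) (N + n - 1) else 0 := by
    intro b
    have e1 : fieldOp N (rename Sum.inl (S b) * X (Sum.inr b)) =
        ∑ d ∈ (S b).support,
          fieldOp N (rename Sum.inl (monomial d ((S b).coeff d)) * X (Sum.inr b)) := by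
      conv_lhs => rw [(S b).as_sum, map_sum, Finset.sum_mul, map_sum]
    have e2 : gammaOp (S b) (N + n - 1) =
        ∑ d ∈ (S b).support, gammaOp (monomial d ((S b).coeff d)) (N + n - 1) := by
      unfold gammaOp
      conv_lhs => rw [(S b).as_sum, map_sum, map_sum]
    rw [e1, e2, Finset.mul_sum, Finset.sum_mul, ← Finset.sum_sub_distrib,
      Finset.sum_congr rfl fun d hd => ghostGamma_commutator_term a b n N d _ (hS b d hd)]
    split_ifs
    · rw [Finset.sum_neg_distrib]
    · simp
  unfold currentOp currentSymbol
  rw [map_sum, Finset.mul_sum, Finset.sum_mul, ← Finset.sum_sub_distrib,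
    Finset.sum_congr rfl fun b _ => key b]
  simp

theorem regularSymbol_gamma {Δ : Type*} (Q : MvPolynomial Δ ℂ) :
    RegularSymbol (rename (Sum.inl : Δ → Δ ⊕ Δ) Q) := by
  classical
  intro d hd
  rw [support_rename_of_injective Sum.inl_injective, Finset.mem_image] at hd
  obtain ⟨d', -, rfl⟩ := hd
  rcases isEmpty_or_nonempty Δ with he | ⟨⟨a⟩⟩
  · intro x
    exact x.elim he.elim he.elim
  · exact (nonContracting_gamma (x := Sum.inl a) (d := d') (by simp)).tail

theorem regularSymbol_current {Δ : Type*} [Fintype Δ] (S : Δ → MvPolynomial Δ ℂ)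
    (hS : ∀ b, ∀ d ∈ (S b).support, d b = 0) : RegularSymbol (currentSymbol S) := by
  classical
  intro d hd
  have h1 := support_sum hd
  rw [Finset.mem_biUnion] at h1
  obtain ⟨b, -, hb⟩ := h1
  rw [support_mul_X, Finset.mem_map, support_rename_of_injective Sum.inl_injective] at hb
  obtain ⟨d', hd', rfl⟩ := hb
  rw [Finset.mem_image] at hd'
  obtain ⟨d'', hd'', rfl⟩ := hd'
  simp only [addRightEmbedding_apply]
  rw [add_comm]
  refine (nonContracting_gamma (x := Sum.inr b) (d := d'') ?_).perm
    (toList_single_add (Sum.inr b) (d''.mapDomain Sum.inl)).symm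
  rintro b' h
  obtain rfl := Sum.inr_injective h
  exact hS _ d'' hd''


/-! ### Leibniz sums over lists -/

/-- The sum over the entries of a list of the products in which `K` is replaced by `κ` at that
entry. -/
def leibnizSum {ι R : Type*} [Semiring R] (K κ : ι → R) : List ι → R
  | [] => 0
  | x :: l => κ x * (l.map K).prod + K x * leibnizSum K κ l

/-- With `leibnizSum_take_mul_prod`, this turns the Leibniz rule on either side of a slot `i` into a
sum over positions. Both are used twice: for operators with `K = id` and for matrices of absolute
values. -/
theorem prod_mul_leibnizSum_drop {ι R : Type*} [Semiring R] (K κ : ι → R) {n : ℕ}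
    (x : Fin n → ι) (i : ℕ) :
    (((List.ofFn x).take i).map K).prod * leibnizSum K κ ((List.ofFn x).drop i) =
      ∑ j : Fin n, if i ≤ j then
        (List.ofFn (Function.update (fun k => K (x k)) j (κ (x j)))).prod else 0 := by
  induction n generalizing i with
  | zero => simp [leibnizSum]
  | succ n ih =>
    have hs : ∀ j : Fin n, (List.ofFn (Function.update (fun k => K (x k)) j.succ
        (κ (x j.succ)))).prod = K (x 0) * (List.ofFn (Function.update
          (fun k : Fin n => K (x k.succ)) j (κ (x j.succ)))).prod := by
      intro j
      rw [List.ofFn_succ, List.prod_cons]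
      congr 3
      ext k
      rcases eq_or_ne k j with rfl | h
      · simp
      · simp [h]
    have h0 : (List.ofFn (Function.update (fun k => K (x k)) 0 (κ (x 0)))).prod =
        κ (x 0) * ((List.ofFn fun k : Fin n => x k.succ).map K).prod := by
      rw [List.ofFn_succ, List.prod_cons, List.map_ofFn]
      simp [Function.comp_def]
    rcases i with _ | i
    · have := ih (fun k => x k.succ) 0
      simp only [List.take_zero, List.map_nil, List.prod_nil, one_mul, List.drop_zero,
        Nat.zero_le, if_true] at this
      rw [Fin.sum_univ_succ]
      simp only [hs, h0, Nat.zero_le, if_true, List.take_zero, List.map_nil, List.prod_nil,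
        one_mul, List.drop_zero]
      rw [← Finset.mul_sum, ← this, List.ofFn_succ, leibnizSum]
    · rw [Fin.sum_univ_succ, List.ofFn_succ, List.take_succ_cons, List.drop_succ_cons,
        List.map_cons, List.prod_cons, mul_assoc, ih]
      simp only [hs, Fin.val_zero, Fin.val_succ, Nat.add_le_add_iff_right, Nat.le_zero,
        Nat.succ_ne_zero, if_false, zero_add, Finset.mul_sum, mul_ite, mul_zero]

theorem leibnizSum_take_mul_prod {ι R : Type*} [Semiring R] (K κ : ι → R) {n : ℕ}
    (x : Fin n → ι) (i : ℕ) :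
    leibnizSum K κ ((List.ofFn x).take i) * (((List.ofFn x).drop i).map K).prod =
      ∑ j : Fin n, if (j : ℕ) < i then
        (List.ofFn (Function.update (fun k => K (x k)) j (κ (x j)))).prod else 0 := by
  induction n generalizing i with
  | zero => simp [leibnizSum]
  | succ n ih =>
    have hs : ∀ j : Fin n, (List.ofFn (Function.update (fun k => K (x k)) j.succ
        (κ (x j.succ)))).prod = K (x 0) * (List.ofFn (Function.update
          (fun k : Fin n => K (x k.succ)) j (κ (x j.succ)))).prod := by
      intro j
      rw [List.ofFn_succ, List.prod_cons]
      congr 3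
      ext k
      rcases eq_or_ne k j with rfl | h
      · simp
      · simp [h]
    have h0 : (List.ofFn (Function.update (fun k => K (x k)) 0 (κ (x 0)))).prod =
        κ (x 0) * ((List.ofFn fun k : Fin n => x k.succ).map K).prod := by
      rw [List.ofFn_succ, List.prod_cons, List.map_ofFn]
      simp [Function.comp_def]
    rcases i with _ | i
    · simp [leibnizSum]
    · rw [Fin.sum_univ_succ, List.ofFn_succ, List.take_succ_cons, List.drop_succ_cons,
        leibnizSum, add_mul, mul_assoc (K (x 0)), ih, mul_assoc (κ (x 0)), ← List.prod_append,
        ← List.map_append, List.take_append_drop]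
      simp only [hs, h0, Fin.val_zero, Fin.val_succ, Nat.add_lt_add_iff_right, Nat.succ_pos,
        if_true, Finset.mul_sum, mul_ite, mul_zero]

theorem prod_ofFn_update {R : Type*} [Monoid R] {n : ℕ} (x : Fin n → R) (i : Fin n) (y : R) :
    (List.ofFn (Function.update x i y)).prod =
      ((List.ofFn x).take i).prod * y * ((List.ofFn x).drop (i + 1)).prod := by
  induction n with
  | zero => exact i.elim0
  | succ n ih =>
    refine Fin.cases ?_ (fun i => ?_) i
    · rw [List.ofFn_succ, List.ofFn_succ]
      simp
    · rw [List.ofFn_succ, List.ofFn_succ (f := x)]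
      have : (fun k : Fin n => Function.update x i.succ y k.succ) =
          Function.update (fun k : Fin n => x k.succ) i y := by
        ext k
        rcases eq_or_ne k i with rfl | h
        · simp
        · simp [h]
      rw [this, List.prod_cons, ih, Function.update_of_ne (Fin.succ_ne_zero i).symm]
      simp [mul_assoc]

theorem prod_drop_ofFn {R : Type*} [Monoid R] {n : ℕ} (x : Fin n → R) (i : Fin n) :
    ((List.ofFn x).drop i).prod = x i * ((List.ofFn x).drop (i + 1)).prod := by
  rw [List.drop_eq_getElem_cons (by simp), List.prod_cons]
  simp

/-! ### Nonnegative kernels -/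

/-- Matrices with entries in `[0, ∞]`. -/
def Kern (I : Type*) : Type _ := I → I → ENNReal

namespace Kern

variable {I : Type*}

noncomputable instance : AddCommMonoid (Kern I) := inferInstanceAs (AddCommMonoid (I → I → ENNReal))

instance : PartialOrder (Kern I) := inferInstanceAs (PartialOrder (I → I → ENNReal))

theorem add_apply (K L : Kern I) (d e : I) : (K + L) d e = K d e + L d e := rfl

theorem zero_apply (d e : I) : (0 : Kern I) d e = 0 := rfl

noncomputable instance : Mul (Kern I) := ⟨fun K L d e => ∑' x, K d x * L x e⟩

theorem mul_apply (K L : Kern I) (d e : I) : (K * L) d e = ∑' x, K d x * L x e := rfl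

noncomputable instance : One (Kern I) := ⟨fun d e => open Classical in if d = e then 1 else 0⟩

theorem one_apply (d e : I) : (1 : Kern I) d e = open Classical in if d = e then 1 else 0 := rfl

/-- Sums in `[0, ∞]` always exist and can be interchanged, so infinite matrices multiply
associatively without side conditions. Estimates of traces become algebra, and convergence is only
the question whether a value is `⊤`. -/
noncomputable instance : Semiring (Kern I) where
  __ := (inferInstance : AddCommMonoid (Kern I))
  left_distrib K L M := by
    funext d e
    simp only [mul_apply, add_apply, mul_add, ENNReal.tsum_add]
  right_distrib K L M := by
    funext d e
    simp only [mul_apply, add_apply, add_mul, ENNReal.tsum_add]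
  zero_mul K := by
    funext d e
    simp [mul_apply, zero_apply]
  mul_zero K := by
    funext d e
    simp [mul_apply, zero_apply]
  mul_assoc K L M := by
    funext d e
    simp only [mul_apply, ← ENNReal.tsum_mul_left, ← ENNReal.tsum_mul_right]
    rw [ENNReal.tsum_comm]
    simp only [mul_assoc]
  one_mul K := by
    funext d e
    rw [mul_apply, tsum_eq_single d]
    · simp [one_apply]
    · intro x hx
      simp [one_apply, hx.symm]
  mul_one K := by
    funext d e
    rw [mul_apply, tsum_eq_single e]
    · simp [one_apply]
    · intro x hx
      simp [one_apply, hx]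

theorem le_def {K L : Kern I} : K ≤ L ↔ ∀ d e, K d e ≤ L d e := Iff.rfl

theorem add_le_add {K L K' L' : Kern I} (h : K ≤ L) (h' : K' ≤ L') : K + K' ≤ L + L' :=
  fun d e => _root_.add_le_add (show K d e ≤ L d e from h d e) (show K' d e ≤ L' d e from h' d e)

theorem mul_le_mul {K L K' L' : Kern I} (h : K ≤ L) (h' : K' ≤ L') : K * K' ≤ L * L' :=
  fun d e => ENNReal.tsum_le_tsum fun x => _root_.mul_le_mul' (h d x) (h' x e)

/-- The pointwise sum of a family of kernels. -/
noncomputable def sum {ι : Type*} (K : ι → Kern I) : Kern I := fun d e => ∑' i, K i d e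

theorem mul_sum {ι : Type*} (L : Kern I) (K : ι → Kern I) : L * sum K = sum fun i => L * K i := by
  funext d e
  simp only [mul_apply, sum, ← ENNReal.tsum_mul_left]
  rw [ENNReal.tsum_comm]

theorem sum_mul {ι : Type*} (K : ι → Kern I) (L : Kern I) : sum K * L = sum fun i => K i * L := by
  funext d e
  simp only [mul_apply, sum, ← ENNReal.tsum_mul_right]
  rw [ENNReal.tsum_comm]

/-- The kernel has finite columns with finite entries. -/
def ColFinite (K : Kern I) : Prop := ∀ e, {d | K d e ≠ 0}.Finite ∧ ∀ d, K d e ≠ ⊤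

theorem ColFinite.mul {K L : Kern I} (hK : ColFinite K) (hL : ColFinite L) :
    ColFinite (K * L) := by
  intro e
  constructor
  · refine Set.Finite.subset ((hL e).1.biUnion fun x _ => (hK x).1) fun d hd => ?_
    simp only [Set.mem_iUnion]
    by_contra hcon
    refine hd (ENNReal.tsum_eq_zero.2 fun x => ?_)
    by_cases hx : L x e = 0
    · rw [hx, mul_zero]
    · have : K d x = 0 := by
        by_contra h
        exact hcon ⟨x, hx, h⟩
      rw [this, zero_mul]
  · intro d
    rw [mul_apply, tsum_eq_sum (s := (hL e).1.toFinset)]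
    · exact ENNReal.sum_ne_top.2 fun x _ => ENNReal.mul_ne_top ((hK x).2 d) ((hL e).2 x)
    · intro x hx
      have : L x e = 0 := by simpa using hx
      rw [this, mul_zero]

theorem ColFinite.one : ColFinite (1 : Kern I) := by
  classical
  intro e
  refine ⟨(Set.finite_singleton e).subset fun d hd => ?_, fun d => ?_⟩
  · by_contra h
    exact hd (by simp only [one_apply]; exact if_neg h)
  · rw [one_apply]
    split_ifs <;> simp

theorem ColFinite.list_prod {l : List (Kern I)} (h : ∀ K ∈ l, ColFinite K) :
    ColFinite l.prod := by
  induction l with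
  | nil => exact ColFinite.one
  | cons K l ih =>
    rw [List.prod_cons]
    exact (h K (by simp)).mul (ih fun L hL => h L (by simp [hL]))

end Kern


/-! ### Kernels of operators on the Fock space -/

/-- The absolute values of the matrix entries of an operator. -/
noncomputable def opKern {Δ : Type*} (A : Module.End ℂ (GhostFock Δ)) :
    Kern (GhostOsc Δ →₀ ℕ) :=
  fun d e => ‖coeff d (A (monomial e 1))‖ₑ

theorem opKern_zero {Δ : Type*} : opKern (0 : Module.End ℂ (GhostFock Δ)) = 0 := by
  funext d e
  simp [opKern, Kern.zero_apply]

theorem opKern_neg {Δ : Type*} (A : Module.End ℂ (GhostFock Δ)) : opKern (-A) = opKern A := by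
  funext d e
  simp [opKern]

theorem opKern_add_le {Δ : Type*} (A B : Module.End ℂ (GhostFock Δ)) :
    opKern (A + B) ≤ opKern A + opKern B := by
  intro d e
  simp only [opKern, LinearMap.add_apply, coeff_add, Kern.add_apply]
  exact enorm_add_le _ _

theorem opKern_smul_apply {Δ : Type*} (r : ℂ) (A : Module.End ℂ (GhostFock Δ))
    (d e : GhostOsc Δ →₀ ℕ) : opKern (r • A) d e = ‖r‖ₑ * opKern A d e := by
  simp [opKern, enorm_mul]

theorem opKern_one {Δ : Type*} : opKern (1 : Module.End ℂ (GhostFock Δ)) = 1 := by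
  classical
  funext d e
  simp only [opKern, Module.End.one_apply, coeff_monomial, Kern.one_apply, eq_comm (a := d)]
  split_ifs <;> simp

theorem coeff_mul_apply {Δ : Type*} (A B : Module.End ℂ (GhostFock Δ)) (d : GhostOsc Δ →₀ ℕ)
    (v : GhostFock Δ) :
    coeff d ((A * B) v) =
      ∑ x ∈ (B v).support, coeff d (A (monomial x 1)) * coeff x (B v) := by
  rw [Module.End.mul_apply]
  conv_lhs => rw [(B v).as_sum, map_sum, coeff_sum]
  refine Finset.sum_congr rfl fun x _ => ?_
  have : (monomial x (coeff x (B v)) : GhostFock Δ) = coeff x (B v) • monomial x 1 := by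
    simp [smul_monomial]
  rw [this, map_smul, coeff_smul, smul_eq_mul, mul_comm]

theorem opKern_mul_le {Δ : Type*} (A B : Module.End ℂ (GhostFock Δ)) :
    opKern (A * B) ≤ opKern A * opKern B := by
  intro d e
  rw [opKern, coeff_mul_apply, Kern.mul_apply]
  refine (enorm_sum_le _ _).trans ?_
  simp only [enorm_mul]
  exact ENNReal.sum_le_tsum _

theorem opKern_list_prod_le {Δ : Type*} (l : List (Module.End ℂ (GhostFock Δ))) :
    opKern l.prod ≤ (l.map opKern).prod := by
  induction l with
  | nil => simp [opKern_one]
  | cons A l ih =>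
    rw [List.prod_cons, List.map_cons, List.prod_cons]
    exact (opKern_mul_le _ _).trans (Kern.mul_le_mul le_rfl ih)

theorem opKern_colFinite {Δ : Type*} (A : Module.End ℂ (GhostFock Δ)) :
    (opKern A).ColFinite := by
  intro e
  refine ⟨(A (monomial e 1)).support.finite_toSet.subset fun d hd => ?_, fun d => enorm_ne_top⟩
  rw [Finset.mem_coe, mem_support_iff]
  intro h
  exact hd (by simp [opKern, h])

/-- Each row and each column of the matrix of the operator has at most one non-zero entry. -/
structure IsMonomialOp {Δ : Type*} (g : Module.End ℂ (GhostFock Δ)) : Prop where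
  row : ∀ d, ∃ x r, ∀ v, coeff d (g v) = r * coeff x v
  col : ∀ e, ∃ x r, g (monomial e 1) = monomial x r

/-- A row with a single entry leaves a single term in the product, so the triangle inequality loses
nothing. Equality, rather than `opKern_mul_le`, is what allows a mode to be commuted past other
factors at the level of absolute values. -/
theorem IsMonomialOp.opKern_mul {Δ : Type*} {g : Module.End ℂ (GhostFock Δ)}
    (hg : IsMonomialOp g) (A : Module.End ℂ (GhostFock Δ)) :
    opKern (g * A) = opKern g * opKern A := by
  classical
  funext d e
  obtain ⟨x, r, h⟩ := hg.row d
  rw [Kern.mul_apply, tsum_eq_single x]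
  · simp [opKern, h, enorm_mul, coeff_monomial]
  · intro y hy
    simp [opKern, h, coeff_monomial, hy]

theorem IsMonomialOp.mul_opKern {Δ : Type*} {g : Module.End ℂ (GhostFock Δ)}
    (hg : IsMonomialOp g) (A : Module.End ℂ (GhostFock Δ)) :
    opKern (A * g) = opKern A * opKern g := by
  classical
  funext d e
  obtain ⟨x, r, h⟩ := hg.col e
  have h' : g (monomial e 1) = r • monomial x 1 := by rw [h]; simp [smul_monomial]
  rw [Kern.mul_apply, tsum_eq_single x]
  · simp [opKern, h', enorm_mul, mul_comm, coeff_monomial]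
  · intro y hy
    simp [opKern, h, coeff_monomial, hy.symm]

theorem coeff_ghostDeriv {Δ : Type*} (o : GhostOsc Δ) (d : GhostOsc Δ →₀ ℕ) (v : GhostFock Δ) :
    coeff d (ghostDeriv o v) = (d o + 1) * coeff (d + Finsupp.single o 1) v := by
  have h := coeff_pderiv (i := o) v d
  rw [mul_comm]
  exact h

theorem coeff_ghostCreate_add {Δ : Type*} (o : GhostOsc Δ) (d : GhostOsc Δ →₀ ℕ)
    (v : GhostFock Δ) : coeff (d + Finsupp.single o 1) (ghostCreate o v) = coeff d v := by
  rw [add_comm]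
  exact coeff_X_mul d o v

theorem coeff_ghostCreate_of_eq_zero {Δ : Type*} {o : GhostOsc Δ} {d : GhostOsc Δ →₀ ℕ}
    (hd : d o = 0) (v : GhostFock Δ) : coeff d (ghostCreate o v) = 0 := by
  classical
  refine (coeff_X_mul' d o v).trans (if_neg ?_)
  simpa using hd

theorem exists_add_single {σ : Type*} {o : σ} {d : σ →₀ ℕ} (hd : d o ≠ 0) :
    ∃ d', d = d' + Finsupp.single o 1 :=
  ⟨d - Finsupp.single o 1, (tsub_add_cancel_of_le (Finsupp.single_le_iff.2
    (Nat.one_le_iff_ne_zero.2 hd))).symm⟩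

theorem ghostCreate_monomial {Δ : Type*} (o : GhostOsc Δ) (e : GhostOsc Δ →₀ ℕ) (r : ℂ) :
    ghostCreate o (monomial e r : GhostFock Δ) = monomial (e + Finsupp.single o 1) r := by
  change X o * monomial e r = _
  rw [X, monomial_mul, one_mul, add_comm]

theorem ghostDeriv_monomial {Δ : Type*} (o : GhostOsc Δ) (e : GhostOsc Δ →₀ ℕ) (r : ℂ) :
    ghostDeriv o (monomial e r : GhostFock Δ) =
      monomial (e - Finsupp.single o 1) (r * e o) :=
  pderiv_monomial

theorem isMonomialOp_ghostCreate {Δ : Type*} (o : GhostOsc Δ) : IsMonomialOp (ghostCreate o) where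
  row d := by
    by_cases hd : d o = 0
    · exact ⟨0, 0, fun v => by rw [coeff_ghostCreate_of_eq_zero hd, zero_mul]⟩
    · obtain ⟨d', rfl⟩ := exists_add_single hd
      exact ⟨d', 1, fun v => by rw [coeff_ghostCreate_add, one_mul]⟩
  col e := ⟨_, _, ghostCreate_monomial o e 1⟩

theorem isMonomialOp_ghostDeriv {Δ : Type*} (o : GhostOsc Δ) : IsMonomialOp (ghostDeriv o) where
  row d := ⟨_, _, fun v => coeff_ghostDeriv o d v⟩
  col e := ⟨_, _, ghostDeriv_monomial o e 1⟩

/-! ### Traces -/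

/-- The eigenvalue of `q ^ T[0] e ^ H[0]` on a monomial. -/
noncomputable def ghostWeight {Δ : Type*} (q : ℂ) (c : Δ → ℂ) (d : GhostOsc Δ →₀ ℕ) : ℂ :=
  q ^ ghostEnergy d * Complex.exp (ghostCharge c d)

/-- The factor of `ghostWeight` that belongs to an oscillator. -/
noncomputable def oscWeight {Δ : Type*} (q : ℂ) (c : Δ → ℂ) : GhostOsc Δ → ℂ
  | Sum.inl (a, n) => q ^ n * Complex.exp (-c a)
  | Sum.inr (a, n) => q ^ (n + 1) * Complex.exp (c a)

theorem ghostWeight_add {Δ : Type*} (q : ℂ) (c : Δ → ℂ) (d e : GhostOsc Δ →₀ ℕ) :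
    ghostWeight q c (d + e) = ghostWeight q c d * ghostWeight q c e := by
  classical
  unfold ghostWeight
  have h1 : ghostEnergy (d + e) = ghostEnergy d + ghostEnergy e :=
    Finsupp.sum_add_index' (by simp) (by intros; ring)
  have h2 : ghostCharge c (d + e) = ghostCharge c d + ghostCharge c e :=
    Finsupp.sum_add_index' (by simp) (by intros; push_cast; ring)
  rw [h1, h2, pow_add, Complex.exp_add]
  ring

theorem ghostWeight_single {Δ : Type*} (q : ℂ) (c : Δ → ℂ) (o : GhostOsc Δ) :
    ghostWeight q c (Finsupp.single o 1) = oscWeight q c o := by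
  rcases o with ⟨a, n⟩ | ⟨a, n⟩ <;> simp [ghostWeight, ghostEnergy, ghostCharge, oscWeight]

theorem ghostWeight_zero {Δ : Type*} (q : ℂ) (c : Δ → ℂ) : ghostWeight q c 0 = 1 := by
  simp [ghostWeight, ghostEnergy, ghostCharge]

/-- The trace of a kernel against a weight, restricted to a set of basis vectors. -/
noncomputable def kernTrace {I : Type*} (w : I → ENNReal) (M : Kern I) : ENNReal :=
  ∑' d, w d * M d d

theorem kernTrace_mono {I : Type*} (w : I → ENNReal) {M M' : Kern I} (h : M ≤ M') :
    kernTrace w M ≤ kernTrace w M' :=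
  ENNReal.tsum_le_tsum fun d => mul_le_mul_right (h d d) _

theorem kernTrace_add {I : Type*} (w : I → ENNReal) (M M' : Kern I) :
    kernTrace w (M + M') = kernTrace w M + kernTrace w M' := by
  simp [kernTrace, Kern.add_apply, mul_add, ENNReal.tsum_add]

theorem kernTrace_sum {I : Type*} (w : I → ENNReal) {ι : Type*} (s : Finset ι) (M : ι → Kern I) :
    kernTrace w (∑ i ∈ s, M i) = ∑ i ∈ s, kernTrace w (M i) := by
  classical
  induction s using Finset.induction_on with
  | empty => simp [kernTrace, Kern.zero_apply]
  | insert a s ha ih => rw [Finset.sum_insert ha, Finset.sum_insert ha, kernTrace_add, ih]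

theorem kernTrace_kernSum {I : Type*} (w : I → ENNReal) {ι : Type*} (M : ι → Kern I) :
    kernTrace w (Kern.sum M) = ∑' i, kernTrace w (M i) := by
  simp only [kernTrace, Kern.sum, ← ENNReal.tsum_mul_left]
  rw [ENNReal.tsum_comm]

theorem tsum_add_single {Δ R : Type*} [AddCommMonoid R] [TopologicalSpace R] (o : GhostOsc Δ)
    (f : (GhostOsc Δ →₀ ℕ) → R) (hf : ∀ d, d o = 0 → f d = 0) :
    ∑' d, f d = ∑' d, f (d + Finsupp.single o 1) := by
  refine ((add_left_injective (Finsupp.single o 1)).tsum_eq fun d hd => ?_).symm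
  obtain ⟨d', rfl⟩ := exists_add_single (o := o) (d := d) fun h => hd (hf d h)
  exact ⟨d', rfl⟩

/-- Cyclicity of the trace: only the vectors `d + single o 1` contribute on the left, and their
weight is at most `r` times that of `d`. -/
theorem kernTrace_create_le {Δ : Type*} {w : (GhostOsc Δ →₀ ℕ) → ENNReal} {o : GhostOsc Δ}
    {r : ENNReal} (hw : ∀ d, w (d + Finsupp.single o 1) ≤ r * w d)
    (M : Kern (GhostOsc Δ →₀ ℕ)) :
    kernTrace w (opKern (ghostCreate o) * M) ≤ r * kernTrace w (M * opKern (ghostCreate o)) := by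
  classical
  have h1 : ∀ d e, (opKern (ghostCreate o) * M) (d + Finsupp.single o 1) e = M d e := by
    intro d e
    rw [Kern.mul_apply, tsum_eq_single d]
    · simp [opKern, coeff_ghostCreate_add, coeff_monomial]
    · intro x hx
      simp [opKern, coeff_ghostCreate_add, coeff_monomial, hx]
  have h2 : ∀ d e, d o = 0 → (opKern (ghostCreate o) * M) d e = 0 := by
    intro d e hd
    rw [Kern.mul_apply]
    simp [opKern, coeff_ghostCreate_of_eq_zero hd]
  have h3 : ∀ d e, (M * opKern (ghostCreate o)) d e = M d (e + Finsupp.single o 1) := by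
    intro d e
    rw [Kern.mul_apply, tsum_eq_single (e + Finsupp.single o 1)]
    · simp [opKern, ghostCreate_monomial, coeff_monomial]
    · intro x hx
      simp [opKern, ghostCreate_monomial, coeff_monomial, hx.symm]
  unfold kernTrace
  rw [tsum_add_single o _ fun d hd => by rw [h2 d d hd, mul_zero], ← ENNReal.tsum_mul_left]
  refine ENNReal.tsum_le_tsum fun d => ?_
  rw [h1, h3, ← mul_assoc]
  exact mul_le_mul_left (hw d) _

/-- The mirror image of `kernTrace_create_le`: an annihilation operator gains the factor `r` on its
way from the end to the front. The multiplicity `d o + 1` occurs equally on both sides. -/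
theorem kernTrace_deriv_le {Δ : Type*} {w : (GhostOsc Δ →₀ ℕ) → ENNReal} {o : GhostOsc Δ}
    {r : ENNReal} (hw : ∀ d, w (d + Finsupp.single o 1) ≤ r * w d)
    (M : Kern (GhostOsc Δ →₀ ℕ)) :
    kernTrace w (M * opKern (ghostDeriv o)) ≤ r * kernTrace w (opKern (ghostDeriv o) * M) := by
  classical
  have h1 : ∀ d e, (M * opKern (ghostDeriv o)) d (e + Finsupp.single o 1) =
      M d e * ‖(e o + 1 : ℂ)‖ₑ := by
    intro d e
    rw [Kern.mul_apply, tsum_eq_single e]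
    · simp [opKern, ghostDeriv_monomial, coeff_monomial]
    · intro x hx
      simp [opKern, ghostDeriv_monomial, coeff_monomial, hx.symm]
  have h2 : ∀ d e, e o = 0 → (M * opKern (ghostDeriv o)) d e = 0 := by
    intro d e hd
    rw [Kern.mul_apply]
    simp [opKern, ghostDeriv_monomial, hd]
  have h3 : ∀ d e, (opKern (ghostDeriv o) * M) d e =
      ‖(d o + 1 : ℂ)‖ₑ * M (d + Finsupp.single o 1) e := by
    intro d e
    rw [Kern.mul_apply, tsum_eq_single (d + Finsupp.single o 1)]
    · simp [opKern, coeff_ghostDeriv, coeff_monomial]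
    · intro x hx
      simp [opKern, coeff_ghostDeriv, coeff_monomial, hx]
  unfold kernTrace
  rw [tsum_add_single o _ fun d hd => by rw [h2 d d hd, mul_zero], ← ENNReal.tsum_mul_left]
  refine ENNReal.tsum_le_tsum fun d => ?_
  rw [h1, h3]
  calc w (d + Finsupp.single o 1) * (M (d + Finsupp.single o 1) d * ‖(d o + 1 : ℂ)‖ₑ)
      ≤ r * w d * (M (d + Finsupp.single o 1) d * ‖(d o + 1 : ℂ)‖ₑ) := mul_le_mul_left (hw d) _
    _ = _ := by ring


/-! ### Moving a mode of `γ` around the trace -/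

/-- The kernel of the commutator with a fixed operator. -/
noncomputable def commKern {Δ : Type*} (g A : Module.End ℂ (GhostFock Δ)) :
    Kern (GhostOsc Δ →₀ ℕ) :=
  opKern (g * A - A * g)

theorem IsMonomialOp.mul_le_comm {Δ : Type*} {g : Module.End ℂ (GhostFock Δ)}
    (hg : IsMonomialOp g) (A : Module.End ℂ (GhostFock Δ)) :
    opKern g * opKern A ≤ opKern A * opKern g + commKern g A := by
  rw [← hg.opKern_mul, ← hg.mul_opKern]
  have := opKern_add_le (A * g) (g * A - A * g)
  rwa [add_sub_cancel] at this

theorem IsMonomialOp.comm_le_mul {Δ : Type*} {g : Module.End ℂ (GhostFock Δ)}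
    (hg : IsMonomialOp g) (A : Module.End ℂ (GhostFock Δ)) :
    opKern A * opKern g ≤ opKern g * opKern A + commKern g A := by
  rw [← hg.opKern_mul, ← hg.mul_opKern]
  have := opKern_add_le (g * A) (-(g * A - A * g))
  rwa [← sub_eq_add_neg, sub_sub_cancel, opKern_neg] at this

theorem IsMonomialOp.mul_prod_le {Δ : Type*} {g : Module.End ℂ (GhostFock Δ)}
    (hg : IsMonomialOp g) (l : List (Module.End ℂ (GhostFock Δ))) :
    opKern g * (l.map opKern).prod ≤
      (l.map opKern).prod * opKern g + leibnizSum opKern (commKern g) l := by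
  induction l with
  | nil => simp [leibnizSum]
  | cons x l ih =>
    simp only [List.map_cons, List.prod_cons, leibnizSum]
    rw [← mul_assoc]
    refine (Kern.mul_le_mul (hg.mul_le_comm x) le_rfl).trans ?_
    rw [add_mul, mul_assoc]
    refine (Kern.add_le_add (Kern.mul_le_mul le_rfl ih) le_rfl).trans (le_of_eq ?_)
    rw [mul_add, mul_assoc]
    abel

theorem IsMonomialOp.prod_mul_le {Δ : Type*} {g : Module.End ℂ (GhostFock Δ)}
    (hg : IsMonomialOp g) (l : List (Module.End ℂ (GhostFock Δ))) :
    (l.map opKern).prod * opKern g ≤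
      opKern g * (l.map opKern).prod + leibnizSum opKern (commKern g) l := by
  induction l with
  | nil => simp [leibnizSum]
  | cons x l ih =>
    simp only [List.map_cons, List.prod_cons, leibnizSum]
    rw [mul_assoc]
    refine (Kern.mul_le_mul le_rfl ih).trans ?_
    rw [mul_add, ← mul_assoc]
    refine (Kern.add_le_add (Kern.mul_le_mul (hg.comm_le_mul x) le_rfl) le_rfl).trans
      (le_of_eq ?_)
    rw [add_mul, mul_assoc]
    abel

/-- Absorption of the unknown into the left side. Finiteness of `x` is essential, since `x = ⊤`
satisfies the inequality for every `r ≠ 0`. -/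
theorem ENNReal.le_inv_mul_of_le_add {x y r : ENNReal} (hx : x ≠ ⊤) (hr : r < 1)
    (h : x ≤ y + r * x) : x ≤ (1 - r)⁻¹ * y := by
  rw [← ENNReal.mul_le_iff_le_inv (tsub_pos_of_lt hr).ne' (by simp)]
  rw [ENNReal.sub_mul (fun _ _ => hx), one_mul]
  exact tsub_le_iff_right.2 h

/-- Absorption needs a finite trace, hence a truncation to finitely many basis vectors. Downward
closed sets are used because truncation to them preserves the bound for the weight of `d + single o
1` (`indicator_add_single_le`). -/
theorem kernTrace_le_of_forall_lower {Δ : Type*} (w : (GhostOsc Δ →₀ ℕ) → ENNReal)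
    (M : Kern (GhostOsc Δ →₀ ℕ)) {y : ENNReal}
    (h : ∀ D : Finset (GhostOsc Δ →₀ ℕ), IsLowerSet (D : Set (GhostOsc Δ →₀ ℕ)) →
      kernTrace ((D : Set (GhostOsc Δ →₀ ℕ)).indicator w) M ≤ y) : kernTrace w M ≤ y := by
  classical
  rw [kernTrace, ENNReal.tsum_eq_iSup_sum]
  refine iSup_le fun s => ?_
  -- A finite set of basis vectors is enlarged to the union of the intervals below its elements,
  -- which is again finite.
  have hD : IsLowerSet ((s.biUnion fun d => Finset.Icc 0 d : Finset (GhostOsc Δ →₀ ℕ)) :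
      Set (GhostOsc Δ →₀ ℕ)) := by
    intro d e hed hd
    simp only [Finset.coe_biUnion, Finset.coe_Icc, Set.mem_iUnion, Set.mem_Icc,
      Finset.mem_coe] at hd ⊢
    obtain ⟨x, hx, -, hdx⟩ := hd
    exact ⟨x, hx, zero_le, hed.trans hdx⟩
  refine le_trans ?_ (h _ hD)
  refine le_trans (Finset.sum_le_sum fun d hd => ?_) (ENNReal.sum_le_tsum s)
  rw [Set.indicator_of_mem]
  simp only [Finset.coe_biUnion, Finset.coe_Icc, Set.mem_iUnion, Set.mem_Icc, Finset.mem_coe]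
  exact ⟨d, hd, zero_le, le_rfl⟩

theorem kernTrace_indicator_ne_top {I : Type*} {w : I → ENNReal} (hw : ∀ d, w d ≠ ⊤)
    {M : Kern I} (hM : M.ColFinite) (D : Finset I) :
    kernTrace ((D : Set I).indicator w) M ≠ ⊤ := by
  rw [kernTrace, tsum_eq_sum (s := D)]
  · refine ENNReal.sum_ne_top.2 fun d hd => ENNReal.mul_ne_top ?_ ((hM d).2 d)
    rw [Set.indicator_of_mem (by simpa using hd)]
    exact hw d
  · intro d hd
    rw [Set.indicator_of_notMem (by simpa using hd), zero_mul]

theorem indicator_add_single_le {Δ : Type*} {w : (GhostOsc Δ →₀ ℕ) → ENNReal} {o : GhostOsc Δ}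
    {r : ENNReal} (hw : ∀ d, w (d + Finsupp.single o 1) ≤ r * w d)
    {D : Set (GhostOsc Δ →₀ ℕ)} (hD : IsLowerSet D) (d : GhostOsc Δ →₀ ℕ) :
    D.indicator w (d + Finsupp.single o 1) ≤ r * D.indicator w d := by
  by_cases h : d + Finsupp.single o 1 ∈ D
  · rw [Set.indicator_of_mem h, Set.indicator_of_mem (hD le_self_add h)]
    exact hw d
  · rw [Set.indicator_of_notMem h]
    exact zero_le

theorem kernTrace_indicator_le {I : Type*} (w : I → ENNReal) (D : Set I) (M : Kern I) :
    kernTrace (D.indicator w) M ≤ kernTrace w M :=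
  ENNReal.tsum_le_tsum fun d => mul_le_mul_left (Set.indicator_le_self _ _ d) _

theorem opKern_prod_colFinite {Δ : Type*} (l : List (Module.End ℂ (GhostFock Δ))) :
    (l.map opKern).prod.ColFinite :=
  Kern.ColFinite.list_prod fun K hK => by
    obtain ⟨A, -, rfl⟩ := List.mem_map.1 hK
    exact opKern_colFinite A

theorem IsMonomialOp.kernTrace_le_left {Δ : Type*} {g : Module.End ℂ (GhostFock Δ)}
    (hg : IsMonomialOp g) (w : (GhostOsc Δ →₀ ℕ) → ENNReal)
    (l l' : List (Module.End ℂ (GhostFock Δ))) :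
    kernTrace w ((l.map opKern).prod * opKern g * (l'.map opKern).prod) ≤
      kernTrace w (opKern g * ((l.map opKern).prod * (l'.map opKern).prod)) +
        kernTrace w (leibnizSum opKern (commKern g) l * (l'.map opKern).prod) := by
  rw [← kernTrace_add]
  refine kernTrace_mono _ ((Kern.mul_le_mul (hg.prod_mul_le l) le_rfl).trans (le_of_eq ?_))
  rw [add_mul, mul_assoc]

theorem IsMonomialOp.kernTrace_left_le {Δ : Type*} {g : Module.End ℂ (GhostFock Δ)}
    (hg : IsMonomialOp g) (w : (GhostOsc Δ →₀ ℕ) → ENNReal)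
    (l l' : List (Module.End ℂ (GhostFock Δ))) :
    kernTrace w (opKern g * ((l.map opKern).prod * (l'.map opKern).prod)) ≤
      kernTrace w ((l.map opKern).prod * opKern g * (l'.map opKern).prod) +
        kernTrace w (leibnizSum opKern (commKern g) l * (l'.map opKern).prod) := by
  rw [← kernTrace_add, ← mul_assoc]
  refine kernTrace_mono _ ((Kern.mul_le_mul (hg.mul_prod_le l) le_rfl).trans (le_of_eq ?_))
  rw [add_mul, mul_assoc]

theorem IsMonomialOp.kernTrace_le_right {Δ : Type*} {g : Module.End ℂ (GhostFock Δ)}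
    (hg : IsMonomialOp g) (w : (GhostOsc Δ →₀ ℕ) → ENNReal)
    (l l' : List (Module.End ℂ (GhostFock Δ))) :
    kernTrace w ((l.map opKern).prod * opKern g * (l'.map opKern).prod) ≤
      kernTrace w ((l.map opKern).prod * (l'.map opKern).prod * opKern g) +
        kernTrace w ((l.map opKern).prod * leibnizSum opKern (commKern g) l') := by
  rw [← kernTrace_add, mul_assoc]
  refine kernTrace_mono _ ((Kern.mul_le_mul le_rfl (hg.mul_prod_le l')).trans (le_of_eq ?_))
  rw [mul_add, mul_assoc]

theorem IsMonomialOp.kernTrace_right_le {Δ : Type*} {g : Module.End ℂ (GhostFock Δ)}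
    (hg : IsMonomialOp g) (w : (GhostOsc Δ →₀ ℕ) → ENNReal)
    (l l' : List (Module.End ℂ (GhostFock Δ))) :
    kernTrace w ((l.map opKern).prod * (l'.map opKern).prod * opKern g) ≤
      kernTrace w ((l.map opKern).prod * opKern g * (l'.map opKern).prod) +
        kernTrace w ((l.map opKern).prod * leibnizSum opKern (commKern g) l') := by
  rw [← kernTrace_add, mul_assoc]
  refine kernTrace_mono _ ((Kern.mul_le_mul le_rfl (hg.prod_mul_le l')).trans (le_of_eq ?_))
  rw [mul_add, mul_assoc]

/-- Let `x` be the trace with the operator in its place. Moving it to the front costs the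
commutators `L` with `l`, cyclicity gives the factor `r`, and moving it back from the end costs the
commutators `R` with `l'`. Hence `x ≤ L + r (x + R)`, and `x` can be absorbed. -/
theorem kernTrace_create_ward {Δ : Type*} {w : (GhostOsc Δ →₀ ℕ) → ENNReal}
    (hw' : ∀ d, w d ≠ ⊤) {o : GhostOsc Δ} {r : ENNReal} (hr : r < 1)
    (hw : ∀ d, w (d + Finsupp.single o 1) ≤ r * w d)
    (l l' : List (Module.End ℂ (GhostFock Δ))) :
    kernTrace w ((l.map opKern).prod * opKern (ghostCreate o) * (l'.map opKern).prod) ≤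
      (1 - r)⁻¹ * (kernTrace w (leibnizSum opKern (commKern (ghostCreate o)) l *
          (l'.map opKern).prod) +
        r * kernTrace w ((l.map opKern).prod *
          leibnizSum opKern (commKern (ghostCreate o)) l')) := by
  refine kernTrace_le_of_forall_lower w _ fun D hD => ?_
  have hg := isMonomialOp_ghostCreate (Δ := Δ) o
  refine (ENNReal.le_inv_mul_of_le_add (kernTrace_indicator_ne_top hw'
    (((opKern_prod_colFinite l).mul (opKern_colFinite (ghostCreate o))).mul
      (opKern_prod_colFinite l')) D) hr
    ((hg.kernTrace_le_left _ l l').trans ((add_le_add_left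
      ((kernTrace_create_le (indicator_add_single_le hw hD) _).trans
        (mul_le_mul_right (hg.kernTrace_right_le _ l l') r)) _).trans (le_of_eq ?_)))).trans
    (mul_le_mul_right (add_le_add (kernTrace_indicator_le w D _)
      (mul_le_mul_right (kernTrace_indicator_le w D _) r)) _)
  rw [mul_add]
  abel

/-- An annihilation operator travels in the opposite direction, first to the end, because its small
factor arises in passing from the end to the front. Therefore `r` falls on the commutators with `l`
here. -/
theorem kernTrace_deriv_ward {Δ : Type*} {w : (GhostOsc Δ →₀ ℕ) → ENNReal}
    (hw' : ∀ d, w d ≠ ⊤) {o : GhostOsc Δ} {r : ENNReal} (hr : r < 1)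
    (hw : ∀ d, w (d + Finsupp.single o 1) ≤ r * w d)
    (l l' : List (Module.End ℂ (GhostFock Δ))) :
    kernTrace w ((l.map opKern).prod * opKern (ghostDeriv o) * (l'.map opKern).prod) ≤
      (1 - r)⁻¹ * (r * kernTrace w (leibnizSum opKern (commKern (ghostDeriv o)) l *
          (l'.map opKern).prod) +
        kernTrace w ((l.map opKern).prod *
          leibnizSum opKern (commKern (ghostDeriv o)) l')) := by
  refine kernTrace_le_of_forall_lower w _ fun D hD => ?_
  have hg := isMonomialOp_ghostDeriv (Δ := Δ) o
  refine (ENNReal.le_inv_mul_of_le_add (kernTrace_indicator_ne_top hw'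
    (((opKern_prod_colFinite l).mul (opKern_colFinite (ghostDeriv o))).mul
      (opKern_prod_colFinite l')) D) hr
    ((hg.kernTrace_le_right _ l l').trans ((add_le_add_left
      ((kernTrace_deriv_le (indicator_add_single_le hw hD) _).trans
        (mul_le_mul_right (hg.kernTrace_left_le _ l l') r)) _).trans (le_of_eq ?_)))).trans
    (mul_le_mul_right (add_le_add (mul_le_mul_right (kernTrace_indicator_le w D _) r)
      (kernTrace_indicator_le w D _)) _)
  rw [mul_add]
  abel

/-! ### The exact trace -/

/-- The trace of `A q ^ T[0] e ^ H[0]`. -/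
noncomputable def opTrace {Δ : Type*} (q : ℂ) (c : Δ → ℂ) (A : Module.End ℂ (GhostFock Δ)) : ℂ :=
  ∑' d, ghostWeight q c d * coeff d (A (monomial d 1))

/-- The absolute values of the weights. -/
noncomputable def absWeight {Δ : Type*} (q : ℂ) (c : Δ → ℂ) (d : GhostOsc Δ →₀ ℕ) : ENNReal :=
  ‖ghostWeight q c d‖ₑ

theorem absWeight_add_single {Δ : Type*} (q : ℂ) (c : Δ → ℂ) (o : GhostOsc Δ)
    (d : GhostOsc Δ →₀ ℕ) :
    absWeight q c (d + Finsupp.single o 1) = ‖oscWeight q c o‖ₑ * absWeight q c d := by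
  rw [absWeight, ghostWeight_add, ghostWeight_single, enorm_mul, mul_comm, absWeight]

theorem summable_opTrace {Δ : Type*} {q : ℂ} {c : Δ → ℂ} {A : Module.End ℂ (GhostFock Δ)}
    {M : Kern (GhostOsc Δ →₀ ℕ)} (hA : opKern A ≤ M) (hM : kernTrace (absWeight q c) M ≠ ⊤) :
    Summable fun d => ghostWeight q c d * coeff d (A (monomial d 1)) := by
  refine Summable.of_enorm (ne_top_of_le_ne_top hM (ENNReal.tsum_le_tsum fun d => ?_))
  rw [enorm_mul]
  exact mul_le_mul_right (hA d d) _

/-- A reindexing of the trace that matches it term by term, so no convergence is required. -/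
theorem opTrace_create {Δ : Type*} (q : ℂ) (c : Δ → ℂ) (o : GhostOsc Δ)
    (A : Module.End ℂ (GhostFock Δ)) :
    opTrace q c (ghostCreate o * A) = oscWeight q c o * opTrace q c (A * ghostCreate o) := by
  unfold opTrace
  rw [tsum_add_single o _ fun d hd => by
    rw [Module.End.mul_apply, coeff_ghostCreate_of_eq_zero hd, mul_zero], ← tsum_mul_left]
  refine tsum_congr fun d => ?_
  rw [Module.End.mul_apply, Module.End.mul_apply, coeff_ghostCreate_add, ghostCreate_monomial,
    ghostWeight_add, ghostWeight_single]
  ring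

theorem opTrace_deriv {Δ : Type*} (q : ℂ) (c : Δ → ℂ) (o : GhostOsc Δ)
    (A : Module.End ℂ (GhostFock Δ)) :
    opTrace q c (A * ghostDeriv o) = oscWeight q c o * opTrace q c (ghostDeriv o * A) := by
  unfold opTrace
  rw [tsum_add_single o _ fun d hd => by
    rw [Module.End.mul_apply, ghostDeriv_monomial, hd]; simp, ← tsum_mul_left]
  refine tsum_congr fun d => ?_
  rw [Module.End.mul_apply, Module.End.mul_apply, coeff_ghostDeriv, ghostDeriv_monomial,
    ghostWeight_add, ghostWeight_single, add_tsub_cancel_right]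
  have : (monomial d (1 * ((d + Finsupp.single o 1 : GhostOsc Δ →₀ ℕ) o : ℂ)) : GhostFock Δ) =
      (d o + 1 : ℂ) • monomial d 1 := by
    rw [smul_monomial]; simp
  rw [this, map_smul, coeff_smul, smul_eq_mul]
  ring

/-- The factor picked up by `γ^a[n]` when it is moved through `q ^ T[0] e ^ H[0]`. -/
noncomputable def gammaFactor {Δ : Type*} (q : ℂ) (c : Δ → ℂ) (a : Δ) (n : ℤ) : ℂ :=
  q ^ n * Complex.exp (c a)

/-- For `n > 0` a derivative of oscillator weight `q^n e^{c_a}` moves from the end to the front; for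
`n ≤ 0` a creation operator of weight `q^{-n} e^{-c_a}` moves from the front to the end. Both give
the same factor. -/
theorem opTrace_ghostGamma {Δ : Type*} {q : ℂ} (hq : q ≠ 0) (c : Δ → ℂ) (a : Δ) (n : ℤ)
    (A : Module.End ℂ (GhostFock Δ)) :
    opTrace q c (A * ghostGamma a n) =
      gammaFactor q c a n * opTrace q c (ghostGamma a n * A) := by
  have hneg : ∀ B : Module.End ℂ (GhostFock Δ), opTrace q c (-B) = -opTrace q c B := fun B => by
    simp [opTrace, tsum_neg]
  unfold ghostGamma gammaFactor
  split_ifs with h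
  · have e1 : A * -ghostDeriv (Sum.inr (a, (n - 1).toNat)) =
        -(A * ghostDeriv (Sum.inr (a, (n - 1).toNat))) :=
      LinearMap.ext fun v => by simp
    have e2 : -ghostDeriv (Sum.inr (a, (n - 1).toNat)) * A =
        -(ghostDeriv (Sum.inr (a, (n - 1).toNat)) * A) := LinearMap.ext fun v => by simp
    rw [e1, e2, hneg, hneg, opTrace_deriv, oscWeight, mul_neg, ← zpow_natCast]
    congr 4
    push_cast
    omega
  · rw [opTrace_create, oscWeight, ← mul_assoc, mul_mul_mul_comm, ← Complex.exp_add,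
      ← zpow_natCast, ← zpow_add₀ hq]
    have : n + ((-n).toNat : ℤ) = 0 := by omega
    rw [this]
    simp

theorem mul_prod_sub_prod_mul {R : Type*} [Ring R] (g : R) (l : List R) :
    g * l.prod - l.prod * g = leibnizSum id (fun x => g * x - x * g) l := by
  induction l with
  | nil => simp [leibnizSum]
  | cons x l ih =>
    rw [List.prod_cons, leibnizSum, ← ih]
    simp only [List.map_id, id]
    noncomm_ring

theorem opTrace_sub {Δ : Type*} {q : ℂ} {c : Δ → ℂ} {A B : Module.End ℂ (GhostFock Δ)}
    (hA : Summable fun d => ghostWeight q c d * coeff d (A (monomial d 1)))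
    (hB : Summable fun d => ghostWeight q c d * coeff d (B (monomial d 1))) :
    opTrace q c (A - B) = opTrace q c A - opTrace q c B := by
  unfold opTrace
  rw [← hA.tsum_sub hB]
  refine tsum_congr fun d => ?_
  rw [LinearMap.sub_apply, coeff_sub, mul_sub]

theorem opTrace_sum {Δ ι : Type*} {q : ℂ} {c : Δ → ℂ} (s : Finset ι)
    {A : ι → Module.End ℂ (GhostFock Δ)}
    (hA : ∀ i ∈ s, Summable fun d => ghostWeight q c d * coeff d (A i (monomial d 1))) :
    opTrace q c (∑ i ∈ s, A i) = ∑ i ∈ s, opTrace q c (A i) := by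
  unfold opTrace
  rw [← Summable.tsum_finsetSum hA]
  refine tsum_congr fun d => ?_
  rw [LinearMap.sum_apply, coeff_sum, Finset.mul_sum]

/-- The absolute value of the factor of `γ^a[n]` or of its inverse, whichever is less than `1`. -/
noncomputable def gammaRadius {Δ : Type*} (q : ℂ) (c : Δ → ℂ) (a : Δ) (n : ℤ) : ENNReal :=
  if 0 < n then ‖gammaFactor q c a n‖ₑ else ‖(gammaFactor q c a n)⁻¹‖ₑ

/-- The bound is uniform in the mode `n`, so that one constant controls all the factors `(1 - r)⁻¹`
when the modes are summed. -/
theorem gammaRadius_le {Δ : Type*} {q : ℂ} (hq : q ≠ 0) (hq1 : ‖q‖ < 1) (c : Δ → ℂ) (a : Δ)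
    (n : ℤ) :
    gammaRadius q c a n ≤
      ENNReal.ofReal (max ‖Complex.exp (-c a)‖ (‖q‖ * ‖Complex.exp (c a)‖)) := by
  have hq0 : 0 < ‖q‖ := norm_pos_iff.2 hq
  unfold gammaRadius gammaFactor
  split_ifs with h
  · rw [← ofReal_norm]
    refine ENNReal.ofReal_le_ofReal (le_max_of_le_right ?_)
    rw [norm_mul, norm_zpow]
    refine mul_le_mul_of_nonneg_right ?_ (norm_nonneg _)
    calc ‖q‖ ^ n ≤ ‖q‖ ^ (1 : ℤ) := zpow_le_zpow_right_of_le_one₀ hq0 hq1.le (by omega)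
      _ = ‖q‖ := zpow_one _
  · rw [← ofReal_norm]
    refine ENNReal.ofReal_le_ofReal (le_max_of_le_left ?_)
    rw [mul_inv, norm_mul, ← Complex.exp_neg, ← zpow_neg, norm_zpow]
    refine mul_le_of_le_one_left (norm_nonneg _) ?_
    calc ‖q‖ ^ (-n) ≤ ‖q‖ ^ (0 : ℤ) := zpow_le_zpow_right_of_le_one₀ hq0 hq1.le (by omega)
      _ = 1 := zpow_zero _

theorem max_exp_lt_one {q c : ℂ} (h1 : ‖Complex.exp (-c)‖ < 1)
    (h2 : ‖q‖ < ‖Complex.exp (-c)‖) :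
    max ‖Complex.exp (-c)‖ (‖q‖ * ‖Complex.exp c‖) < 1 := by
  refine max_lt h1 ?_
  have h : ‖Complex.exp (-c)‖ * ‖Complex.exp c‖ = 1 := by
    rw [← norm_mul, ← Complex.exp_add]; simp
  rw [← h]
  exact mul_lt_mul_of_pos_right h2 (norm_pos_iff.2 (Complex.exp_ne_zero _))

theorem gammaRadius_lt_one {Δ : Type*} {q : ℂ} (hq : q ≠ 0) (hq1 : ‖q‖ < 1) {c : Δ → ℂ} {a : Δ}
    (h1 : ‖Complex.exp (-c a)‖ < 1) (h2 : ‖q‖ < ‖Complex.exp (-c a)‖) (n : ℤ) :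
    gammaRadius q c a n < 1 :=
  (gammaRadius_le hq hq1 c a n).trans_lt (by
    rw [← ENNReal.ofReal_one]
    exact (ENNReal.ofReal_lt_ofReal_iff one_pos).2 (max_exp_lt_one h1 h2))

/-- The coefficient in the bound of a trace by contractions of `γ^a[n]`: the contraction is with a
field to the right of `γ^a[n]` if `right` holds and with one to the left otherwise. -/
noncomputable def contractBound {Δ : Type*} (q : ℂ) (c : Δ → ℂ) (a : Δ) (n : ℤ) (right : Prop)
    [Decidable right] : ENNReal :=
  (1 - gammaRadius q c a n)⁻¹ * if (0 < n ↔ right) then 1 else gammaRadius q c a n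

/-- The estimates for creation and annihilation operators in one notation: the sign of `n` decides
on which side of the slot the commutators carry the extra small factor. -/
theorem kernTrace_ghostGamma_ward {Δ : Type*} {q : ℂ} (hq : q ≠ 0) (hq1 : ‖q‖ < 1) {c : Δ → ℂ}
    {a : Δ} (h1 : ‖Complex.exp (-c a)‖ < 1) (h2 : ‖q‖ < ‖Complex.exp (-c a)‖) (n : ℤ) {N : ℕ}
    (X : Fin N → Module.End ℂ (GhostFock Δ)) (i : ℕ) :
    kernTrace (absWeight q c) ((((List.ofFn X).take i).map opKern).prod *
        opKern (ghostGamma a n) * (((List.ofFn X).drop i).map opKern).prod) ≤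
      ∑ j : Fin N, contractBound q c a n (i ≤ j) *
        kernTrace (absWeight q c) (List.ofFn (Function.update (fun k => opKern (X k)) j
          (commKern (ghostGamma a n) (X j)))).prod := by
  have hr := gammaRadius_lt_one hq hq1 h1 h2 n
  have hw' : ∀ d, absWeight q c d ≠ ⊤ := fun d => enorm_ne_top
  have hL : kernTrace (absWeight q c) (leibnizSum opKern (commKern (ghostGamma a n))
      ((List.ofFn X).take i) * (((List.ofFn X).drop i).map opKern).prod) =
      ∑ j : Fin N, if (j : ℕ) < i then kernTrace (absWeight q c) (List.ofFn (Function.update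
        (fun k => opKern (X k)) j (commKern (ghostGamma a n) (X j)))).prod else 0 := by
    rw [leibnizSum_take_mul_prod, kernTrace_sum]
    refine Finset.sum_congr rfl fun j _ => ?_
    split_ifs
    · rfl
    · simp [kernTrace, Kern.zero_apply]
  have hR : kernTrace (absWeight q c) ((((List.ofFn X).take i).map opKern).prod *
      leibnizSum opKern (commKern (ghostGamma a n)) ((List.ofFn X).drop i)) =
      ∑ j : Fin N, if i ≤ (j : ℕ) then kernTrace (absWeight q c) (List.ofFn (Function.update
        (fun k => opKern (X k)) j (commKern (ghostGamma a n) (X j)))).prod else 0 := by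
    rw [prod_mul_leibnizSum_drop, kernTrace_sum]
    refine Finset.sum_congr rfl fun j _ => ?_
    split_ifs
    · rfl
    · simp [kernTrace, Kern.zero_apply]
  unfold contractBound
  by_cases h : 0 < n
  · have hg : opKern (ghostGamma a n) = opKern (ghostDeriv (Sum.inr (a, (n - 1).toNat))) := by
      rw [ghostGamma, if_pos h, opKern_neg]
    have hc : commKern (ghostGamma a n) = commKern (ghostDeriv (Sum.inr (a, (n - 1).toNat))) := by
      funext A
      rw [commKern, commKern, ghostGamma, if_pos h, ← opKern_neg]
      congr 1
      refine LinearMap.ext fun v => ?_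
      simp only [Module.End.mul_apply, LinearMap.neg_apply, LinearMap.sub_apply, map_neg]
      abel
    have ho : gammaFactor q c a n = oscWeight q c (Sum.inr (a, (n - 1).toNat)) := by
      rw [oscWeight, gammaFactor, ← zpow_natCast]
      congr 2
      push_cast
      omega
    have hrn : gammaRadius q c a n = ‖oscWeight q c (Sum.inr (a, (n - 1).toNat))‖ₑ := by
      rw [gammaRadius, if_pos h, ho]
    have key := kernTrace_deriv_ward (o := Sum.inr (a, (n - 1).toNat)) hw' hr
      (fun d => by rw [absWeight_add_single, hrn]) ((List.ofFn X).take i) ((List.ofFn X).drop i)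
    rw [← hg, ← hc, hL, hR, Finset.mul_sum, ← Finset.sum_add_distrib, Finset.mul_sum] at key
    refine key.trans (Finset.sum_le_sum fun j _ => ?_)
    rw [mul_assoc]
    refine mul_le_mul_right (le_of_eq ?_) _
    by_cases hj : i ≤ (j : ℕ)
    · simp [h, hj, not_lt.2 hj]
    · simp [h, hj, not_le.1 hj]
  · have hg : ghostGamma a n = ghostCreate (Sum.inl (a, (-n).toNat)) := by
      rw [ghostGamma, if_neg h]
    have ho : (gammaFactor q c a n)⁻¹ = oscWeight q c (Sum.inl (a, (-n).toNat)) := by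
      rw [oscWeight, gammaFactor, ← zpow_natCast, mul_inv, ← Complex.exp_neg, ← zpow_neg]
      congr 2
      omega
    have hrn : gammaRadius q c a n = ‖oscWeight q c (Sum.inl (a, (-n).toNat))‖ₑ := by
      rw [gammaRadius, if_neg h, ho]
    have key := kernTrace_create_ward (o := Sum.inl (a, (-n).toNat)) hw' hr
      (fun d => by rw [absWeight_add_single, hrn]) ((List.ofFn X).take i) ((List.ofFn X).drop i)
    rw [← hg, hL, hR, Finset.mul_sum, ← Finset.sum_add_distrib, Finset.mul_sum] at key
    refine key.trans (Finset.sum_le_sum fun j _ => ?_)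
    rw [mul_assoc]
    refine mul_le_mul_right (le_of_eq ?_) _
    by_cases hj : i ≤ (j : ℕ)
    · simp [h, hj, not_lt.2 hj]
    · simp [h, hj, not_le.1 hj]

theorem contractBound_ne_top {Δ : Type*} {q : ℂ} (hq : q ≠ 0) (hq1 : ‖q‖ < 1) {c : Δ → ℂ}
    {a : Δ} (h1 : ‖Complex.exp (-c a)‖ < 1) (h2 : ‖q‖ < ‖Complex.exp (-c a)‖) (n : ℤ)
    (right : Prop) [Decidable right] : contractBound q c a n right ≠ ⊤ := by
  have hr := gammaRadius_lt_one hq hq1 h1 h2 n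
  refine ENNReal.mul_ne_top (ENNReal.inv_ne_top.2 (tsub_pos_of_lt hr).ne') ?_
  split_ifs
  · simp
  · exact hr.ne_top

theorem opKern_ofFn_prod_le {Δ : Type*} {N : ℕ} (X : Fin N → Module.End ℂ (GhostFock Δ)) :
    opKern (List.ofFn X).prod ≤ (List.ofFn fun k => opKern (X k)).prod := by
  have := opKern_list_prod_le (List.ofFn X)
  rwa [List.map_ofFn] at this

theorem opKern_comp_update {Δ : Type*} {N : ℕ} (X : Fin N → Module.End ℂ (GhostFock Δ))
    (j : Fin N) (Y : Module.End ℂ (GhostFock Δ)) :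
    (fun k => opKern (Function.update X j Y k)) =
      Function.update (fun k => opKern (X k)) j (opKern Y) := by
  funext k
  rcases eq_or_ne k j with rfl | h
  · simp
  · simp [h]

/-- Let `x`, `y`, `w` be the traces with the mode in its slot, at the front and at the end. Then `y
- x` collects the commutators to the left of the slot, `x - w` those to the right, and `w` is
`gammaFactor` times `y`; eliminating `y` and `w` gives the formula. Summability of the three traces
comes from the inequality version with the slot at `i`, `0` and `N`. -/
theorem opTrace_ghostGamma_ward {Δ : Type*} {q : ℂ} (hq : q ≠ 0) (hq1 : ‖q‖ < 1) {c : Δ → ℂ}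
    {a : Δ} (h1 : ‖Complex.exp (-c a)‖ < 1) (h2 : ‖q‖ < ‖Complex.exp (-c a)‖) (n : ℤ) {N : ℕ}
    (X : Fin N → Module.End ℂ (GhostFock Δ)) (i : ℕ)
    (hfin : ∀ j, kernTrace (absWeight q c) (List.ofFn (Function.update (fun k => opKern (X k)) j
          (commKern (ghostGamma a n) (X j)))).prod ≠ ⊤) :
    (1 - gammaFactor q c a n) * opTrace q c (((List.ofFn X).take i).prod * ghostGamma a n *
        ((List.ofFn X).drop i).prod) =
      ∑ j : Fin N, (if i ≤ (j : ℕ) then 1 else gammaFactor q c a n) *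
        opTrace q c (List.ofFn (Function.update X j
          (ghostGamma a n * X j - X j * ghostGamma a n))).prod := by
  set g := ghostGamma (Δ := Δ) a n
  set A := ((List.ofFn X).take i).prod with hA
  set B := ((List.ofFn X).drop i).prod with hB
  have hAB : A * B = (List.ofFn X).prod := by
    rw [hA, hB, ← List.prod_append, List.take_append_drop]
  have hsum : ∀ i, Summable fun d => ghostWeight q c d *
      coeff d ((((List.ofFn X).take i).prod * g * ((List.ofFn X).drop i).prod)
        (monomial d 1)) := by
    intro i
    refine summable_opTrace ((opKern_mul_le _ _).trans (Kern.mul_le_mul ((opKern_mul_le _ _).trans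
      (Kern.mul_le_mul (opKern_list_prod_le _) le_rfl)) (opKern_list_prod_le _)))
      (ne_top_of_le_ne_top ?_ (kernTrace_ghostGamma_ward hq hq1 h1 h2 n X i))
    exact ENNReal.sum_ne_top.2 fun j _ =>
      ENNReal.mul_ne_top (contractBound_ne_top hq hq1 h1 h2 n _) (hfin j)
  have hs0 : Summable fun d => ghostWeight q c d * coeff d ((g * (A * B)) (monomial d 1)) := by
    have := hsum 0
    simp only [List.take_zero, List.prod_nil, one_mul, List.drop_zero] at this
    rwa [hAB]
  have hsN : Summable fun d => ghostWeight q c d * coeff d ((A * B * g) (monomial d 1)) := by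
    have := hsum N
    rw [List.take_of_length_le (by simp), List.drop_of_length_le (by simp)] at this
    simp only [List.prod_nil, mul_one] at this
    rwa [hAB]
  have hsi := hsum i
  rw [← hA, ← hB] at hsi
  have hsj : ∀ j, Summable fun d => ghostWeight q c d * coeff d
      ((List.ofFn (Function.update X j (g * X j - X j * g))).prod (monomial d 1)) := by
    intro j
    refine summable_opTrace (opKern_ofFn_prod_le _) ?_
    rw [opKern_comp_update]
    exact hfin j
  have hif : ∀ (p : Fin N → Prop) [DecidablePred p], opTrace q c (∑ j : Fin N, if p j then
      (List.ofFn (Function.update X j (g * X j - X j * g))).prod else 0) =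
      ∑ j : Fin N, if p j then opTrace q c
        (List.ofFn (Function.update X j (g * X j - X j * g))).prod else 0 := by
    intro p _
    rw [opTrace_sum]
    · refine Finset.sum_congr rfl fun j _ => ?_
      split_ifs
      · rfl
      · simp [opTrace]
    · intro j _
      split_ifs
      · exact hsj j
      · simp [summable_zero]
  have e1 : opTrace q c (g * (A * B)) - opTrace q c (A * g * B) =
      ∑ j : Fin N, if (j : ℕ) < i then opTrace q c
        (List.ofFn (Function.update X j (g * X j - X j * g))).prod else 0 := by
    rw [← opTrace_sub hs0 hsi, ← hif, ← mul_assoc, ← sub_mul, hA, mul_prod_sub_prod_mul]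
    have := leibnizSum_take_mul_prod id (fun x => g * x - x * g) X i
    rw [List.map_id] at this
    exact congrArg (opTrace q c) this
  have e2 : opTrace q c (A * g * B) - opTrace q c (A * B * g) =
      ∑ j : Fin N, if i ≤ (j : ℕ) then opTrace q c
        (List.ofFn (Function.update X j (g * X j - X j * g))).prod else 0 := by
    rw [← opTrace_sub hsi hsN, ← hif, mul_assoc, mul_assoc, ← mul_sub, hB, mul_prod_sub_prod_mul]
    have := prod_mul_leibnizSum_drop id (fun x => g * x - x * g) X i
    rw [List.map_id] at this
    exact congrArg (opTrace q c) this
  have e3 := opTrace_ghostGamma hq c a n (A * B)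
  have e4 : ∑ j : Fin N, (if i ≤ (j : ℕ) then 1 else gammaFactor q c a n) *
        opTrace q c (List.ofFn (Function.update X j (g * X j - X j * g))).prod =
      (opTrace q c (A * g * B) - opTrace q c (A * B * g)) +
      gammaFactor q c a n * (opTrace q c (g * (A * B)) - opTrace q c (A * g * B)) := by
    rw [e1, e2, Finset.mul_sum, ← Finset.sum_add_distrib]
    refine Finset.sum_congr rfl fun j _ => ?_
    by_cases hj : i ≤ (j : ℕ)
    · simp [hj, not_lt.2 hj]
    · simp [hj, not_le.1 hj]
  rw [e4, e3]
  ring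


/-! ### Correlators of polynomials in `γ` and currents -/

theorem prod_ofFn_update_mul {R : Type*} [Monoid R] {n : ℕ} (x : Fin n → R) (i : Fin n)
    (g y : R) :
    (List.ofFn (Function.update x i (g * y))).prod =
      ((List.ofFn (Function.update x i y)).take i).prod * g *
        ((List.ofFn (Function.update x i y)).drop i).prod := by
  have h1 := prod_ofFn_update (Function.update x i y) i (g * y)
  rw [Function.update_idem] at h1
  rw [h1, prod_drop_ofFn (Function.update x i y) i, Function.update_self]
  simp only [mul_assoc]

theorem Kern.ofFn_prod_mono {I : Type*} {n : ℕ} {x y : Fin n → Kern I} (h : ∀ k, x k ≤ y k) :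
    (List.ofFn x).prod ≤ (List.ofFn y).prod := by
  induction n with
  | zero => simp
  | succ n ih =>
    rw [List.ofFn_succ, List.ofFn_succ, List.prod_cons, List.prod_cons]
    exact Kern.mul_le_mul (h 0) (ih fun k => h k.succ)

theorem Kern.ofFn_prod_update_sum {I ι : Type*} {n : ℕ} (x : Fin n → Kern I) (i : Fin n)
    (Y : ι → Kern I) :
    (List.ofFn (Function.update x i (Kern.sum Y))).prod =
      Kern.sum fun l => (List.ofFn (Function.update x i (Y l))).prod := by
  simp only [prod_ofFn_update, Kern.mul_sum, Kern.sum_mul]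

theorem Kern.ofFn_prod_update_zero {I : Type*} {n : ℕ} (x : Fin n → Kern I) (i : Fin n) :
    (List.ofFn (Function.update x i 0)).prod = 0 := by
  simp [prod_ofFn_update]

section

variable {Δ : Type*} [Fintype Δ] {N : ℕ}

/-- The modes of the fields at the points `u_k`: the current of the vector field `S k` for `k ∈ J`
and the polynomial `Q k` in `γ` for `k ∉ J`. -/
noncomputable def stateOp (S : Fin N → Δ → MvPolynomial Δ ℂ) (J : Finset (Fin N))
    (Q : Fin N → MvPolynomial Δ ℂ) (n : Fin N → ℤ) (k : Fin N) : Module.End ℂ (GhostFock Δ) :=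
  if k ∈ J then currentOp (S k) (n k) else gammaOp (Q k) (n k)

/-- The symbols of the fields of `stateOp`. -/
noncomputable def stateSymbol (S : Fin N → Δ → MvPolynomial Δ ℂ) (J : Finset (Fin N))
    (Q : Fin N → MvPolynomial Δ ℂ) (k : Fin N) : MvPolynomial (Δ ⊕ Δ) ℂ :=
  if k ∈ J then currentSymbol (S k) else rename Sum.inl (Q k)

/-- No vector field coefficient `S^b` depends on the coordinate `x^b`. -/
def NoSelfContraction (S : Fin N → Δ → MvPolynomial Δ ℂ) : Prop :=
  ∀ k b, ∀ d ∈ (S k b).support, d b = 0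

/-- The monomial that multiplies the modes `n`. -/
noncomputable def modeFactor (u : Fin N → ℂ) (n : Fin N → ℤ) : ℂ := ∏ k, u k ^ (-n k)

/-- An upper bound for the sum of the absolute values of the terms of the correlator. -/
noncomputable def stateBound (q : ℂ) (c : Δ → ℂ) (u : Fin N → ℂ)
    (S : Fin N → Δ → MvPolynomial Δ ℂ) (J : Finset (Fin N)) (Q : Fin N → MvPolynomial Δ ℂ) :
    ENNReal :=
  ∑' n : Fin N → ℤ, ‖modeFactor u n‖ₑ *
    kernTrace (absWeight q c) (List.ofFn fun k => opKern (stateOp S J Q n k)).prod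

/-- The correlator of the fields of `stateSymbol`. -/
noncomputable def stateCorr (q : ℂ) (c : Δ → ℂ) (u : Fin N → ℂ)
    (S : Fin N → Δ → MvPolynomial Δ ℂ) (J : Finset (Fin N)) (Q : Fin N → MvPolynomial Δ ℂ) : ℂ :=
  ghostCorr q c (stateSymbol S J Q) u

theorem modeFactor_add {u : Fin N → ℂ} (hu : ∀ k, u k ≠ 0) (n n' : Fin N → ℤ) :
    modeFactor u (n + n') = modeFactor u n * modeFactor u n' := by
  unfold modeFactor
  rw [← Finset.prod_mul_distrib]
  refine Finset.prod_congr rfl fun k _ => ?_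
  rw [Pi.add_apply, neg_add, zpow_add₀ (hu k)]

theorem modeFactor_single (u : Fin N → ℂ) (k : Fin N) (l : ℤ) :
    modeFactor u (Pi.single k l) = u k ^ (-l) := by
  unfold modeFactor
  rw [Finset.prod_eq_single k]
  · simp
  · intro j _ hj
    simp [hj]
  · simp

theorem fieldMode_stateSymbol {S : Fin N → Δ → MvPolynomial Δ ℂ} (hS : NoSelfContraction S)
    (J : Finset (Fin N)) (Q : Fin N → MvPolynomial Δ ℂ) (n : Fin N → ℤ) (k : Fin N)
    (v : GhostFock Δ) : fieldMode (stateSymbol S J Q k) (n k) v = stateOp S J Q n k v := by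
  unfold stateSymbol stateOp
  split_ifs
  · exact fieldMode_eq_fieldOp (regularSymbol_current _ (hS k)) _ _
  · exact fieldMode_eq_fieldOp (regularSymbol_gamma _) _ _

theorem foldr_ofFn_apply {V : Type*} [AddCommGroup V] [Module ℂ V] {k : ℕ}
    (f : Fin k → V → V) (A : Fin k → Module.End ℂ V) (h : ∀ i v, f i v = A i v) (v : V) :
    (List.ofFn f).foldr (fun f v => f v) v = (List.ofFn A).prod v := by
  induction k with
  | zero => simp
  | succ k ih =>
    rw [List.ofFn_succ, List.foldr_cons, List.ofFn_succ, List.prod_cons, Module.End.mul_apply,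
      ih (fun i => f i.succ) (fun i => A i.succ) (fun i => h i.succ), h]

theorem ghostTwist_monomial {Δ : Type*} (q : ℂ) (c : Δ → ℂ) (d : GhostOsc Δ →₀ ℕ) :
    ghostTwist q c (monomial d 1) = ghostWeight q c d • (monomial d 1 : GhostFock Δ) := by
  classical
  unfold ghostTwist
  rw [support_monomial, if_neg one_ne_zero, Finset.sum_singleton, smul_monomial, smul_eq_mul]
  simp [ghostWeight, coeff_monomial]

theorem ghostTraceTerm_stateSymbol {S : Fin N → Δ → MvPolynomial Δ ℂ}
    (hS : NoSelfContraction S) (q : ℂ) (c : Δ → ℂ) (u : Fin N → ℂ) (J : Finset (Fin N))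
    (Q : Fin N → MvPolynomial Δ ℂ) (n : Fin N → ℤ) (d : GhostOsc Δ →₀ ℕ) :
    ghostTraceTerm q c (stateSymbol S J Q) u (n, d) = modeFactor u n *
      (ghostWeight q c d * coeff d ((List.ofFn (stateOp S J Q n)).prod (monomial d 1))) := by
  unfold ghostTraceTerm
  rw [foldr_ofFn_apply _ (stateOp S J Q n) fun i v => fieldMode_stateSymbol hS J Q n i v,
    ghostTwist_monomial, map_smul, coeff_smul, smul_eq_mul]
  rfl

theorem tsum_enorm_ghostTraceTerm_le {S : Fin N → Δ → MvPolynomial Δ ℂ}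
    (hS : NoSelfContraction S) (q : ℂ) (c : Δ → ℂ) (u : Fin N → ℂ) (J : Finset (Fin N))
    (Q : Fin N → MvPolynomial Δ ℂ) :
    ∑' p, ‖ghostTraceTerm q c (stateSymbol S J Q) u p‖ₑ ≤ stateBound q c u S J Q := by
  rw [ENNReal.tsum_prod']
  refine ENNReal.tsum_le_tsum fun n => ?_
  rw [kernTrace, ← ENNReal.tsum_mul_left]
  refine ENNReal.tsum_le_tsum fun d => ?_
  rw [ghostTraceTerm_stateSymbol hS, enorm_mul, enorm_mul]
  exact mul_le_mul_right (mul_le_mul_right (opKern_ofFn_prod_le (stateOp S J Q n) d d) _) _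

theorem summable_stateCorr {S : Fin N → Δ → MvPolynomial Δ ℂ}
    (hS : NoSelfContraction S) {q : ℂ} {c : Δ → ℂ} {u : Fin N → ℂ} {J : Finset (Fin N)}
    {Q : Fin N → MvPolynomial Δ ℂ} (h : stateBound q c u S J Q ≠ ⊤) :
    Summable (ghostTraceTerm q c (stateSymbol S J Q) u) :=
  Summable.of_enorm (ne_top_of_le_ne_top h (tsum_enorm_ghostTraceTerm_le hS q c u J Q))

theorem hasSum_stateCorr {S : Fin N → Δ → MvPolynomial Δ ℂ}
    (hS : NoSelfContraction S) {q : ℂ} {c : Δ → ℂ} {u : Fin N → ℂ} {J : Finset (Fin N)}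
    {Q : Fin N → MvPolynomial Δ ℂ} (h : stateBound q c u S J Q ≠ ⊤) :
    HasSum (fun n => modeFactor u n * opTrace q c (List.ofFn (stateOp S J Q n)).prod)
      (stateCorr q c u S J Q) := by
  have h1 := summable_stateCorr hS h
  have h2 := h1.hasSum.prod_fiberwise fun n => (h1.prod_factor n).hasSum
  refine Eq.mp (congrArg (fun f => HasSum f _) (funext fun n => ?_)) h2
  simp only [ghostTraceTerm_stateSymbol hS]
  rw [tsum_mul_left]
  rfl

/-! ### Contraction of one `γ` with the currents -/

theorem update_stateOp (S : Fin N → Δ → MvPolynomial Δ ℂ) (J : Finset (Fin N))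
    (Q : Fin N → MvPolynomial Δ ℂ) (n : Fin N → ℤ) (j : Fin N) (P : MvPolynomial Δ ℂ) (l : ℤ) :
    Function.update (stateOp S J Q n) j (gammaOp P l) =
      stateOp S (J.erase j) (Function.update Q j P) (Function.update n j l) := by
  funext k
  unfold stateOp
  rcases eq_or_ne k j with rfl | h
  · simp
  · simp [h]

theorem commutator_stateOp {S : Fin N → Δ → MvPolynomial Δ ℂ} (hS : NoSelfContraction S)
    (J : Finset (Fin N)) (Q : Fin N → MvPolynomial Δ ℂ) (n : Fin N → ℤ) (a : Δ) (l : ℤ)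
    (j : Fin N) :
    ghostGamma a l * stateOp S J Q n j - stateOp S J Q n j * ghostGamma a l =
      if j ∈ J then -gammaOp (S j a) (n j + l - 1) else 0 := by
  unfold stateOp
  split_ifs
  · exact ghostGamma_commutator_current (S j) (hS j) a l (n j)
  · rw [(commute_ghostGamma_gammaOp a l (Q j) (n j)).eq, sub_self]

/-- The coefficient of the contraction of `γ^a[l]` with a current. -/
noncomputable def contractCoeff (q : ℂ) (c : Δ → ℂ) (a : Δ) (right : Prop) [Decidable right]
    (x y : ℂ) (l : ℤ) : ℂ :=
  -((if right then 1 else gammaFactor q c a l) / (1 - gammaFactor q c a l)) *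
    (x ^ (-l) * y ^ (l - 1))

/-- The result of contracting one factor `γ^a` at the point `i` with the current at `j`. -/
noncomputable def contractedPoly (S : Fin N → Δ → MvPolynomial Δ ℂ) (Q : Fin N → MvPolynomial Δ ℂ)
    (a : Δ) (i j : Fin N) (R : MvPolynomial Δ ℂ) : Fin N → MvPolynomial Δ ℂ :=
  Function.update (Function.update Q i R) j (S j a)

/-- The change of the modes in a contraction. -/
def contractShift (i j : Fin N) (l : ℤ) : Fin N → ℤ := Pi.single i (-l) + Pi.single j (l - 1)

theorem stateOp_contracted {S : Fin N → Δ → MvPolynomial Δ ℂ} (J : Finset (Fin N))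
    (Q : Fin N → MvPolynomial Δ ℂ) (n : Fin N → ℤ) (a : Δ) (l : ℤ) {i j : Fin N} (hij : j ≠ i)
    (R : MvPolynomial Δ ℂ) :
    Function.update (stateOp S J (Function.update Q i R) (n + Pi.single i (-l))) j
        (gammaOp (S j a) ((n + Pi.single i (-l) : Fin N → ℤ) j + l - 1)) =
      stateOp S (J.erase j) (contractedPoly S Q a i j R) (n + contractShift i j l) := by
  rw [update_stateOp]
  congr 1
  funext k
  rcases eq_or_ne k j with rfl | h
  · simp [contractShift, hij]
    ring
  · simp [contractShift, h]

theorem stateOp_eq_update {S : Fin N → Δ → MvPolynomial Δ ℂ} {J : Finset (Fin N)}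
    (Q : Fin N → MvPolynomial Δ ℂ) (n : Fin N → ℤ) {i : Fin N} (hi : i ∉ J)
    (R : MvPolynomial Δ ℂ) (l : ℤ) :
    stateOp S J (Function.update Q i R) (n + Pi.single i (-l)) =
      Function.update (stateOp S J Q n) i (gammaOp R (n i - l)) := by
  rw [update_stateOp, Finset.erase_eq_of_notMem hi]
  congr 1
  funext k
  rcases eq_or_ne k i with rfl | h
  · simp [sub_eq_add_neg]
  · simp [h]

/-- The product of modes in which one factor `γ^a[l]` has been split off at the point `i`. -/
noncomputable def splitOp (S : Fin N → Δ → MvPolynomial Δ ℂ) (J : Finset (Fin N))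
    (Q : Fin N → MvPolynomial Δ ℂ) (a : Δ) (i : Fin N) (n : Fin N → ℤ) (l : ℤ) :
    Module.End ℂ (GhostFock Δ) :=
  ((List.ofFn (stateOp S J Q (n + Pi.single i (-l)))).take i).prod * ghostGamma a l *
    ((List.ofFn (stateOp S J Q (n + Pi.single i (-l)))).drop i).prod

/-- The kernel that bounds `splitOp`. -/
noncomputable def splitKern (S : Fin N → Δ → MvPolynomial Δ ℂ) (J : Finset (Fin N))
    (Q : Fin N → MvPolynomial Δ ℂ) (a : Δ) (i : Fin N) (n : Fin N → ℤ) (l : ℤ) :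
    Kern (GhostOsc Δ →₀ ℕ) :=
  (((List.ofFn (stateOp S J Q (n + Pi.single i (-l)))).take i).map opKern).prod *
    opKern (ghostGamma a l) *
    (((List.ofFn (stateOp S J Q (n + Pi.single i (-l)))).drop i).map opKern).prod

theorem opKern_splitOp_le (S : Fin N → Δ → MvPolynomial Δ ℂ) (J : Finset (Fin N))
    (Q : Fin N → MvPolynomial Δ ℂ) (a : Δ) (i : Fin N) (n : Fin N → ℤ) (l : ℤ) :
    opKern (splitOp S J Q a i n l) ≤ splitKern S J Q a i n l :=
  (opKern_mul_le _ _).trans (Kern.mul_le_mul ((opKern_mul_le _ _).trans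
    (Kern.mul_le_mul (opKern_list_prod_le _) le_rfl)) (opKern_list_prod_le _))

theorem splitOp_eq {S : Fin N → Δ → MvPolynomial Δ ℂ} {J : Finset (Fin N)}
    (Q : Fin N → MvPolynomial Δ ℂ) (a : Δ) {i : Fin N} (hi : i ∉ J) (R : MvPolynomial Δ ℂ)
    (n : Fin N → ℤ) (l : ℤ) :
    splitOp S J (Function.update Q i R) a i n l =
      ((List.ofFn (stateOp S J Q n)).take i).prod * (ghostGamma a l * gammaOp R (n i - l)) *
        ((List.ofFn (stateOp S J Q n)).drop (i + 1)).prod := by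
  rw [← prod_ofFn_update, prod_ofFn_update_mul, splitOp, stateOp_eq_update Q n hi]

theorem splitKern_eq {S : Fin N → Δ → MvPolynomial Δ ℂ} {J : Finset (Fin N)}
    (Q : Fin N → MvPolynomial Δ ℂ) (a : Δ) {i : Fin N} (hi : i ∉ J) (R : MvPolynomial Δ ℂ)
    (n : Fin N → ℤ) (l : ℤ) :
    splitKern S J (Function.update Q i R) a i n l =
      (List.ofFn (Function.update (fun k => opKern (stateOp S J Q n k)) i
        (opKern (ghostGamma a l) * opKern (gammaOp R (n i - l))))).prod := by
  rw [prod_ofFn_update_mul, splitKern, stateOp_eq_update Q n hi, ← opKern_comp_update,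
    List.map_take, List.map_drop, List.map_ofFn]
  rfl

theorem coeff_gammaOp_single_add {Δ : Type*} (a : Δ) (d : Δ →₀ ℕ) (r : ℂ) (k : ℤ)
    (A B : Module.End ℂ (GhostFock Δ)) (e : GhostOsc Δ →₀ ℕ) (v : GhostFock Δ) :
    HasSum (fun l : ℤ => coeff e ((A * (ghostGamma a l * gammaOp (monomial d r) (k - l)) * B : Module.End ℂ (GhostFock Δ)) v))
      (coeff e ((A * gammaOp (monomial (Finsupp.single a 1 + d) r) k * B : Module.End ℂ (GhostFock Δ)) v)) := by
  have hfin := gammaOp_single_add_support a d r k (B v)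
  have h1 : (A * gammaOp (monomial (Finsupp.single a 1 + d) r) k * B : Module.End ℂ (GhostFock Δ)) v =
      ∑ᶠ l : ℤ, (A * (ghostGamma a l * gammaOp (monomial d r) (k - l)) * B : Module.End ℂ (GhostFock Δ)) v := by
    simp only [Module.End.mul_apply]
    rw [gammaOp_single_add, map_finsum A hfin]
  have hfin2 : (Function.support fun l : ℤ =>
      (A * (ghostGamma a l * gammaOp (monomial d r) (k - l)) * B : Module.End ℂ (GhostFock Δ)) v).Finite := by
    refine hfin.subset fun l hl h0 => hl ?_
    simp only [Module.End.mul_apply]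
    exact (congrArg A h0).trans (map_zero A)
  have h2 : coeff e ((A * gammaOp (monomial (Finsupp.single a 1 + d) r) k * B : Module.End ℂ (GhostFock Δ)) v) =
      ∑ᶠ l : ℤ, coeff e ((A * (ghostGamma a l * gammaOp (monomial d r) (k - l)) * B : Module.End ℂ (GhostFock Δ)) v) := by
    rw [h1]
    exact map_finsum (lcoeff ℂ e) hfin2
  have hfin3 : (Function.support fun l : ℤ =>
      coeff e ((A * (ghostGamma a l * gammaOp (monomial d r) (k - l)) * B : Module.End ℂ (GhostFock Δ)) v)).Finite := by
    refine hfin2.subset fun l hl h0 => hl ?_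
    exact (congrArg (coeff e) h0).trans (coeff_zero e)
  rw [h2, finsum_eq_sum _ hfin3]
  refine hasSum_sum_of_ne_finset_zero fun l hl => ?_
  simpa using hl

theorem opKern_gammaOp_single_add_le (a : Δ) (d : Δ →₀ ℕ) (r : ℂ) (k : ℤ) :
    opKern (gammaOp (monomial (Finsupp.single a 1 + d) r) k) ≤
      Kern.sum fun l : ℤ => opKern (ghostGamma a l) * opKern (gammaOp (monomial d r) (k - l)) := by
  intro e e'
  have h := coeff_gammaOp_single_add a d r k 1 1 e (monomial e' 1)
  simp only [one_mul, mul_one] at h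
  have h2 : opKern (gammaOp (monomial (Finsupp.single a 1 + d) r) k) e e' ≤
      ∑' l : ℤ, opKern (ghostGamma a l * gammaOp (monomial d r) (k - l)) e e' := by
    rw [opKern, ← h.tsum_eq]
    exact enorm_tsum_le_tsum_enorm
  refine h2.trans (ENNReal.tsum_le_tsum fun l => ?_)
  exact opKern_mul_le _ _ e e'

end


/-! ### Convergence and evaluation of a single contraction, summed over all modes. -/

section

variable {Δ : Type*} [Fintype Δ] {N : ℕ}

theorem commKern_eq_opKern {Δ : Type*} (g A : Module.End ℂ (GhostFock Δ)) :
    commKern g A = opKern (g * A - A * g) := rfl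

theorem mul_neg_mul {V : Type*} [AddCommGroup V] [Module ℂ V] (A B C : Module.End ℂ V) :
    A * -B * C = -(A * B * C) :=
  LinearMap.ext fun v => by simp [Module.End.mul_apply]

theorem modeFactor_ne_zero {u : Fin N → ℂ} (hu : ∀ k, u k ≠ 0) (n : Fin N → ℤ) :
    modeFactor u n ≠ 0 :=
  Finset.prod_ne_zero_iff.2 fun k _ => zpow_ne_zero _ (hu k)

theorem modeFactor_eq_shift {u : Fin N → ℂ} (hu : ∀ k, u k ≠ 0) (i j : Fin N) (l : ℤ)
    (n : Fin N → ℤ) : modeFactor u n =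
      u i ^ (-l) * u j ^ (l - 1) * modeFactor u (n + contractShift i j l) := by
  have h1 : modeFactor u (contractShift i j l) = u i ^ l * u j ^ (1 - l) := by
    rw [contractShift, modeFactor_add hu, modeFactor_single, modeFactor_single, neg_neg, neg_sub]
  rw [modeFactor_add hu, h1, zpow_neg, show 1 - l = -(l - 1) by ring, zpow_neg]
  have := zpow_ne_zero l (hu i)
  have := zpow_ne_zero (l - 1) (hu j)
  field_simp

/-- The trace of the kernels that bound the modes `n` of a state. -/
noncomputable def stateTrace (q : ℂ) (c : Δ → ℂ) (S : Fin N → Δ → MvPolynomial Δ ℂ)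
    (J : Finset (Fin N)) (Q : Fin N → MvPolynomial Δ ℂ) (n : Fin N → ℤ) : ENNReal :=
  kernTrace (absWeight q c) (List.ofFn fun k => opKern (stateOp S J Q n k)).prod

theorem stateTrace_le_tsum (q : ℂ) (c : Δ → ℂ) (S : Fin N → Δ → MvPolynomial Δ ℂ)
    {J : Finset (Fin N)} {Q : Fin N → MvPolynomial Δ ℂ} (n : Fin N → ℤ) {i : Fin N} (hi : i ∉ J)
    {a : Δ} {d : Δ →₀ ℕ} {r : ℂ} (hQ : Q i = monomial (Finsupp.single a 1 + d) r) :
    stateTrace q c S J Q n ≤ ∑' l, kernTrace (absWeight q c)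
      (splitKern S J (Function.update Q i (monomial d r)) a i n l) := by
  rw [← kernTrace_kernSum]
  refine kernTrace_mono _ ?_
  have e : splitKern S J (Function.update Q i (monomial d r)) a i n = fun l =>
      (List.ofFn (Function.update (fun k => opKern (stateOp S J Q n k)) i
        (opKern (ghostGamma a l) * opKern (gammaOp (monomial d r) (n i - l))))).prod :=
    funext fun l => splitKern_eq Q a hi (monomial d r) n l
  rw [e, ← Kern.ofFn_prod_update_sum]
  refine Kern.ofFn_prod_mono fun k => ?_
  rcases eq_or_ne k i with rfl | h
  · rw [Function.update_self]
    simp only [stateOp, if_neg hi, hQ]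
    exact opKern_gammaOp_single_add_le a d r _
  · rw [Function.update_of_ne h]

theorem update_commKern_stateOp {S : Fin N → Δ → MvPolynomial Δ ℂ} (hS : NoSelfContraction S)
    (J : Finset (Fin N)) (Q : Fin N → MvPolynomial Δ ℂ) (n : Fin N → ℤ) (a : Δ) (l : ℤ)
    {i j : Fin N} (hi : i ∉ J) (hj : j ∈ J) (R : MvPolynomial Δ ℂ) :
    Function.update (fun k => opKern (stateOp S J (Function.update Q i R)
        (n + Pi.single i (-l)) k)) j
      (commKern (ghostGamma a l) (stateOp S J (Function.update Q i R) (n + Pi.single i (-l)) j)) =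
    fun k => opKern (stateOp S (J.erase j) (contractedPoly S Q a i j R)
      (n + contractShift i j l) k) := by
  have hji : j ≠ i := fun h => hi (h ▸ hj)
  rw [commKern_eq_opKern, commutator_stateOp hS, if_pos hj, opKern_neg, ← opKern_comp_update,
    stateOp_contracted J Q n a l hji]

theorem kernTrace_splitKern_le {q : ℂ} (hq : q ≠ 0) (hq1 : ‖q‖ < 1) {c : Δ → ℂ}
    {a : Δ} (h1 : ‖Complex.exp (-c a)‖ < 1) (h2 : ‖q‖ < ‖Complex.exp (-c a)‖)
    {S : Fin N → Δ → MvPolynomial Δ ℂ} (hS : NoSelfContraction S)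
    {J : Finset (Fin N)} (Q : Fin N → MvPolynomial Δ ℂ) (n : Fin N → ℤ) {i : Fin N} (hi : i ∉ J)
    (R : MvPolynomial Δ ℂ) (l : ℤ) :
    kernTrace (absWeight q c) (splitKern S J (Function.update Q i R) a i n l) ≤
      ∑ j ∈ J, contractBound q c a l (i ≤ j) *
        stateTrace q c S (J.erase j) (contractedPoly S Q a i j R) (n + contractShift i j l) := by
  refine (kernTrace_ghostGamma_ward hq hq1 h1 h2 l _ i).trans ?_
  rw [← Finset.sum_subset (Finset.subset_univ J)]
  · refine Finset.sum_le_sum fun j hj => ?_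
    rw [update_commKern_stateOp hS J Q n a l hi hj R]
    rfl
  · intro j _ hj
    rw [commKern_eq_opKern, commutator_stateOp hS, if_neg hj, opKern_zero,
      Kern.ofFn_prod_update_zero]
    simp [kernTrace, Kern.zero_apply]

/-- The sum of the bounds for the contractions of all modes of `γ^a(x)` with a current at `y`. -/
noncomputable def contractTotal (q : ℂ) (c : Δ → ℂ) (a : Δ) (right : Prop) [Decidable right]
    (x y : ℂ) : ENNReal :=
  ∑' l : ℤ, ‖x ^ (-l) * y ^ (l - 1)‖ₑ * contractBound q c a l right

/-- For fixed `l` the shift of `n` is a bijection of `ℤ^N`, so the sum over `n` reproduces the whole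
bound of the contracted state, and the sum over `l` splits off as `contractTotal`. -/
theorem tsum_splitKern_le {q : ℂ} (hq : q ≠ 0) (hq1 : ‖q‖ < 1) {c : Δ → ℂ}
    {a : Δ} (h1 : ‖Complex.exp (-c a)‖ < 1) (h2 : ‖q‖ < ‖Complex.exp (-c a)‖)
    {u : Fin N → ℂ} (hu : ∀ k, u k ≠ 0)
    {S : Fin N → Δ → MvPolynomial Δ ℂ} (hS : NoSelfContraction S)
    {J : Finset (Fin N)} (Q : Fin N → MvPolynomial Δ ℂ) {i : Fin N} (hi : i ∉ J)
    (R : MvPolynomial Δ ℂ) :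
    ∑' n, ‖modeFactor u n‖ₑ * ∑' l, kernTrace (absWeight q c)
        (splitKern S J (Function.update Q i R) a i n l) ≤
      ∑ j ∈ J, contractTotal q c a (i ≤ j) (u i) (u j) *
        stateBound q c u S (J.erase j) (contractedPoly S Q a i j R) := by
  have key : ∀ n l, ‖modeFactor u n‖ₑ * kernTrace (absWeight q c)
        (splitKern S J (Function.update Q i R) a i n l) ≤
      ∑ j ∈ J, ‖u i ^ (-l) * u j ^ (l - 1)‖ₑ * contractBound q c a l (i ≤ j) *
        (‖modeFactor u (n + contractShift i j l)‖ₑ *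
          stateTrace q c S (J.erase j) (contractedPoly S Q a i j R) (n + contractShift i j l)) := by
    intro n l
    refine (mul_le_mul_right (kernTrace_splitKern_le hq hq1 h1 h2 hS Q n hi R l) _).trans ?_
    rw [Finset.mul_sum]
    refine Finset.sum_le_sum fun j _ => ?_
    rw [modeFactor_eq_shift hu i j l n, enorm_mul]
    refine le_of_eq ?_
    ring
  simp only [← ENNReal.tsum_mul_left]
  refine (ENNReal.tsum_le_tsum fun n => ENNReal.tsum_le_tsum fun l => key n l).trans ?_
  rw [ENNReal.tsum_comm]
  simp only [Summable.tsum_finsetSum (fun _ _ => ENNReal.summable)]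
  refine Finset.sum_le_sum fun j _ => ?_
  simp only [ENNReal.tsum_mul_left]
  rw [contractTotal, ← ENNReal.tsum_mul_right]
  refine ENNReal.tsum_le_tsum fun l => mul_le_mul_right (le_of_eq ?_) _
  exact (Equiv.addRight (contractShift i j l)).tsum_eq fun n => ‖modeFactor u n‖ₑ *
    stateTrace q c S (J.erase j) (contractedPoly S Q a i j R) n

theorem stateBound_le_of_monomial {q : ℂ} (hq : q ≠ 0) (hq1 : ‖q‖ < 1) {c : Δ → ℂ}
    {a : Δ} (h1 : ‖Complex.exp (-c a)‖ < 1) (h2 : ‖q‖ < ‖Complex.exp (-c a)‖)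
    {u : Fin N → ℂ} (hu : ∀ k, u k ≠ 0)
    {S : Fin N → Δ → MvPolynomial Δ ℂ} (hS : NoSelfContraction S)
    {J : Finset (Fin N)} {Q : Fin N → MvPolynomial Δ ℂ} {i : Fin N} (hi : i ∉ J)
    {d : Δ →₀ ℕ} {r : ℂ} (hQ : Q i = monomial (Finsupp.single a 1 + d) r) :
    stateBound q c u S J Q ≤
      ∑ j ∈ J, contractTotal q c a (i ≤ j) (u i) (u j) *
        stateBound q c u S (J.erase j) (contractedPoly S Q a i j (monomial d r)) :=
  (ENNReal.tsum_le_tsum fun n => mul_le_mul_right (stateTrace_le_tsum q c S n hi hQ) _).trans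
    (tsum_splitKern_le hq hq1 h1 h2 hu hS Q hi _)

theorem one_sub_gammaFactor_ne_zero {Δ : Type*} {q : ℂ} (hq : q ≠ 0) (hq1 : ‖q‖ < 1) {c : Δ → ℂ}
    {a : Δ} (h1 : ‖Complex.exp (-c a)‖ < 1) (h2 : ‖q‖ < ‖Complex.exp (-c a)‖) (n : ℤ) :
    1 - gammaFactor q c a n ≠ 0 := by
  intro h
  have h3 := gammaRadius_lt_one hq hq1 h1 h2 n
  rw [sub_eq_zero] at h
  unfold gammaRadius at h3
  rw [← h] at h3
  simp at h3

/-- The Ward identity divided by `1 - gammaFactor`. Polynomials in `γ` commute with the mode, so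
only the points of `J` contribute. -/
theorem opTrace_splitOp {q : ℂ} (hq : q ≠ 0) (hq1 : ‖q‖ < 1) {c : Δ → ℂ}
    {a : Δ} (h1 : ‖Complex.exp (-c a)‖ < 1) (h2 : ‖q‖ < ‖Complex.exp (-c a)‖)
    {S : Fin N → Δ → MvPolynomial Δ ℂ} (hS : NoSelfContraction S)
    {J : Finset (Fin N)} (Q : Fin N → MvPolynomial Δ ℂ) (n : Fin N → ℤ) {i : Fin N} (hi : i ∉ J)
    (R : MvPolynomial Δ ℂ) (l : ℤ)
    (hfin : ∀ j ∈ J, ∀ n', stateTrace q c S (J.erase j) (contractedPoly S Q a i j R) n' ≠ ⊤) :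
    opTrace q c (splitOp S J (Function.update Q i R) a i n l) =
      ∑ j ∈ J, -((if i ≤ j then 1 else gammaFactor q c a l) / (1 - gammaFactor q c a l)) *
        opTrace q c (List.ofFn (stateOp S (J.erase j) (contractedPoly S Q a i j R)
          (n + contractShift i j l))).prod := by
  have h3 := one_sub_gammaFactor_ne_zero hq hq1 h1 h2 l
  have key := opTrace_ghostGamma_ward hq hq1 h1 h2 l
    (stateOp S J (Function.update Q i R) (n + Pi.single i (-l))) i fun j => by
      by_cases hj : j ∈ J
      · rw [update_commKern_stateOp hS J Q n a l hi hj R]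
        exact hfin j hj _
      · rw [commKern_eq_opKern, commutator_stateOp hS, if_neg hj, opKern_zero,
          Kern.ofFn_prod_update_zero]
        simp [kernTrace, Kern.zero_apply]
  rw [splitOp, eq_comm, ← mul_right_inj' h3, key, Finset.mul_sum,
    ← Finset.sum_subset (Finset.subset_univ J)]
  · refine Finset.sum_congr rfl fun j hj => ?_
    have hji : j ≠ i := fun h => hi (h ▸ hj)
    rw [commutator_stateOp hS, if_pos hj]
    have e : (List.ofFn (Function.update (stateOp S J (Function.update Q i R)
        (n + Pi.single i (-l))) j
          (-gammaOp (S j a) ((n + Pi.single i (-l) : Fin N → ℤ) j + l - 1)))).prod =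
        -(List.ofFn (stateOp S (J.erase j) (contractedPoly S Q a i j R)
          (n + contractShift i j l))).prod := by
      rw [← stateOp_contracted J Q n a l hji, prod_ofFn_update, prod_ofFn_update, mul_neg_mul]
    rw [e]
    have e2 : ∀ A : Module.End ℂ (GhostFock Δ), opTrace q c (-A) = -opTrace q c A := fun A => by
      simp [opTrace, tsum_neg]
    rw [e2, ← mul_assoc, mul_neg, mul_div_cancel₀ _ h3]
    simp only [Fin.le_def]
    ring
  · intro j _ hj
    rw [commutator_stateOp hS, if_neg hj, prod_ofFn_update]
    simp [opTrace]

theorem stateTrace_ne_top {q : ℂ} {c : Δ → ℂ} {u : Fin N → ℂ} (hu : ∀ k, u k ≠ 0)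
    {S : Fin N → Δ → MvPolynomial Δ ℂ} {J : Finset (Fin N)} {Q : Fin N → MvPolynomial Δ ℂ}
    (h : stateBound q c u S J Q ≠ ⊤) (n : Fin N → ℤ) : stateTrace q c S J Q n ≠ ⊤ := by
  intro h0
  refine ENNReal.ne_top_of_tsum_ne_top h n (ENNReal.mul_eq_top.2 (Or.inl ⟨?_, h0⟩))
  rw [enorm_ne_zero]
  exact modeFactor_ne_zero hu n

/-- The trace is interchanged with the sum over the modes of the split-off `γ`; the absolute bound
justifies this, and for a fixed basis vector the sum over the modes is finite. -/
theorem hasSum_opTrace_splitOp {q : ℂ} {c : Δ → ℂ} {S : Fin N → Δ → MvPolynomial Δ ℂ}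
    {J : Finset (Fin N)} {Q : Fin N → MvPolynomial Δ ℂ} (n : Fin N → ℤ) {i : Fin N} (hi : i ∉ J)
    {a : Δ} {d : Δ →₀ ℕ} {r : ℂ} (hQ : Q i = monomial (Finsupp.single a 1 + d) r)
    (hfin : ∑' l, kernTrace (absWeight q c)
        (splitKern S J (Function.update Q i (monomial d r)) a i n l) ≠ ⊤) :
    HasSum (fun l => opTrace q c (splitOp S J (Function.update Q i (monomial d r)) a i n l))
      (opTrace q c (List.ofFn (stateOp S J Q n)).prod) := by
  have hs : Summable fun p : ℤ × (GhostOsc Δ →₀ ℕ) => ghostWeight q c p.2 *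
      coeff p.2 (splitOp S J (Function.update Q i (monomial d r)) a i n p.1 (monomial p.2 1)) := by
    refine Summable.of_enorm (ne_top_of_le_ne_top hfin ?_)
    rw [ENNReal.tsum_prod']
    refine ENNReal.tsum_le_tsum fun l => ENNReal.tsum_le_tsum fun e => ?_
    rw [enorm_mul]
    exact mul_le_mul_right (opKern_splitOp_le S J _ a i n l e e) _
  have h1 : ∀ e, HasSum (fun l => ghostWeight q c e * coeff e (splitOp S J
      (Function.update Q i (monomial d r)) a i n l (monomial e 1)))
      (ghostWeight q c e * coeff e ((List.ofFn (stateOp S J Q n)).prod (monomial e 1))) := by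
    intro e
    refine HasSum.mul_left _ ?_
    have h2 := coeff_gammaOp_single_add a d r (n i) ((List.ofFn (stateOp S J Q n)).take i).prod
      ((List.ofFn (stateOp S J Q n)).drop (i + 1)).prod e (monomial e 1)
    have e1 : ((List.ofFn (stateOp S J Q n)).take i).prod *
        gammaOp (monomial (Finsupp.single a 1 + d) r) (n i) *
        ((List.ofFn (stateOp S J Q n)).drop (i + 1)).prod = (List.ofFn (stateOp S J Q n)).prod := by
      rw [← prod_ofFn_update]
      congr 2
      rw [Function.update_eq_self_iff, stateOp, if_neg hi, hQ]
    rw [e1] at h2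
    simpa only [splitOp_eq Q a hi] using h2
  have h3 := hs.hasSum.prod_fiberwise fun l => (hs.prod_factor l).hasSum
  have h4 := hs.prod_symm.hasSum.prod_fiberwise h1
  have h5 : ∑' p : (GhostOsc Δ →₀ ℕ) × ℤ, (fun p : ℤ × (GhostOsc Δ →₀ ℕ) => ghostWeight q c p.2 *
      coeff p.2 (splitOp S J (Function.update Q i (monomial d r)) a i n p.1 (monomial p.2 1)))
      p.swap = opTrace q c (List.ofFn (stateOp S J Q n)).prod := h4.tsum_eq.symm
  rw [← h5]
  have h6 := (Equiv.prodComm (GhostOsc Δ →₀ ℕ) ℤ).tsum_eq fun p : ℤ × (GhostOsc Δ →₀ ℕ) =>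
    ghostWeight q c p.2 * coeff p.2
      (splitOp S J (Function.update Q i (monomial d r)) a i n p.1 (monomial p.2 1))
  rw [← h6] at h3
  exact h3

theorem norm_contractCoeff_le {q : ℂ} (hq : q ≠ 0) (hq1 : ‖q‖ < 1) {c : Δ → ℂ}
    {a : Δ} (h1 : ‖Complex.exp (-c a)‖ < 1) (h2 : ‖q‖ < ‖Complex.exp (-c a)‖)
    (right : Prop) [Decidable right] (x y : ℂ) (l : ℤ) :
    ‖contractCoeff q c a right x y l‖ₑ ≤
      ‖x ^ (-l) * y ^ (l - 1)‖ₑ * contractBound q c a l right := by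
  have h3 := one_sub_gammaFactor_ne_zero hq hq1 h1 h2 l
  have h4 := gammaRadius_lt_one hq hq1 h1 h2 l
  have hg : gammaFactor q c a l ≠ 0 := mul_ne_zero (zpow_ne_zero _ hq) (Complex.exp_ne_zero _)
  have hinv : ∀ z : ℂ, 1 - z ≠ 0 → ‖(1 - z)⁻¹‖ₑ ≤ (1 - ‖z‖ₑ)⁻¹ := by
    intro z hz
    rw [enorm_inv hz]
    refine ENNReal.inv_le_inv.2 ?_
    rw [tsub_le_iff_right]
    calc (1 : ENNReal) = ‖(1 - z) + z‖ₑ := by simp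
      _ ≤ _ := enorm_add_le _ _
  rw [contractCoeff, enorm_mul, enorm_neg, mul_comm]
  refine mul_le_mul_right ?_ _
  unfold contractBound gammaRadius at *
  by_cases hl : 0 < l
  · simp only [hl, if_true, true_iff] at h4 ⊢
    by_cases hr : right
    · simp only [hr, if_true, one_div, mul_one]
      exact hinv _ h3
    · simp only [hr, if_false, div_eq_inv_mul, enorm_mul]
      exact mul_le_mul_left (hinv _ h3) _
  -- For `l ≤ 0` the factor exceeds `1` in absolute value, so both fractions are rewritten through
  -- its inverse.
  · simp only [hl, if_false, false_iff] at h4 ⊢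
    have h5 : 1 - (gammaFactor q c a l)⁻¹ ≠ 0 := by
      rw [sub_ne_zero, ne_comm, Ne, inv_eq_one]
      exact (sub_ne_zero.1 h3).symm
    by_cases hr : right
    · have e : (1 : ℂ) / (1 - gammaFactor q c a l) =
          -((1 - (gammaFactor q c a l)⁻¹)⁻¹ * (gammaFactor q c a l)⁻¹) := by
        rw [← mul_inv, sub_mul, inv_mul_cancel₀ hg, one_mul, ← inv_neg, neg_sub, one_div]
      simp only [hr, if_true, not_true, if_false, e, enorm_neg, enorm_mul]
      exact mul_le_mul_left (hinv _ h5) _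
    · have e : gammaFactor q c a l / (1 - gammaFactor q c a l) =
          -(1 - (gammaFactor q c a l)⁻¹)⁻¹ := by
        rw [div_eq_iff h3, neg_mul, eq_comm, neg_eq_iff_eq_neg, inv_mul_eq_iff_eq_mul₀ h5, sub_mul,
          one_mul, mul_neg, inv_mul_cancel₀ hg]
        ring
      simp only [hr, not_false_eq_true, if_true, if_false, e, enorm_neg, mul_one]
      exact hinv _ h5

theorem hasSum_mul_shift {A ι : Type*} [AddCommGroup A] {f : ι → ℂ} {g : A → ℂ} {x y : ℂ}
    (hf : HasSum f x) (hg : HasSum g y) (s : ι → A) :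
    HasSum (fun p : A × ι => f p.2 * g (p.1 + s p.2)) (x * y) := by
  let E : A × ι ≃ ι × A :=
    { toFun := fun p => (p.2, p.1 + s p.2)
      invFun := fun p => (p.2 - s p.1, p.1)
      left_inv := fun p => by simp
      right_inv := fun p => by simp }
  exact (E.hasSum_iff (f := fun p : ι × A => f p.1 * g p.2)).2
    (hf.mul hg (summable_mul_of_summable_norm hf.summable.norm hg.summable.norm))

/-- The exact counterpart of `stateBound_le_of_monomial`. After the shear of `hasSum_mul_shift`, the
double sum over the modes `n` of the state and `l` of the split-off `γ` becomes a product, whose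
first factor is the summed kernel. -/
theorem stateCorr_eq_of_monomial {q : ℂ} (hq : q ≠ 0) (hq1 : ‖q‖ < 1) {c : Δ → ℂ}
    {a : Δ} (h1 : ‖Complex.exp (-c a)‖ < 1) (h2 : ‖q‖ < ‖Complex.exp (-c a)‖)
    {u : Fin N → ℂ} (hu : ∀ k, u k ≠ 0)
    {S : Fin N → Δ → MvPolynomial Δ ℂ} (hS : NoSelfContraction S)
    {J : Finset (Fin N)} {Q : Fin N → MvPolynomial Δ ℂ} {i : Fin N} (hi : i ∉ J)
    {d : Δ →₀ ℕ} {r : ℂ} (hQ : Q i = monomial (Finsupp.single a 1 + d) r)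
    (hT : ∀ j ∈ J, contractTotal q c a (i ≤ j) (u i) (u j) ≠ ⊤)
    (hB : ∀ j ∈ J, stateBound q c u S (J.erase j) (contractedPoly S Q a i j (monomial d r)) ≠ ⊤) :
    stateCorr q c u S J Q = ∑ j ∈ J, (∑' l, contractCoeff q c a (i ≤ j) (u i) (u j) l) *
      stateCorr q c u S (J.erase j) (contractedPoly S Q a i j (monomial d r)) := by
  have hfin : ∑ j ∈ J, contractTotal q c a (i ≤ j) (u i) (u j) *
        stateBound q c u S (J.erase j) (contractedPoly S Q a i j (monomial d r)) ≠ ⊤ :=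
    ENNReal.sum_ne_top.2 fun j hj => ENNReal.mul_ne_top (hT j hj) (hB j hj)
  have hJ := ne_top_of_le_ne_top hfin (stateBound_le_of_monomial hq hq1 h1 h2 hu hS hi hQ)
  have hsplit := ne_top_of_le_ne_top hfin
    (tsum_splitKern_le hq hq1 h1 h2 hu hS Q hi (monomial d r))
  have hin : ∀ n, HasSum (fun l => modeFactor u n * opTrace q c (splitOp S J
      (Function.update Q i (monomial d r)) a i n l))
      (modeFactor u n * opTrace q c (List.ofFn (stateOp S J Q n)).prod) := by
    intro n
    refine (hasSum_opTrace_splitOp n hi hQ fun h0 => ?_).mul_left _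
    refine ENNReal.ne_top_of_tsum_ne_top hsplit n (ENNReal.mul_eq_top.2 (Or.inl ⟨?_, h0⟩))
    rw [enorm_ne_zero]
    exact modeFactor_ne_zero hu n
  have hj : ∀ j ∈ J, HasSum (fun p : (Fin N → ℤ) × ℤ =>
      contractCoeff q c a (i ≤ j) (u i) (u j) p.2 *
        (modeFactor u (p.1 + contractShift i j p.2) * opTrace q c (List.ofFn (stateOp S (J.erase j)
          (contractedPoly S Q a i j (monomial d r)) (p.1 + contractShift i j p.2))).prod))
      ((∑' l, contractCoeff q c a (i ≤ j) (u i) (u j) l) *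
        stateCorr q c u S (J.erase j) (contractedPoly S Q a i j (monomial d r))) := by
    intro j hj
    have s1 : Summable (contractCoeff q c a (i ≤ j) (u i) (u j)) := by
      refine Summable.of_enorm (ne_top_of_le_ne_top (hT j hj) (ENNReal.tsum_le_tsum fun l => ?_))
      exact norm_contractCoeff_le hq hq1 h1 h2 _ _ _ l
    have s2 := hasSum_stateCorr hS (hB j hj)
    exact hasSum_mul_shift s1.hasSum s2 fun l => contractShift i j l
  have htot := hasSum_sum hj
  refine (hasSum_stateCorr hS hJ).unique (HasSum.prod_fiberwise htot fun n => ?_)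
  convert hin n using 2 with l
  rw [opTrace_splitOp hq hq1 h1 h2 hS Q n hi (monomial d r) l
    fun j hj n' => stateTrace_ne_top hu (hB j hj) n', Finset.mul_sum]
  refine Finset.sum_congr rfl fun j _ => ?_
  rw [modeFactor_eq_shift hu i j l n, contractCoeff]
  ring

end


/-! ### The elliptic kernel as a sum over the modes -/

/-- The Laurent series of the elliptic kernel with multiplier `a`, in the annuli
`‖q‖ < ‖x‖ < 1` and `1 < ‖x‖ < ‖q‖⁻¹`. -/
noncomputable def ellKern (q a x : ℂ) : ℂ :=
  ∑' n : ℤ, x ^ n * ((1 - a * q ^ n)⁻¹ - if 1 < ‖x‖ then 1 else 0)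

theorem summable_pow_natAbs {s : ℝ} (h0 : 0 ≤ s) (h1 : s < 1) :
    Summable fun n : ℤ => s ^ n.natAbs := by
  refine Summable.of_nat_of_neg ?_ ?_
  · simpa using summable_geometric_of_lt_one h0 h1
  · simpa using summable_geometric_of_lt_one h0 h1

theorem tsum_ofReal_pow_natAbs_ne_top {s : ℝ} (h0 : 0 ≤ s) (h1 : s < 1) (C : ENNReal)
    (hC : C ≠ ⊤) : ∑' n : ℤ, C * ENNReal.ofReal (s ^ n.natAbs) ≠ ⊤ := by
  rw [ENNReal.tsum_mul_left]
  refine ENNReal.mul_ne_top hC ?_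
  rw [← ENNReal.ofReal_tsum_of_nonneg (fun n => by positivity) (summable_pow_natAbs h0 h1)]
  exact ENNReal.ofReal_ne_top

/-- The rate of decay of the modes at `x`. -/
noncomputable def decayRate (q x : ℂ) : ℝ := max ‖x‖ (‖q‖ * ‖x‖⁻¹)

theorem decayRate_nonneg (q x : ℂ) : 0 ≤ decayRate q x := le_max_of_le_left (norm_nonneg x)

theorem decayRate_lt_one {q x : ℂ} (h1 : ‖q‖ < ‖x‖) (h2 : ‖x‖ < 1) : decayRate q x < 1 := by
  have h0 : 0 < ‖x‖ := (norm_nonneg q).trans_lt h1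
  refine max_lt h2 ?_
  rw [← div_eq_mul_inv, div_lt_one h0]
  exact h1

theorem norm_pow_le_decayRate (q x : ℂ) {n : ℤ} (hn : 0 ≤ n) :
    ‖x ^ n‖ ≤ decayRate q x ^ n.natAbs := by
  obtain ⟨k, rfl⟩ := Int.eq_ofNat_of_zero_le hn
  simp only [zpow_natCast, Int.natAbs_natCast, norm_pow]
  exact pow_le_pow_left₀ (norm_nonneg x) (le_max_left _ _) _

theorem norm_mul_pow_le_decayRate (q x : ℂ) {n : ℤ} (hn : n ≤ 0) :
    ‖q ^ (-n) * x ^ n‖ ≤ decayRate q x ^ n.natAbs := by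
  obtain ⟨k, hk⟩ := Int.eq_ofNat_of_zero_le (neg_nonneg.2 hn)
  obtain rfl : n = -(k : ℤ) := by omega
  simp only [neg_neg, zpow_natCast, zpow_neg, norm_mul, norm_pow, norm_inv, Int.natAbs_neg,
    Int.natAbs_natCast]
  rw [← inv_pow, ← mul_pow]
  exact pow_le_pow_left₀ (by positivity) (le_max_right _ _) _

/-- Modes of one sign decay because `x` and `y` are radially ordered, those of the other sign
because `gammaRadius` supplies a power of `q`. The common rate is `decayRate` of `y / x` or of `x /
y`. -/
theorem contractTotal_ne_top {Δ : Type*} [Fintype Δ] {q : ℂ} (hq : q ≠ 0) (hq1 : ‖q‖ < 1)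
    {c : Δ → ℂ} {a : Δ} (h1 : ‖Complex.exp (-c a)‖ < 1) (h2 : ‖q‖ < ‖Complex.exp (-c a)‖)
    (right : Prop) [Decidable right] {x y : ℂ}
    (hr : right → ‖q‖ * ‖x‖ < ‖y‖ ∧ ‖y‖ < ‖x‖) (hl : ¬ right → ‖q‖ * ‖y‖ < ‖x‖ ∧ ‖x‖ < ‖y‖) :
    contractTotal q c a right x y ≠ ⊤ := by
  set ρ : ENNReal := ENNReal.ofReal (max ‖Complex.exp (-c a)‖ (‖q‖ * ‖Complex.exp (c a)‖)) with hρ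
  have hρ1 : ρ < 1 := by
    rw [← ENNReal.ofReal_one]
    exact (ENNReal.ofReal_lt_ofReal_iff one_pos).2 (max_exp_lt_one h1 h2)
  have hC : (1 - ρ)⁻¹ ≠ ⊤ := ENNReal.inv_ne_top.2 (tsub_pos_of_lt hρ1).ne'
  have hb : ∀ n, (1 - gammaRadius q c a n)⁻¹ ≤ (1 - ρ)⁻¹ := fun n =>
    ENNReal.inv_le_inv.2 (tsub_le_tsub_left (gammaRadius_le hq hq1 c a n) 1)
  have hx : x ≠ 0 := by
    rintro rfl
    by_cases h : right
    · exact absurd (hr h).2 (by simp)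
    · have := (hl h).1
      simp at this
      exact absurd this (not_lt.2 (by positivity))
  have hy : y ≠ 0 := by
    rintro rfl
    by_cases h : right
    · have := (hr h).1
      simp at this
      exact absurd this (not_lt.2 (by positivity))
    · exact absurd (hl h).2 (by simp)
  -- the bound for a single mode
  have main : ∀ s : ℝ, 0 ≤ s → s < 1 →
      (∀ l : ℤ, ‖x ^ (-l) * y ^ (l - 1)‖ₑ * (if (0 < l ↔ right) then 1 else gammaRadius q c a l) ≤
        ENNReal.ofReal (‖y⁻¹‖ * (1 + ‖Complex.exp (c a)‖ + ‖Complex.exp (-c a)‖)) *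
          ENNReal.ofReal (s ^ l.natAbs)) → contractTotal q c a right x y ≠ ⊤ := by
    intro s hs0 hs1 hs
    refine ne_top_of_le_ne_top (tsum_ofReal_pow_natAbs_ne_top hs0 hs1
      ((1 - ρ)⁻¹ * ENNReal.ofReal (‖y⁻¹‖ * (1 + ‖Complex.exp (c a)‖ + ‖Complex.exp (-c a)‖)))
      (ENNReal.mul_ne_top hC ENNReal.ofReal_ne_top)) (ENNReal.tsum_le_tsum fun l => ?_)
    calc _ = (1 - gammaRadius q c a l)⁻¹ * (‖x ^ (-l) * y ^ (l - 1)‖ₑ *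
          (if (0 < l ↔ right) then 1 else gammaRadius q c a l)) := by
          rw [contractBound]; ring
      _ ≤ _ := by
        rw [mul_assoc]
        exact mul_le_mul' (hb l) (hs l)
  have hone : ∀ w : ℂ, ∀ l : ℤ, ∀ s : ℝ, 0 ≤ s → ‖w‖ ≤ s ^ l.natAbs →
      ‖y⁻¹ * w‖ₑ ≤ ENNReal.ofReal (‖y⁻¹‖ * (1 + ‖Complex.exp (c a)‖ + ‖Complex.exp (-c a)‖)) *
          ENNReal.ofReal (s ^ l.natAbs) := by
    intro w l s hs0 hw
    rw [← ofReal_norm, ← ENNReal.ofReal_mul (by positivity), norm_mul]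
    refine ENNReal.ofReal_le_ofReal (mul_le_mul ?_ hw (norm_nonneg _) (by positivity))
    refine le_mul_of_one_le_right (norm_nonneg _) ?_
    have := norm_nonneg (Complex.exp (c a))
    have := norm_nonneg (Complex.exp (-c a))
    linarith
  have htwo : ∀ w e : ℂ, ∀ l : ℤ, ∀ s : ℝ, 0 ≤ s → ‖w‖ ≤ s ^ l.natAbs →
      (e = Complex.exp (c a) ∨ e = Complex.exp (-c a)) →
      ‖y⁻¹ * w * e‖ₑ ≤ ENNReal.ofReal (‖y⁻¹‖ * (1 + ‖Complex.exp (c a)‖ + ‖Complex.exp (-c a)‖)) *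
          ENNReal.ofReal (s ^ l.natAbs) := by
    intro w e l s hs0 hw he
    rw [← ofReal_norm, ← ENNReal.ofReal_mul (by positivity), mul_right_comm, norm_mul, norm_mul]
    refine ENNReal.ofReal_le_ofReal (mul_le_mul ?_ hw (norm_nonneg _) (by positivity))
    refine mul_le_mul_of_nonneg_left ?_ (norm_nonneg _)
    have := norm_nonneg (Complex.exp (c a))
    have := norm_nonneg (Complex.exp (-c a))
    rcases he with rfl | rfl <;> linarith
  have e1 : ∀ l : ℤ, x ^ (-l) * y ^ (l - 1) = y⁻¹ * (y / x) ^ l := by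
    intro l
    rw [zpow_sub_one₀ hy, div_zpow, zpow_neg]
    field_simp
  have e2 : ∀ l : ℤ, x ^ (-l) * y ^ (l - 1) = y⁻¹ * (x / y) ^ (-l) := by
    intro l
    rw [e1, zpow_neg, ← inv_zpow, inv_div]
  have hx0 := norm_pos_iff.2 hx
  have hy0 := norm_pos_iff.2 hy
  by_cases h : right
  · have hs1 : decayRate q (y / x) < 1 := decayRate_lt_one
      (by rw [norm_div, lt_div_iff₀ hx0]; exact (hr h).1)
      (by rw [norm_div, div_lt_one hx0]; exact (hr h).2)
    refine main _ (decayRate_nonneg q _) hs1 fun l => ?_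
    by_cases hl0 : 0 < l
    · simp only [h, hl0, if_true, mul_one, e1]
      exact hone _ l _ (decayRate_nonneg q _) (norm_pow_le_decayRate q _ hl0.le)
    · simp only [h, hl0, iff_true, if_false, e1]
      rw [gammaRadius, if_neg hl0, ← enorm_mul, gammaFactor, mul_inv, ← zpow_neg,
        ← Complex.exp_neg]
      have := htwo _ _ l _ (decayRate_nonneg q _)
        (norm_mul_pow_le_decayRate q (y / x) (not_lt.1 hl0)) (Or.inr rfl)
      refine le_of_eq_of_le ?_ this
      congr 1
      ring
  · have hs1 : decayRate q (x / y) < 1 := decayRate_lt_one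
      (by rw [norm_div, lt_div_iff₀ hy0]; exact (hl h).1)
      (by rw [norm_div, div_lt_one hy0]; exact (hl h).2)
    refine main _ (decayRate_nonneg q _) hs1 fun l => ?_
    by_cases hl0 : 0 < l
    · simp only [h, hl0, iff_false, not_true, if_false, e2]
      rw [gammaRadius, if_pos hl0, ← enorm_mul, gammaFactor]
      have := htwo _ _ (-l) _ (decayRate_nonneg q _)
        (norm_mul_pow_le_decayRate q (x / y) (by omega)) (Or.inl rfl)
      rw [neg_neg, Int.natAbs_neg] at this
      refine le_of_eq_of_le ?_ this
      congr 1
      ring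
    · simp only [h, hl0, if_true, mul_one, e2]
      have := hone _ (-l) _ (decayRate_nonneg q _)
        (norm_pow_le_decayRate q (x / y) (n := -l) (by omega))
      rwa [Int.natAbs_neg] at this

/-- With `l = -n` and `μ = e^{-c} q^n`, the coefficients `1 / (1 - μ⁻¹)` and `μ⁻¹ / (1 - μ⁻¹)` equal
`1 - (1 - μ)⁻¹` and `-(1 - μ)⁻¹`. The two positions of the current thus produce the two Laurent
expansions in `ellKern`. -/
theorem tsum_contractCoeff {Δ : Type*} [Fintype Δ] {q : ℂ} (hq : q ≠ 0) (hq1 : ‖q‖ < 1)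
    {c : Δ → ℂ} {a : Δ} (h1 : ‖Complex.exp (-c a)‖ < 1) (h2 : ‖q‖ < ‖Complex.exp (-c a)‖)
    (right : Prop) [Decidable right] {x y : ℂ} (hx : x ≠ 0) (hy : y ≠ 0)
    (hr : right → ‖y‖ < ‖x‖) (hl : ¬ right → ‖x‖ < ‖y‖) :
    ∑' l, contractCoeff q c a right x y l = y⁻¹ * ellKern q (Complex.exp (-c a)) (x / y) := by
  rw [← (Equiv.neg ℤ).tsum_eq, ellKern, ← tsum_mul_left]
  refine tsum_congr fun n => ?_
  have h3 := one_sub_gammaFactor_ne_zero hq hq1 h1 h2 (-n)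
  have hm : gammaFactor q c a (-n) = (Complex.exp (-c a) * q ^ n)⁻¹ := by
    rw [gammaFactor, zpow_neg, mul_inv, Complex.exp_neg, inv_inv, mul_comm]
  have hm0 : Complex.exp (-c a) * q ^ n ≠ 0 :=
    mul_ne_zero (Complex.exp_ne_zero _) (zpow_ne_zero _ hq)
  have e2 : x ^ (- -n) * y ^ (-n - 1) = y⁻¹ * (x / y) ^ n := by
    rw [zpow_sub_one₀ hy, div_zpow, neg_neg, zpow_neg]
    field_simp
  have hx0 := norm_pos_iff.2 hx
  have hy0 := norm_pos_iff.2 hy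
  rw [Equiv.neg_apply, contractCoeff, e2]
  rw [hm] at h3 ⊢
  set μ := Complex.exp (-c a) * q ^ n
  have h4 : 1 - μ ≠ 0 := by
    intro h
    rw [sub_eq_zero] at h
    rw [← h] at h3
    simp at h3
  by_cases h : right
  · have : 1 < ‖x / y‖ := by rw [norm_div, one_lt_div hy0]; exact hr h
    rw [if_pos h, if_pos this]
    have : (1 : ℂ) / (1 - μ⁻¹) = -((1 - μ)⁻¹ - 1) := by
      have : μ - 1 ≠ 0 := by rwa [← neg_ne_zero, neg_sub]
      rw [div_eq_iff h3]
      field_simp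
      ring
    rw [this]
    ring
  · have : ¬ 1 < ‖x / y‖ := by rw [norm_div, one_lt_div hy0, not_lt]; exact (hl h).le
    rw [if_neg h, if_neg this]
    have : μ⁻¹ / (1 - μ⁻¹) = -(1 - μ)⁻¹ := by
      have : μ - 1 ≠ 0 := by rwa [← neg_ne_zero, neg_sub]
      rw [div_eq_iff h3]
      field_simp
      ring
    rw [this]
    ring


/-! ### Convergence and three-term identity of Kronecker's series. -/

theorem exists_inv_one_sub_le {q : ℂ} (hq1 : ‖q‖ < 1) (a : ℂ) :
    ∃ C : ℝ, 0 ≤ C ∧ ∀ n : ℤ, 0 ≤ n → ‖(1 - a * q ^ n)⁻¹‖ ≤ C := by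
  have h1 : Filter.Tendsto (fun n : ℕ => (1 - a * q ^ n)⁻¹) Filter.atTop (𝓝 ((1 - a * 0)⁻¹)) :=
    ((tendsto_pow_atTop_nhds_zero_of_norm_lt_one hq1).const_mul a |>.const_sub 1).inv₀ (by simp)
  obtain ⟨C, hC⟩ := h1.norm.bddAbove_range
  refine ⟨C, (norm_nonneg _).trans (hC ⟨0, rfl⟩), fun n hn => ?_⟩
  obtain ⟨k, rfl⟩ := Int.eq_ofNat_of_zero_le hn
  exact hC ⟨k, by simp⟩

theorem inv_one_sub_neg {μ : ℂ} (h0 : μ ≠ 0) (h1 : 1 - μ ≠ 0) :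
    (1 - μ)⁻¹ = -(μ⁻¹ * (1 - μ⁻¹)⁻¹) ∧ (1 - μ)⁻¹ - 1 = -(1 - μ⁻¹)⁻¹ ∧
      (1 - μ)⁻¹ - 1 = μ * (1 - μ)⁻¹ := by
  have h3 : μ - 1 ≠ 0 := by rwa [← neg_ne_zero, neg_sub]
  refine ⟨?_, ?_, ?_⟩ <;> field_simp <;> ring

/-- For `‖x‖ < 1` the coefficients are bounded as `n → ∞` and of order `q^{-n}` as `n → -∞`.
Subtracting `1` exchanges these roles: they become of order `q^n` as `n → ∞` and bounded as `n →
-∞`, as convergence for `‖x‖ > 1` requires. -/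
theorem summable_ellKern {q a x : ℂ} (hq : q ≠ 0) (hq1 : ‖q‖ < 1) (ha0 : a ≠ 0)
    (ha : ∀ n : ℤ, a * q ^ n ≠ 1) (hx : ‖q‖ < ‖x‖) (hx' : ‖q‖ * ‖x‖ < 1) (hx1 : ‖x‖ ≠ 1) :
    Summable fun n : ℤ => x ^ n * ((1 - a * q ^ n)⁻¹ - if 1 < ‖x‖ then 1 else 0) := by
  obtain ⟨C, hC0, hC⟩ := exists_inv_one_sub_le hq1 a
  obtain ⟨D, hD0, hD⟩ := exists_inv_one_sub_le hq1 a⁻¹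
  have hinv : ∀ n : ℤ, (a * q ^ n)⁻¹ = a⁻¹ * q ^ (-n) := fun n => by rw [mul_inv, zpow_neg]
  have hμ := fun n : ℤ => inv_one_sub_neg (mul_ne_zero ha0 (zpow_ne_zero n hq))
    (sub_ne_zero.2 (ha n).symm)
  have hx0 : 0 < ‖x‖ := (norm_nonneg q).trans_lt hx
  have main : ∀ s : ℝ, 0 ≤ s → s < 1 →
      (∀ n : ℤ, ∃ B, 0 ≤ B ∧ B ≤ C + ‖a⁻¹‖ * D + ‖a‖ * C + D ∧
        ‖x ^ n * ((1 - a * q ^ n)⁻¹ - if 1 < ‖x‖ then 1 else 0)‖ ≤ B * s ^ n.natAbs) →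
      Summable fun n : ℤ => x ^ n * ((1 - a * q ^ n)⁻¹ - if 1 < ‖x‖ then 1 else 0) := by
    intro s hs0 hs1 h
    refine Summable.of_norm_bounded ((summable_pow_natAbs hs0 hs1).mul_left
      (C + ‖a⁻¹‖ * D + ‖a‖ * C + D)) fun n => ?_
    obtain ⟨B, -, hB, hn⟩ := h n
    exact hn.trans (mul_le_mul_of_nonneg_right hB (by positivity))
  have p1 : 0 ≤ ‖a⁻¹‖ * D := by positivity
  have p2 : 0 ≤ ‖a‖ * C := by positivity
  have prod : ∀ {w v : ℂ} {A B : ℝ}, ‖w‖ ≤ B → ‖v‖ ≤ A → ‖w * v‖ ≤ A * B := by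
    intro w v A B h h'
    rw [norm_mul, mul_comm]
    exact mul_le_mul h' h (norm_nonneg _) ((norm_nonneg _).trans h')
  rcases lt_or_gt_of_ne hx1 with h | h
  · refine main _ (decayRate_nonneg q x) (decayRate_lt_one hx h) fun n => ?_
    simp only [not_lt.2 h.le, if_false, sub_zero]
    rcases le_total 0 n with hn | hn
    · exact ⟨C, hC0, by linarith, prod (norm_pow_le_decayRate q x hn) (hC n hn)⟩
    · refine ⟨‖a⁻¹‖ * D, p1, by linarith, ?_⟩
      rw [(hμ n).1, hinv]
      have e : x ^ n * -(a⁻¹ * q ^ (-n) * (1 - a⁻¹ * q ^ (-n))⁻¹) =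
        (q ^ (-n) * x ^ n) * -(a⁻¹ * (1 - a⁻¹ * q ^ (-n))⁻¹) := by ring
      rw [e]
      refine prod (norm_mul_pow_le_decayRate q x hn) ?_
      rw [norm_neg, norm_mul]
      exact mul_le_mul_of_nonneg_left (hD (-n) (by omega)) (norm_nonneg _)
  · have hr : decayRate q x⁻¹ < 1 := decayRate_lt_one
      (by rw [norm_inv, ← one_div, lt_div_iff₀ hx0]; exact hx')
      (by rw [norm_inv]; exact inv_lt_one_of_one_lt₀ h)
    refine main _ (decayRate_nonneg q x⁻¹) hr fun n => ?_
    simp only [h, if_true]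
    have hxn : x ^ n = x⁻¹ ^ (-n) := by simp
    rcases le_total 0 n with hn | hn
    · refine ⟨‖a‖ * C, p2, by linarith, ?_⟩
      rw [(hμ n).2.2, hxn]
      have e : x⁻¹ ^ (-n) * (a * q ^ n * (1 - a * q ^ n)⁻¹) =
        (q ^ (- -n) * x⁻¹ ^ (-n)) * (a * (1 - a * q ^ n)⁻¹) := by rw [neg_neg]; ring
      rw [e, ← Int.natAbs_neg]
      refine prod (norm_mul_pow_le_decayRate q x⁻¹ (n := -n) (by omega)) ?_
      rw [norm_mul]
      exact mul_le_mul_of_nonneg_left (hC n hn) (norm_nonneg _)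
    · refine ⟨D, hD0, by linarith, ?_⟩
      rw [(hμ n).2.1, hinv, hxn, ← Int.natAbs_neg]
      refine prod (norm_pow_le_decayRate q x⁻¹ (n := -n) (by omega)) ?_
      rw [norm_neg]
      exact hD (-n) (by omega)

/-- This partial fraction identity is the Fay identity for single Laurent coefficients, before the
constants of the annuli are subtracted. -/
theorem inv_one_sub_mul_inv_one_sub {x y : ℂ} (hx : 1 - x ≠ 0) (hy : 1 - y ≠ 0)
    (hxy : 1 - x * y ≠ 0) :
    (1 - x)⁻¹ * (1 - y)⁻¹ = (1 - x * y)⁻¹ * ((1 - x)⁻¹ + (1 - y)⁻¹ - 1) := by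
  field_simp
  ring

/-- The subtracted constants depend on the order of `1`, `r` and `t`. In each of the six possible
orders the identity reduces to `key`; the two remaining combinations of inequalities are
contradictory. -/
theorem laurent_coeff_identity {α β γ : ℂ} {r t : ℝ} (key : α * β = γ * (α + β - 1)) (hr : r ≠ 1)
    (ht : t ≠ 1) (hrt : r ≠ t) :
    (α - if 1 < r then 1 else 0) * (β - if 1 < t then 1 else 0) =
      (α - if t < r then 1 else 0) * (γ - if 1 < t then 1 else 0) +
        (β - if r < t then 1 else 0) * (γ - if 1 < r then 1 else 0) := by
  rcases lt_or_gt_of_ne hrt with h | h <;> rcases lt_or_gt_of_ne hr with h' | h' <;>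
    rcases lt_or_gt_of_ne ht with h'' | h''
  all_goals
    simp only [h, h', h'', not_lt.2 h.le, if_true, if_false, not_lt.2 h'.le, not_lt.2 h''.le]
    first
      | linear_combination key
      | linarith

theorem hasSum_mul_prod {f g : ℤ → ℂ} {x y : ℂ} (hf : HasSum f x) (hg : HasSum g y) :
    HasSum (fun p : ℤ × ℤ => f p.1 * g p.2) (x * y) :=
  hf.mul hg (summable_mul_of_summable_norm hf.summable.norm hg.summable.norm)

theorem hasSum_mul_comp_addLeft {f g : ℤ → ℂ} {x y : ℂ} (hf : HasSum f x) (hg : HasSum g y) :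
    HasSum (fun p : ℤ × ℤ => f p.1 * g (p.1 + p.2)) (x * y) := by
  let E : ℤ × ℤ ≃ ℤ × ℤ :=
    { toFun := fun p => (p.1, p.1 + p.2)
      invFun := fun p => (p.1, p.2 - p.1)
      left_inv := fun p => by simp
      right_inv := fun p => by simp }
  exact (E.hasSum_iff (f := fun p : ℤ × ℤ => f p.1 * g p.2)).2
    (hf.mul hg (summable_mul_of_summable_norm hf.summable.norm hg.summable.norm))

theorem hasSum_mul_comp_addRight {f g : ℤ → ℂ} {x y : ℂ} (hf : HasSum f x) (hg : HasSum g y) :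
    HasSum (fun p : ℤ × ℤ => f p.2 * g (p.1 + p.2)) (x * y) := by
  let E : ℤ × ℤ ≃ ℤ × ℤ :=
    { toFun := fun p => (p.2, p.1 + p.2)
      invFun := fun p => (p.2 - p.1, p.1)
      left_inv := fun p => by simp
      right_inv := fun p => by simp }
  exact (E.hasSum_iff (f := fun p : ℤ × ℤ => f p.1 * g p.2)).2
    (hf.mul hg (summable_mul_of_summable_norm hf.summable.norm hg.summable.norm))

/-- The Fay identity. -/
theorem ellKern_mul_ellKern {q a b x y : ℂ} (hq : q ≠ 0) (hq1 : ‖q‖ < 1) (ha0 : a ≠ 0)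
    (hb0 : b ≠ 0) (ha : ∀ n : ℤ, a * q ^ n ≠ 1) (hb : ∀ n : ℤ, b * q ^ n ≠ 1)
    (hab : ∀ n : ℤ, a * b * q ^ n ≠ 1)
    (hx : ‖q‖ < ‖x‖) (hx' : ‖q‖ * ‖x‖ < 1) (hx1 : ‖x‖ ≠ 1)
    (hy : ‖q‖ < ‖y‖) (hy' : ‖q‖ * ‖y‖ < 1) (hy1 : ‖y‖ ≠ 1)
    (hxy : ‖q‖ * ‖y‖ < ‖x‖) (hxy' : ‖q‖ * ‖x‖ < ‖y‖) (hxy1 : ‖x‖ ≠ ‖y‖) :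
    ellKern q a x * ellKern q b y =
      ellKern q a (x / y) * ellKern q (a * b) y + ellKern q b (y / x) * ellKern q (a * b) x := by
  have hx0 : 0 < ‖x‖ := (norm_nonneg q).trans_lt hx
  have hy0 : 0 < ‖y‖ := (norm_nonneg q).trans_lt hy
  have hxn : x ≠ 0 := norm_pos_iff.1 hx0
  have hyn : y ≠ 0 := norm_pos_iff.1 hy0
  have s1 := summable_ellKern hq hq1 ha0 ha hx hx' hx1
  have s2 := summable_ellKern hq hq1 hb0 hb hy hy' hy1
  have s3 := summable_ellKern (x := x / y) hq hq1 ha0 ha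
    (by rw [norm_div, lt_div_iff₀ hy0]; exact hxy)
    (by rw [norm_div, ← mul_div_assoc, div_lt_one hy0]; exact hxy')
    (by rw [norm_div, Ne, div_eq_one_iff_eq hy0.ne']; exact hxy1)
  have s4 := summable_ellKern (x := y / x) hq hq1 hb0 hb
    (by rw [norm_div, lt_div_iff₀ hx0]; exact hxy')
    (by rw [norm_div, ← mul_div_assoc, div_lt_one hx0]; exact hxy)
    (by rw [norm_div, Ne, div_eq_one_iff_eq hx0.ne']; exact hxy1.symm)
  have s5 := summable_ellKern hq hq1 (mul_ne_zero ha0 hb0) hab hx hx' hx1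
  have s6 := summable_ellKern hq hq1 (mul_ne_zero ha0 hb0) hab hy hy' hy1
  have k1 : HasSum _ (ellKern q a x) := s1.hasSum
  have k2 : HasSum _ (ellKern q b y) := s2.hasSum
  have k3 : HasSum _ (ellKern q a (x / y)) := s3.hasSum
  have k4 : HasSum _ (ellKern q b (y / x)) := s4.hasSum
  have k5 : HasSum _ (ellKern q (a * b) x) := s5.hasSum
  have k6 : HasSum _ (ellKern q (a * b) y) := s6.hasSum
  have h12 := hasSum_mul_prod k1 k2
  have h36 := hasSum_mul_comp_addLeft k3 k6
  have h45 := hasSum_mul_comp_addRight k4 k5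
  -- All three products are double series in the monomials `x^m y^n`, thanks to the index shifts in
  -- `h36` and `h45`; it remains to compare coefficients.
  refine h12.unique ?_
  refine Eq.mp (congrArg (fun f => HasSum f _) (funext fun p => ?_)) (h36.add h45)
  obtain ⟨m, n⟩ := p
  dsimp only
  have g1 : (x / y) ^ m * y ^ (m + n) = x ^ m * y ^ n := by
    rw [div_zpow, zpow_add₀ hyn]
    field_simp
  have g2 : (y / x) ^ n * x ^ (m + n) = x ^ m * y ^ n := by
    rw [div_zpow, zpow_add₀ hxn]
    field_simp
  have hmn : a * b * q ^ (m + n) = (a * q ^ m) * (b * q ^ n) := by rw [zpow_add₀ hq]; ring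
  have hC := sub_ne_zero.2 (hab (m + n)).symm
  rw [hmn] at hC ⊢
  have key := inv_one_sub_mul_inv_one_sub (sub_ne_zero.2 (ha m).symm) (sub_ne_zero.2 (hb n).symm) hC
  have c1 : 1 < ‖x / y‖ ↔ ‖y‖ < ‖x‖ := by rw [norm_div, one_lt_div hy0]
  have c2 : 1 < ‖y / x‖ ↔ ‖x‖ < ‖y‖ := by rw [norm_div, one_lt_div hx0]
  rw [if_congr c1 rfl rfl, if_congr c2 rfl rfl, mul_mul_mul_comm ((x / y) ^ m),
    mul_mul_mul_comm ((y / x) ^ n), mul_mul_mul_comm (x ^ m), g1, g2, ← mul_add]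
  exact (congrArg _ (laurent_coeff_identity key hx1 hy1 hxy1)).symm


/-! ### Charge conservation -/

/-- The charge of an oscillator. -/
def oscGrade {Δ : Type*} (h : Δ → ℤ) : GhostOsc Δ → ℤ :=
  Sum.elim (fun p => -h p.1) (fun p => h p.1)

/-- The charge of an elementary field. -/
def fieldGrade {Δ : Type*} (h : Δ → ℤ) : Δ ⊕ Δ → ℤ := Sum.elim (fun a => -h a) h

/-- The operator raises the charge by `s`. -/
def HasShift {Δ : Type*} (h : Δ → ℤ) (A : Module.End ℂ (GhostFock Δ)) (s : ℤ) : Prop :=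
  ∀ t v, IsWeightedHomogeneous (oscGrade h) v t → IsWeightedHomogeneous (oscGrade h) (A v) (t + s)

theorem hasShift_ghostCreate {Δ : Type*} (h : Δ → ℤ) (o : GhostOsc Δ) :
    HasShift h (ghostCreate o) (oscGrade h o) := by
  intro t v hv
  rw [add_comm]
  exact (isWeightedHomogeneous_X ℂ (oscGrade h) o).mul hv

theorem hasShift_ghostDeriv {Δ : Type*} (h : Δ → ℤ) (o : GhostOsc Δ) :
    HasShift h (ghostDeriv o) (-oscGrade h o) := by
  intro t v hv
  exact hv.pderiv (by ring)

theorem hasShift_ghostMode {Δ : Type*} (h : Δ → ℤ) (x : Δ ⊕ Δ) (n : ℤ) :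
    HasShift h (ghostMode x n) (fieldGrade h x) := by
  rcases x with a | a
  · simp only [ghostMode, ghostGamma]
    split_ifs
    · intro t v hv
      exact (hasShift_ghostDeriv h _ t v hv).neg
    · exact hasShift_ghostCreate h _
  · simp only [ghostMode, ghostBeta]
    split_ifs
    · have := hasShift_ghostDeriv h (Sum.inl (a, n.toNat))
      simpa [oscGrade, fieldGrade] using this
    · exact hasShift_ghostCreate h _

theorem hasShift_zero {Δ : Type*} (h : Δ → ℤ) (s : ℤ) :
    HasShift h (0 : Module.End ℂ (GhostFock Δ)) s :=
  fun t _ _ => isWeightedHomogeneous_zero ℂ (oscGrade h) (t + s)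

theorem hasShift_listOp {Δ : Type*} (h : Δ → ℤ) (L : List (Δ ⊕ Δ)) (N : ℤ) :
    HasShift h (listOp L N) (L.map (fieldGrade h)).sum := by
  by_cases hL : NonContracting L
  · induction L generalizing N with
    | nil =>
      intro t v hv
      rw [listOp_apply hL, normalOrderedMode_nil]
      split_ifs
      · simpa using hv
      · exact isWeightedHomogeneous_zero ℂ _ _
    | cons x L ih =>
      intro t v hv
      rw [listOp_cons hL]
      refine finsum_induction (fun v : GhostFock Δ => IsWeightedHomogeneous (oscGrade h) v
        (t + ((x :: L).map (fieldGrade h)).sum)) (isWeightedHomogeneous_zero ℂ _ _)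
        (fun _ _ h1 h2 => h1.add h2) fun k => ?_
      have := hasShift_ghostMode h x k _ _ (ih (N - ghostSpin x - k) hL.tail t v hv)
      rwa [List.map_cons, List.sum_cons, add_comm (fieldGrade h x), ← add_assoc]
  · rw [listOp, dif_neg hL]
    exact hasShift_zero h _

theorem sum_map_toList_toMultiset {σ : Type*} (w : σ → ℤ) (d : σ →₀ ℕ) :
    ((Finsupp.toMultiset d).toList.map w).sum = Finsupp.weight w d := by
  have h1 : ((Finsupp.toMultiset d).toList.map w).sum = ((Finsupp.toMultiset d).map w).sum := by
    conv_rhs => rw [← Multiset.coe_toList (Finsupp.toMultiset d)]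
    rw [Multiset.map_coe, Multiset.sum_coe]
  rw [h1]
  induction d using Finsupp.induction_linear with
  | zero => simp
  | add f g hf hg =>
    rw [map_add, map_add, Multiset.map_add, Multiset.sum_add]
    rw [hf, hg] <;>
    · rw [← Multiset.sum_coe, ← Multiset.map_coe, Multiset.coe_toList]
  | single x n =>
    rw [Finsupp.toMultiset_single, Multiset.map_nsmul, Multiset.sum_nsmul, Finsupp.weight_single]
    simp

theorem hasShift_fieldOp {Δ : Type*} (h : Δ → ℤ) {F : MvPolynomial (Δ ⊕ Δ) ℂ} {s : ℤ}
    (hF : IsWeightedHomogeneous (fieldGrade h) F s) (N : ℤ) : HasShift h (fieldOp N F) s := by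
  intro t v hv
  conv => enter [2]; rw [F.as_sum, map_sum, LinearMap.sum_apply]
  refine IsWeightedHomogeneous.sum _ _ _ fun d hd => ?_
  rw [fieldOp_monomial, LinearMap.smul_apply, smul_eq_C_mul]
  have h1 := hasShift_listOp h (Finsupp.toMultiset d).toList N t v hv
  rw [sum_map_toList_toMultiset, hF (mem_support_iff.1 hd)] at h1
  exact h1.C_mul _

theorem HasShift.opKern_ne_zero {Δ : Type*} {h : Δ → ℤ} {A : Module.End ℂ (GhostFock Δ)} {s : ℤ}
    (hA : HasShift h A s) {d e : GhostOsc Δ →₀ ℕ} (hde : opKern A d e ≠ 0) :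
    Finsupp.weight (oscGrade h) d = Finsupp.weight (oscGrade h) e + s := by
  refine hA _ _ (isWeightedHomogeneous_monomial (oscGrade h) e 1 rfl) ?_
  simpa [opKern] using hde

theorem ofFn_prod_shift {I : Type*} {n : ℕ} (g : I → ℤ) (M : Fin n → Kern I) (s : Fin n → ℤ)
    (hM : ∀ k d e, M k d e ≠ 0 → g d = g e + s k) (d e : I)
    (h : (List.ofFn M).prod d e ≠ 0) : g d = g e + ∑ k, s k := by
  induction n generalizing d with
  | zero =>
    simp only [List.ofFn_zero, List.prod_nil, Kern.one_apply] at h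
    have : d = e := by
      by_contra hde
      simp [hde] at h
    simp [this]
  | succ n ih =>
    rw [List.ofFn_succ, List.prod_cons, Kern.mul_apply, Ne, ENNReal.tsum_eq_zero] at h
    push Not at h
    obtain ⟨x, hx⟩ := h
    have h1 := hM 0 d x (left_ne_zero_of_mul hx)
    have h2 := ih (fun k => M k.succ) (fun k => s k.succ) (fun k => hM k.succ) x
      (right_ne_zero_of_mul hx)
    rw [Fin.sum_univ_succ, h1, h2]
    ring

theorem hasShift_gammaOp {Δ : Type*} (h : Δ → ℤ) (r : ℂ) (N : ℤ) :
    HasShift h (gammaOp (C r : MvPolynomial Δ ℂ) N) 0 := by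
  rw [gammaOp, rename_C]
  exact hasShift_fieldOp h (isWeightedHomogeneous_C _ r) N

theorem hasShift_currentOp {Δ : Type*} [Fintype Δ] (h : Δ → ℤ) {S : Δ → MvPolynomial Δ ℂ} {k : ℤ}
    (hS : ∀ b, IsWeightedHomogeneous h (S b) (h b - k)) (N : ℤ) :
    HasShift h (currentOp S N) k := by
  refine hasShift_fieldOp h ?_ N
  refine IsWeightedHomogeneous.sum _ _ _ fun b _ => ?_
  have h1 : IsWeightedHomogeneous (fieldGrade h) (rename Sum.inl (S b)) (k - h b) := by
    rw [(S b).as_sum, map_sum]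
    refine IsWeightedHomogeneous.sum _ _ _ fun d hd => ?_
    rw [rename_monomial]
    refine isWeightedHomogeneous_monomial _ _ _ ?_
    have h2 := hS b (mem_support_iff.1 hd)
    rw [Finsupp.weight_apply, Finsupp.sum_mapDomain_index (by simp) (by intros; simp [add_mul])]
    rw [Finsupp.weight_apply] at h2
    simp only [fieldGrade, Sum.elim_inl, smul_neg]
    rw [Finsupp.sum] at h2 ⊢
    rw [Finset.sum_neg_distrib, h2]
    ring
  have h3 := h1.mul (isWeightedHomogeneous_X ℂ (fieldGrade h) (Sum.inr b))
  have h4 : k - h b + fieldGrade h (Sum.inr b) = k := by simp [fieldGrade]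
  rwa [h4] at h3

/-- Constants preserve the charge, and each current raises it by a positive amount, so a product
with at least one current has no diagonal entries. -/
theorem stateTrace_eq_zero {Δ : Type*} [Fintype Δ] {N : ℕ} (q : ℂ) (c : Δ → ℂ) (h : Δ → ℤ)
    {S : Fin N → Δ → MvPolynomial Δ ℂ} {k : Fin N → ℤ} (hk : ∀ j, 0 < k j)
    (hS : ∀ j b, IsWeightedHomogeneous h (S j b) (h b - k j)) {J : Finset (Fin N)}
    (hJ : J.Nonempty) {Q : Fin N → MvPolynomial Δ ℂ} (hQ : ∀ i ∉ J, ∃ r, Q i = C r)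
    (n : Fin N → ℤ) : stateTrace q c S J Q n = 0 := by
  rw [stateTrace, kernTrace, ENNReal.tsum_eq_zero]
  intro d
  rw [mul_eq_zero]
  right
  by_contra hd
  have h1 := ofFn_prod_shift (fun d => Finsupp.weight (oscGrade h) d) _
    (fun j => if j ∈ J then k j else 0) (fun j d e hde => ?_) d d hd
  · have h2 : 0 < ∑ j, if j ∈ J then k j else 0 := by
      rw [Finset.sum_ite_mem, Finset.univ_inter]
      exact Finset.sum_pos (fun j _ => hk j) hJ
    omega
  · refine HasShift.opKern_ne_zero ?_ hde
    unfold stateOp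
    split_ifs with hj
    · exact hasShift_currentOp h (hS j) _
    · obtain ⟨r, hr⟩ := hQ j hj
      rw [hr]
      exact hasShift_gammaOp h r _

theorem stateBound_eq_zero {Δ : Type*} [Fintype Δ] {N : ℕ} (q : ℂ) (c : Δ → ℂ) (u : Fin N → ℂ)
    (h : Δ → ℤ) {S : Fin N → Δ → MvPolynomial Δ ℂ} {k : Fin N → ℤ} (hk : ∀ j, 0 < k j)
    (hS : ∀ j b, IsWeightedHomogeneous h (S j b) (h b - k j)) {J : Finset (Fin N)}
    (hJ : J.Nonempty) {Q : Fin N → MvPolynomial Δ ℂ} (hQ : ∀ i ∉ J, ∃ r, Q i = C r) :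
    stateBound q c u S J Q = 0 := by
  rw [stateBound, ENNReal.tsum_eq_zero]
  intro n
  have := stateTrace_eq_zero q c h hk hS hJ hQ n
  rw [stateTrace] at this
  rw [this, mul_zero]

theorem stateCorr_eq_zero {Δ : Type*} [Fintype Δ] {N : ℕ} {q : ℂ} {c : Δ → ℂ} {u : Fin N → ℂ}
    {S : Fin N → Δ → MvPolynomial Δ ℂ} (hS : NoSelfContraction S) {J : Finset (Fin N)}
    {Q : Fin N → MvPolynomial Δ ℂ} (h0 : stateBound q c u S J Q = 0) :
    stateCorr q c u S J Q = 0 := by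
  have h1 := tsum_enorm_ghostTraceTerm_le hS q c u J Q
  rw [h0, nonpos_iff_eq_zero, ENNReal.tsum_eq_zero] at h1
  rw [stateCorr, ghostCorr]
  exact (tsum_congr fun p => enorm_eq_zero.1 (h1 p)).trans tsum_zero

/-! ### The partition function -/

/-- The product of geometric series is expanded one oscillator at a time: `d` is determined by `d o`
and `d.erase o`, and the weight is multiplicative. -/
theorem tsum_absWeight_support_le {Δ : Type*} [DecidableEq (GhostOsc Δ)] (q : ℂ) (c : Δ → ℂ) (T : Finset (GhostOsc Δ)) :
    ∑' d : GhostOsc Δ →₀ ℕ, (if d.support ⊆ T then absWeight q c d else 0) ≤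
      ∏ o ∈ T, (1 - ‖oscWeight q c o‖ₑ)⁻¹ := by
  induction T using Finset.induction_on with
  | empty =>
    rw [tsum_eq_single 0]
    · simp [absWeight, ghostWeight_zero]
    · intro d hd
      simp [hd]
  | insert o T ho ih =>
    have hinj : Function.Injective fun d : GhostOsc Δ →₀ ℕ => (d o, d.erase o) := by
      intro d e hde
      simp only [Prod.mk.injEq] at hde
      rw [← Finsupp.single_add_erase o d, ← Finsupp.single_add_erase o e, hde.1, hde.2]
    rw [Finset.prod_insert ho, ← ENNReal.tsum_geometric]
    refine le_trans ?_ (mul_le_mul_right ih _)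
    rw [← ENNReal.tsum_mul_right]
    simp only [← ENNReal.tsum_mul_left]
    rw [← ENNReal.tsum_prod]
    refine le_trans (ENNReal.tsum_le_tsum fun d => ?_)
      (ENNReal.tsum_comp_le_tsum_of_injective hinj _)
    have hw : ∀ n : ℕ, ∀ e, absWeight q c (Finsupp.single o n + e) =
        ‖oscWeight q c o‖ₑ ^ n * absWeight q c e := by
      intro n e
      induction n with
      | zero => simp
      | succ n ihn =>
        rw [add_comm n 1, Finsupp.single_add, add_assoc, add_comm, absWeight_add_single, ihn]
        ring
    have hd : absWeight q c d = ‖oscWeight q c o‖ₑ ^ d o * absWeight q c (d.erase o) := by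
      rw [← hw, Finsupp.single_add_erase]
    by_cases h : d.support ⊆ insert o T
    · have h2 : (d.erase o).support ⊆ T := by
        rw [Finsupp.support_erase]
        intro x hx
        rw [Finset.mem_erase] at hx
        exact (Finset.mem_insert.1 (h hx.2)).resolve_left hx.1
      simp only [h, h2, if_true]
      exact hd.le
    · simp [h]

/-- The partition function is dominated by the product of `(1 - w_o)⁻¹` over all oscillators `o`.
With `w_o ≤ r f(o)`, where `r < 1` and `f ≤ 1` is summable, each factor is at most `exp (r f(o) / (1
- r))`, so the product converges. -/
theorem tsum_absWeight_ne_top {Δ : Type*} [Fintype Δ] {q : ℂ} (hq1 : ‖q‖ < 1) {c : Δ → ℂ}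
    (h1 : ∀ a, ‖Complex.exp (-c a)‖ < 1) (h2 : ∀ a, ‖q‖ < ‖Complex.exp (-c a)‖) :
    ∑' d, absWeight q c d ≠ ⊤ := by
  classical
  obtain ⟨r, hr0, hr1, hr⟩ : ∃ r : ℝ, 0 ≤ r ∧ r < 1 ∧
      ∀ a, max ‖Complex.exp (-c a)‖ (‖q‖ * ‖Complex.exp (c a)‖) ≤ r := by
    rcases isEmpty_or_nonempty Δ with hΔ | hΔ
    · exact ⟨0, le_rfl, one_pos, fun a => isEmptyElim a⟩
    · obtain ⟨a, ha⟩ := Finite.exists_max fun a => max ‖Complex.exp (-c a)‖ (‖q‖ * ‖Complex.exp (c a)‖)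
      exact ⟨_, le_max_of_le_left (norm_nonneg _), max_exp_lt_one (h1 a) (h2 a), ha⟩
  let f : GhostOsc Δ → ℝ := Sum.elim (fun p => ‖q‖ ^ p.2) (fun p => ‖q‖ ^ p.2)
  have hf0 : ∀ o, 0 ≤ f o := by
    rintro (p | p) <;> exact pow_nonneg (norm_nonneg q) _
  have hf1 : ∀ o, f o ≤ 1 := by
    rintro (p | p) <;> exact pow_le_one₀ (norm_nonneg q) hq1.le
  have hfs : Summable f := by
    have : Summable fun p : Δ × ℕ => ‖q‖ ^ p.2 := by
      have h3 := (hasSum_fintype (fun _ : Δ => (1 : ℝ))).summable.mul_of_nonneg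
        (summable_geometric_of_lt_one (norm_nonneg q) hq1) (fun _ => zero_le_one)
        (fun n => pow_nonneg (norm_nonneg q) n)
      simpa using h3
    exact Summable.sum f this this
  have hosc : ∀ o, ‖oscWeight q c o‖ ≤ r * f o := by
    rintro (⟨a, n⟩ | ⟨a, n⟩)
    · simp only [oscWeight, norm_mul, norm_pow, f, Sum.elim_inl]
      rw [mul_comm]
      exact mul_le_mul_of_nonneg_right ((le_max_left _ _).trans (hr a)) (by positivity)
    · simp only [oscWeight, norm_mul, norm_pow, f, Sum.elim_inr]
      rw [pow_succ, mul_assoc, mul_comm]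
      exact mul_le_mul_of_nonneg_right ((le_max_right _ _).trans (hr a)) (by positivity)
  have hfac : ∀ o, (1 - ‖oscWeight q c o‖ₑ)⁻¹ ≤ ENNReal.ofReal (Real.exp (r / (1 - r) * f o)) := by
    intro o
    have h3 : r * f o ≤ r := mul_le_of_le_one_right hr0 (hf1 o)
    have h4 : ‖oscWeight q c o‖ < 1 := ((hosc o).trans h3).trans_lt hr1
    rw [← ofReal_norm, ← ENNReal.ofReal_one, ← ENNReal.ofReal_sub _ (norm_nonneg _),
      ← ENNReal.ofReal_inv_of_pos (sub_pos.2 h4)]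
    refine ENNReal.ofReal_le_ofReal (le_trans ?_ (Real.add_one_le_exp _))
    rw [inv_le_iff_one_le_mul₀ (sub_pos.2 h4)]
    have h5 : 0 < 1 - r := sub_pos.2 hr1
    have h6 : (1 - r * f o) * (r / (1 - r) * f o + 1) ≤
        (1 - ‖oscWeight q c o‖) * (r / (1 - r) * f o + 1) := by
      refine mul_le_mul_of_nonneg_right (by linarith [hosc o]) ?_
      have := hf0 o
      positivity
    rw [mul_comm]
    refine le_trans ?_ h6
    have h7 : (1 - r * f o) * (r / (1 - r) * f o + 1) - 1 =
        r * f o * (r * (1 - f o)) / (1 - r) := by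
      field_simp
      ring
    have h8 : 0 ≤ r * f o * (r * (1 - f o)) / (1 - r) := by
      have := hf0 o
      have := hf1 o
      have : 0 ≤ 1 - f o := by linarith
      positivity
    linarith
  refine ne_top_of_le_ne_top (b := ENNReal.ofReal (Real.exp (r / (1 - r) * ∑' o, f o)))
    ENNReal.ofReal_ne_top ?_
  rw [ENNReal.tsum_eq_iSup_sum]
  refine iSup_le fun D => ?_
  let T : Finset (GhostOsc Δ) := D.biUnion Finsupp.support
  calc ∑ d ∈ D, absWeight q c d
      = ∑ d ∈ D, (if d.support ⊆ T then absWeight q c d else 0) :=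
        Finset.sum_congr rfl fun d hd => by
          rw [if_pos (Finset.subset_biUnion_of_mem Finsupp.support hd)]
    _ ≤ _ := ENNReal.sum_le_tsum D
    _ ≤ _ := tsum_absWeight_support_le q c T
    _ ≤ ∏ o ∈ T, ENNReal.ofReal (Real.exp (r / (1 - r) * f o)) :=
        Finset.prod_le_prod' fun o _ => hfac o
    _ = ENNReal.ofReal (Real.exp (r / (1 - r) * ∑ o ∈ T, f o)) := by
        rw [← ENNReal.ofReal_prod_of_nonneg (fun o _ => (Real.exp_pos _).le), ← Real.exp_sum,
          Finset.mul_sum]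
    _ ≤ _ := by
        have h5 : 0 < 1 - r := sub_pos.2 hr1
        refine ENNReal.ofReal_le_ofReal (Real.exp_le_exp.2
          (mul_le_mul_of_nonneg_left (hfs.sum_le_tsum T fun o _ => hf0 o) (by positivity)))


/-! ### Determination of the correlators by contractions -/

section

variable {Δ : Type*} [Fintype Δ] {N : ℕ}

theorem stateOp_update {S : Fin N → Δ → MvPolynomial Δ ℂ} {J : Finset (Fin N)}
    (Q : Fin N → MvPolynomial Δ ℂ) (n : Fin N → ℤ) {i : Fin N} (hi : i ∉ J)
    (p : MvPolynomial Δ ℂ) :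
    stateOp S J (Function.update Q i p) n =
      Function.update (stateOp S J Q n) i (gammaOp p (n i)) := by
  rw [update_stateOp, Finset.erase_eq_of_notMem hi, Function.update_eq_self]

theorem stateBound_update_add_le (q : ℂ) (c : Δ → ℂ) (u : Fin N → ℂ)
    (S : Fin N → Δ → MvPolynomial Δ ℂ) {J : Finset (Fin N)}
    (Q : Fin N → MvPolynomial Δ ℂ) {i : Fin N} (hi : i ∉ J) (p p' : MvPolynomial Δ ℂ) :
    stateBound q c u S J (Function.update Q i (p + p')) ≤
      stateBound q c u S J (Function.update Q i p) +
        stateBound q c u S J (Function.update Q i p') := by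
  unfold stateBound
  rw [← ENNReal.tsum_add]
  refine ENNReal.tsum_le_tsum fun n => ?_
  rw [← mul_add]
  refine mul_le_mul_right ?_ _
  rw [← kernTrace_add]
  refine kernTrace_mono _ ?_
  rw [stateOp_update Q n hi, stateOp_update Q n hi, stateOp_update Q n hi, opKern_comp_update,
    opKern_comp_update, opKern_comp_update, prod_ofFn_update, prod_ofFn_update, prod_ofFn_update,
    ← add_mul, ← mul_add, gammaOp_add]
  exact Kern.mul_le_mul (Kern.mul_le_mul le_rfl (opKern_add_le _ _)) le_rfl

theorem opTrace_add {Δ : Type*} {q : ℂ} {c : Δ → ℂ} {A B : Module.End ℂ (GhostFock Δ)}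
    (hA : Summable fun d => ghostWeight q c d * coeff d (A (monomial d 1)))
    (hB : Summable fun d => ghostWeight q c d * coeff d (B (monomial d 1))) :
    opTrace q c (A + B) = opTrace q c A + opTrace q c B := by
  unfold opTrace
  rw [← hA.tsum_add hB]
  refine tsum_congr fun d => ?_
  rw [LinearMap.add_apply, coeff_add, mul_add]

theorem summable_opTrace_stateOp {q : ℂ} {c : Δ → ℂ} {u : Fin N → ℂ} (hu : ∀ k, u k ≠ 0)
    {S : Fin N → Δ → MvPolynomial Δ ℂ} {J : Finset (Fin N)} {Q : Fin N → MvPolynomial Δ ℂ}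
    (h : stateBound q c u S J Q ≠ ⊤) (n : Fin N → ℤ) :
    Summable fun d => ghostWeight q c d *
      coeff d ((List.ofFn (stateOp S J Q n)).prod (monomial d 1)) :=
  summable_opTrace (opKern_ofFn_prod_le _) (stateTrace_ne_top hu h n)

theorem stateCorr_update_add {q : ℂ} {c : Δ → ℂ} {u : Fin N → ℂ} (hu : ∀ k, u k ≠ 0)
    {S : Fin N → Δ → MvPolynomial Δ ℂ} (hS : NoSelfContraction S) {J : Finset (Fin N)}
    (Q : Fin N → MvPolynomial Δ ℂ) {i : Fin N} (hi : i ∉ J) (p p' : MvPolynomial Δ ℂ)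
    (h : stateBound q c u S J (Function.update Q i p) ≠ ⊤)
    (h' : stateBound q c u S J (Function.update Q i p') ≠ ⊤) :
    stateCorr q c u S J (Function.update Q i (p + p')) =
      stateCorr q c u S J (Function.update Q i p) +
        stateCorr q c u S J (Function.update Q i p') := by
  have h3 := ne_top_of_le_ne_top (ENNReal.add_ne_top.2 ⟨h, h'⟩)
    (stateBound_update_add_le q c u S Q hi p p')
  refine (hasSum_stateCorr hS h3).unique ?_
  refine Eq.mp (congrArg (fun f => HasSum f _) (funext fun n => ?_))
    ((hasSum_stateCorr hS h).add (hasSum_stateCorr hS h'))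
  rw [← mul_add, ← opTrace_add (summable_opTrace_stateOp hu h n) (summable_opTrace_stateOp hu h' n),
    stateOp_update Q n hi, stateOp_update Q n hi, stateOp_update Q n hi, prod_ofFn_update,
    prod_ofFn_update, prod_ofFn_update, ← add_mul, ← mul_add, gammaOp_add]

theorem stateOp_const {S : Fin N → Δ → MvPolynomial Δ ℂ} {Q : Fin N → MvPolynomial Δ ℂ}
    {r : Fin N → ℂ} (hQ : ∀ i, Q i = C (r i)) (n : Fin N → ℤ) (k : Fin N) :
    stateOp S ∅ Q n k = if n k = 0 then r k • 1 else 0 := by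
  rw [stateOp, if_neg (Finset.notMem_empty k), hQ, gammaOp_C]

theorem Kern.ofFn_prod_eq_zero {I : Type*} {n : ℕ} (x : Fin n → Kern I) (k : Fin n)
    (hk : x k = 0) : (List.ofFn x).prod = 0 := by
  have : x = Function.update x k 0 := by rw [← hk, Function.update_eq_self]
  rw [this, Kern.ofFn_prod_update_zero]

/-- Matrices dominated by multiples of the identity; this covers the zero modes of constant
polynomials and reduces their traces to the partition function. -/
theorem Kern.ofFn_prod_le_one {I : Type*} {n : ℕ} (x : Fin n → Kern I)
    (hx : ∀ k, ∃ B : ENNReal, B ≠ ⊤ ∧ ∀ d e, x k d e ≤ B * (1 : Kern I) d e) :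
    ∃ B : ENNReal, B ≠ ⊤ ∧ ∀ d e, (List.ofFn x).prod d e ≤ B * (1 : Kern I) d e := by
  induction n with
  | zero => exact ⟨1, by simp, fun d e => by simp⟩
  | succ n ih =>
    obtain ⟨B, hB, h⟩ := hx 0
    obtain ⟨B', hB', h'⟩ := ih (fun k => x k.succ) fun k => hx k.succ
    refine ⟨B * B', ENNReal.mul_ne_top hB hB', fun d e => ?_⟩
    rw [List.ofFn_succ, List.prod_cons]
    calc _ ≤ ∑' y, (B * (1 : Kern I) d y) * (B' * (1 : Kern I) y e) :=
          ENNReal.tsum_le_tsum fun y => mul_le_mul' (h d y) (h' y e)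
      _ = B * B' * ((1 : Kern I) * 1) d e := by
          rw [Kern.mul_apply, ← ENNReal.tsum_mul_left]
          exact tsum_congr fun y => by ring
      _ = _ := by rw [one_mul]

theorem stateTrace_const_of_ne {q : ℂ} {c : Δ → ℂ} {S : Fin N → Δ → MvPolynomial Δ ℂ}
    {Q : Fin N → MvPolynomial Δ ℂ} {r : Fin N → ℂ} (hQ : ∀ i, Q i = C (r i)) {n : Fin N → ℤ}
    (hn : n ≠ 0) : stateTrace q c S ∅ Q n = 0 := by
  obtain ⟨k, hk⟩ := Function.ne_iff.1 hn
  rw [stateTrace, Kern.ofFn_prod_eq_zero _ k]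
  · simp [kernTrace, Kern.zero_apply]
  · rw [stateOp_const hQ, if_neg (show ¬ n k = 0 from hk), opKern_zero]

theorem stateBound_const_ne_top {q : ℂ} {c : Δ → ℂ} (hχ : ∑' d, absWeight q c d ≠ ⊤)
    (u : Fin N → ℂ) (S : Fin N → Δ → MvPolynomial Δ ℂ)
    {Q : Fin N → MvPolynomial Δ ℂ} {r : Fin N → ℂ} (hQ : ∀ i, Q i = C (r i)) :
    stateBound q c u S ∅ Q ≠ ⊤ := by
  have h0 : stateBound q c u S ∅ Q = ‖modeFactor u 0‖ₑ * stateTrace q c S ∅ Q 0 :=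
    tsum_eq_single 0 fun n hn => by
      have := stateTrace_const_of_ne (q := q) (c := c) (S := S) hQ hn
      rw [stateTrace] at this
      rw [this, mul_zero]
  rw [h0]
  refine ENNReal.mul_ne_top enorm_ne_top ?_
  obtain ⟨B, hB, h⟩ := Kern.ofFn_prod_le_one (fun k => opKern (stateOp S ∅ Q 0 k)) fun k =>
    ⟨‖r k‖ₑ, enorm_ne_top, fun d e => by
      rw [stateOp_const hQ]
      simp [opKern_smul_apply, opKern_one]⟩
  refine ne_top_of_le_ne_top (ENNReal.mul_ne_top hB hχ) ?_
  rw [stateTrace, kernTrace, ← ENNReal.tsum_mul_left]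
  refine ENNReal.tsum_le_tsum fun d => ?_
  rw [mul_comm]
  refine mul_le_mul_left ((h d d).trans ?_) _
  simp [Kern.one_apply]

theorem stateCorr_const {q : ℂ} {c : Δ → ℂ} (hχ : ∑' d, absWeight q c d ≠ ⊤)
    (u : Fin N → ℂ) {S : Fin N → Δ → MvPolynomial Δ ℂ} (hS : NoSelfContraction S)
    {Q : Fin N → MvPolynomial Δ ℂ} {r : Fin N → ℂ} (hQ : ∀ i, Q i = C (r i)) :
    stateCorr q c u S ∅ Q = (∑' d, ghostWeight q c d) * ∏ i, r i := by
  classical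
  have h1 := hasSum_stateCorr hS (stateBound_const_ne_top hχ u S hQ)
  have h2 : ∀ n : Fin N → ℤ, n ≠ 0 →
      modeFactor u n * opTrace q c (List.ofFn (stateOp S ∅ Q n)).prod = 0 := by
    intro n hn
    obtain ⟨k, hk⟩ := Function.ne_iff.1 hn
    have h3 : stateOp S ∅ Q n = Function.update (stateOp S ∅ Q n) k 0 := by
      rw [eq_comm, Function.update_eq_self_iff, stateOp_const hQ, if_neg (show ¬ n k = 0 from hk)]
    rw [h3, prod_ofFn_update]
    simp [opTrace]
  rw [h1.unique (hasSum_single 0 h2)]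
  have h4 : (stateOp S ∅ Q 0) = fun k => algebraMap ℂ (Module.End ℂ (GhostFock Δ)) (r k) := by
    funext k
    rw [stateOp_const hQ, if_pos (Pi.zero_apply k), Algebra.algebraMap_eq_smul_one]
  have h5 : (List.ofFn (stateOp S ∅ Q 0)).prod = (∏ i, r i) • 1 := by
    rw [h4, ← Algebra.algebraMap_eq_smul_one, ← List.prod_ofFn, map_list_prod, List.map_ofFn]
    rfl
  rw [h5]
  simp [opTrace, modeFactor, coeff_monomial, tsum_mul_right]

/-- The rules that determine the correlators divided by the partition function: `V J Q` is the value
for currents at the points of `J` and the polynomials `Q` in `γ` at the other points. -/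
structure ContractionRules (q : ℂ) (c : Δ → ℂ) (u : Fin N → ℂ) (S : Fin N → Δ → MvPolynomial Δ ℂ)
    (J₀ : Finset (Fin N))
    (V : Finset (Fin N) → (Fin N → MvPolynomial Δ ℂ) → ℂ) : Prop where
  const : ∀ (Q : Fin N → MvPolynomial Δ ℂ) (r : Fin N → ℂ), (∀ i, Q i = C (r i)) → V ∅ Q = ∏ i, r i
  const_zero : ∀ (J : Finset (Fin N)) (Q : Fin N → MvPolynomial Δ ℂ), J.Nonempty → (∀ i ∉ J, ∃ r : ℂ, Q i = C r) → V J Q = 0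
  add : ∀ J Q i p p', i ∉ J → V J (Function.update Q i (p + p')) =
    V J (Function.update Q i p) + V J (Function.update Q i p')
  -- The restriction to `J₀` is there because forest sums satisfy this rule through the Fay
  -- identity, which needs regular kernel parameters; these are available for the points of `J₀`
  -- only.
  ward : ∀ J Q i a d r, J ⊆ J₀ → i ∉ J → Q i = monomial (Finsupp.single a 1 + d) r → V J Q =
    ∑ j ∈ J, (u j)⁻¹ * ellKern q (Complex.exp (-c a)) (u i / u j) *
      V (J.erase j) (contractedPoly S Q a i j (monomial d r))

/-- Strong induction on the number of currents: a contraction consumes one current, and the degree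
of the polynomial replacing it is immaterial. Finiteness of the bound is carried along with the
value because the contraction formula presupposes it for the smaller states. -/
theorem stateCorr_eq {q : ℂ} (hq : q ≠ 0) (hq1 : ‖q‖ < 1) {c : Δ → ℂ}
    (h1 : ∀ a, ‖Complex.exp (-c a)‖ < 1) (h2 : ∀ a, ‖q‖ < ‖Complex.exp (-c a)‖)
    {u : Fin N → ℂ} (hu : ∀ k, u k ≠ 0)
    (hgeo : ∀ i j, i < j → ‖q‖ * ‖u i‖ < ‖u j‖ ∧ ‖u j‖ < ‖u i‖)
    {S : Fin N → Δ → MvPolynomial Δ ℂ} (hS : NoSelfContraction S)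
    {h : Δ → ℤ} {k : Fin N → ℤ} (hk : ∀ j, 0 < k j)
    (hSh : ∀ j b, IsWeightedHomogeneous h (S j b) (h b - k j))
    {V : Finset (Fin N) → (Fin N → MvPolynomial Δ ℂ) → ℂ} {J₀ : Finset (Fin N)} (hV : ContractionRules q c u S J₀ V)
    {J : Finset (Fin N)} (hJ₀ : J ⊆ J₀) (Q : Fin N → MvPolynomial Δ ℂ) :
    stateBound q c u S J Q ≠ ⊤ ∧ stateCorr q c u S J Q = (∑' d, ghostWeight q c d) * V J Q := by
  induction hn : J.card using Nat.strong_induction_on generalizing J Q with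
  | _ n ih =>
  -- the case of monomials
  have hmono : ∀ Q : Fin N → MvPolynomial Δ ℂ, (∀ i ∉ J, ∃ d r, Q i = monomial d r) →
      stateBound q c u S J Q ≠ ⊤ ∧ stateCorr q c u S J Q = (∑' d, ghostWeight q c d) * V J Q := by
    intro Q hQ
    by_cases hc : ∀ i ∉ J, ∃ r, Q i = C r
    · rcases J.eq_empty_or_nonempty with rfl | hJ
      · choose r hr using fun i => hc i (Finset.notMem_empty i)
        have hχ := tsum_absWeight_ne_top hq1 h1 h2
        exact ⟨stateBound_const_ne_top hχ u S hr, by rw [stateCorr_const hχ u hS hr, hV.const Q r hr]⟩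
      · have h0 := stateBound_eq_zero q c u h hk hSh hJ hc
        exact ⟨by simp [h0], by rw [stateCorr_eq_zero hS h0, hV.const_zero J Q hJ hc, mul_zero]⟩
    · push Not at hc
      obtain ⟨i, hi, hne⟩ := hc
      obtain ⟨d, r, hd⟩ := hQ i hi
      have hd0 : d ≠ 0 := by
        rintro rfl
        exact hne r hd
      obtain ⟨a, ha⟩ := Finsupp.ne_iff.1 hd0
      have hsplit : Finsupp.single a 1 + (d - Finsupp.single a 1) = d := by
        rw [add_tsub_cancel_of_le]
        rw [Finsupp.single_le_iff]
        exact Nat.one_le_iff_ne_zero.2 ha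
      rw [← hsplit] at hd
      have hlt : ∀ j ∈ J, (J.erase j).card < n := fun j hj => hn ▸ Finset.card_erase_lt_of_mem hj
      have hT : ∀ j ∈ J, contractTotal q c a (i ≤ j) (u i) (u j) ≠ ⊤ := by
        intro j hj
        have hji : i ≠ j := fun h => hi (h ▸ hj)
        exact contractTotal_ne_top hq hq1 (h1 a) (h2 a) _
          (fun h => hgeo i j (lt_of_le_of_ne h hji)) fun h => hgeo j i (not_le.1 h)
      have hB := fun j (hj : j ∈ J) => (ih _ (hlt j hj)
        ((Finset.erase_subset j J).trans hJ₀) (contractedPoly S Q a i j (monomial (d - Finsupp.single a 1) r)) rfl)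
      refine ⟨ne_top_of_le_ne_top (ENNReal.sum_ne_top.2 fun j hj =>
        ENNReal.mul_ne_top (hT j hj) (hB j hj).1)
        (stateBound_le_of_monomial hq hq1 (h1 a) (h2 a) hu hS hi hd), ?_⟩
      rw [stateCorr_eq_of_monomial hq hq1 (h1 a) (h2 a) hu hS hi hd hT fun j hj => (hB j hj).1,
        hV.ward J Q i a _ r hJ₀ hi hd, Finset.mul_sum]
      refine Finset.sum_congr rfl fun j hj => ?_
      have hji : i ≠ j := fun h => hi (h ▸ hj)
      rw [(hB j hj).2, tsum_contractCoeff hq hq1 (h1 a) (h2 a) _ (hu i) (hu j)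
        (fun h => (hgeo i j (lt_of_le_of_ne h hji)).2) fun h => (hgeo j i (not_le.1 h)).2]
      ring
  -- reduction to monomials
  have hred : ∀ s : Finset (Fin N), ∀ Q : Fin N → MvPolynomial Δ ℂ,
      (∀ i ∉ J, i ∉ s → ∃ d r, Q i = monomial d r) →
      stateBound q c u S J Q ≠ ⊤ ∧ stateCorr q c u S J Q = (∑' d, ghostWeight q c d) * V J Q := by
    intro s
    induction s using Finset.induction_on with
    | empty => exact fun Q hQ => hmono Q fun i hi => hQ i hi (Finset.notMem_empty i)
    | insert i s _ ihs =>
      intro Q hQ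
      by_cases hi : i ∈ J
      · refine ihs Q fun j hj hjs => hQ j hj ?_
        rw [Finset.mem_insert, not_or]
        exact ⟨fun h => hj (h ▸ hi), hjs⟩
      · have hmon : ∀ d r, stateBound q c u S J (Function.update Q i (monomial d r)) ≠ ⊤ ∧
            stateCorr q c u S J (Function.update Q i (monomial d r)) =
              (∑' d, ghostWeight q c d) * V J (Function.update Q i (monomial d r)) := by
          intro d r
          refine ihs _ fun j hj hjs => ?_
          rcases eq_or_ne j i with rfl | hne
          · exact ⟨d, r, Function.update_self _ _ _⟩
          · rw [Function.update_of_ne hne]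
            refine hQ j hj ?_
            rw [Finset.mem_insert, not_or]
            exact ⟨hne, hjs⟩
        have hall : ∀ p, stateBound q c u S J (Function.update Q i p) ≠ ⊤ ∧
            stateCorr q c u S J (Function.update Q i p) =
              (∑' d, ghostWeight q c d) * V J (Function.update Q i p) := by
          intro p
          induction p using MvPolynomial.induction_on' with
          | monomial d r => exact hmon d r
          | add p p' hp hp' =>
            refine ⟨ne_top_of_le_ne_top (ENNReal.add_ne_top.2 ⟨hp.1, hp'.1⟩)
              (stateBound_update_add_le q c u S Q hi p p'), ?_⟩
            rw [stateCorr_update_add hu hS Q hi p p' hp.1 hp'.1, hp.2, hp'.2, hV.add J Q i p p' hi,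
              mul_add]
        have := hall (Q i)
        rwa [Function.update_eq_self] at this
  exact hred Finset.univ Q fun i _ hi => absurd (Finset.mem_univ i) hi

end


/-! ### Sums over chains -/

/-- A subset with a marked element is the same as an element together with a subset of the others.
-/
theorem sum_powerset_erase {ι : Type*} [DecidableEq ι] (M : Finset ι) (f : ι → Finset ι → ℂ) :
    ∑ A ∈ M.powerset, ∑ j ∈ A, f j (A.erase j) =
      ∑ j ∈ M, ∑ A ∈ (M.erase j).powerset, f j A := by
  rw [Finset.sum_sigma', Finset.sum_sigma']
  refine Finset.sum_bij' (fun p _ => ⟨p.2, p.1.erase p.2⟩) (fun p _ => ⟨insert p.1 p.2, p.1⟩)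
    ?_ ?_ ?_ ?_ ?_
  · rintro ⟨A, j⟩ h
    simp only [Finset.mem_sigma, Finset.mem_powerset] at h ⊢
    exact ⟨h.1 h.2, Finset.erase_subset_erase _ h.1⟩
  · rintro ⟨j, A⟩ h
    simp only [Finset.mem_sigma, Finset.mem_powerset] at h ⊢
    exact ⟨Finset.insert_subset h.1 (h.2.trans (Finset.erase_subset _ _)),
      Finset.mem_insert_self _ _⟩
  · rintro ⟨A, j⟩ h
    simp only [Finset.mem_sigma] at h
    simp [Finset.insert_erase h.2]
  · rintro ⟨j, A⟩ h
    simp only [Finset.mem_sigma, Finset.mem_powerset] at h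
    have : j ∉ A := fun hj => Finset.notMem_erase j M (h.2 hj)
    simp [Finset.erase_insert this]
  · rintro ⟨A, j⟩ _
    rfl

theorem sum_powerset_sdiff {ι : Type*} [DecidableEq ι] (M : Finset ι) (f : Finset ι → ℂ) :
    ∑ A ∈ M.powerset, f (M \ A) = ∑ A ∈ M.powerset, f A := by
  refine Finset.sum_bij' (fun A _ => M \ A) (fun A _ => M \ A) ?_ ?_ ?_ ?_ ?_
  · intro A _
    simp
  · intro A _
    simp
  · intro A hA
    exact Finset.sdiff_sdiff_eq_self (Finset.mem_powerset.1 hA)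
  · intro A hA
    exact Finset.sdiff_sdiff_eq_self (Finset.mem_powerset.1 hA)
  · intro A _
    rfl

theorem sdiff_eq_erase_sdiff_erase {ι : Type*} [DecidableEq ι] {M A : Finset ι} {j : ι}
    (hj : j ∈ A) : M \ A = M.erase j \ A.erase j := by
  ext x
  simp only [Finset.mem_sdiff, Finset.mem_erase]
  constructor
  · rintro ⟨h1, h2⟩
    exact ⟨⟨fun h => h2 (h ▸ hj), h1⟩, fun h => h2 h.2⟩
  · rintro ⟨⟨h1, h2⟩, h3⟩
    exact ⟨h2, fun h => h3 ⟨h1, h⟩⟩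

section

variable {Δ ι : Type*} [DecidableEq ι]

/-- The sum over all orderings of the points in `M` of the products of the functions `G` along the
chain that ends in `i`, times the value at `0` of the iterated derivatives of a polynomial. -/
noncomputable def chainSumAux (G : ℂ → ι → ι → ℂ) (κ : ι → ℂ) (S : ι → Δ → MvPolynomial Δ ℂ) :
    ℕ → Finset ι → ι → MvPolynomial Δ ℂ → ℂ
  | 0, _, _, P => coeff 0 P
  | n + 1, M, i, P => ∑ j ∈ M, G (∑ k ∈ M, κ k) j i *
      chainSumAux G κ S n (M.erase j) j (mkDerivation ℂ (S j) P)

/-- The sum over all orderings of the points in `M`. -/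
noncomputable def chainSum (G : ℂ → ι → ι → ℂ) (κ : ι → ℂ) (S : ι → Δ → MvPolynomial Δ ℂ)
    (M : Finset ι) (i : ι) (P : MvPolynomial Δ ℂ) : ℂ :=
  chainSumAux G κ S M.card M i P

variable (G : ℂ → ι → ι → ℂ) (κ : ι → ℂ) (S : ι → Δ → MvPolynomial Δ ℂ)

theorem chainSum_empty (i : ι) (P : MvPolynomial Δ ℂ) : chainSum G κ S ∅ i P = coeff 0 P := rfl

theorem chainSum_of_nonempty {M : Finset ι} (hM : M.Nonempty) (i : ι) (P : MvPolynomial Δ ℂ) :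
    chainSum G κ S M i P = ∑ j ∈ M, G (∑ k ∈ M, κ k) j i *
      chainSum G κ S (M.erase j) j (mkDerivation ℂ (S j) P) := by
  obtain ⟨n, hn⟩ := Nat.exists_eq_succ_of_ne_zero (Finset.card_ne_zero.2 hM)
  rw [chainSum, hn, chainSumAux]
  refine Finset.sum_congr rfl fun j hj => ?_
  rw [chainSum, Finset.card_erase_of_mem hj, hn]
  rfl

theorem chainSum_add (M : Finset ι) (i : ι) (P P' : MvPolynomial Δ ℂ) :
    chainSum G κ S M i (P + P') = chainSum G κ S M i P + chainSum G κ S M i P' := by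
  induction M using Finset.strongInduction generalizing i P P' with
  | H M ih =>
  rcases M.eq_empty_or_nonempty with rfl | hM
  · simp [chainSum_empty]
  · simp only [chainSum_of_nonempty G κ S hM, ← Finset.sum_add_distrib]
    refine Finset.sum_congr rfl fun j hj => ?_
    rw [map_add, ih _ (Finset.erase_ssubset hj), mul_add]

theorem chainSum_C {M : Finset ι} (hM : M.Nonempty) (i : ι) (r : ℂ) :
    chainSum G κ S M i (C r) = 0 := by
  have h0 : ∀ (M : Finset ι) (i : ι), chainSum G κ S M i 0 = 0 := by
    intro M i
    have := chainSum_add G κ S M i 0 0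
    simpa using this
  rw [chainSum_of_nonempty G κ S hM]
  refine Finset.sum_eq_zero fun j _ => ?_
  rw [derivation_C, h0, mul_zero]

theorem mkDerivation_eq_sum [Fintype Δ] (v : Δ → MvPolynomial Δ ℂ) (P : MvPolynomial Δ ℂ) :
    mkDerivation ℂ v P = ∑ b, v b * pderiv b P := by
  classical
  have hs : ∀ P : MvPolynomial Δ ℂ, (∑ b, v b • (pderiv b : Derivation ℂ (MvPolynomial Δ ℂ)
      (MvPolynomial Δ ℂ))) P = ∑ b, v b * pderiv b P := fun P =>
    (congrArg (fun f : MvPolynomial Δ ℂ → MvPolynomial Δ ℂ => f P)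
      (map_sum (Derivation.coeFnAddMonoidHom : Derivation ℂ (MvPolynomial Δ ℂ) (MvPolynomial Δ ℂ) →+ _)
        _ _)).trans (by rw [Finset.sum_apply]; rfl)
  have h : (mkDerivation ℂ v : Derivation ℂ (MvPolynomial Δ ℂ) (MvPolynomial Δ ℂ)) =
      ∑ b, v b • pderiv b := by
    refine derivation_ext fun i => ?_
    rw [mkDerivation_X, hs, Finset.sum_eq_single i]
    · simp
    · intro b _ hb
      simp [pderiv_X_of_ne hb.symm]
    · simp
  rw [h, hs]

theorem isWeightedHomogeneous_mkDerivation [Fintype Δ] {c : Δ → ℂ} {v : Δ → MvPolynomial Δ ℂ}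
    {k : ℂ} (hv : ∀ b, IsWeightedHomogeneous c (v b) (c b - k)) {P : MvPolynomial Δ ℂ} {w : ℂ}
    (hP : IsWeightedHomogeneous c P w) : IsWeightedHomogeneous c (mkDerivation ℂ v P) (w - k) := by
  rw [mkDerivation_eq_sum]
  refine IsWeightedHomogeneous.sum _ _ _ fun b _ => ?_
  have := (hv b).mul (hP.pderiv (n' := w - c b) (i := b) (by ring))
  rwa [show c b - k + (w - c b) = w - k by ring] at this

/-- Each derivation along the chain lowers the weight by its `κ`, and evaluation at `0` sees weight
`0` only. -/
theorem chainSum_eq_zero [Fintype Δ] {c : Δ → ℂ}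
    (hS : ∀ j b, IsWeightedHomogeneous c (S j b) (c b - κ j)) (M : Finset ι) (i : ι)
    {P : MvPolynomial Δ ℂ} {w : ℂ} (hP : IsWeightedHomogeneous c P w) (hw : w ≠ ∑ k ∈ M, κ k) :
    chainSum G κ S M i P = 0 := by
  induction M using Finset.strongInduction generalizing i P w with
  | H M ih =>
  rcases M.eq_empty_or_nonempty with rfl | hM
  · rw [chainSum_empty]
    exact hP.coeff_eq_zero 0 (by simpa using hw.symm)
  · rw [chainSum_of_nonempty G κ S hM]
    refine Finset.sum_eq_zero fun j hj => ?_
    rw [ih _ (Finset.erase_ssubset hj) j (isWeightedHomogeneous_mkDerivation (hS j) hP), mul_zero]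
    intro h
    refine hw ?_
    rw [← Finset.add_sum_erase M κ hj, ← h]
    ring

/-- The three-term identity for all disjoint sets of points. -/
def FayIdentity (J : Finset ι) : Prop :=
  ∀ A B : Finset ι, A ⊆ J → B ⊆ J → Disjoint A B → A.Nonempty → B.Nonempty →
    ∀ i j k, j ∈ A → k ∈ B → i ∉ A → i ∉ B →
      G (∑ l ∈ A, κ l) j i * G (∑ l ∈ B, κ l) k i =
        G (∑ l ∈ A, κ l) j k * G (∑ l ∈ A, κ l + ∑ l ∈ B, κ l) k i +
          G (∑ l ∈ B, κ l) k j * G (∑ l ∈ A, κ l + ∑ l ∈ B, κ l) j i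

/-- Two chains, through `A` and through `M \ A`, end in `i`. The Fay identity for their last links
detaches one chain from `i` and hangs it on the last point of the other. Then a single link,
carrying the total parameter of `M`, leads to `i`. -/
theorem chainSum_mul_chainSum {J : Finset ι} (hG : FayIdentity G κ J) {M : Finset ι} (hM : M ⊆ J)
    (hne : M.Nonempty) {i : ι} (hi : i ∉ M) (P Q : MvPolynomial Δ ℂ) {A : Finset ι} (hA : A ⊆ M) :
    chainSum G κ S A i P * chainSum G κ S (M \ A) i Q =
      ∑ j ∈ A, G (∑ k ∈ M, κ k) j i * (chainSum G κ S (A.erase j) j (mkDerivation ℂ (S j) P) *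
        chainSum G κ S (M \ A) j Q) +
      ∑ j ∈ M \ A, G (∑ k ∈ M, κ k) j i * (chainSum G κ S A j P *
        chainSum G κ S ((M \ A).erase j) j (mkDerivation ℂ (S j) Q)) := by
  rcases A.eq_empty_or_nonempty with rfl | hA0
  · rw [Finset.sum_empty, zero_add, Finset.sdiff_empty, chainSum_of_nonempty G κ S hne i Q,
      Finset.mul_sum]
    refine Finset.sum_congr rfl fun j _ => ?_
    rw [chainSum_empty, chainSum_empty]
    ring
  rcases (M \ A).eq_empty_or_nonempty with hB | hB0
  · have : A = M := Finset.Subset.antisymm hA (Finset.sdiff_eq_empty_iff_subset.1 hB)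
    subst this
    rw [hB, Finset.sum_empty, add_zero, chainSum_of_nonempty G κ S hne i P, Finset.sum_mul]
    refine Finset.sum_congr rfl fun j _ => ?_
    rw [chainSum_empty, chainSum_empty]
    ring
  have hdisj : Disjoint A (M \ A) := Finset.disjoint_sdiff
  have hsum : ∑ k ∈ M, κ k = ∑ l ∈ A, κ l + ∑ l ∈ M \ A, κ l := by
    rw [add_comm, Finset.sum_sdiff hA]
  rw [chainSum_of_nonempty G κ S hA0 i P, chainSum_of_nonempty G κ S hB0 i Q,
    Finset.sum_mul_sum]
  have e1 : ∀ j ∈ A, G (∑ k ∈ M, κ k) j i *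
      (chainSum G κ S (A.erase j) j (mkDerivation ℂ (S j) P) * chainSum G κ S (M \ A) j Q) =
      ∑ k ∈ M \ A, G (∑ l ∈ M, κ l) j i *
        (chainSum G κ S (A.erase j) j (mkDerivation ℂ (S j) P) *
          (G (∑ l ∈ M \ A, κ l) k j *
            chainSum G κ S ((M \ A).erase k) k (mkDerivation ℂ (S k) Q))) := by
    intro j _
    rw [chainSum_of_nonempty G κ S hB0 j Q, Finset.mul_sum, Finset.mul_sum]
  have e2 : ∀ k ∈ M \ A, G (∑ l ∈ M, κ l) k i * (chainSum G κ S A k P *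
        chainSum G κ S ((M \ A).erase k) k (mkDerivation ℂ (S k) Q)) =
      ∑ j ∈ A, G (∑ l ∈ M, κ l) k i *
        (G (∑ l ∈ A, κ l) j k * chainSum G κ S (A.erase j) j (mkDerivation ℂ (S j) P) *
            chainSum G κ S ((M \ A).erase k) k (mkDerivation ℂ (S k) Q)) := by
    intro k _
    rw [chainSum_of_nonempty G κ S hA0 k P, Finset.sum_mul, Finset.mul_sum]
  rw [Finset.sum_congr rfl e1, Finset.sum_congr rfl e2, Finset.sum_comm (s := M \ A),
    ← Finset.sum_add_distrib]
  refine Finset.sum_congr rfl fun j hj => ?_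
  rw [← Finset.sum_add_distrib]
  refine Finset.sum_congr rfl fun k hk => ?_
  have := hG A (M \ A) (hA.trans hM) (Finset.sdiff_subset.trans hM) hdisj hA0 hB0 i j k hj hk
    (fun h => hi (hA h)) (fun h => hi (Finset.sdiff_subset h))
  rw [hsum]
  -- The remainders of the two chains beyond `j` and `k` are common factors of all three terms.
  linear_combination (chainSum G κ S (A.erase j) j (mkDerivation ℂ (S j) P) *
    chainSum G κ S ((M \ A).erase k) k (mkDerivation ℂ (S k) Q)) * this

/-- The Leibniz rule for the first derivation, with the induction hypothesis for the shorter chains,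
yields exactly the terms of `chainSum_mul_chainSum` summed over `A`. This multiplicativity allows
one variable of a monomial to be contracted at a time. -/
theorem chainSum_mul {J : Finset ι} (hG : FayIdentity G κ J) {M : Finset ι} (hM : M ⊆ J) {i : ι}
    (hi : i ∉ M) (P Q : MvPolynomial Δ ℂ) :
    chainSum G κ S M i (P * Q) =
      ∑ A ∈ M.powerset, chainSum G κ S A i P * chainSum G κ S (M \ A) i Q := by
  induction M using Finset.strongInduction generalizing i P Q with
  | H M ih =>
  rcases M.eq_empty_or_nonempty with rfl | hne
  · simp [chainSum_empty, ← constantCoeff_eq]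
  · rw [chainSum_of_nonempty G κ S hne, Finset.sum_congr rfl fun A hA =>
      chainSum_mul_chainSum G κ S hG hM hne hi P Q (Finset.mem_powerset.1 hA),
      Finset.sum_add_distrib]
    have e1 : ∑ A ∈ M.powerset, ∑ j ∈ A, G (∑ k ∈ M, κ k) j i *
        (chainSum G κ S (A.erase j) j (mkDerivation ℂ (S j) P) * chainSum G κ S (M \ A) j Q) =
        ∑ j ∈ M, ∑ A ∈ (M.erase j).powerset, G (∑ k ∈ M, κ k) j i *
          (chainSum G κ S A j (mkDerivation ℂ (S j) P) *
            chainSum G κ S (M.erase j \ A) j Q) := by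
      rw [← sum_powerset_erase]
      refine Finset.sum_congr rfl fun A _ => Finset.sum_congr rfl fun j hj => ?_
      rw [← sdiff_eq_erase_sdiff_erase hj]
    have e2 : ∑ A ∈ M.powerset, ∑ j ∈ M \ A, G (∑ k ∈ M, κ k) j i * (chainSum G κ S A j P *
        chainSum G κ S ((M \ A).erase j) j (mkDerivation ℂ (S j) Q)) =
        ∑ j ∈ M, ∑ A ∈ (M.erase j).powerset, G (∑ k ∈ M, κ k) j i *
          (chainSum G κ S A j P *
            chainSum G κ S (M.erase j \ A) j (mkDerivation ℂ (S j) Q)) := by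
      have e3 := sum_powerset_sdiff M fun B => ∑ j ∈ B, G (∑ k ∈ M, κ k) j i *
        (chainSum G κ S (M \ B) j P * chainSum G κ S (B.erase j) j (mkDerivation ℂ (S j) Q))
      have e4 : ∑ A ∈ M.powerset, ∑ j ∈ A, G (∑ k ∈ M, κ k) j i *
        (chainSum G κ S (M \ A) j P * chainSum G κ S (A.erase j) j (mkDerivation ℂ (S j) Q)) =
        ∑ j ∈ M, ∑ A ∈ (M.erase j).powerset, G (∑ k ∈ M, κ k) j i *
          (chainSum G κ S (M.erase j \ A) j P *
            chainSum G κ S A j (mkDerivation ℂ (S j) Q)) := by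
        rw [← sum_powerset_erase]
        refine Finset.sum_congr rfl fun A _ => Finset.sum_congr rfl fun j hj => ?_
        rw [← sdiff_eq_erase_sdiff_erase hj]
      rw [e4] at e3
      refine (Finset.sum_congr rfl fun A hA => ?_).trans (e3.trans
        (Finset.sum_congr rfl fun j _ => ?_))
      · rw [Finset.sdiff_sdiff_eq_self (Finset.mem_powerset.1 hA)]
      · have := sum_powerset_sdiff (M.erase j) fun B => G (∑ k ∈ M, κ k) j i *
          (chainSum G κ S B j P * chainSum G κ S (M.erase j \ B) j (mkDerivation ℂ (S j) Q))
        rw [← this]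
        refine Finset.sum_congr rfl fun A hA => ?_
        rw [Finset.sdiff_sdiff_eq_self (Finset.mem_powerset.1 hA)]
    rw [e1, e2, ← Finset.sum_add_distrib]
    refine Finset.sum_congr rfl fun j hj => ?_
    have hsub := Finset.erase_ssubset hj
    rw [Derivation.leibniz, chainSum_add, smul_eq_mul, smul_eq_mul,
      ih _ hsub (hsub.subset.trans hM) (Finset.notMem_erase j M),
      mul_comm Q, ih _ hsub (hsub.subset.trans hM) (Finset.notMem_erase j M), add_comm, mul_add,
      Finset.mul_sum, Finset.mul_sum]

end


/-! ### Convolution of functions of finite sets -/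

section

variable {ι : Type*} [DecidableEq ι]

/-- The exponent of the square-free monomial with variables in `M`. -/
noncomputable def indicatorExp (M : Finset ι) : ι →₀ ℕ := Finsupp.indicator M fun _ _ => 1

theorem indicatorExp_apply (M : Finset ι) (x : ι) : indicatorExp M x = if x ∈ M then 1 else 0 := by
  simp [indicatorExp, Finsupp.indicator_apply]

theorem support_indicatorExp (M : Finset ι) : (indicatorExp M).support = M := by
  ext x
  simp [indicatorExp_apply]

/-- The power series whose square-free coefficients are given by a function of finite sets. -/
noncomputable def setSeries (f : Finset ι → ℂ) : MvPowerSeries ι ℂ := fun d => f d.support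

theorem coeff_setSeries (f : Finset ι → ℂ) (M : Finset ι) :
    MvPowerSeries.coeff (indicatorExp M) (setSeries f) = f M := by
  change f (indicatorExp M).support = f M
  rw [support_indicatorExp]

/-- Both summands of a square-free exponent are square-free, so multiplication of power series
restricts to the convolution over subsets. Commutativity and associativity of that convolution are
thereby inherited from the ring of power series. -/
theorem coeff_indicatorExp_mul (F H : MvPowerSeries ι ℂ) (M : Finset ι) :
    MvPowerSeries.coeff (indicatorExp M) (F * H) =
      ∑ A ∈ M.powerset, MvPowerSeries.coeff (indicatorExp A) F *
        MvPowerSeries.coeff (indicatorExp (M \ A)) H := by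
  rw [MvPowerSeries.coeff_mul]
  have key : ∀ p : (ι →₀ ℕ) × (ι →₀ ℕ), p.1 + p.2 = indicatorExp M →
      p.1 = indicatorExp p.1.support ∧ p.2 = indicatorExp (M \ p.1.support) ∧
        p.1.support ⊆ M := by
    intro p hp
    have hx : ∀ x, p.1 x + p.2 x = if x ∈ M then 1 else 0 := fun x => by
      rw [← indicatorExp_apply, ← hp, Finsupp.add_apply]
    refine ⟨?_, ?_, ?_⟩
    · ext x
      have := hx x
      simp only [indicatorExp_apply, Finsupp.mem_support_iff]
      split_ifs at this ⊢ <;> omega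
    · ext x
      have := hx x
      simp only [indicatorExp_apply, Finset.mem_sdiff, Finsupp.mem_support_iff]
      by_cases h : x ∈ M <;> simp only [h, if_true, if_false, true_and, false_and] at this ⊢
      · split_ifs <;> omega
      · omega
    · intro x hxs
      have := hx x
      rw [Finsupp.mem_support_iff] at hxs
      by_contra h
      rw [if_neg h] at this
      omega
  refine Finset.sum_bij' (fun p _ => p.1.support) (fun A _ => (indicatorExp A, indicatorExp (M \ A)))
    ?_ ?_ ?_ ?_ ?_
  · intro p hp
    exact Finset.mem_powerset.2 (key p (Finset.HasAntidiagonal.mem_antidiagonal.1 hp)).2.2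
  · intro A hA
    rw [Finset.mem_powerset] at hA
    rw [Finset.HasAntidiagonal.mem_antidiagonal]
    ext x
    simp only [Finsupp.add_apply, indicatorExp_apply, Finset.mem_sdiff]
    by_cases h1 : x ∈ A
    · simp [h1, hA h1]
    · by_cases h2 : x ∈ M <;> simp [h1, h2]
  · intro p hp
    have := key p (Finset.HasAntidiagonal.mem_antidiagonal.1 hp)
    exact Prod.ext this.1.symm this.2.1.symm
  · intro A _
    exact support_indicatorExp A
  · intro p hp
    have := key p (Finset.HasAntidiagonal.mem_antidiagonal.1 hp)
    rw [← this.1, ← this.2.1]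

theorem indicatorExp_empty : indicatorExp (∅ : Finset ι) = 0 := by
  ext x
  simp [indicatorExp_apply]

theorem coeff_indicatorExp_prod_eq_zero {κ : Type*} [DecidableEq κ] (s : Finset κ)
    (F : κ → MvPowerSeries ι ℂ)
    (hF : ∀ k ∈ s, ∀ A : Finset ι, A.Nonempty → MvPowerSeries.coeff (indicatorExp A) (F k) = 0)
    {M : Finset ι} (hM : M.Nonempty) :
    MvPowerSeries.coeff (indicatorExp M) (∏ k ∈ s, F k) = 0 := by
  induction s using Finset.induction_on with
  | empty =>
    rw [Finset.prod_empty, MvPowerSeries.coeff_one, if_neg]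
    intro h
    have := support_indicatorExp M
    rw [h, Finsupp.support_zero] at this
    exact hM.ne_empty this.symm
  | insert k s hk ih =>
    rw [Finset.prod_insert hk, coeff_indicatorExp_mul]
    refine Finset.sum_eq_zero fun A _ => ?_
    rcases A.eq_empty_or_nonempty with rfl | hA
    · rw [Finset.sdiff_empty, ih fun k hk => hF k (Finset.mem_insert_of_mem hk), mul_zero]
    · rw [hF k (Finset.mem_insert_self _ _) A hA, zero_mul]

end

/-! ### Forest sums and their Ward identity. -/

section

variable {Δ : Type*} {N : ℕ} (G : ℂ → Fin N → Fin N → ℂ) (κ : Fin N → ℂ)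
  (S : Fin N → Δ → MvPolynomial Δ ℂ)

/-- The sum over all ways to distribute the points of `J` over chains that end in the points outside
of `J`. -/
noncomputable def forestSum (J : Finset (Fin N)) (Q : Fin N → MvPolynomial Δ ℂ) : ℂ :=
  MvPowerSeries.coeff (indicatorExp J)
    (∏ i ∈ Jᶜ, setSeries fun M => chainSum G κ S M i (Q i))

theorem forestSum_eq {J : Finset (Fin N)} (Q : Fin N → MvPolynomial Δ ℂ) {i : Fin N} (hi : i ∉ J) :
    forestSum G κ S J Q = MvPowerSeries.coeff (indicatorExp J)
      ((setSeries fun M => chainSum G κ S M i (Q i)) *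
        ∏ k ∈ Jᶜ.erase i, setSeries fun M => chainSum G κ S M k (Q k)) := by
  rw [forestSum, Finset.mul_prod_erase Jᶜ (fun i => setSeries fun M => chainSum G κ S M i (Q i))
    (Finset.mem_compl.2 hi)]

theorem forestSum_const {Q : Fin N → MvPolynomial Δ ℂ} {r : Fin N → ℂ} (hQ : ∀ i, Q i = C (r i)) :
    forestSum G κ S ∅ Q = ∏ i, r i := by
  rw [forestSum, indicatorExp_empty, MvPowerSeries.coeff_zero_eq_constantCoeff, map_prod,
    Finset.compl_empty]
  refine Finset.prod_congr rfl fun i _ => ?_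
  rw [← MvPowerSeries.coeff_zero_eq_constantCoeff, ← indicatorExp_empty, coeff_setSeries,
    chainSum_empty, hQ, coeff_zero_C]

theorem forestSum_const_zero {J : Finset (Fin N)} {Q : Fin N → MvPolynomial Δ ℂ} (hJ : J.Nonempty)
    (hQ : ∀ i ∉ J, ∃ r, Q i = C r) : forestSum G κ S J Q = 0 := by
  refine coeff_indicatorExp_prod_eq_zero _ _ (fun i hi A hA => ?_) hJ
  obtain ⟨r, hr⟩ := hQ i (Finset.mem_compl.1 hi)
  rw [coeff_setSeries, hr, chainSum_C G κ S hA]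

theorem prod_erase_update {J : Finset (Fin N)} (Q : Fin N → MvPolynomial Δ ℂ) (i : Fin N)
    (p : MvPolynomial Δ ℂ) :
    (∏ k ∈ Jᶜ.erase i, setSeries fun M => chainSum G κ S M k (Function.update Q i p k)) =
      ∏ k ∈ Jᶜ.erase i, setSeries fun M => chainSum G κ S M k (Q k) := by
  refine Finset.prod_congr rfl fun k hk => ?_
  rw [Function.update_of_ne (Finset.ne_of_mem_erase hk)]

theorem forestSum_add {J : Finset (Fin N)} (Q : Fin N → MvPolynomial Δ ℂ) {i : Fin N} (hi : i ∉ J)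
    (p p' : MvPolynomial Δ ℂ) :
    forestSum G κ S J (Function.update Q i (p + p')) =
      forestSum G κ S J (Function.update Q i p) + forestSum G κ S J (Function.update Q i p') := by
  simp only [forestSum_eq G κ S _ hi, prod_erase_update, Function.update_self]
  have : (setSeries fun M => chainSum G κ S M i (p + p')) =
      (setSeries fun M => chainSum G κ S M i p) + setSeries fun M => chainSum G κ S M i p' := by
    funext d
    exact chainSum_add G κ S d.support i p p'
  rw [this, add_mul, map_add]

/-- By multiplicativity `X a` at `i` receives a chain of its own. Weight conservation forces the
parameter of its last link to be `c a`, and what lies beyond the last point `j` is a chain ending in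
`j` for the polynomial `S j a`. That is a contribution to the state contracted at `j`. -/
theorem forestSum_ward [Fintype Δ] {c : Δ → ℂ} (hS : ∀ j b, IsWeightedHomogeneous c (S j b) (c b - κ j))
    {J : Finset (Fin N)} (hG : FayIdentity G κ J) {Q : Fin N → MvPolynomial Δ ℂ} {i : Fin N}
    (hi : i ∉ J) {a : Δ} {R : MvPolynomial Δ ℂ} (hQ : Q i = X a * R) :
    forestSum G κ S J Q =
      ∑ j ∈ J, G (c a) j i * forestSum G κ S (J.erase j) (contractedPoly S Q a i j R) := by
  set W := (setSeries fun M => chainSum G κ S M i R) *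
    ∏ k ∈ Jᶜ.erase i, setSeries fun M => chainSum G κ S M k (Q k) with hW
  have h1 : forestSum G κ S J Q = MvPowerSeries.coeff (indicatorExp J)
      ((setSeries fun M => chainSum G κ S M i (X a)) * W) := by
    rw [forestSum_eq G κ S Q hi, hW, ← mul_assoc, coeff_indicatorExp_mul, coeff_indicatorExp_mul]
    refine Finset.sum_congr rfl fun A hA => ?_
    rw [Finset.mem_powerset] at hA
    rw [coeff_setSeries, hQ, chainSum_mul G κ S hG hA fun h => hi (hA h), coeff_indicatorExp_mul]
    simp only [coeff_setSeries]
  have h2 : ∀ A : Finset (Fin N), chainSum G κ S A i (X a) =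
      ∑ j ∈ A, G (c a) j i * chainSum G κ S (A.erase j) j (S j a) := by
    intro A
    rcases A.eq_empty_or_nonempty with rfl | hA
    · rw [chainSum_empty, Finset.sum_empty, coeff_zero_X]
    · rw [chainSum_of_nonempty G κ S hA]
      refine Finset.sum_congr rfl fun j hj => ?_
      rw [mkDerivation_X]
      -- If the two parameters differ, the rest of the chain vanishes by weight, so the kernel may
      -- be written with `c a` in either case.
      by_cases hc : c a = ∑ k ∈ A, κ k
      · rw [hc]
      · rw [chainSum_eq_zero G κ S hS (A.erase j) j (hS j a), mul_zero, mul_zero]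
        intro h
        refine hc ?_
        rw [← Finset.add_sum_erase A κ hj, ← h]
        ring
  have h3 : ∀ j ∈ J, forestSum G κ S (J.erase j) (contractedPoly S Q a i j R) =
      MvPowerSeries.coeff (indicatorExp (J.erase j))
        ((setSeries fun M => chainSum G κ S M j (S j a)) * W) := by
    intro j hj
    have hji : j ≠ i := fun h => hi (h ▸ hj)
    rw [forestSum_eq G κ S _ (Finset.notMem_erase j J), hW]
    have e1 : (J.erase j)ᶜ.erase j = Jᶜ := by
      ext x
      simp only [Finset.mem_erase, Finset.mem_compl, not_and]
      constructor
      · rintro ⟨h, h'⟩ hx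
        exact h' h hx
      · exact fun h => ⟨fun hxj => h (hxj ▸ hj), fun _ => h⟩
    rw [e1, ← Finset.mul_prod_erase Jᶜ _ (Finset.mem_compl.2 hi)]
    have e2 : contractedPoly S Q a i j R j = S j a := Function.update_self _ _ _
    have e3 : contractedPoly S Q a i j R i = R := by
      simp [contractedPoly, hji.symm]
    rw [e2, e3]
    congr 3
    refine Finset.prod_congr rfl fun k hk => ?_
    rw [Finset.mem_erase, Finset.mem_compl] at hk
    have e4 : contractedPoly S Q a i j R k = Q k := by
      have : k ≠ j := fun h => hk.2 (h ▸ hj)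
      simp [contractedPoly, this, hk.1]
    rw [e4]
  rw [h1, coeff_indicatorExp_mul]
  simp only [coeff_setSeries, h2, Finset.sum_mul]
  have h4 : ∑ A ∈ J.powerset, ∑ j ∈ A, G (c a) j i * chainSum G κ S (A.erase j) j (S j a) *
      MvPowerSeries.coeff (indicatorExp (J \ A)) W =
      ∑ j ∈ J, ∑ A ∈ (J.erase j).powerset, G (c a) j i * chainSum G κ S A j (S j a) *
        MvPowerSeries.coeff (indicatorExp (J.erase j \ A)) W := by
    rw [← sum_powerset_erase]
    refine Finset.sum_congr rfl fun A _ => Finset.sum_congr rfl fun j hj => ?_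
    rw [← sdiff_eq_erase_sdiff_erase hj]
  rw [h4]
  refine Finset.sum_congr rfl fun j hj => ?_
  rw [h3 j hj, coeff_indicatorExp_mul, Finset.mul_sum]
  refine Finset.sum_congr rfl fun A _ => ?_
  rw [coeff_setSeries, mul_assoc]

end

/-! ### Forest sums with the elliptic kernel. -/

section

variable {Δ : Type*} [Fintype Δ] {N : ℕ}

/-- The kernel of a contraction. -/
noncomputable def chainKern (q : ℂ) (u : Fin N → ℂ) (x : ℂ) (j i : Fin N) : ℂ :=
  (u j)⁻¹ * ellKern q (Complex.exp (-x)) (u i / u j)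

theorem contractionRules_forestSum {q : ℂ} {c : Δ → ℂ} {u : Fin N → ℂ}
    {S : Fin N → Δ → MvPolynomial Δ ℂ} {κ : Fin N → ℂ} {J₀ : Finset (Fin N)}
    (hS : ∀ j b, IsWeightedHomogeneous c (S j b) (c b - κ j))
    (hG : FayIdentity (chainKern q u) κ J₀) :
    ContractionRules q c u S J₀ (forestSum (chainKern q u) κ S) where
  const _ _ hQ := forestSum_const _ κ S hQ
  const_zero _ _ hJ hQ := forestSum_const_zero _ κ S hJ hQ
  add _ Q _ p p' hi := forestSum_add _ κ S Q hi p p'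
  ward J Q i a d r hJ hi hQ := by
    refine forestSum_ward (chainKern q u) κ S hS (fun A B hA hB => hG A B (hA.trans hJ) (hB.trans hJ))
      hi (hQ.trans ?_)
    rw [X, monomial_mul, one_mul]

/-- This is `ellKern_mul_ellKern` at `x = u i / u j` and `y = u i / u k`. The radial ordering puts
the quotients of distinct points into the annuli of convergence. -/
theorem fayIdentity_chainKern {q : ℂ} (hq : q ≠ 0) (hq1 : ‖q‖ < 1) {u : Fin N → ℂ}
    (hu : ∀ k, u k ≠ 0) (hgeo : ∀ i j, i < j → ‖q‖ * ‖u i‖ < ‖u j‖ ∧ ‖u j‖ < ‖u i‖)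
    {κ : Fin N → ℂ} {J : Finset (Fin N)}
    (hκ : ∀ A ⊆ J, A.Nonempty → ∀ n : ℤ, Complex.exp (∑ i ∈ A, κ i) ≠ q ^ n) :
    FayIdentity (chainKern q u) κ J := by
  intro A B hA hB hAB hA0 hB0 i j k hj hk hi hi'
  have hreg : ∀ A ⊆ J, A.Nonempty → ∀ n : ℤ, Complex.exp (-∑ i ∈ A, κ i) * q ^ n ≠ 1 := by
    intro A hA hA0 n h
    refine hκ A hA hA0 n ?_
    rw [Complex.exp_neg, inv_mul_eq_one₀ (Complex.exp_ne_zero _)] at h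
    exact h
  have hpos : ∀ i, 0 < ‖u i‖ := fun i => norm_pos_iff.2 (hu i)
  have hg : ∀ i j, i ≠ j → ‖q‖ < ‖u i / u j‖ ∧ ‖q‖ * ‖u i / u j‖ < 1 ∧ ‖u i / u j‖ ≠ 1 := by
    intro i j hij
    rw [norm_div, lt_div_iff₀ (hpos j), ← mul_div_assoc, div_lt_one (hpos j), Ne,
      div_eq_one_iff_eq (hpos j).ne']
    rcases lt_or_gt_of_ne hij with h | h
    · have h1 := hgeo i j h
      refine ⟨?_, h1.1, h1.2.ne'⟩
      exact (mul_le_of_le_one_left (norm_nonneg _) hq1.le).trans_lt h1.2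
    · have h1 := hgeo j i h
      refine ⟨h1.1, ?_, h1.2.ne⟩
      exact (mul_le_of_le_one_left (norm_nonneg _) hq1.le).trans_lt h1.2
  have hij : i ≠ j := fun h => hi (h ▸ hj)
  have hik : i ≠ k := fun h => hi' (h ▸ hk)
  have hjk : k ≠ j := fun h => Finset.disjoint_left.1 hAB hj (h ▸ hk)
  have hsum : ∑ l ∈ A ∪ B, κ l = ∑ l ∈ A, κ l + ∑ l ∈ B, κ l := Finset.sum_union hAB
  have hexp : Complex.exp (-(∑ l ∈ A, κ l + ∑ l ∈ B, κ l)) =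
      Complex.exp (-∑ l ∈ A, κ l) * Complex.exp (-∑ l ∈ B, κ l) := by
    rw [neg_add, Complex.exp_add]
  obtain ⟨x1, x2, x3⟩ := hg i j hij
  obtain ⟨y1, y2, y3⟩ := hg i k hik
  obtain ⟨z1, z2, z3⟩ := hg k j hjk
  have e1 : u i / u j / (u i / u k) = u k / u j := by
    have := hu i; have := hu j; have := hu k
    field_simp
  have e2 : u i / u k / (u i / u j) = u j / u k := by
    have := hu i; have := hu j; have := hu k
    field_simp
  have n1 : ‖u k / u j‖ = ‖u i / u j‖ / ‖u i / u k‖ := by rw [← norm_div, e1]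
  have hy0 : 0 < ‖u i / u k‖ := norm_pos_iff.2 (div_ne_zero (hu i) (hu k))
  rw [n1, lt_div_iff₀ hy0] at z1
  rw [n1, ← mul_div_assoc, div_lt_one hy0] at z2
  rw [n1, Ne, div_eq_one_iff_eq hy0.ne'] at z3
  have key := ellKern_mul_ellKern hq hq1 (Complex.exp_ne_zero _) (Complex.exp_ne_zero _)
    (hreg A hA hA0) (hreg B hB hB0) (fun n => by
      rw [← hexp, ← hsum]
      exact hreg _ (Finset.union_subset hA hB) (hA0.mono Finset.subset_union_left) n)
    x1 x2 x3 y1 y2 y3 z1 z2 z3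
  rw [e1, e2, ← hexp] at key
  unfold chainKern
  linear_combination ((u j)⁻¹ * (u k)⁻¹) * key

end


/-! ### Sums over chains as sums over permutations -/

/-- The choice of the point next to the end of a chain corresponds to the choice of `p` in
`Equiv.Perm.decomposeFin`; the points left over are those visited by the remaining permutation. -/
theorem image_swap_succ {ι : Type*} [DecidableEq ι] {m : ℕ} {a : Fin (m + 1) → ι}
    (ha : Function.Injective a) (p : Fin (m + 1)) :
    Finset.univ.image (fun k : Fin m => a (Equiv.swap 0 p k.succ)) =
      (Finset.univ.image a).erase (a p) := by
  ext x
  simp only [Finset.mem_image, Finset.mem_univ, true_and, Finset.mem_erase]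
  constructor
  · rintro ⟨k, rfl⟩
    refine ⟨fun h => ?_, _, rfl⟩
    have h1 := ha h
    rw [Equiv.swap_apply_eq_iff, Equiv.swap_apply_right] at h1
    exact Fin.succ_ne_zero k h1
  · rintro ⟨h, l, rfl⟩
    have h1 : Equiv.swap 0 p l ≠ 0 := by
      intro h0
      rw [Equiv.swap_apply_eq_iff, Equiv.swap_apply_left] at h0
      exact h (congrArg a h0)
    obtain ⟨k, hk⟩ := Fin.exists_succ_eq.2 h1
    exact ⟨k, by rw [hk, Equiv.swap_apply_self]⟩

section

variable {Δ ι : Type*}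
  (G : ℂ → ι → ι → ℂ) (κ : ι → ℂ) (S : ι → Δ → MvPolynomial Δ ℂ)

/-- The contribution of a single chain, listed from its end. -/
noncomputable def chainTerm : (m : ℕ) → (Fin m → ι) → ι → MvPolynomial Δ ℂ → ℂ
  | 0, _, _, P => coeff 0 P
  | m + 1, f, i, P => G (∑ k, κ (f k)) (f 0) i *
      chainTerm m (fun k => f k.succ) (f 0) (mkDerivation ℂ (S (f 0)) P)

theorem chainSum_image [DecidableEq ι] {m : ℕ} {a : Fin m → ι} (ha : Function.Injective a) (i : ι)
    (P : MvPolynomial Δ ℂ) :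
    chainSum G κ S (Finset.univ.image a) i P =
      ∑ σ : Equiv.Perm (Fin m), chainTerm G κ S m (fun k => a (σ k)) i P := by
  induction m generalizing i P with
  | zero =>
    simp only [Finset.univ_eq_empty, Finset.image_empty, chainSum_empty, chainTerm]
    simp
  | succ m ih =>
    have hne : (Finset.univ.image a).Nonempty := ⟨a 0, Finset.mem_image_of_mem a (Finset.mem_univ 0)⟩
    rw [chainSum_of_nonempty G κ S hne, Finset.sum_image fun x _ y _ h => ha h,
      ← Equiv.Perm.decomposeFin.symm.sum_comp, Fintype.sum_prod_type]
    refine Finset.sum_congr rfl fun p _ => ?_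
    have hinj : Function.Injective fun k : Fin m => a (Equiv.swap 0 p k.succ) := fun k l h =>
      Fin.succ_injective m ((Equiv.swap 0 p).injective (ha h))
    rw [← image_swap_succ ha p, ih hinj, Finset.mul_sum]
    refine Finset.sum_congr rfl fun e _ => ?_
    have hs : ∑ k ∈ Finset.univ.image a, κ k =
        ∑ k, κ (a (Equiv.Perm.decomposeFin.symm (p, e) k)) := by
      rw [Finset.sum_image fun x _ y _ h => ha h]
      exact (Equiv.sum_comp _ fun k => κ (a k)).symm
    rw [chainTerm, hs, Equiv.Perm.decomposeFin_symm_apply_zero]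
    simp only [Equiv.Perm.decomposeFin_symm_apply_succ]

theorem chainTerm_eq {m : ℕ} (f : Fin m → ι) (i : ι) (P : MvPolynomial Δ ℂ) :
    chainTerm G κ S m f i P =
      (∏ j : Fin m, G (∑ k ∈ Finset.Ici j, κ (f k)) (f j)
        ((Fin.cons i f : Fin (m + 1) → ι) j.castSucc)) *
      coeff 0 ((List.ofFn fun j => (mkDerivation ℂ (S (f j)) :
        MvPolynomial Δ ℂ → MvPolynomial Δ ℂ)).foldl (fun Q D => D Q) P) := by
  induction m generalizing i P with
  | zero => simp [chainTerm]
  | succ m ih =>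
    rw [chainTerm, ih, Fin.prod_univ_succ, List.ofFn_succ, List.foldl_cons, mul_assoc]
    have h0 : Finset.Ici (0 : Fin (m + 1)) = Finset.univ := by
      ext x
      simp
    have h1 : ∀ j : Fin m, ∑ k ∈ Finset.Ici j.succ, κ (f k) = ∑ k ∈ Finset.Ici j, κ (f k.succ) := by
      intro j
      rw [← Fin.map_succEmb_Ici, Finset.sum_map]
      rfl
    have h2 : ∀ j : Fin m, (Fin.cons i f : Fin (m + 1 + 1) → ι) j.succ.castSucc =
        (Fin.cons (f 0) (fun k => f k.succ) : Fin (m + 1) → ι) j.castSucc := by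
      intro j
      rw [← Fin.succ_castSucc, Fin.cons_succ]
      exact congrFun (Fin.cons_self_tail f).symm j.castSucc
    simp only [h0, h1, h2, Fin.castSucc_zero, Fin.cons_zero]

/-- `chainTerm` lists a chain from its end, while products of operators are listed from the far end.
Reversing the places merely permutes the summands, and it turns upper partial sums of the `κ` into
lower ones. -/
theorem chainSum_eq_sum_perm [DecidableEq ι] {m : ℕ} {a : Fin m → ι} (ha : Function.Injective a) (i : ι)
    (P : MvPolynomial Δ ℂ) :
    chainSum G κ S (Finset.univ.image a) i P = ∑ σ : Equiv.Perm (Fin m),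
      (∏ j : Fin m, G (∑ k ∈ Finset.Iic j, κ (a (σ k))) (a (σ j))
        ((Fin.snoc (fun k => a (σ k)) i : Fin (m + 1) → ι) j.succ)) *
      coeff 0 ((List.ofFn fun j => (mkDerivation ℂ (S (a (σ j))) :
        MvPolynomial Δ ℂ → MvPolynomial Δ ℂ)).foldr (fun D Q => D Q) P) := by
  have hrev : ∀ σ : Equiv.Perm (Fin m), ∀ k : Fin m,
      ((Equiv.mulRight Fin.revPerm) σ : Equiv.Perm (Fin m)) k = σ k.rev := fun σ k => rfl
  rw [chainSum_image G κ S ha, ← Equiv.sum_comp (Equiv.mulRight Fin.revPerm)]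
  refine Finset.sum_congr rfl fun σ _ => ?_
  simp only [hrev]
  rw [chainTerm_eq, ← Equiv.prod_comp Fin.revPerm, List.foldr_eq_foldl_reverse]
  congr 1
  · refine Finset.prod_congr rfl fun j _ => ?_
    have h1 : ∑ k ∈ Finset.Ici (Fin.rev j), κ (a (σ k.rev)) =
        ∑ k ∈ Finset.Iic j, κ (a (σ k)) := by
      rw [← Fin.finsetImage_rev_Iic, Finset.sum_image fun x _ y _ h => Fin.rev_injective h]
      simp only [Fin.rev_rev]
    have h2 : (Fin.cons i fun k => a (σ k.rev) : Fin (m + 1) → ι) (Fin.rev j).castSucc =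
        (Fin.snoc (fun k => a (σ k)) i : Fin (m + 1) → ι) j.succ := by
      rw [← Fin.rev_succ, Fin.cons_rev]
      congr 1
      funext k
      simp
    rw [Fin.revPerm_apply, h1, h2, Fin.rev_rev]
  · congr 2
    refine List.ext_getElem (by simp) fun k h1 h2 => ?_
    simp only [List.getElem_ofFn, List.getElem_reverse, List.length_ofFn]
    rw [show (⟨k, by simpa using h1⟩ : Fin m).rev = ⟨m - 1 - k, by simp at h1; omega⟩ from
      Fin.ext (by simp only [Fin.val_rev]; omega)]

end


/-! ### The theta function and Kronecker's formula -/

/-- The Laurent coefficients of the reduced theta function. -/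
noncomputable def thetaCoeff (q : ℂ) (n : ℤ) : ℂ := (-1) ^ n * q ^ (n * (n + 1) / 2)

theorem triangle_succ (n : ℤ) : (n + 1) * (n + 1 + 1) / 2 = n * (n + 1) / 2 + (n + 1) := by
  have : (n + 1) * (n + 1 + 1) = n * (n + 1) + (n + 1) * 2 := by ring
  rw [this, Int.add_mul_ediv_right _ _ (by norm_num)]

theorem thetaCoeff_succ {q : ℂ} (hq : q ≠ 0) (n : ℤ) :
    thetaCoeff q (n + 1) = -q ^ (n + 1) * thetaCoeff q n := by
  rw [thetaCoeff, thetaCoeff, triangle_succ, zpow_add₀ hq, zpow_add₀ (by norm_num : (-1 : ℂ) ≠ 0)]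
  ring

theorem thetaCoeff_zero (q : ℂ) : thetaCoeff q 0 = 1 := by simp [thetaCoeff]

/-- The antisymmetry under `n ↦ -1 - n` is the source of the zero at `x = 1`. -/
theorem thetaCoeff_neg_sub_one (q : ℂ) (n : ℤ) : thetaCoeff q (-1 - n) = -thetaCoeff q n := by
  have h1 : (-1 - n) * (-1 - n + 1) = n * (n + 1) := by ring
  have h2 : ((-1 : ℂ)) ^ (-1 - n) = -(-1) ^ n := by
    rw [zpow_sub₀ (by norm_num), zpow_neg, zpow_one, div_eq_mul_inv, ← zpow_neg]
    rcases Int.even_or_odd n with h | h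
    · rw [h.neg.neg_one_zpow, h.neg_one_zpow]; norm_num
    · rw [h.neg.neg_one_zpow, h.neg_one_zpow]; norm_num
  rw [thetaCoeff, thetaCoeff, h1, h2, neg_mul]

/-- Convergence and holomorphy of the reduced theta function are obtained from `jacobiTheta₂` at a
shifted argument. -/
theorem thetaCoeff_exp_eq (τ z : ℂ) (n : ℤ) :
    thetaCoeff (Complex.exp (2 * Real.pi * Complex.I * τ)) n *
      Complex.exp (2 * Real.pi * Complex.I * z) ^ n =
    jacobiTheta₂_term n (z + 1 / 2 + τ / 2) τ := by
  obtain ⟨k, hk⟩ := Int.even_mul_succ_self n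
  have hk' : n * (n + 1) / 2 = k := by omega
  have hkc : (n : ℂ) * (n + 1) = k + k := by exact_mod_cast hk
  have e1 : Complex.exp (Real.pi * Complex.I * n) = (-1) ^ n := by
    rw [mul_comm, Complex.exp_int_mul, Complex.exp_pi_mul_I]
  rw [thetaCoeff, hk', ← e1, ← Complex.exp_int_mul, ← Complex.exp_int_mul, ← Complex.exp_add,
    ← Complex.exp_add, jacobiTheta₂_term]
  congr 1
  linear_combination (-Real.pi * Complex.I * τ) * hkc

theorem thetaRed_exp (τ z : ℂ) :
    thetaRed (Complex.exp (2 * Real.pi * Complex.I * τ)) (Complex.exp (2 * Real.pi * Complex.I * z)) =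
      jacobiTheta₂ (z + 1 / 2 + τ / 2) τ :=
  tsum_congr fun n => thetaCoeff_exp_eq τ z n

theorem two_pi_I_mul_div (w : ℂ) : 2 * Real.pi * Complex.I * (w / (2 * Real.pi * Complex.I)) = w :=
  mul_div_cancel₀ _ Complex.two_pi_I_ne_zero

theorem im_pos_of_norm_exp_lt_one {τ : ℂ} (h : ‖Complex.exp (2 * Real.pi * Complex.I * τ)‖ < 1) :
    0 < τ.im := by
  rw [Complex.norm_exp, Real.exp_lt_one_iff] at h
  have : (2 * Real.pi * Complex.I * τ).re = -(2 * Real.pi * τ.im) := by simp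
  rw [this, neg_lt_zero] at h
  exact pos_of_mul_pos_right h (by positivity)

theorem exists_exp_two_pi_I {q : ℂ} (hq : q ≠ 0) :
    ∃ τ, Complex.exp (2 * Real.pi * Complex.I * τ) = q :=
  ⟨Complex.log q / (2 * Real.pi * Complex.I), by rw [two_pi_I_mul_div, Complex.exp_log hq]⟩

theorem summable_thetaCoeff {q : ℂ} (hq : q ≠ 0) (hq1 : ‖q‖ < 1) {x : ℂ} (hx : x ≠ 0) :
    Summable fun n => thetaCoeff q n * x ^ n := by
  obtain ⟨τ, rfl⟩ := exists_exp_two_pi_I hq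
  obtain ⟨z, rfl⟩ := exists_exp_two_pi_I hx
  simp only [thetaCoeff_exp_eq]
  exact (summable_jacobiTheta₂_term_iff _ _).2 (im_pos_of_norm_exp_lt_one hq1)

theorem hasSum_thetaRed {q : ℂ} (hq : q ≠ 0) (hq1 : ‖q‖ < 1) {x : ℂ} (hx : x ≠ 0) :
    HasSum (fun n => thetaCoeff q n * x ^ n) (thetaRed q x) :=
  (summable_thetaCoeff hq hq1 hx).hasSum

theorem thetaRed_mul {q : ℂ} (hq : q ≠ 0) (hq1 : ‖q‖ < 1) {x : ℂ} (hx : x ≠ 0) :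
    thetaRed q (q * x) = -(q * x)⁻¹ * thetaRed q x := by
  have h := (hasSum_thetaRed hq hq1 hx).mul_left (-(q * x)⁻¹)
  rw [← (Equiv.addRight (1 : ℤ)).hasSum_iff] at h
  refine (hasSum_thetaRed hq hq1 (mul_ne_zero hq hx)).unique
    (Eq.mp (congrArg (fun f => HasSum f _) (funext fun n => ?_)) h)
  simp only [Function.comp_apply, Equiv.coe_addRight]
  rw [thetaCoeff_succ hq, mul_zpow, zpow_add₀ hq, zpow_add₀ hx]
  field_simp

theorem thetaRed_one {q : ℂ} (hq : q ≠ 0) (hq1 : ‖q‖ < 1) : thetaRed q 1 = 0 := by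
  have h := hasSum_thetaRed hq hq1 one_ne_zero
  have h2 := (Equiv.subLeft (-1 : ℤ)).hasSum_iff.2 h
  have h3 : HasSum (fun n => thetaCoeff q n * 1 ^ n) (-thetaRed q 1) := by
    have := h2.neg
    refine Eq.mp (congrArg (fun f => HasSum f _) (funext fun n => ?_)) this
    simp [thetaCoeff_neg_sub_one]
  have := h.unique h3
  exact self_eq_neg.1 this

theorem thetaRed_self {q : ℂ} (hq : q ≠ 0) (hq1 : ‖q‖ < 1) : thetaRed q q = 0 := by
  have := thetaRed_mul hq hq1 one_ne_zero
  rwa [mul_one, thetaRed_one hq hq1, mul_zero] at this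

theorem exists_inv_one_sub_le_pow {q a : ℂ} (hq : q ≠ 0) (hq1 : ‖q‖ < 1) (ha0 : a ≠ 0)
    (ha : ∀ n : ℤ, a * q ^ n ≠ 1) : ∃ C : ℝ, 0 ≤ C ∧
      ∀ n : ℤ, ‖(1 - a * q ^ n)⁻¹ - if 0 ≤ n then 1 else 0‖ ≤ C * ‖q‖ ^ n.natAbs := by
  obtain ⟨C, hC0, hC⟩ := exists_inv_one_sub_le hq1 a
  obtain ⟨D, hD0, hD⟩ := exists_inv_one_sub_le hq1 a⁻¹
  have hμ := fun n : ℤ => inv_one_sub_neg (mul_ne_zero ha0 (zpow_ne_zero n hq))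
    (sub_ne_zero.2 (ha n).symm)
  refine ⟨‖a‖ * C + ‖a⁻¹‖ * D, by positivity, fun n => ?_⟩
  have p1 : 0 ≤ ‖a⁻¹‖ * D := by positivity
  have p2 : 0 ≤ ‖a‖ * C := by positivity
  rcases le_or_gt 0 n with hn | hn
  · rw [if_pos hn, (hμ n).2.2]
    obtain ⟨k, rfl⟩ := Int.eq_ofNat_of_zero_le hn
    rw [norm_mul, norm_mul, Int.natAbs_natCast, zpow_natCast, norm_pow]
    calc ‖a‖ * ‖q‖ ^ k * ‖(1 - a * q ^ k)⁻¹‖ ≤ ‖a‖ * ‖q‖ ^ k * C := by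
          gcongr
          simpa using hC k hn
      _ = (‖a‖ * C) * ‖q‖ ^ k := by ring
      _ ≤ _ := by gcongr; linarith
  · rw [if_neg (not_le.2 hn), sub_zero, (hμ n).1, mul_inv, ← zpow_neg]
    obtain ⟨k, hk⟩ := Int.eq_ofNat_of_zero_le (by omega : 0 ≤ -n)
    have hk' : n.natAbs = k := by omega
    rw [hk, hk', norm_neg, norm_mul, norm_mul, zpow_natCast, norm_pow]
    calc ‖a⁻¹‖ * ‖q‖ ^ k * ‖(1 - a⁻¹ * q ^ k)⁻¹‖ ≤ ‖a⁻¹‖ * ‖q‖ ^ k * D := by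
          gcongr
          simpa using hD k (by omega)
      _ = (‖a⁻¹‖ * D) * ‖q‖ ^ k := by ring
      _ ≤ _ := by gcongr; linarith

/-- The Laurent coefficients of the product of the theta function and Kronecker's kernel. -/
noncomputable def kroneckerCoeff (q a : ℂ) (N : ℤ) : ℂ :=
  ∑' n : ℤ, thetaCoeff q (N - n) * (1 - a * q ^ n)⁻¹

theorem summable_kroneckerCoeff {q a : ℂ} (hq : q ≠ 0) (hq1 : ‖q‖ < 1) (ha0 : a ≠ 0)
    (ha : ∀ n : ℤ, a * q ^ n ≠ 1) (N : ℤ) :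
    Summable fun n : ℤ => thetaCoeff q (N - n) * (1 - a * q ^ n)⁻¹ := by
  obtain ⟨C, hC0, hC⟩ := exists_inv_one_sub_le_pow hq hq1 ha0 ha
  have h1 : Summable fun n : ℤ => ‖thetaCoeff q (N - n)‖ := by
    have := (summable_thetaCoeff hq hq1 one_ne_zero).norm
    simp only [one_zpow, mul_one] at this
    exact (Equiv.subLeft N).summable_iff.2 this
  refine Summable.of_norm_bounded (h1.mul_right (C + 1)) fun n => ?_
  rw [norm_mul]
  refine mul_le_mul_of_nonneg_left ?_ (norm_nonneg _)
  have h2 : ‖(if 0 ≤ n then 1 else 0 : ℂ)‖ ≤ 1 := by split_ifs <;> simp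
  have h3 : C * ‖q‖ ^ n.natAbs ≤ C :=
    mul_le_of_le_one_right hC0 (pow_le_one₀ (norm_nonneg _) hq1.le)
  calc _ = ‖((1 - a * q ^ n)⁻¹ - if 0 ≤ n then 1 else 0) + if 0 ≤ n then 1 else 0‖ := by
        rw [sub_add_cancel]
    _ ≤ _ := (norm_add_le _ _).trans (add_le_add ((hC n).trans h3) h2)

/-- Since `q^{-n} / (1 - a q^n) = q^{-n} + a / (1 - a q^n)`, the recursion of the theta coefficients
yields the stated term plus a multiple of the series for `thetaRed q q`, which is zero. -/
theorem kroneckerCoeff_succ {q a : ℂ} (hq : q ≠ 0) (hq1 : ‖q‖ < 1) (ha0 : a ≠ 0)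
    (ha : ∀ n : ℤ, a * q ^ n ≠ 1) (N : ℤ) :
    kroneckerCoeff q a (N + 1) = -a * q ^ (N + 1) * kroneckerCoeff q a N := by
  have h1 := (summable_kroneckerCoeff hq hq1 ha0 ha N).hasSum.mul_left (-a * q ^ (N + 1))
  have h2 := ((Equiv.subLeft N).hasSum_iff.2 (hasSum_thetaRed hq hq1 hq)).mul_left (-q)
  rw [thetaRed_self hq hq1, mul_zero] at h2
  have h3 := h1.add h2
  rw [add_zero] at h3
  refine (Eq.mp (congrArg (fun f => HasSum f _) (funext fun n => ?_)) h3).tsum_eq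
  have hn : 1 - a * q ^ n ≠ 0 := sub_ne_zero.2 (ha n).symm
  have e1 : N + 1 - n = (N - n) + 1 := by ring
  have e2 : q ^ (N - n + 1) * q ^ n = q ^ (N + 1) := by rw [← zpow_add₀ hq]; congr 1; ring
  have e3 : q * q ^ (N - n) = q ^ (N - n + 1) := by rw [zpow_add₀ hq, zpow_one, mul_comm]
  simp only [Function.comp_apply, Equiv.subLeft_apply]
  rw [e1, thetaCoeff_succ hq, ← e2, mul_left_comm, ← mul_assoc (-q), neg_mul, ← e3]
  field_simp
  ring

/-- The Laurent coefficients of `x ↦ thetaRed q (a * x)` satisfy the same first-order recursion, so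
the two sequences are proportional. -/
theorem kroneckerCoeff_eq {q a : ℂ} (hq : q ≠ 0) (hq1 : ‖q‖ < 1) (ha0 : a ≠ 0)
    (ha : ∀ n : ℤ, a * q ^ n ≠ 1) (N : ℤ) :
    kroneckerCoeff q a N = kroneckerCoeff q a 0 * (thetaCoeff q N * a ^ N) := by
  have hr : ∀ n : ℤ, thetaCoeff q (n + 1) * a ^ (n + 1) =
      -a * q ^ (n + 1) * (thetaCoeff q n * a ^ n) := fun n => by
    rw [thetaCoeff_succ hq, zpow_add₀ ha0, zpow_one]; ring
  induction N using Int.induction_on with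
  | zero => simp [thetaCoeff_zero]
  | succ n ih => rw [kroneckerCoeff_succ hq hq1 ha0 ha, hr, ih]; ring
  | pred n ih =>
    have h1 := kroneckerCoeff_succ hq hq1 ha0 ha (-n - 1)
    have h2 := hr (-n - 1)
    rw [sub_add_cancel] at h1 h2
    rw [h1, h2] at ih
    have h3 : -a * q ^ (-n : ℤ) ≠ 0 := mul_ne_zero (neg_ne_zero.2 ha0) (zpow_ne_zero _ hq)
    refine mul_left_cancel₀ h3 (ih.trans ?_)
    ring

/-- The constant subtracted in the outer annulus contributes a multiple of `thetaRed q 1 = 0` to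
every Laurent coefficient of the product. Both annuli therefore lead to the coefficients
`kroneckerCoeff`. -/
theorem thetaRed_mul_ellKern {q a x : ℂ} (hq : q ≠ 0) (hq1 : ‖q‖ < 1) (ha0 : a ≠ 0)
    (ha : ∀ n : ℤ, a * q ^ n ≠ 1) (hx : ‖q‖ < ‖x‖) (hx' : ‖q‖ * ‖x‖ < 1) (hx1 : ‖x‖ ≠ 1) :
    thetaRed q x * ellKern q a x = kroneckerCoeff q a 0 * thetaRed q (a * x) := by
  have hx0 : x ≠ 0 := norm_pos_iff.1 ((norm_nonneg q).trans_lt hx)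
  have s1 := summable_thetaCoeff hq hq1 hx0
  have s2 := summable_ellKern hq hq1 ha0 ha hx hx' hx1
  have s3 := summable_mul_of_summable_norm s1.norm s2.norm
  have k1 : HasSum _ (thetaRed q x * ellKern q a x) := s1.hasSum.mul s2.hasSum s3
  let φ : ℤ × ℤ ≃ ℤ × ℤ :=
    { toFun := fun p => (p.1 - p.2, p.2)
      invFun := fun p => (p.1 + p.2, p.2)
      left_inv := fun p => by simp
      right_inv := fun p => by simp }
  have k2 := (φ.hasSum_iff.2 k1).prod_fiberwise (g := fun N =>
    kroneckerCoeff q a 0 * (thetaCoeff q N * (a * x) ^ N)) fun N => by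
    have h1 := (summable_kroneckerCoeff hq hq1 ha0 ha N).hasSum
    have h2 := ((Equiv.subLeft N).hasSum_iff.2 (hasSum_thetaRed hq hq1 one_ne_zero)).mul_right
      (if 1 < ‖x‖ then 1 else 0)
    rw [thetaRed_one hq hq1, zero_mul] at h2
    have h3 := (h1.sub h2).mul_left (x ^ N)
    change HasSum _ (x ^ N * (kroneckerCoeff q a N - 0)) at h3
    rw [sub_zero, kroneckerCoeff_eq hq hq1 ha0 ha, mul_comm (x ^ N), mul_assoc, mul_assoc,
      ← mul_zpow] at h3
    refine Eq.mp (congrArg (fun f => HasSum f _) (funext fun n => ?_)) h3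
    simp only [Function.comp_apply, Equiv.subLeft_apply, one_zpow, mul_one, φ, Equiv.coe_fn_mk]
    have e : x ^ N = x ^ (N - n) * x ^ n := by rw [← zpow_add₀ hx0, sub_add_cancel]
    rw [e]
    ring
  exact k2.unique ((hasSum_thetaRed hq hq1 (mul_ne_zero ha0 hx0)).mul_left _)


/-! ### Zeros of the theta function -/

theorem hasDerivAt_thetaRed {q x : ℂ} (hq : q ≠ 0) (hq1 : ‖q‖ < 1) (hx : x ≠ 0) :
    HasDerivAt (thetaRed q) (deriv (thetaRed q) x) x := by
  refine DifferentiableAt.hasDerivAt ?_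
  obtain ⟨τ, rfl⟩ := exists_exp_two_pi_I hq
  have hτ := im_pos_of_norm_exp_lt_one hq1
  have h1 : (fun w => jacobiTheta₂ ((Complex.log (w / x) + Complex.log x) / (2 * Real.pi * Complex.I)
      + 1 / 2 + τ / 2) τ) =ᶠ[𝓝 x] thetaRed (Complex.exp (2 * Real.pi * Complex.I * τ)) := by
    filter_upwards [isOpen_ne.mem_nhds hx] with w hw
    rw [← thetaRed_exp, two_pi_I_mul_div, Complex.exp_add, Complex.exp_log hx,
      Complex.exp_log (div_ne_zero hw hx), div_mul_cancel₀ _ hx]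
  refine DifferentiableAt.congr_of_eventuallyEq ?_ h1.symm
  have h2 : DifferentiableAt ℂ (fun w : ℂ => Complex.log (w / x)) x :=
    (differentiableAt_id.div_const x).clog (by simp [div_self hx])
  exact (differentiableAt_jacobiTheta₂_fst _ hτ).comp x
    ((((h2.add_const _).div_const _).add_const _).add_const _)

theorem hasSum_one_sub_inv {x : ℂ} (hx : ‖x‖ < 1) :
    HasSum (fun n : ℤ => x ^ n * if 0 ≤ n then 1 else 0) (1 - x)⁻¹ := by
  have h1 := hasSum_geometric_of_norm_lt_one hx
  rw [← (Nat.cast_injective (R := ℤ)).hasSum_iff]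
  · refine Eq.mp (congrArg (fun f => HasSum f _) (funext fun n => ?_)) h1
    simp
  · intro n hn
    rw [if_neg, mul_zero]
    rintro h
    exact hn ⟨n.toNat, by simp [h]⟩

/-- Kronecker's kernel has a simple pole with residue `-1` at `1`. -/
theorem exists_norm_ellKern_sub_le {q a : ℂ} (hq : q ≠ 0) (hq1 : ‖q‖ < 1) (ha0 : a ≠ 0)
    (ha : ∀ n : ℤ, a * q ^ n ≠ 1) :
    ∃ C : ℝ, ∀ x : ℂ, (1 + ‖q‖) / 2 ≤ ‖x‖ → ‖x‖ < 1 → ‖ellKern q a x - (1 - x)⁻¹‖ ≤ C := by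
  obtain ⟨C, hC0, hC⟩ := exists_inv_one_sub_le_pow hq hq1 ha0 ha
  have hr0 : 0 < (1 + ‖q‖) / 2 := by positivity
  have hr1 : ‖q‖ / ((1 + ‖q‖) / 2) < 1 := by
    rw [div_lt_one hr0]
    linarith
  have hs := (summable_pow_natAbs (by positivity) hr1).mul_left C
  refine ⟨∑' n : ℤ, C * (‖q‖ / ((1 + ‖q‖) / 2)) ^ n.natAbs, fun x hx hx1 => ?_⟩
  have hxq : ‖q‖ < ‖x‖ := by linarith
  have h1 := (summable_ellKern hq hq1 ha0 ha hxq
    ((mul_le_of_le_one_right (norm_nonneg q) hx1.le).trans_lt hq1) hx1.ne).hasSum.sub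
    (hasSum_one_sub_inv hx1)
  have h2 : HasSum _ (ellKern q a x - (1 - x)⁻¹) := h1
  rw [← h2.tsum_eq]
  refine tsum_of_norm_bounded hs.hasSum fun n => ?_
  rw [if_neg (not_lt.2 hx1.le), sub_zero, ← mul_sub, norm_mul, norm_zpow, div_pow]
  have h3 : ‖x‖ ^ n ≤ (((1 + ‖q‖) / 2) ^ n.natAbs)⁻¹ := by
    have hx0 : 0 < ‖x‖ := hr0.trans_le hx
    rw [← inv_pow]
    rcases le_total 0 n with hn | hn
    · obtain ⟨k, rfl⟩ := Int.eq_ofNat_of_zero_le hn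
      rw [Int.natAbs_natCast, zpow_natCast]
      refine pow_le_pow_left₀ hx0.le (hx1.le.trans ?_) k
      rw [one_le_inv₀ hr0]
      linarith
    · obtain ⟨k, hk⟩ := Int.eq_ofNat_of_zero_le (by omega : 0 ≤ -n)
      have e : n = -(k : ℤ) := by omega
      rw [e, Int.natAbs_neg, Int.natAbs_natCast, zpow_neg, zpow_natCast, ← inv_pow]
      exact pow_le_pow_left₀ (by positivity) (inv_anti₀ hr0 hx) k
  calc _ ≤ (((1 + ‖q‖) / 2) ^ n.natAbs)⁻¹ * (C * ‖q‖ ^ n.natAbs) :=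
        mul_le_mul h3 (hC n) (norm_nonneg _) (by positivity)
    _ = _ := by ring

theorem tendsto_ofReal_left : Filter.Tendsto (fun r : ℝ => (r : ℂ)) (𝓝[<] 1) (𝓝[≠] 1) := by
  refine tendsto_nhdsWithin_iff.2 ⟨?_, ?_⟩
  · have : Filter.Tendsto (fun r : ℝ => (r : ℂ)) (𝓝 1) (𝓝 ((1 : ℝ) : ℂ)) :=
      Complex.continuous_ofReal.continuousAt
    rw [Complex.ofReal_one] at this
    exact this.mono_left nhdsWithin_le_nhds
  · filter_upwards [self_mem_nhdsWithin] with r hr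
    simpa using ne_of_lt hr

theorem eventually_norm_ofReal {q : ℂ} (hq1 : ‖q‖ < 1) :
    ∀ᶠ r : ℝ in 𝓝[<] 1, (1 + ‖q‖) / 2 ≤ ‖(r : ℂ)‖ ∧ ‖(r : ℂ)‖ < 1 := by
  have h0 : (1 + ‖q‖) / 2 < 1 := by linarith
  filter_upwards [self_mem_nhdsWithin, Ioo_mem_nhdsLT h0] with r hr hr'
  have : 0 < r := lt_of_le_of_lt (by positivity) hr'.1
  rw [Complex.norm_of_nonneg this.le]
  exact ⟨hr'.1.le, hr⟩

theorem tendsto_one_sub_mul_ellKern {q a : ℂ} (hq : q ≠ 0) (hq1 : ‖q‖ < 1) (ha0 : a ≠ 0)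
    (ha : ∀ n : ℤ, a * q ^ n ≠ 1) :
    Filter.Tendsto (fun r : ℝ => ((r : ℂ) - 1) * ellKern q a r) (𝓝[<] 1) (𝓝 (-1)) := by
  obtain ⟨C, hC⟩ := exists_norm_ellKern_sub_le hq hq1 ha0 ha
  have h1 : Filter.Tendsto (fun r : ℝ => (r : ℂ) - 1) (𝓝[<] 1) (𝓝 0) := by
    have := (tendsto_ofReal_left.mono_right nhdsWithin_le_nhds).sub_const 1
    rwa [sub_self] at this
  have h2 : Filter.Tendsto (fun r : ℝ => ((r : ℂ) - 1) * (ellKern q a r - (1 - (r : ℂ))⁻¹))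
      (𝓝[<] 1) (𝓝 0) := by
    refine h1.zero_mul_isBoundedUnder_le ⟨C, ?_⟩
    rw [Filter.eventually_map]
    filter_upwards [eventually_norm_ofReal hq1] with r hr
    exact hC r hr.1 hr.2
  have h3 := h2.add_const (-1)
  rw [zero_add] at h3
  refine h3.congr' ?_
  filter_upwards [self_mem_nhdsWithin] with r hr
  have : (r : ℂ) - 1 ≠ 0 := sub_ne_zero.2 (by simpa using ne_of_lt hr)
  have h4 : 1 - (r : ℂ) ≠ 0 := by rwa [← neg_ne_zero, neg_sub]
  field_simp
  ring

/-- Let `x` tend to `1` along the real axis in `thetaRed_mul_ellKern`: on the left, the zero of the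
theta function meets the simple pole of the kernel, which leaves `-θ'(1)`. -/
theorem kroneckerCoeff_mul_thetaRed {q a : ℂ} (hq : q ≠ 0) (hq1 : ‖q‖ < 1) (ha0 : a ≠ 0)
    (ha : ∀ n : ℤ, a * q ^ n ≠ 1) :
    kroneckerCoeff q a 0 * thetaRed q a = -deriv (thetaRed q) 1 := by
  have h1 := ((hasDerivAt_iff_tendsto_slope.1 (hasDerivAt_thetaRed hq hq1 one_ne_zero)).comp
    tendsto_ofReal_left).mul (tendsto_one_sub_mul_ellKern hq hq1 ha0 ha)
  have h2 : Filter.Tendsto (fun r : ℝ => kroneckerCoeff q a 0 * thetaRed q (a * r)) (𝓝[<] 1)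
      (𝓝 (kroneckerCoeff q a 0 * thetaRed q a)) := by
    have h3 : Filter.Tendsto (fun r : ℝ => a * (r : ℂ)) (𝓝[<] 1) (𝓝 a) := by
      have := (tendsto_ofReal_left.mono_right nhdsWithin_le_nhds).const_mul a
      rwa [mul_one] at this
    exact ((hasDerivAt_thetaRed hq hq1 ha0).continuousAt.tendsto.comp h3).const_mul _
  refine (tendsto_nhds_unique (h2.congr' ?_) h1).trans (by ring)
  filter_upwards [self_mem_nhdsWithin, eventually_norm_ofReal hq1] with r hr hr'
  have h4 : (r : ℂ) - 1 ≠ 0 := sub_ne_zero.2 (by simpa using ne_of_lt hr)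
  rw [← thetaRed_mul_ellKern hq hq1 ha0 ha (by linarith [hr'.1])
    ((mul_le_of_le_one_right (norm_nonneg q) hr'.2.le).trans_lt hq1) hr'.2.ne]
  simp only [Function.comp_apply, slope_def_field, thetaRed_one hq hq1, sub_zero]
  field_simp

/-- The constant Fourier coefficient, found by integrating the series over a period, is `1`. -/
theorem exists_jacobiTheta₂_ne_zero {τ : ℂ} (hτ : 0 < τ.im) : ∃ z, jacobiTheta₂ z τ ≠ 0 := by
  by_contra! h
  have h1 : HasSum (fun n : ℤ => ∫ x in (0 : ℝ)..1, jacobiTheta₂_term n x τ)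
      (∫ x in (0 : ℝ)..1, (0 : ℂ)) := by
    refine intervalIntegral.hasSum_integral_of_dominated_convergence
      (fun n _ => ‖jacobiTheta₂_term n 0 τ‖) (fun n => ?_) (fun n => ?_) ?_ ?_ ?_
    · refine Continuous.aestronglyMeasurable ?_
      unfold jacobiTheta₂_term
      fun_prop
    · refine Filter.Eventually.of_forall fun x _ => ?_
      rw [norm_jacobiTheta₂_term, norm_jacobiTheta₂_term]
      simp
    · exact Filter.Eventually.of_forall fun x _ =>
        ((summable_jacobiTheta₂_term_iff 0 τ).2 hτ).norm
    · exact intervalIntegrable_const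
    · refine Filter.Eventually.of_forall fun x _ => ?_
      rw [← h x]
      exact hasSum_jacobiTheta₂_term x hτ
  have h2 : ∀ n : ℤ, ∫ x in (0 : ℝ)..1, jacobiTheta₂_term n x τ = if n = 0 then 1 else 0 := by
    intro n
    split_ifs with hn
    · subst hn
      simp [jacobiTheta₂_term]
    · have hc : 2 * Real.pi * Complex.I * n ≠ 0 :=
        mul_ne_zero Complex.two_pi_I_ne_zero (by exact_mod_cast hn)
      simp only [jacobiTheta₂_term, Complex.exp_add]
      rw [intervalIntegral.integral_mul_const, integral_exp_mul_complex hc]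
      have : Complex.exp (2 * Real.pi * Complex.I * n * (1 : ℝ)) = 1 := by
        rw [Complex.ofReal_one, mul_one, mul_comm, Complex.exp_int_mul_two_pi_mul_I]
      rw [this]
      simp
  simp only [h2, intervalIntegral.integral_zero] at h1
  exact one_ne_zero ((hasSum_ite_eq (0 : ℤ) (1 : ℂ)).unique h1)

/-- The identity theorem in the logarithmic coordinate, where the function is entire and the points
with `r → 1` accumulate at `0`. -/
theorem not_eventually_thetaRed_eq_zero {q : ℂ} (hq : q ≠ 0) (hq1 : ‖q‖ < 1) :
    ¬ ∀ᶠ r : ℝ in 𝓝[<] 1, thetaRed q r = 0 := by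
  intro h
  obtain ⟨τ, rfl⟩ := exists_exp_two_pi_I hq
  have hτ := im_pos_of_norm_exp_lt_one hq1
  obtain ⟨z₀, hz₀⟩ := exists_jacobiTheta₂_ne_zero hτ
  have hd : Differentiable ℂ fun z : ℂ => jacobiTheta₂ (z + 1 / 2 + τ / 2) τ := fun z =>
    (differentiableAt_jacobiTheta₂_fst _ hτ).comp z
      ((differentiableAt_id.add_const _).add_const _)
  have ha : AnalyticOnNhd ℂ (fun z : ℂ => jacobiTheta₂ (z + 1 / 2 + τ / 2) τ) Set.univ :=
    hd.differentiableOn.analyticOnNhd isOpen_univ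
  have ht : Filter.Tendsto (fun r : ℝ => Complex.log r / (2 * Real.pi * Complex.I)) (𝓝[<] 1)
      (𝓝[≠] 0) := by
    refine tendsto_nhdsWithin_iff.2 ⟨?_, ?_⟩
    · have := ((continuousAt_clog (by simp : (1 : ℂ) ∈ Complex.slitPlane)).tendsto.comp
        (tendsto_ofReal_left.mono_right nhdsWithin_le_nhds)).div_const (2 * Real.pi * Complex.I)
      simpa using this
    · filter_upwards [self_mem_nhdsWithin, Ioo_mem_nhdsLT (zero_lt_one (α := ℝ))] with r hr hr'
      refine div_ne_zero (fun h0 => ?_) Complex.two_pi_I_ne_zero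
      have := Complex.exp_log (x := (r : ℂ)) (by simpa using hr'.1.ne')
      rw [h0, Complex.exp_zero] at this
      exact ne_of_lt hr (by exact_mod_cast this.symm)
  have hf : ∃ᶠ z in 𝓝[≠] (0 : ℂ), jacobiTheta₂ (z + 1 / 2 + τ / 2) τ = 0 := by
    refine ht.frequently (Filter.Eventually.frequently ?_)
    filter_upwards [h, Ioo_mem_nhdsLT (zero_lt_one (α := ℝ))] with r hr hr'
    rwa [← thetaRed_exp, two_pi_I_mul_div, Complex.exp_log (by simpa using hr'.1.ne')]
  have h0 := ha.eqOn_zero_of_preconnected_of_frequently_eq_zero isPreconnected_univ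
    (Set.mem_univ 0) hf (Set.mem_univ (z₀ - 1 / 2 - τ / 2))
  have e : z₀ - 1 / 2 - τ / 2 + 1 / 2 + τ / 2 = z₀ := by ring
  exact hz₀ (by rw [← e]; exact h0)

/-- A zero at `a` outside `q^ℤ` forces `θ'(1) = 0` by Kronecker's formula. Take a real `b` near `1`
that is not a zero; its Kronecker constant is then `0`, so the product of the theta function and
`ellKern q b` vanishes. Near `1` the kernel has a pole and is non-zero, so the theta function
vanishes to the left of `1`, which is impossible. -/
theorem thetaRed_ne_zero {q a : ℂ} (hq : q ≠ 0) (hq1 : ‖q‖ < 1) (ha0 : a ≠ 0)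
    (ha : ∀ n : ℤ, a * q ^ n ≠ 1) : thetaRed q a ≠ 0 := by
  intro h
  have hd := kroneckerCoeff_mul_thetaRed hq hq1 ha0 ha
  rw [h, mul_zero, eq_comm, neg_eq_zero] at hd
  refine not_eventually_thetaRed_eq_zero hq hq1 ?_
  by_cases hb : ∀ᶠ r : ℝ in 𝓝[<] 1, thetaRed q r = 0
  · exact hb
  obtain ⟨b, hb, hb1, hb2⟩ := ((Filter.not_eventually.1 hb).and_eventually
    (eventually_norm_ofReal hq1)).exists
  have hb' : ∀ n : ℤ, (b : ℂ) * q ^ n ≠ 1 := by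
    intro n hn
    have hn' := congrArg norm hn
    rw [norm_mul, norm_zpow, norm_one] at hn'
    have hq0 := norm_pos_iff.2 hq
    rcases le_or_gt 0 n with h0 | h0
    · have := zpow_le_one₀ hq0 hq1.le h0
      nlinarith [norm_nonneg (b : ℂ)]
    · have h3 : ‖q‖ * ‖q‖ ^ n ≥ 1 := by
        rw [← zpow_one_add₀ hq0.ne']
        exact one_le_zpow_of_nonpos₀ hq0 hq1.le (by omega)
      have h4 : 0 < ‖q‖ ^ n := zpow_pos hq0 _
      nlinarith
  have hb0 : (b : ℂ) ≠ 0 := norm_pos_iff.1 (lt_of_lt_of_le (by positivity) hb1)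
  have hκ := kroneckerCoeff_mul_thetaRed hq hq1 hb0 hb'
  rw [hd, neg_zero] at hκ
  have hκ0 := (mul_eq_zero.1 hκ).resolve_right hb
  filter_upwards [eventually_norm_ofReal hq1, (tendsto_one_sub_mul_ellKern hq hq1 hb0
    hb').eventually_ne (neg_ne_zero.2 one_ne_zero)] with r hr hr'
  have := thetaRed_mul_ellKern hq hq1 hb0 hb' (x := r) (by linarith [hr.1])
    ((mul_le_of_le_one_right (norm_nonneg q) hr.2.le).trans_lt hq1) hr.2.ne
  rw [hκ0, zero_mul] at this
  exact (mul_eq_zero.1 this).resolve_right (right_ne_zero_of_mul hr')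

theorem mul_zpow_ne_one_of_norm {q x : ℂ} (hq : q ≠ 0) (hq1 : ‖q‖ < 1) (hx : ‖q‖ < ‖x‖)
    (hx' : ‖q‖ * ‖x‖ < 1) (hx1 : ‖x‖ ≠ 1) (n : ℤ) : x * q ^ n ≠ 1 := by
  intro hn
  have hn' := congrArg norm hn
  rw [norm_mul, norm_zpow, norm_one] at hn'
  have hq0 := norm_pos_iff.2 hq
  have h4 : 0 < ‖q‖ ^ n := zpow_pos hq0 _
  rcases lt_trichotomy n 0 with h0 | h0 | h0
  · have h3 : ‖q‖ * ‖q‖ ^ n ≥ 1 := by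
      rw [← zpow_one_add₀ hq0.ne']
      exact one_le_zpow_of_nonpos₀ hq0 hq1.le (by omega)
    nlinarith
  · rw [h0, zpow_zero, mul_one] at hn'
    exact hx1 hn'
  · have h3 : ‖q‖ ^ n ≤ ‖q‖ := by
      have := zpow_le_zpow_right_of_le_one₀ hq0 hq1.le (by omega : (1 : ℤ) ≤ n)
      rwa [zpow_one] at this
    nlinarith [norm_nonneg x]

/-- Kronecker's formula solved for `ellKern`, its constant being `-θ'(1) / θ(e^{-c})`. -/
theorem chainKern_eq_neg_wKernel {N : ℕ} {q c : ℂ} {u : Fin N → ℂ} {i j : Fin N} (hq : q ≠ 0)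
    (hq1 : ‖q‖ < 1) (hc : ∀ n : ℤ, Complex.exp c ≠ q ^ n) (hj : u j ≠ 0)
    (h1 : ‖q‖ * ‖u j‖ < ‖u i‖) (h2 : ‖q‖ * ‖u i‖ < ‖u j‖) (h3 : ‖u i‖ ≠ ‖u j‖) :
    chainKern q u c j i = -wKernel q c (u j) (u i) := by
  have hj' := norm_pos_iff.2 hj
  have ha : ∀ n : ℤ, Complex.exp (-c) * q ^ n ≠ 1 := by
    intro n hn
    refine hc n ?_
    rw [Complex.exp_neg] at hn
    exact (eq_of_inv_mul_eq_one hn)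
  have hx1 : ‖q‖ < ‖u i / u j‖ := by rwa [norm_div, lt_div_iff₀ hj']
  have hx2 : ‖q‖ * ‖u i / u j‖ < 1 := by rwa [norm_div, ← mul_div_assoc, div_lt_one hj']
  have hx3 : ‖u i / u j‖ ≠ 1 := by rwa [norm_div, Ne, div_eq_one_iff_eq hj'.ne']
  have hx0 : u i / u j ≠ 0 := norm_pos_iff.1 ((norm_nonneg q).trans_lt hx1)
  have k1 := thetaRed_mul_ellKern hq hq1 (Complex.exp_ne_zero (-c)) ha hx1 hx2 hx3
  have k2 := kroneckerCoeff_mul_thetaRed hq hq1 (Complex.exp_ne_zero (-c)) ha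
  have k3 := thetaRed_ne_zero hq hq1 (Complex.exp_ne_zero (-c)) ha
  have k4 := thetaRed_ne_zero hq hq1 hx0 (mul_zpow_ne_one_of_norm hq hq1 hx1 hx2 hx3)
  rw [chainKern, wKernel, ← neg_eq_iff_eq_neg.2 k2]
  generalize u i / u j = x at *
  field_simp
  linear_combination k1


/-! ### Holomorphic dependence on parameters -/

/-- The set where `f` vanishes locally is open, and it is relatively closed: a ball around a limit
point contains some point of the set, and every other point of the ball is joined to it by a complex
line, on which the identity theorem in one variable applies. -/
theorem eqOn_zero_of_isPreconnected_of_differentiableOn {E : Type*} [NormedAddCommGroup E]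
    [NormedSpace ℂ E] {U : Set E} (hU : IsOpen U) (hc : IsPreconnected U) {f : E → ℂ}
    (hf : DifferentiableOn ℂ f U) {p : E} (hp : p ∈ U) (h : ∀ᶠ y in 𝓝 p, f y = 0) :
    ∀ y ∈ U, f y = 0 := by
  have hV : IsOpen {y | ∀ᶠ x in 𝓝 y, f x = 0} := isOpen_setOfPred_eventually_nhds
  have key : U ⊆ {y | ∀ᶠ x in 𝓝 y, f x = 0} := by
    refine hc.subset_of_closure_inter_subset hV ⟨p, hp, h⟩ ?_
    rintro y ⟨hy, hyU⟩
    obtain ⟨r, hr, hrU⟩ := Metric.isOpen_iff.1 hU y hyU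
    obtain ⟨x, hx, hxr⟩ := Metric.mem_closure_iff.1 hy r hr
    rw [dist_comm] at hxr
    refine Metric.eventually_nhds_iff.2 ⟨r, hr, fun w hw => ?_⟩
    let L : ℂ → E := fun l => x + l • (w - x)
    have hL : Differentiable ℂ L := (differentiable_id.smul_const (w - x)).const_add x
    have hO : IsOpen (L ⁻¹' Metric.ball y r) := Metric.isOpen_ball.preimage hL.continuous
    have hC : Convex ℝ (L ⁻¹' Metric.ball y r) := by
      intro l hl k hk a b ha hb hab
      have e : L (a • l + b • k) = a • L l + b • L k := by
        simp only [L, smul_add, ← smul_assoc]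
        rw [add_add_add_comm, ← add_smul, hab, one_smul, add_smul]
      simp only [Set.mem_preimage, e]
      exact convex_ball y r hl hk ha hb hab
    have hA : AnalyticOnNhd ℂ (f ∘ L) (L ⁻¹' Metric.ball y r) := by
      refine DifferentiableOn.analyticOnNhd ?_ hO
      exact hf.comp hL.differentiableOn fun l hl => hrU hl
    have h0 : (0 : ℂ) ∈ L ⁻¹' Metric.ball y r := by simpa [L] using hxr
    have h1 : (1 : ℂ) ∈ L ⁻¹' Metric.ball y r := by simpa [L] using hw
    have hev : (f ∘ L) =ᶠ[𝓝 0] 0 := by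
      have : Filter.Tendsto L (𝓝 0) (𝓝 x) := by
        have := hL.continuous.tendsto 0
        simpa [L] using this
      exact this.eventually hx
    have := hA.eqOn_zero_of_preconnected_of_eventuallyEq_zero hC.isPreconnected h0 hev h1
    simpa [L] using this
  exact fun y hy => (key hy).self_of_nhds

theorem differentiableAt_div {E : Type*} [NormedAddCommGroup E] [NormedSpace ℂ E] {f g : E → ℂ}
    {y : E} (hf : DifferentiableAt ℂ f y) (hg : DifferentiableAt ℂ g y) (h : g y ≠ 0) :
    DifferentiableAt ℂ (fun y => f y / g y) y := by
  simp only [div_eq_mul_inv]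
  exact hf.mul (hg.inv h)

theorem differentiableAt_prod {E ι : Type*} [NormedAddCommGroup E] [NormedSpace ℂ E]
    {f : ι → E → ℂ} {y : E} (s : Finset ι) (hf : ∀ i ∈ s, DifferentiableAt ℂ (fun y => f i y) y) :
    DifferentiableAt ℂ (fun y => ∏ i ∈ s, f i y) y := by
  classical
  induction s using Finset.induction_on with
  | empty => simp
  | insert i s hi ih =>
    simp only [Finset.prod_insert hi]
    exact (hf i (Finset.mem_insert_self i s)).mul
      (ih fun j hj => hf j (Finset.mem_insert_of_mem hj))

/-- Local logarithms of `q` and `x` reduce this to the joint holomorphy of `jacobiTheta₂`. -/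
theorem differentiableAt_thetaRed {E : Type*} [NormedAddCommGroup E] [NormedSpace ℂ E]
    {q x : E → ℂ} {y : E} (hq : DifferentiableAt ℂ q y) (hx : DifferentiableAt ℂ x y)
    (hq0 : q y ≠ 0) (hq1 : ‖q y‖ < 1) (hx0 : x y ≠ 0) :
    DifferentiableAt ℂ (fun y => thetaRed (q y) (x y)) y := by
  have hlog : ∀ g : E → ℂ, DifferentiableAt ℂ g y → g y ≠ 0 → ∃ l : E → ℂ,
      DifferentiableAt ℂ l y ∧ ∀ᶠ w in 𝓝 y, Complex.exp (2 * Real.pi * Complex.I * l w) = g w := by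
    intro g hg hg0
    refine ⟨fun w => (Complex.log (g w / g y) + Complex.log (g y)) / (2 * Real.pi * Complex.I),
      differentiableAt_div (((differentiableAt_div hg (differentiableAt_const _) hg0).clog
        (by simp [div_self hg0])).add_const _) (differentiableAt_const _)
        Complex.two_pi_I_ne_zero, ?_⟩
    filter_upwards [hg.continuousAt.eventually_ne hg0] with w hw
    rw [two_pi_I_mul_div, Complex.exp_add, Complex.exp_log hg0, Complex.exp_log (div_ne_zero hw hg0),
      div_mul_cancel₀ _ hg0]
  obtain ⟨τ, hτ, hτq⟩ := hlog q hq hq0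
  obtain ⟨z, hz, hzx⟩ := hlog x hx hx0
  have h0 : 0 < (τ y).im := im_pos_of_norm_exp_lt_one (by rwa [hτq.self_of_nhds])
  have h1 : (fun w => jacobiTheta₂ (z w + 1 / 2 + τ w / 2) (τ w)) =ᶠ[𝓝 y]
      fun w => thetaRed (q w) (x w) := by
    filter_upwards [hτq, hzx] with w h2 h3
    rw [← h2, ← h3, thetaRed_exp]
  refine DifferentiableAt.congr_of_eventuallyEq ?_ h1.symm
  exact (hasFDerivAt_jacobiTheta₂ _ h0).differentiableAt.comp (f := fun w =>
    (z w + 1 / 2 + τ w / 2, τ w)) y (((hz.add_const _).add (differentiableAt_div hτ (differentiableAt_const _)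
      two_ne_zero)).prodMk hτ)

/-- The factor `n` produced by differentiating a Laurent series is dominated by the values of `x^n`
at `2` and `1/2`, so that the series at these points provide a majorant. -/
theorem natAbs_le_two_zpow (n : ℤ) : (n.natAbs : ℝ) ≤ 2 ^ n + (2 ^ n)⁻¹ := by
  rcases le_total 0 n with hn | hn
  · obtain ⟨k, rfl⟩ := Int.eq_ofNat_of_zero_le hn
    have h1 : (k : ℝ) ≤ 2 ^ k := by exact_mod_cast k.lt_two_pow_self.le
    have h2 : (0 : ℝ) ≤ (2 ^ k)⁻¹ := by positivity
    rw [Int.natAbs_natCast, zpow_natCast]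
    linarith
  · obtain ⟨k, hk⟩ := Int.eq_ofNat_of_zero_le (by omega : 0 ≤ -n)
    have e : n = -(k : ℤ) := by omega
    have h1 : (k : ℝ) ≤ 2 ^ k := by exact_mod_cast k.lt_two_pow_self.le
    have h2 : (0 : ℝ) ≤ (2 ^ k)⁻¹ := by positivity
    rw [e, Int.natAbs_neg, Int.natAbs_natCast, zpow_neg, zpow_natCast, inv_inv]
    linarith

theorem summable_two_zpow_mul_thetaCoeff {q : ℂ} (hq : q ≠ 0) (hq1 : ‖q‖ < 1) :
    Summable fun n : ℤ => (2 ^ n + (2 ^ n)⁻¹ : ℝ) * ‖thetaCoeff q n‖ := by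
  have h1 := (summable_thetaCoeff hq hq1 (two_ne_zero (α := ℂ))).norm
  have h2 := (summable_thetaCoeff hq hq1 (inv_ne_zero (two_ne_zero (α := ℂ)))).norm
  refine (h1.add h2).congr fun n => ?_
  simp only [norm_mul, norm_zpow, norm_inv, Complex.norm_ofNat, inv_zpow]
  ring

theorem hasSum_deriv_thetaRed {q : ℂ} (hq : q ≠ 0) (hq1 : ‖q‖ < 1) :
    HasSum (fun n : ℤ => thetaCoeff q n * n) (deriv (thetaRed q) 1) := by
  have hU : IsOpen {x : ℂ | 2⁻¹ < ‖x‖ ∧ ‖x‖ < 2} :=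
    (isOpen_lt continuous_const continuous_norm).inter (isOpen_lt continuous_norm continuous_const)
  have hne : ∀ x ∈ {x : ℂ | 2⁻¹ < ‖x‖ ∧ ‖x‖ < 2}, x ≠ 0 := fun x hx =>
    norm_pos_iff.1 (lt_trans (by norm_num) hx.1)
  have h := Complex.hasSum_deriv_of_summable_norm (F := fun (n : ℤ) x => thetaCoeff q n * x ^ n)
    (summable_two_zpow_mul_thetaCoeff hq hq1)
    (fun n x hx => ((differentiableAt_zpow.2 (Or.inl (hne x hx))).const_mul
      _).differentiableWithinAt) hU (fun n x hx => ?_)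
    (show (1 : ℂ) ∈ {x : ℂ | 2⁻¹ < ‖x‖ ∧ ‖x‖ < 2} by norm_num [Set.mem_ofPred_eq])
  · refine Eq.mp (congrArg (fun f => HasSum f _) (funext fun n => ?_)) h
    rw [deriv_const_mul _ (differentiableAt_zpow.2 (Or.inl one_ne_zero)), deriv_zpow]
    simp
  · rw [norm_mul, mul_comm, norm_zpow]
    refine mul_le_mul_of_nonneg_right ?_ (norm_nonneg _)
    have h2 : (0 : ℝ) < 2 ^ n := by positivity
    have h2' := inv_pos.2 h2
    have hx0 := norm_pos_iff.2 (hne x hx)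
    rcases le_total 0 n with hn | hn
    · obtain ⟨k, rfl⟩ := Int.eq_ofNat_of_zero_le hn
      have := pow_le_pow_left₀ hx0.le hx.2.le k
      simp only [zpow_natCast] at *
      linarith
    · obtain ⟨k, hk⟩ := Int.eq_ofNat_of_zero_le (by omega : 0 ≤ -n)
      have e : n = -(k : ℤ) := by omega
      subst e
      have h3 : ‖x‖⁻¹ ≤ 2 := by
        rw [inv_le_comm₀ hx0 two_pos]
        exact hx.1.le
      have := pow_le_pow_left₀ (inv_nonneg.2 hx0.le) h3 k
      simp only [zpow_neg, zpow_natCast, inv_inv, inv_pow] at *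
      linarith

/-- The exponents `n (n + 1) / 2` are non-negative, so the series of `hasSum_deriv_thetaRed`
consists of functions of `q` holomorphic on a disc. Its terms are dominated by those at the real
radius `r > ‖q‖`. -/
theorem differentiableAt_deriv_thetaRed {q : ℂ} (hq : q ≠ 0) (hq1 : ‖q‖ < 1) :
    DifferentiableAt ℂ (fun q => deriv (thetaRed q) 1) q := by
  set r : ℝ := (1 + ‖q‖) / 2 with hr
  have hr0 : 0 < r := by positivity
  have hr1 : r < 1 := by linarith
  have hqr : ‖q‖ < r := by linarith
  have hs := summable_two_zpow_mul_thetaCoeff (q := (r : ℂ)) (by simpa using hr0.ne')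
    (by rwa [Complex.norm_of_nonneg hr0.le])
  have htri : ∀ n : ℤ, 0 ≤ n * (n + 1) / 2 := fun n => by
    refine Int.ediv_nonneg ?_ (by norm_num)
    rcases le_or_gt 0 n with h | h
    · exact mul_nonneg h (by omega)
    · exact mul_nonneg_of_nonpos_of_nonpos h.le (by omega)
  have hd := Complex.differentiableOn_tsum_of_summable_norm (F := fun (n : ℤ) q => thetaCoeff q n * n) hs
    (U := Metric.ball 0 r) (fun n => ?_) Metric.isOpen_ball (fun n w hw => ?_)
  · refine DifferentiableAt.congr_of_eventuallyEq
      (hd.differentiableAt (Metric.isOpen_ball.mem_nhds (by simpa using hqr))) ?_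
    filter_upwards [isOpen_ne.mem_nhds hq, Metric.isOpen_ball.mem_nhds
      (show q ∈ Metric.ball 0 1 by simpa using hq1)] with w hw hw1
    exact (hasSum_deriv_thetaRed hw (by simpa using hw1)).tsum_eq.symm
  · unfold thetaCoeff
    exact fun w _ => (((differentiableAt_zpow.2 (Or.inr (htri n))).const_mul _).mul_const
      _).differentiableWithinAt
  · have hw' : ‖w‖ ≤ r := by simpa using (Metric.mem_ball.1 hw).le
    rw [norm_mul, mul_comm]
    refine mul_le_mul ?_ ?_ (norm_nonneg _) (by positivity)
    · rw [Complex.norm_intCast, ← Int.cast_abs, Int.abs_eq_natAbs, Int.cast_natCast]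
      exact natAbs_le_two_zpow n
    · rw [thetaCoeff, thetaCoeff, norm_mul, norm_mul, norm_zpow w, norm_zpow (r : ℂ),
        Complex.norm_of_nonneg hr0.le]
      refine mul_le_mul_of_nonneg_left ?_ (norm_nonneg _)
      obtain ⟨k, hk⟩ := Int.eq_ofNat_of_zero_le (htri n)
      rw [hk, zpow_natCast, zpow_natCast]
      exact pow_le_pow_left₀ (norm_nonneg _) hw' k

theorem differentiableAt_wKernel {E : Type*} [NormedAddCommGroup E] [NormedSpace ℂ E]
    {q c w z : E → ℂ} {y : E} (hq : DifferentiableAt ℂ q y) (hc : DifferentiableAt ℂ c y)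
    (hw : DifferentiableAt ℂ w y) (hz : DifferentiableAt ℂ z y) (hq0 : q y ≠ 0) (hq1 : ‖q y‖ < 1)
    (hcq : ∀ n : ℤ, Complex.exp (c y) ≠ q y ^ n) (hw0 : w y ≠ 0) (hz0 : z y ≠ 0)
    (hzw : ∀ n : ℤ, w y ≠ q y ^ n * z y) :
    DifferentiableAt ℂ (fun y => wKernel (q y) (c y) (w y) (z y)) y := by
  have h1 : DifferentiableAt ℂ (fun y => Complex.exp (-c y)) y := hc.neg.cexp
  have h2 : DifferentiableAt ℂ (fun y => z y / w y) y := differentiableAt_div hz hw hw0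
  have h0 := div_ne_zero hz0 hw0
  refine (differentiableAt_div ((differentiableAt_deriv_thetaRed hq0 hq1).comp y hq)
    (differentiableAt_thetaRed hq h1 hq0 hq1 (Complex.exp_ne_zero _)) ?_).mul
    (differentiableAt_div (differentiableAt_thetaRed hq (h1.mul h2) hq0 hq1
      (mul_ne_zero (Complex.exp_ne_zero _) h0)) (hw.mul (differentiableAt_thetaRed hq h2 hq0 hq1 h0)) (mul_ne_zero hw0 ?_))
  · refine thetaRed_ne_zero hq0 hq1 (Complex.exp_ne_zero _) fun n hn => hcq n ?_
    rw [Complex.exp_neg] at hn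
    exact eq_of_inv_mul_eq_one hn
  · refine thetaRed_ne_zero hq0 hq1 h0 fun n hn => hzw n ?_
    rw [div_mul_eq_mul_div, div_eq_one_iff_eq hw0] at hn
    rw [← hn, mul_comm]

theorem differentiableAt_kernelChain {E : Type*} [NormedAddCommGroup E] [NormedSpace ℂ E] {m : ℕ}
    {q z : E → ℂ} {c t : E → Fin m → ℂ} {y : E} (hq : DifferentiableAt ℂ q y)
    (hc : ∀ i, DifferentiableAt ℂ (fun y => c y i) y)
    (ht : ∀ i, DifferentiableAt ℂ (fun y => t y i) y) (hz : DifferentiableAt ℂ z y) (hq0 : q y ≠ 0)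
    (hq1 : ‖q y‖ < 1) (hd : DistinctOnCurve (q y) (z y) (t y)) (hk : KernelParamsRegular (q y) (c y))
    (σ : Equiv.Perm (Fin m)) :
    DifferentiableAt ℂ (fun y => kernelChain (q y) (c y) (t y) (z y) σ) y := by
  unfold kernelChain
  refine differentiableAt_prod Finset.univ fun j _ => DifferentiableAt.fun_neg ?_
  have hsum : ∀ n : ℤ, Complex.exp (∑ k ∈ Finset.Iic j, c y (σ k)) ≠ q y ^ n := by
    intro n
    have := hk ((Finset.Iic j).map σ.toEmbedding) ((Finset.nonempty_Iic).map) n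
    rwa [Finset.sum_map] at this
  have hsd : DifferentiableAt ℂ (fun y => ∑ k ∈ Finset.Iic j, c y (σ k)) y :=
    DifferentiableAt.fun_sum fun k _ => hc (σ k)
  rcases Fin.eq_castSucc_or_eq_last j.succ with ⟨i, hi⟩ | hl
  · simp only [hi, Fin.snoc_castSucc]
    refine differentiableAt_wKernel hq hsd (ht _) (ht _) hq0 hq1 hsum (hd.2.1 _) (hd.2.1 _)
      (hd.2.2.2 _ _ fun h => ?_)
    have := congrArg Fin.val hi
    rw [σ.injective h] at this
    simp at this
  · simp only [hl, Fin.snoc_last]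
    exact differentiableAt_wKernel hq hsd (ht _) hz hq0 hq1 hsum (hd.2.1 _) hd.1 (hd.2.2.1 _)

theorem eventually_traceDomain {E Δ : Type*} [TopologicalSpace E] [Finite Δ] {m : ℕ}
    {q z : E → ℂ} {c : E → Δ → ℂ} {t : E → Fin m → ℂ} {p : E} (hq : ContinuousAt q p)
    (hc : ∀ a, ContinuousAt (fun y => c y a) p) (hz : ContinuousAt z p)
    (ht : ∀ i, ContinuousAt (fun y => t y i) p) (h : TraceDomain (q p) (c p) (z p) (t p)) :
    ∀ᶠ y in 𝓝 p, TraceDomain (q y) (c y) (z y) (t y) := by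
  obtain ⟨h1, h2, h3, h4, h5, h6⟩ := h
  have hexp : ∀ a, ContinuousAt (fun y => ‖Complex.exp (-c y a)‖) p := fun a =>
    (Complex.continuous_exp.continuousAt.comp (hc a).neg).norm
  refine (hq.eventually_ne h1).and ((hq.norm.eventually_lt continuousAt_const h2).and
    ((hz.eventually_ne h3).and (Filter.Eventually.and ?_ (Filter.Eventually.and ?_ ?_))))
  · exact Filter.eventually_all.2 fun a => (hq.norm.eventually_lt (hexp a) (h4 a).1).and
      ((hexp a).eventually_lt continuousAt_const (h4 a).2)
  · exact Filter.eventually_all.2 fun i => ((hq.mul hz).norm.eventually_lt (ht i).norm (h5 i).1).and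
      ((ht i).norm.eventually_lt hz.norm (h5 i).2)
  · refine Filter.eventually_all.2 fun i => Filter.eventually_all.2 fun j => ?_
    by_cases hij : i < j
    · exact ((ht j).norm.eventually_lt (ht i).norm (h6 i j hij)).mono fun y hy _ => hy
    · exact Filter.Eventually.of_forall fun y hy => absurd hy hij


/-! ### The vector fields of the left action are homogeneous -/

/-- By Cayley–Hamilton, since the characteristic polynomial is a power of the variable. Hence the
truncation in `nilExp` omits only zero terms. -/
theorem pow_finrank_eq_zero {V : Type*} [AddCommGroup V] [Module ℂ V] [FiniteDimensional ℂ V]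
    {f : Module.End ℂ V} (hf : IsNilpotent f) : f ^ Module.finrank ℂ V = 0 := by
  have h := f.aeval_self_charpoly
  rwa [(LinearMap.isNilpotent_iff_charpoly f).1 hf, map_pow, Polynomial.aeval_X] at h

theorem nilExp_eq_exp {V : Type*} [AddCommGroup V] [Module ℂ V] [FiniteDimensional ℂ V]
    [Module ℚ V] [IsScalarTower ℚ ℂ V] {f : Module.End ℂ V} (hf : IsNilpotent f) :
    nilExp f = IsNilpotent.exp f := by
  rw [IsNilpotent.exp_eq_sum (pow_finrank_eq_zero hf), nilExp]
  refine Finset.sum_congr rfl fun k _ => LinearMap.ext fun u => ?_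
  rw [LinearMap.smul_apply, LinearMap.smul_apply, ← algebraMap_smul ℂ ((k.factorial : ℚ)⁻¹)]
  simp

theorem isUnit_nilExp {V : Type*} [AddCommGroup V] [Module ℂ V] [FiniteDimensional ℂ V]
    {f : Module.End ℂ V} (hf : IsNilpotent f) : IsUnit (nilExp f) := by
  let _ : Module ℚ V := Module.compHom V (algebraMap ℚ ℂ)
  have : IsScalarTower ℚ ℂ V := IsScalarTower.of_algebraMap_smul fun r u => rfl
  rw [nilExp_eq_exp hf]
  exact hf.isUnit_exp

theorem nilExp_zero {V : Type*} [AddCommGroup V] [Module ℂ V] [FiniteDimensional ℂ V] :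
    nilExp (0 : Module.End ℂ V) = 1 := by
  let _ : Module ℚ V := Module.compHom V (algebraMap ℚ ℂ)
  have : IsScalarTower ℚ ℂ V := IsScalarTower.of_algebraMap_smul fun r u => rfl
  rw [nilExp_eq_exp IsNilpotent.zero, IsNilpotent.exp_zero]

/-- The exponential of a nilpotent derivation is an automorphism. -/
theorem nilExp_lie {L : Type*} [LieRing L] [LieAlgebra ℂ L] [FiniteDimensional ℂ L] {y : L}
    (hy : IsNilpotent (LieAlgebra.ad ℂ L y)) (v w : L) :
    nilExp (LieAlgebra.ad ℂ L y) ⁅v, w⁆ =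
      ⁅nilExp (LieAlgebra.ad ℂ L y) v, nilExp (LieAlgebra.ad ℂ L y) w⁆ := by
  let _ : Module ℚ L := Module.compHom L (algebraMap ℚ ℂ)
  let _ : LieAlgebra ℚ L :=
    { lie_smul := fun r u v => lie_smul (algebraMap ℚ ℂ r) u v }
  have : IsScalarTower ℚ ℂ L := IsScalarTower.of_algebraMap_smul fun r u => rfl
  have h2 := (LieDerivation.exp (LieDerivation.ad ℂ L y) (by simpa using hy)).map_lie v w
  rw [nilExp_eq_exp hy]
  simpa [LieDerivation.exp_map_apply] using h2

theorem isNilpotent_smul {V : Type*} [AddCommGroup V] [Module ℂ V] {f : Module.End ℂ V}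
    (hf : IsNilpotent f) (x : ℂ) : IsNilpotent (x • f) := by
  obtain ⟨k, hk⟩ := hf
  exact ⟨k, by rw [smul_pow, hk, smul_zero]⟩

theorem nilExp_apply {V : Type*} [AddCommGroup V] [Module ℂ V] (f : Module.End ℂ V) (y : V) :
    nilExp f y = ∑ k ∈ Finset.range (Module.finrank ℂ V), ((k.factorial : ℂ)⁻¹) • (f ^ k) y := by
  simp [nilExp, LinearMap.sum_apply]

theorem nilExp_smul_comm {V : Type*} [AddCommGroup V] [Module ℂ V] {f τ : Module.End ℂ V} {s x : ℂ}
    (h : ∀ y, τ (f y) = s • f (τ y)) (y : V) : τ (nilExp (x • f) y) = nilExp ((s * x) • f) (τ y) := by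
  have hk : ∀ k y, τ ((f ^ k) y) = s ^ k • (f ^ k) (τ y) := by
    intro k
    induction k with
    | zero => simp
    | succ k ih =>
      intro y
      rw [pow_succ, Module.End.mul_apply, ih, h, map_smul, Module.End.mul_apply, smul_smul, pow_succ]
  rw [nilExp_apply, nilExp_apply, map_sum]
  refine Finset.sum_congr rfl fun k _ => ?_
  rw [map_smul, smul_pow, smul_pow, LinearMap.smul_apply, LinearMap.smul_apply, map_smul, hk,
    smul_smul (x ^ k), mul_pow, mul_comm]

theorem hasDerivAt_nilExp {V : Type*} [AddCommGroup V] [Module ℂ V] [FiniteDimensional ℂ V]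
    {f : Module.End ℂ V} (hf : IsNilpotent f) (x w : ℂ) (y : V) (l : Module.Dual ℂ V) :
    HasDerivAt (fun r : ℂ => l (nilExp ((x + r * w) • f) y)) (l (w • f (nilExp (x • f) y))) 0 := by
  have h0 := pow_finrank_eq_zero hf
  simp only [nilExp_apply, smul_pow, LinearMap.smul_apply, map_sum, map_smul, smul_eq_mul]
  have hx : HasDerivAt (fun r : ℂ => x + r * w) w 0 := by
    simpa using ((hasDerivAt_id (0 : ℂ)).mul_const w).const_add x
  have h1 : HasDerivAt (fun r : ℂ => ∑ k ∈ Finset.range (Module.finrank ℂ V),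
      ((k.factorial : ℂ))⁻¹ * ((x + r * w) ^ k * l ((f ^ k) y)))
      (∑ k ∈ Finset.range (Module.finrank ℂ V),
        ((k.factorial : ℂ))⁻¹ * ((k * x ^ (k - 1) * w) * l ((f ^ k) y))) 0 := by
    refine HasDerivAt.fun_sum fun k _ => ?_
    have := ((hx.pow k).mul_const (l ((f ^ k) y))).const_mul ((k.factorial : ℂ))⁻¹
    simpa using this
  refine Eq.mp (congrArg (fun d => HasDerivAt _ d 0) ?_) h1
  have e : ∀ k, f ((f ^ k) y) = (f ^ (k + 1)) y := fun k => by rw [pow_succ']; rfl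
  simp only [e]
  generalize Module.finrank ℂ V = n at h0
  cases n with
  | zero => simp
  | succ n =>
    -- The term `k = 0` of the derivative is zero, and so is the last term on the other side,
    -- because `f` to the power `finrank` vanishes; the others match by a shift of the index.
    rw [Finset.sum_range_succ', Finset.sum_range_succ, h0]
    simp only [Nat.cast_zero, zero_mul, mul_zero, add_zero, LinearMap.zero_apply, map_zero,
      Finset.mul_sum]
    refine Finset.sum_congr rfl fun k _ => ?_
    have hk : (k.factorial : ℂ) ≠ 0 := by exact_mod_cast k.factorial_ne_zero
    have hk1 : ((k : ℂ) + 1) ≠ 0 := by exact_mod_cast k.succ_ne_zero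
    rw [Nat.factorial_succ, Nat.add_sub_cancel]
    push_cast
    field_simp

/-- Derivatives are tested against linear forms, so `V` needs no topology; a basis reduces the
product rule to the scalar one. -/
theorem hasDerivAt_mul_apply {V : Type*} [AddCommGroup V] [Module ℂ V] [FiniteDimensional ℂ V]
    {A B : ℂ → Module.End ℂ V} {A' B' : Module.End ℂ V} {x : ℂ}
    (hA : ∀ y (l : Module.Dual ℂ V), HasDerivAt (fun r => l (A r y)) (l (A' y)) x)
    (hB : ∀ y (l : Module.Dual ℂ V), HasDerivAt (fun r => l (B r y)) (l (B' y)) x)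
    (y : V) (l : Module.Dual ℂ V) :
    HasDerivAt (fun r => l (A r (B r y))) (l (A' (B x y) + A x (B' y))) x := by
  let β := Module.finBasis ℂ V
  have h1 : ∀ (C : Module.End ℂ V) v, l (C v) = ∑ i, β.coord i v * l (C (β i)) := by
    intro C v
    conv_lhs => rw [← β.sum_repr v]
    rw [map_sum, map_sum]
    simp [map_smul]
  have h2 : HasDerivAt (fun r => ∑ i, β.coord i (B r y) * l (A r (β i)))
      (∑ i, (β.coord i (B' y) * l (A x (β i)) + β.coord i (B x y) * l (A' (β i)))) x :=
    HasDerivAt.fun_sum fun i _ => (hB y (β.coord i)).mul (hA (β i) l)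
  rw [map_add, h1 A', h1 (A x)]
  simp only [fun r => h1 (A r) (B r y)]
  refine Eq.mp (congrArg (fun d => HasDerivAt _ d x) ?_) h2
  rw [Finset.sum_add_distrib, add_comm]

/-! ### Logarithmic derivative of the coordinates on the unipotent group. -/

section

variable {L : Type*} [LieRing L] [LieAlgebra ℂ L] {Δ : Type*}

/-- The partial products in the coordinates on the unipotent group. -/
noncomputable def cellProd (e : Δ → L) (x : Δ → ℂ) (l : List Δ) : Module.End ℂ L :=
  (l.map fun c => nilExp (x c • LieAlgebra.ad ℂ L (e c))).prod

/-- The logarithmic derivative of `cellProd` in the direction `v`. -/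
noncomputable def cellVelocity (e : Δ → L) (x v : Δ → ℂ) : List Δ → L
  | [] => 0
  | c :: l => v c • e c + nilExp (x c • LieAlgebra.ad ℂ L (e c)) (cellVelocity e x v l)

theorem bigCell_eq_cellProd {s : ℕ} (ord : Fin s ≃ Δ) (e : Δ → L) (x : Δ → ℂ) :
    bigCell ord e x = cellProd e x (List.ofFn ord) := by
  rw [bigCell, cellProd, List.map_ofFn]
  rfl

theorem cellVelocity_sub (e : Δ → L) (x v w : Δ → ℂ) (l : List Δ) :
    cellVelocity e x (v - w) l = cellVelocity e x v l - cellVelocity e x w l := by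
  induction l with
  | nil => simp [cellVelocity]
  | cons c l ih =>
    simp only [cellVelocity, ih, map_sub, Pi.sub_apply, sub_smul]
    abel

theorem cellVelocity_smul (e : Δ → L) (x v : Δ → ℂ) (r : ℂ) (l : List Δ) :
    cellVelocity e x (r • v) l = r • cellVelocity e x v l := by
  induction l with
  | nil => simp [cellVelocity]
  | cons c l ih => simp only [cellVelocity, ih, map_smul, Pi.smul_apply, smul_eq_mul, mul_smul, smul_add]

theorem cellVelocity_scale {e : Δ → L} {τ : Module.End ℂ L} {s : Δ → ℂ}
    (hτ : ∀ c y, τ ⁅e c, y⁆ = s c • ⁅e c, τ y⁆) (hτe : ∀ c, τ (e c) = s c • e c) (x v : Δ → ℂ)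
    (l : List Δ) : τ (cellVelocity e x v l) =
      cellVelocity e (fun c => s c * x c) (fun c => s c * v c) l := by
  induction l with
  | nil => simp [cellVelocity]
  | cons c l ih =>
    rw [cellVelocity, cellVelocity, map_add, map_smul, hτe, smul_smul, mul_comm (v c),
      nilExp_smul_comm (s := s c) (fun y => hτ c y), ih]

variable [FiniteDimensional ℂ L]

/-- Each factor contributes its own `e c`, transported by the factors in front of it. These are
automorphisms, so they carry the inner derivation of an element to that of its image. -/
theorem hasDerivAt_cellProd {e : Δ → L} (he : ∀ c, IsNilpotent (LieAlgebra.ad ℂ L (e c)))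
    (x v : Δ → ℂ) (l : List Δ) (y : L) (φ : Module.Dual ℂ L) :
    HasDerivAt (fun r : ℂ => φ (cellProd e (fun c => x c + r * v c) l y))
      (φ ⁅cellVelocity e x v l, cellProd e x l y⁆) 0 := by
  induction l generalizing y φ with
  | nil => simpa [cellProd, cellVelocity] using hasDerivAt_const (0 : ℂ) (φ y)
  | cons c l ih =>
    have h := hasDerivAt_mul_apply (A := fun r : ℂ => nilExp ((x c + r * v c) • LieAlgebra.ad ℂ L (e c)))
      (A' := v c • (LieAlgebra.ad ℂ L (e c) * nilExp (x c • LieAlgebra.ad ℂ L (e c))))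
      (B := fun r => cellProd e (fun c => x c + r * v c) l)
      (B' := LieAlgebra.ad ℂ L (cellVelocity e x v l) * cellProd e x l) (x := 0)
      (fun y φ => hasDerivAt_nilExp (he c) (x c) (v c) y φ) (fun y φ => ih y φ) y φ
    have e1 : ∀ x : Δ → ℂ, cellProd e x (c :: l) y =
        nilExp (x c • LieAlgebra.ad ℂ L (e c)) (cellProd e x l y) := fun x => by
      simp [cellProd]
    simp only [e1]
    refine Eq.mp (congrArg (fun d => HasDerivAt _ d 0) ?_) h
    have e2 := fun v w => nilExp_lie (y := x c • e c) (by
      rw [map_smul]; exact isNilpotent_smul (he c) (x c)) v w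
    simp only [map_smul] at e2
    simp [cellVelocity, add_lie, e2]

theorem isUnit_cellProd {e : Δ → L} (he : ∀ c, IsNilpotent (LieAlgebra.ad ℂ L (e c))) (x : Δ → ℂ)
    (l : List Δ) : IsUnit (cellProd e x l) := by
  induction l with
  | nil => simp [cellProd]
  | cons c l ih =>
    have : cellProd e x (c :: l) = nilExp (x c • LieAlgebra.ad ℂ L (e c)) * cellProd e x l := by
      simp [cellProd]
    rw [this]
    exact (isUnit_nilExp (isNilpotent_smul (he c) (x c))).mul ih

/-- The infinitesimal left action in terms of the logarithmic derivative. -/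
theorem IsInfinitesimalLeftAction.cellVelocity_eq [LieModule.IsFaithful ℂ L L] {s : ℕ}
    {ord : Fin s ≃ Δ} {e : Δ → L} (he : ∀ c, IsNilpotent (LieAlgebra.ad ℂ L (e c))) {ξ : L}
    (hξ : IsNilpotent (LieAlgebra.ad ℂ L ξ)) {v : Δ → MvPolynomial Δ ℂ}
    (h : IsInfinitesimalLeftAction ord e ξ v) (x : Δ → ℂ) :
    cellVelocity e x (fun c => eval x (v c)) (List.ofFn ord) = -ξ := by
  -- An element is determined by its brackets with all `w`, and each `w` is of the form `cellProd e
  -- x _ y` because the product is invertible.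
  refine LieModule.ext_of_isFaithful (R := ℂ) (M := L) fun w => ?_
  obtain ⟨y, rfl⟩ := ((Module.End.isUnit_iff _).1
    (isUnit_cellProd he x (List.ofFn ord))).surjective w
  rw [← sub_eq_zero]
  refine (Module.forall_dual_apply_eq_zero_iff ℂ _).1 fun φ => ?_
  have h1 := hasDerivAt_cellProd he x (fun c => eval x (v c)) (List.ofFn ord) y φ
  have h2 := hasDerivAt_nilExp hξ 0 (-1) (cellProd e x (List.ofFn ord) y) φ
  have h3 := h x y φ
  simp only [bigCell_eq_cellProd] at h3
  have h4 := h1.sub h2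
  have e1 : ∀ r : ℂ, (0 + r * -1) = -r := fun r => by ring
  simp only [e1] at h4
  have h5 := h4.unique h3
  rw [← h5, zero_smul, nilExp_zero, ← map_sub]
  simp

end


/-! ### Uniqueness of the velocity and scaling under the torus. -/

section

variable {L : Type*} [LieRing L] [LieAlgebra ℂ L] {Δ : Type*}

/-- The sum of the eigenspaces of `D` for the integers `≥ k`. -/
noncomputable def eigenFiltration (D : Module.End ℂ L) (k : ℤ) : Submodule ℂ L :=
  ⨆ j : {j : ℤ // k ≤ j}, D.eigenspace (j.1 : ℂ)

theorem eigenspace_le_eigenFiltration (D : Module.End ℂ L) {k j : ℤ} (h : k ≤ j) :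
    D.eigenspace (j : ℂ) ≤ eigenFiltration D k :=
  le_iSup (fun j : {j : ℤ // k ≤ j} => D.eigenspace (j.1 : ℂ)) ⟨j, h⟩

theorem eigenFiltration_anti (D : Module.End ℂ L) {k j : ℤ} (h : k ≤ j) :
    eigenFiltration D j ≤ eigenFiltration D k :=
  iSup_le fun i => eigenspace_le_eigenFiltration D (h.trans i.2)

theorem disjoint_eigenFiltration (D : Module.End ℂ L) (k : ℤ) :
    Disjoint (D.eigenspace (k : ℂ)) (eigenFiltration D (k + 1)) := by
  refine (D.eigenspaces_iSupIndep (k : ℂ)).mono_right (iSup_le fun j => ?_)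
  refine le_iSup₂_of_le (j.1 : ℂ) ?_ le_rfl
  have := j.2
  exact_mod_cast (by omega : j.1 ≠ k)

theorem lie_mem_eigenspace {H y : L} {c : ℂ} (h : ⁅H, y⁆ = c • y) {d : ℂ} {w : L}
    (hw : w ∈ (LieAlgebra.ad ℂ L H).eigenspace d) :
    ⁅y, w⁆ ∈ (LieAlgebra.ad ℂ L H).eigenspace (d + c) := by
  rw [Module.End.mem_eigenspace_iff, LieAlgebra.ad_apply] at *
  rw [leibniz_lie, h, hw, smul_lie, lie_smul, add_smul, add_comm]

theorem lie_mem_eigenFiltration {H y : L} {h : ℤ} (hy : ⁅H, y⁆ = (h : ℂ) • y) (hh : 0 < h) {k : ℤ}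
    {w : L} (hw : w ∈ eigenFiltration (LieAlgebra.ad ℂ L H) k) :
    ⁅y, w⁆ ∈ eigenFiltration (LieAlgebra.ad ℂ L H) (k + 1) := by
  have : eigenFiltration (LieAlgebra.ad ℂ L H) k ≤
      (eigenFiltration (LieAlgebra.ad ℂ L H) (k + 1)).comap (LieAlgebra.ad ℂ L y) := by
    refine iSup_le fun j w hw => ?_
    have h1 := lie_mem_eigenspace hy hw
    rw [← Int.cast_add] at h1
    have := j.2
    exact eigenspace_le_eigenFiltration _ (by omega) h1
  exact this hw

theorem nilExp_sub_mem {V : Type*} [AddCommGroup V] [Module ℂ V] [FiniteDimensional ℂ V]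
    {f : Module.End ℂ V} {A B : Submodule ℂ V} (hBA : B ≤ A) (hf : ∀ y ∈ A, f y ∈ B) {y : V}
    (hy : y ∈ A) : nilExp f y - y ∈ B := by
  have hk : ∀ k, (f ^ (k + 1)) y ∈ B := by
    intro k
    induction k with
    | zero => simpa using hf y hy
    | succ k ih =>
      rw [pow_succ']
      exact hf _ (hBA ih)
  rw [nilExp_apply]
  rcases hn : Module.finrank ℂ V with _ | n
  · have := Module.finrank_zero_iff.1 hn
    rw [Subsingleton.elim y 0]
    simp
  · rw [Finset.sum_range_succ']
    simp only [pow_zero, Nat.factorial_zero, Nat.cast_one, inv_one, one_smul, Module.End.one_apply,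
      add_sub_cancel_right]
    exact B.sum_mem fun k _ => B.smul_mem _ (hk k)

/-- Bracketing with `e c` raises the filtration strictly, so modulo the next level the factors
`nilExp` act as the identity and the velocity reduces to `∑ v c • e c`. -/
theorem cellVelocity_mem [FiniteDimensional ℂ L] {e : Δ → L} {H : L} {h : Δ → ℤ}
    (hH : ∀ c, ⁅H, e c⁆ = (h c : ℂ) • e c) (hh : ∀ c, 0 < h c) {x v : Δ → ℂ} {k : ℤ}
    (hv : ∀ c, h c < k → v c = 0) (l : List Δ) :
    cellVelocity e x v l ∈ eigenFiltration (LieAlgebra.ad ℂ L H) k ∧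
      cellVelocity e x v l - (l.map fun c => v c • e c).sum ∈
        eigenFiltration (LieAlgebra.ad ℂ L H) (k + 1) := by
  have hle := eigenFiltration_anti (LieAlgebra.ad ℂ L H) (by omega : k ≤ k + 1)
  have h1 : ∀ c, v c • e c ∈ eigenFiltration (LieAlgebra.ad ℂ L H) k := by
    intro c
    by_cases hc : h c < k
    · rw [hv c hc, zero_smul]
      exact Submodule.zero_mem _
    · exact Submodule.smul_mem _ _ (eigenspace_le_eigenFiltration _ (not_lt.1 hc)
        (Module.End.mem_eigenspace_iff.2 (hH c)))
  induction l with
  | nil => simp [cellVelocity]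
  | cons c l ih =>
    have h2 := nilExp_sub_mem (f := x c • LieAlgebra.ad ℂ L (e c)) hle
      (fun y hy => Submodule.smul_mem _ (x c) (lie_mem_eigenFiltration (hH c) (hh c) hy)) ih.1
    rw [cellVelocity, List.map_cons, List.sum_cons]
    constructor
    · refine Submodule.add_mem _ (h1 c) ?_
      have := Submodule.add_mem _ (hle h2) ih.1
      rwa [sub_add_cancel] at this
    · have := Submodule.add_mem _ h2 ih.2
      rwa [sub_add_sub_cancel, ← add_sub_add_left_eq_sub _ _ (v c • e c)] at this

/-- The coordinates are an immersion. By induction on the level `k`, the leading part of a vanishing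
velocity is zero, and linear independence kills its coefficients. This makes the coefficients of the
vector field unique at every point. -/
theorem cellVelocity_injective [FiniteDimensional ℂ L] {e : Δ → L} (hli : LinearIndependent ℂ e)
    {H : L} {h : Δ → ℤ} (hH : ∀ c, ⁅H, e c⁆ = (h c : ℂ) • e c) (hh : ∀ c, 0 < h c) {x v : Δ → ℂ}
    {s : ℕ} (ord : Fin s ≃ Δ) (h0 : cellVelocity e x v (List.ofFn ord) = 0) : v = 0 := by
  classical
  let _ : Fintype Δ := Fintype.ofEquiv _ ord
  have hsum : ∀ f : Δ → L, ((List.ofFn ord).map f).sum = ∑ c, f c := by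
    intro f
    rw [List.map_ofFn, List.sum_ofFn]
    exact Equiv.sum_comp ord f
  have main : ∀ k : ℕ, ∀ c, h c < k → v c = 0 := by
    intro k
    induction k with
    | zero => exact fun c hc => absurd (hh c) (by push_cast at hc; omega)
    | succ k ih =>
      have h1 := (cellVelocity_mem hH hh (x := x) ih (List.ofFn ord)).2
      rw [h0, zero_sub, hsum, Submodule.neg_mem_iff] at h1
      have h2 : ∑ c, (if h c = k then v c else 0) • e c ∈
          eigenFiltration (LieAlgebra.ad ℂ L H) (k + 1) := by
        have h3 : ∑ c, (if h c = k then 0 else v c) • e c ∈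
            eigenFiltration (LieAlgebra.ad ℂ L H) (k + 1) := by
          refine Submodule.sum_mem _ fun c _ => ?_
          split_ifs with hc
          · rw [zero_smul]; exact Submodule.zero_mem _
          · rcases lt_or_gt_of_ne hc with hc | hc
            · rw [ih c hc, zero_smul]; exact Submodule.zero_mem _
            · exact Submodule.smul_mem _ _ (eigenspace_le_eigenFiltration _ (by omega)
                (Module.End.mem_eigenspace_iff.2 (hH c)))
        have h4 := Submodule.sub_mem _ h1 h3
        rw [← Finset.sum_sub_distrib] at h4
        refine Eq.mp (congrArg (· ∈ _) (Finset.sum_congr rfl fun c _ => ?_)) h4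
        split_ifs <;> simp
      have h3 : ∑ c, (if h c = k then v c else 0) • e c ∈
          (LieAlgebra.ad ℂ L H).eigenspace ((k : ℤ) : ℂ) := by
        refine Submodule.sum_mem _ fun c _ => ?_
        split_ifs with hc
        · refine Submodule.smul_mem _ _ (Module.End.mem_eigenspace_iff.2 ?_)
          rw [← hc]
          exact hH c
        · rw [zero_smul]; exact Submodule.zero_mem _
      have h4 := (Submodule.disjoint_def.1 (disjoint_eigenFiltration (LieAlgebra.ad ℂ L H) k)) _ h3 h2
      intro c hc
      rcases (by push_cast at hc; omega : h c < k ∨ h c = k) with hc | hc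
      · exact ih c hc
      · have := Fintype.linearIndependent_iff.1 hli _ h4 c
        rwa [if_pos hc] at this
  funext c
  exact main (h c + 1).toNat c (by have := hh c; omega)

/-- A semisimple inner derivation integrates to a one-parameter group. -/
theorem exists_torus {Δ : Type*} [FiniteDimensional ℂ L] {e : Δ → L} {H : L} {χ : Δ → ℂ}
    (hs : (LieAlgebra.ad ℂ L H).IsSemisimple) (hH : ∀ c, ⁅H, e c⁆ = χ c • e c) (r : ℂ) :
    ∃ τ : Module.End ℂ L, (∀ c y, τ ⁅e c, y⁆ = Complex.exp (r * χ c) • ⁅e c, τ y⁆) ∧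
      ∀ c, τ (e c) = Complex.exp (r * χ c) • e c := by
  classical
  set D := LieAlgebra.ad ℂ L H with hD
  -- The torus element is a polynomial in `ad H` interpolating `e^{rμ}` at the finitely many
  -- eigenvalues `μ`.
  obtain ⟨p, hp⟩ : ∃ p : Polynomial ℂ, ∀ μ, D.HasEigenvalue μ → p.eval μ = Complex.exp (r * μ) := by
    have hfin : {μ | D.HasEigenvalue μ}.Finite := D.finite_hasEigenvalue
    refine ⟨Lagrange.interpolate hfin.toFinset id fun μ => Complex.exp (r * μ), fun μ hμ => ?_⟩
    exact Lagrange.eval_interpolate_at_node _ (Set.injOn_id _) (by simpa using hμ)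
  have key : ∀ μ, ∀ y ∈ D.eigenspace μ, Polynomial.aeval D p y = Complex.exp (r * μ) • y := by
    intro μ y hy
    by_cases h0 : y = 0
    · simp [h0]
    · have hv : D.HasEigenvector μ y := ⟨hy, h0⟩
      rw [Module.End.aeval_apply_of_hasEigenvector hv, hp μ (Module.End.hasEigenvalue_of_hasEigenvector hv)]
  refine ⟨Polynomial.aeval D p, fun c y => ?_, fun c =>
    key _ _ (Module.End.mem_eigenspace_iff.2 (hH c))⟩
  have hy : y ∈ ⨆ μ, D.eigenspace μ := by rw [hs.iSup_eigenspace_eq_top]; trivial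
  induction hy using Submodule.iSup_induction' with
  | mem μ y hy =>
    rw [key _ _ (lie_mem_eigenspace (hH c) hy), key _ _ hy, lie_smul, smul_smul, ← Complex.exp_add]
    congr 2
    ring
  | zero => simp
  | add y z _ _ h1 h2 => rw [lie_add, map_add, map_add, h1, h2, lie_add, smul_add]

/-- For a monomial of a different weight, `r` can be chosen so that its scaling factor is twice
`e^{rw}`; comparing coefficients then rules the monomial out. -/
theorem isWeightedHomogeneous_of_scale [Fintype Δ] {χ : Δ → ℂ} {w : ℂ} {p : MvPolynomial Δ ℂ}
    (h : ∀ (r : ℂ) (x : Δ → ℂ), eval (fun c => Complex.exp (r * χ c) * x c) p =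
      Complex.exp (r * w) * eval x p) : IsWeightedHomogeneous χ p w := by
  classical
  intro d hd
  by_contra hne
  have hne' : Finsupp.weight χ d - w ≠ 0 := sub_ne_zero.2 hne
  obtain ⟨r, hr⟩ : ∃ r : ℂ, r = Complex.log 2 / (Finsupp.weight χ d - w) := ⟨_, rfl⟩
  have hq : (∑ d ∈ p.support, monomial d ((Complex.exp (r * Finsupp.weight χ d) -
      Complex.exp (r * w)) * coeff d p)) = 0 := by
    refine MvPolynomial.funext fun x => ?_
    have h1 := h r x
    rw [eval_eq', eval_eq', Finset.mul_sum, ← sub_eq_zero, ← Finset.sum_sub_distrib] at h1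
    rw [map_sum, map_zero, ← h1]
    refine Finset.sum_congr rfl fun d _ => ?_
    rw [eval_monomial, Finsupp.prod_fintype _ _ (by simp), Finsupp.weight_apply,
      Finsupp.sum_fintype _ _ (by simp), Finset.mul_sum, Complex.exp_sum]
    simp only [mul_pow, Finset.prod_mul_distrib, ← Complex.exp_nat_mul]
    have e : ∀ c, (d c : ℂ) * (r * χ c) = r * d c • χ c := fun c => by rw [nsmul_eq_mul]; ring
    simp only [e]
    ring
  have h2 := congrArg (coeff d) hq
  rw [coeff_sum, coeff_zero, Finset.sum_eq_single d] at h2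
  · rw [coeff_monomial, if_pos rfl] at h2
    have h3 := (mul_eq_zero.1 h2).resolve_right hd
    rw [sub_eq_zero] at h3
    have h4 : Complex.exp (r * (Finsupp.weight χ d - w)) = 1 := by
      rw [mul_sub, Complex.exp_sub, h3, div_self (Complex.exp_ne_zero _)]
    rw [hr, div_mul_cancel₀ _ hne', Complex.exp_log two_ne_zero] at h4
    norm_num at h4
  · intro d' _ hd'
    rw [coeff_monomial, if_neg hd']
  · intro hd'
    rw [notMem_support_iff.1 hd', mul_zero, monomial_zero, coeff_zero]

/-- The coefficients of the vector field of a root vector are homogeneous for every semisimple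
element that normalizes all the root vectors. -/
theorem isWeightedHomogeneous_leftField [Fintype Δ] [FiniteDimensional ℂ L]
    [LieModule.IsFaithful ℂ L L] {s : ℕ} (ord : Fin s ≃ Δ) {e : Δ → L}
    (he : ∀ c, IsNilpotent (LieAlgebra.ad ℂ L (e c))) (hli : LinearIndependent ℂ e) {H₀ : L}
    {h : Δ → ℤ} (hH₀ : ∀ c, ⁅H₀, e c⁆ = (h c : ℂ) • e c) (hh : ∀ c, 0 < h c) {H : L} {χ : Δ → ℂ}
    (hs : (LieAlgebra.ad ℂ L H).IsSemisimple) (hH : ∀ c, ⁅H, e c⁆ = χ c • e c) (a b : Δ) :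
    IsWeightedHomogeneous χ (leftField ord e (e a) b) (χ b - χ a) := by
  unfold leftField
  split_ifs with hv
  · have hv' := IsInfinitesimalLeftAction.cellVelocity_eq he (he a) hv.choose_spec
    generalize hv.choose = v at hv'
    refine isWeightedHomogeneous_of_scale fun r x => ?_
    -- The torus carries the equation at `x` to the equation at the rescaled point, with `e a`
    -- multiplied by `e^{rχ_a}`; uniqueness of the velocity then yields the scaling law of the
    -- coefficients.
    obtain ⟨τ, hτ, hτe⟩ := exists_torus hs hH r
    have h1 := congrArg τ (hv' x)
    rw [cellVelocity_scale hτ hτe, map_neg, hτe, ← smul_neg,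
      ← hv' (fun c => Complex.exp (r * χ c) * x c), ← cellVelocity_smul, ← sub_eq_zero,
      ← cellVelocity_sub] at h1
    have h2 := congrFun (cellVelocity_injective hli hH₀ hh ord h1) b
    simp only [Pi.sub_apply, Pi.smul_apply, smul_eq_mul, Pi.zero_apply] at h2
    rw [sub_eq_zero] at h2
    rw [mul_sub, Complex.exp_sub, div_mul_eq_mul_div, h2, mul_div_cancel_left₀ _
      (Complex.exp_ne_zero _)]
  -- If no polynomial vector field solves the equation, `leftField` is `0` and homogeneous of every
  -- weight.
  · exact isWeightedHomogeneous_zero ℂ χ _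

theorem isWeightedHomogeneous_intCast {h : Δ → ℤ} {w : ℤ} {p : MvPolynomial Δ ℂ}
    (hp : IsWeightedHomogeneous (fun c => (h c : ℂ)) p (w : ℂ)) : IsWeightedHomogeneous h p w := by
  intro d hd
  have := hp hd
  rw [Finsupp.weight_apply, Finsupp.sum] at this ⊢
  simp only [nsmul_eq_mul] at this ⊢
  exact_mod_cast this

/-- A monomial containing `x^b` has weight at least `h b`, which exceeds `h b - k`. This excludes
contractions within a current. -/
theorem apply_eq_zero_of_isWeightedHomogeneous_sub [Fintype Δ] {S : Δ → MvPolynomial Δ ℂ} {h : Δ → ℤ} {k : ℤ}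
    (hh : ∀ c, 0 < h c) (hk : 0 < k) (hS : ∀ b, IsWeightedHomogeneous h (S b) (h b - k)) (b : Δ)
    {d : Δ →₀ ℕ} (hd : d ∈ (S b).support) : d b = 0 := by
  have h1 := hS b (mem_support_iff.1 hd)
  rw [Finsupp.weight_apply, Finsupp.sum_fintype _ _ (by simp)] at h1
  by_contra h0
  have h2 : d b • h b ≤ ∑ c, d c • h c :=
    Finset.single_le_sum (f := fun c => d c • h c) (fun c _ => nsmul_nonneg (hh c).le _)
      (Finset.mem_univ b)
  have h3 : (1 : ℤ) ≤ d b := by exact_mod_cast Nat.one_le_iff_ne_zero.2 h0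
  rw [nsmul_eq_mul, h1] at h2
  nlinarith [hh b]

end


/-! ### Root vectors: height grading, nilpotency, independence. -/

section

variable {𝔤 : Type*} [LieRing 𝔤] [LieAlgebra ℂ 𝔤] [FiniteDimensional ℂ 𝔤]
  [LieAlgebra.IsKilling ℂ 𝔤] {𝔥 : LieSubalgebra ℂ 𝔤} [𝔥.IsCartanSubalgebra]
  (b : (LieAlgebra.IsKilling.rootSystem 𝔥).Base)

/-- The element on which all simple roots take the value `1`. Its eigenvalues supply both the
filtration for uniqueness and the integer charge. -/
theorem exists_rootVal_eq_height :
    ∃ H : 𝔥, ∀ a : PosRoot b, rootVal b H a = (b.height a.1 : ℂ) := by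
  obtain ⟨H, hH⟩ := (Module.evalEquiv ℂ 𝔥).surjective (b.toWeightBasis.constr ℂ fun _ => (1 : ℂ))
  have h1 : ∀ i ∈ b.support, (LieAlgebra.IsKilling.rootSystem 𝔥).root i H = 1 := by
    intro i hi
    have := LinearMap.congr_fun hH (b.toWeightBasis ⟨i, hi⟩)
    rw [Module.Basis.constr_basis] at this
    simpa using this
  refine ⟨H, fun a => ?_⟩
  obtain ⟨f, -, -, hf⟩ := b.exists_root_eq_sum_int a.1
  rw [RootPairing.Base.height_eq_sum hf]
  have h2 := LinearMap.congr_fun hf H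
  rw [LinearMap.sum_apply] at h2
  have h3 : rootVal b H a = (LieAlgebra.IsKilling.rootSystem 𝔥).root a.1 H := rfl
  rw [h3, h2, Int.cast_sum]
  refine Finset.sum_congr rfl fun i hi => ?_
  rw [LinearMap.smul_apply, h1 i hi]
  simp


theorem lie_rootVector {e : PosRoot b → 𝔤}
    (he : ∀ a : PosRoot b, e a ∈ LieAlgebra.rootSpace 𝔥 (a.1.1 : 𝔥 → ℂ) ∧ e a ≠ 0) (H : 𝔥) (a : PosRoot b) : ⁅(H : 𝔤), e a⁆ = rootVal b H a • e a :=
  LieAlgebra.IsKilling.lie_eq_smul_of_mem_rootSpace (he a).1 H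

theorem isNilpotent_ad_rootVector {e : PosRoot b → 𝔤}
    (he : ∀ a : PosRoot b, e a ∈ LieAlgebra.rootSpace 𝔥 (a.1.1 : 𝔥 → ℂ) ∧ e a ≠ 0) (a : PosRoot b) : IsNilpotent (LieAlgebra.ad ℂ 𝔤 (e a)) := by
  refine LieAlgebra.isNilpotent_ad_of_mem_rootSpace (H := 𝔥) ?_ (he a).1
  simp

theorem linearIndependent_rootVector {e : PosRoot b → 𝔤}
    (he : ∀ a : PosRoot b, e a ∈ LieAlgebra.rootSpace 𝔥 (a.1.1 : 𝔥 → ℂ) ∧ e a ≠ 0) : LinearIndependent ℂ e := by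
  have h := LieModule.iSupIndep_genWeightSpace' ℂ 𝔥 𝔤
  have h2 : iSupIndep fun a : PosRoot b =>
      (LieAlgebra.rootSpace 𝔥 (a.1.1 : 𝔥 → ℂ)).toSubmodule := by
    have h3 := (LieSubmodule.iSupIndep_toSubmodule.2 h)
    exact h3.comp (f := fun a : PosRoot b => a.1.1) fun x y hxy => Subtype.ext (Subtype.ext hxy)
  exact h2.linearIndependent _ (fun a => (he a).1) fun a => (he a).2

theorem isWeightedHomogeneous_leftField_rootVal {e : PosRoot b → 𝔤}
    (he : ∀ a : PosRoot b, e a ∈ LieAlgebra.rootSpace 𝔥 (a.1.1 : 𝔥 → ℂ) ∧ e a ≠ 0) {s : ℕ} (ord : Fin s ≃ PosRoot b) (H : 𝔥)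
    (a c : PosRoot b) : IsWeightedHomogeneous (rootVal b H) (leftField ord e (e a) c)
      (rootVal b H c - rootVal b H a) := by
  obtain ⟨H₀, hH₀⟩ := exists_rootVal_eq_height b
  exact isWeightedHomogeneous_leftField ord (isNilpotent_ad_rootVector b he)
    (linearIndependent_rootVector b he) (H₀ := H₀) (h := fun a => b.height a.1)
    (fun c => by rw [lie_rootVector b he, hH₀]) (fun c => c.2)
    (LieAlgebra.IsKilling.isSemisimple_ad_of_mem_isCartanSubalgebra H.2)
    (lie_rootVector b he H) a c

theorem isWeightedHomogeneous_leftField_height {e : PosRoot b → 𝔤}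
    (he : ∀ a : PosRoot b, e a ∈ LieAlgebra.rootSpace 𝔥 (a.1.1 : 𝔥 → ℂ) ∧ e a ≠ 0) {s : ℕ} (ord : Fin s ≃ PosRoot b)
    (a c : PosRoot b) : IsWeightedHomogeneous (fun a : PosRoot b => b.height a.1)
      (leftField ord e (e a) c) (b.height c.1 - b.height a.1) := by
  obtain ⟨H₀, hH₀⟩ := exists_rootVal_eq_height b
  refine isWeightedHomogeneous_intCast ?_
  have := isWeightedHomogeneous_leftField_rootVal b he ord H₀ a c
  rw [funext hH₀] at this
  push_cast
  exact this

end


/-! ### Correlators of screening currents -/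

section

variable {Δ : Type*} [Fintype Δ]

/-- The general formula for one point without currents; the vector field `0` and `J₀ = ∅` are
placeholders. -/
theorem ghostCorr_gamma {q : ℂ} (hq : q ≠ 0) (hq1 : ‖q‖ < 1) {c : Δ → ℂ}
    (h1 : ∀ a, ‖Complex.exp (-c a)‖ < 1) (h2 : ∀ a, ‖q‖ < ‖Complex.exp (-c a)‖) {z : ℂ} (hz : z ≠ 0)
    (P : MvPolynomial Δ ℂ) :
    Summable (ghostTraceTerm q c ![rename Sum.inl P] ![z]) ∧
      ghostCorr q c ![rename Sum.inl P] ![z] = (∑' d, ghostWeight q c d) * coeff 0 P := by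
  have hS : NoSelfContraction (fun (_ : Fin 1) (_ : Δ) => (0 : MvPolynomial Δ ℂ)) := by
    intro k b d hd
    simp at hd
  have hu : ∀ k, ![z] k ≠ 0 := fun k => by
    rw [Subsingleton.elim k 0]
    exact hz
  have hgeo : ∀ i j : Fin 1, i < j → ‖q‖ * ‖![z] i‖ < ‖![z] j‖ ∧ ‖![z] j‖ < ‖![z] i‖ :=
    fun i j hij => absurd hij (by omega)
  have hV := contractionRules_forestSum (q := q) (c := c) (u := ![z])
    (S := fun (_ : Fin 1) (_ : Δ) => (0 : MvPolynomial Δ ℂ)) (κ := fun _ => 0) (J₀ := ∅)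
    (fun j b => isWeightedHomogeneous_zero ℂ c _)
    (fayIdentity_chainKern hq hq1 hu hgeo fun A hA hA0 =>
      absurd (Finset.subset_empty.1 hA) hA0.ne_empty)
  have h := stateCorr_eq hq hq1 h1 h2 hu hgeo hS (h := fun _ => 0) (k := fun _ => 1)
    (fun _ => one_pos) (fun j b => isWeightedHomogeneous_zero ℂ _ _) hV (Finset.empty_subset _)
    fun _ => P
  have e : stateSymbol (fun (_ : Fin 1) (_ : Δ) => (0 : MvPolynomial Δ ℂ)) ∅ (fun _ => P) =
      ![rename Sum.inl P] := by
    funext k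
    rw [Subsingleton.elim k 0]
    simp [stateSymbol]
  have h3 := summable_stateCorr hS h.1
  have h4 := h.2
  rw [stateCorr, e] at h4
  rw [e] at h3
  refine ⟨h3, h4.trans ?_⟩
  congr 1
  have : (∅ : Finset (Fin 1))ᶜ = {0} := by decide
  rw [forestSum, this, Finset.prod_singleton, coeff_setSeries, chainSum_empty]

/-- Only `z` lies outside the set of currents, so the forest sum is one chain sum ending in `z`. The
partition function is kept next to the value at `0`, since together they form the correlator of the
differentiated polynomial. -/
theorem ghostCorr_screening {q : ℂ} {c : Δ → ℂ} {m : ℕ} {z : ℂ} {t : Fin m → ℂ}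
    (hd : TraceDomain q c z t) {κ : Fin m → ℂ} (hκ : KernelParamsRegular q κ)
    {S : Fin m → Δ → MvPolynomial Δ ℂ} {h : Δ → ℤ} (hh : ∀ a, 0 < h a) {k : Fin m → ℤ}
    (hk : ∀ j, 0 < k j) (hSh : ∀ j b, IsWeightedHomogeneous h (S j b) (h b - k j))
    (hSc : ∀ j b, IsWeightedHomogeneous c (S j b) (c b - κ j)) (P : MvPolynomial Δ ℂ) :
    Summable (ghostTraceTerm q c (Fin.cons (rename Sum.inl P) fun i => currentSymbol (S i))
      (Fin.cons z t)) ∧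
    ghostCorr q c (Fin.cons (rename Sum.inl P) fun i => currentSymbol (S i)) (Fin.cons z t) =
      ∑ σ : Equiv.Perm (Fin m), kernelChain q κ t z σ *
        ((∑' d, ghostWeight q c d) *
          coeff 0 ((List.ofFn fun j => (mkDerivation ℂ (S (σ j)) :
            MvPolynomial Δ ℂ → MvPolynomial Δ ℂ)).foldr (fun D Q => D Q) P)) := by
  obtain ⟨hq, hq1, hz, hc, ht, hlt⟩ := hd
  have ht0 : ∀ i, t i ≠ 0 := fun i => norm_pos_iff.1 ((norm_nonneg _).trans_lt (ht i).1)
  have hq0 : 0 < ‖q‖ := norm_pos_iff.2 hq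
  set u : Fin (m + 1) → ℂ := Fin.cons z t with hu_def
  have hu : ∀ k, u k ≠ 0 := Fin.cases hz ht0
  have hgeo : ∀ i j, i < j → ‖q‖ * ‖u i‖ < ‖u j‖ ∧ ‖u j‖ < ‖u i‖ := by
    intro i j hij
    obtain ⟨j, rfl⟩ := Fin.exists_succ_eq.2 (Fin.pos_iff_ne_zero.1 (lt_of_le_of_lt (Fin.zero_le i) hij))
    have hj := ht j
    rw [norm_mul] at hj
    induction i using Fin.cases with
    | zero => exact hj
    | succ i =>
      simp only [hu_def, Fin.cons_succ]
      refine ⟨lt_of_le_of_lt ?_ hj.1, hlt i j (Fin.succ_lt_succ_iff.1 hij)⟩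
      exact mul_le_mul_of_nonneg_left (ht i).2.le hq0.le
  -- The point `z` has index `0`, where vector field, parameter and charge are placeholders; the
  -- charge is `1` because charges have to be positive.
  let S' : Fin (m + 1) → Δ → MvPolynomial Δ ℂ := Fin.cons (fun _ => 0) S
  let κ' : Fin (m + 1) → ℂ := Fin.cons 0 κ
  let k' : Fin (m + 1) → ℤ := Fin.cons 1 k
  let J : Finset (Fin (m + 1)) := Finset.univ.image Fin.succ
  have hS : NoSelfContraction S' := by
    intro j
    induction j using Fin.cases with
    | zero => intro b d hd; simp [S'] at hd
    | succ j => exact fun b d hd => apply_eq_zero_of_isWeightedHomogeneous_sub hh (hk j) (hSh j) b hd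
  have hk' : ∀ j, 0 < k' j := Fin.cases one_pos hk
  have hSh' : ∀ j b, IsWeightedHomogeneous h (S' j b) (h b - k' j) := by
    intro j
    induction j using Fin.cases with
    | zero => exact fun b => isWeightedHomogeneous_zero ℂ h _
    | succ j => exact hSh j
  have hSc' : ∀ j b, IsWeightedHomogeneous c (S' j b) (c b - κ' j) := by
    intro j
    induction j using Fin.cases with
    | zero => exact fun b => isWeightedHomogeneous_zero ℂ c _
    | succ j => exact hSc j
  have hκ' : ∀ A ⊆ J, A.Nonempty → ∀ n : ℤ, Complex.exp (∑ i ∈ A, κ' i) ≠ q ^ n := by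
    intro A hA hA0 n
    obtain ⟨I, -, rfl⟩ := Finset.subset_image_iff.1 hA
    rw [Finset.sum_image fun x _ y _ hxy => Fin.succ_injective m hxy]
    exact hκ I (Finset.image_nonempty.1 hA0) n
  have hmain := stateCorr_eq hq hq1 (fun a => (hc a).2) (fun a => (hc a).1) hu hgeo hS hk' hSh'
    (contractionRules_forestSum hSc' (fayIdentity_chainKern hq hq1 hu hgeo hκ'))
    (Finset.Subset.refl J) fun _ => P
  have e : stateSymbol S' J (fun _ => P) =
      Fin.cons (rename Sum.inl P) fun i => currentSymbol (S i) := by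
    funext j
    induction j using Fin.cases with
    | zero => simp [stateSymbol, J]
    | succ j => simp [stateSymbol, J, S']
  have h3 := summable_stateCorr hS hmain.1
  have h4 := hmain.2
  rw [stateCorr, e] at h4
  rw [e] at h3
  refine ⟨h3, h4.trans ?_⟩
  have hJ : Jᶜ = {0} := by
    ext j
    induction j using Fin.cases <;> simp [J]
  rw [forestSum, hJ, Finset.prod_singleton, coeff_setSeries,
    chainSum_eq_sum_perm _ κ' S' (Fin.succ_injective m), Finset.mul_sum]
  refine Finset.sum_congr rfl fun σ _ => ?_
  rw [mul_left_comm]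
  congr 1
  unfold kernelChain
  refine Finset.prod_congr rfl fun j _ => ?_
  set i : Fin (m + 1) := (Fin.snoc (fun k => (σ k).succ) 0 : Fin (m + 1) → Fin (m + 1)) j.succ
    with hi
  have hui : u i = (Fin.snoc (fun k => t (σ k)) z : Fin (m + 1) → ℂ) j.succ := by
    rw [hi]
    induction j.succ using Fin.lastCases with
    | last => simp [hu_def]
    | cast k => simp [hu_def]
  have hne : i ≠ (σ j).succ := by
    rw [hi]
    rcases Fin.eq_castSucc_or_eq_last j.succ with ⟨l, hl⟩ | hl
    · rw [hl, Fin.snoc_castSucc]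
      intro h0
      have h5 := congrArg Fin.val hl
      rw [σ.injective (Fin.succ_injective m h0)] at h5
      simp at h5
    · rw [hl, Fin.snoc_last]
      exact (Fin.succ_ne_zero _).symm
  have hn : ‖q‖ * ‖u (σ j).succ‖ < ‖u i‖ ∧ ‖q‖ * ‖u i‖ < ‖u (σ j).succ‖ ∧
      ‖u i‖ ≠ ‖u (σ j).succ‖ := by
    have hle : ∀ i, ‖q‖ * ‖u i‖ < ‖u i‖ := fun i =>
      mul_lt_of_lt_one_left (norm_pos_iff.2 (hu i)) hq1
    rcases lt_or_gt_of_ne hne with h0 | h0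
    · have := hgeo _ _ h0
      exact ⟨(hle _).trans this.2, this.1, this.2.ne'⟩
    · have := hgeo _ _ h0
      exact ⟨this.1, (hle _).trans this.2, this.2.ne⟩
  have hsum : ∑ k ∈ Finset.Iic j, κ' (σ k).succ = ∑ k ∈ Finset.Iic j, κ (σ k) := rfl
  have hreg : ∀ n : ℤ, Complex.exp (∑ k ∈ Finset.Iic j, κ (σ k)) ≠ q ^ n := by
    intro n
    have := hκ ((Finset.Iic j).map σ.toEmbedding) ((Finset.nonempty_Iic).map) n
    rwa [Finset.sum_map] at this
  rw [hsum, chainKern_eq_neg_wKernel hq hq1 hreg (hu _) hn.1 hn.2.1 hn.2.2, hui]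
  rfl

end

theorem scrOp_eq_mkDerivation {𝔤 : Type*} [LieRing 𝔤] [LieAlgebra ℂ 𝔤] {Δ : Type*} [Fintype Δ]
    {s : ℕ} (ord : Fin s ≃ Δ) (e : Δ → 𝔤) (a : Δ) :
    scrOp ord e a = fun P => mkDerivation ℂ (leftField ord e (e a)) P := by
  funext P
  rw [scrOp, mkDerivation_eq_sum]

theorem mainTheorem6 {𝔤 : Type*} [LieRing 𝔤] [LieAlgebra ℂ 𝔤] [FiniteDimensional ℂ 𝔤]
    [LieAlgebra.IsSimple ℂ 𝔤] (𝔥 : LieSubalgebra ℂ 𝔤) [𝔥.IsCartanSubalgebra]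
    (b : (LieAlgebra.IsKilling.rootSystem 𝔥).Base)
    {s : ℕ} (ord : Fin s ≃ PosRoot b)
    (e : PosRoot b → 𝔤)
    (he : ∀ a : PosRoot b, e a ∈ LieAlgebra.rootSpace 𝔥 (a.1.1 : 𝔥 → ℂ) ∧ e a ≠ 0)
    {m : ℕ} (α : Fin m → PosRoot b) (P : MvPolynomial (PosRoot b) ℂ) :
    -- the identity between convergent traces
    (∀ (q : ℂ) (H : 𝔥) (z : ℂ) (t : Fin m → ℂ),
      TraceDomain q (rootVal b H) z t →
      KernelParamsRegular q (fun i => rootVal b H (α i)) →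
      Summable (ghostTraceTerm q (rootVal b H) (scrFields ord e P α) (Fin.cons z t)) ∧
      (∀ σ : Equiv.Perm (Fin m),
        Summable (ghostTraceTerm q (rootVal b H)
          ![rename Sum.inl ((List.ofFn fun i => scrOp ord e (α (σ i))).foldr (fun S Q => S Q) P)]
          ![z])) ∧
      ghostCorr q (rootVal b H) (scrFields ord e P α) (Fin.cons z t) =
        ∑ σ : Equiv.Perm (Fin m),
          kernelChain q (fun i => rootVal b H (α i)) t z σ *
            ghostCorr q (rootVal b H)
              ![rename Sum.inl
                ((List.ofFn fun i => scrOp ord e (α (σ i))).foldr (fun S Q => S Q) P)]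
              ![z]) ∧
    -- the same identity between the analytic continuations of the traces, along any connected
    -- holomorphic family of parameters that avoids the poles of the kernels
    (∀ (E : Type) [NormedAddCommGroup E] [NormedSpace ℂ E] (U : Set E)
      (q : E → ℂ) (H : E → 𝔥) (z : E → ℂ) (t : E → Fin m → ℂ)
      (F : E → ℂ) (G : Equiv.Perm (Fin m) → E → ℂ) (p : E),
      IsOpen U → IsPreconnected U →
      DifferentiableOn ℂ q U → (∀ a, DifferentiableOn ℂ (fun y => rootVal b (H y) a) U) →
      DifferentiableOn ℂ z U → DifferentiableOn ℂ t U →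
      (∀ y ∈ U, q y ≠ 0 ∧ ‖q y‖ < 1 ∧ DistinctOnCurve (q y) (z y) (t y) ∧
        KernelParamsRegular (q y) (fun i => rootVal b (H y) (α i))) →
      DifferentiableOn ℂ F U → (∀ σ, DifferentiableOn ℂ (G σ) U) →
      p ∈ U → TraceDomain (q p) (rootVal b (H p)) (z p) (t p) →
      (∀ᶠ y in 𝓝 p, F y =
        ghostCorr (q y) (rootVal b (H y)) (scrFields ord e P α) (Fin.cons (z y) (t y))) →
      (∀ σ, ∀ᶠ y in 𝓝 p, G σ y =
        ghostCorr (q y) (rootVal b (H y))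
          ![rename Sum.inl ((List.ofFn fun i => scrOp ord e (α (σ i))).foldr (fun S Q => S Q) P)]
          ![z y]) →
      ∀ y ∈ U, F y =
        ∑ σ : Equiv.Perm (Fin m),
          kernelChain (q y) (fun i => rootVal b (H y) (α i)) (t y) (z y) σ * G σ y) := by
  have key : ∀ (q : ℂ) (H : 𝔥) (z : ℂ) (t : Fin m → ℂ), TraceDomain q (rootVal b H) z t →
      KernelParamsRegular q (fun i => rootVal b H (α i)) →
      Summable (ghostTraceTerm q (rootVal b H) (scrFields ord e P α) (Fin.cons z t)) ∧
      (∀ σ : Equiv.Perm (Fin m),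
        Summable (ghostTraceTerm q (rootVal b H)
          ![rename Sum.inl ((List.ofFn fun i => scrOp ord e (α (σ i))).foldr (fun S Q => S Q) P)]
          ![z])) ∧
      ghostCorr q (rootVal b H) (scrFields ord e P α) (Fin.cons z t) =
        ∑ σ : Equiv.Perm (Fin m),
          kernelChain q (fun i => rootVal b H (α i)) t z σ *
            ghostCorr q (rootVal b H)
              ![rename Sum.inl
                ((List.ofFn fun i => scrOp ord e (α (σ i))).foldr (fun S Q => S Q) P)]
              ![z] := by
    intro q H z t hd hκ
    have h1 := fun Q => ghostCorr_gamma hd.1 hd.2.1 (fun a => (hd.2.2.2.1 a).2)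
      (fun a => (hd.2.2.2.1 a).1) hd.2.2.1 Q
    have h2 := ghostCorr_screening hd hκ (S := fun i => leftField ord e (e (α i)))
      (h := fun a => b.height a.1) (k := fun i => b.height (α i).1) (fun a => a.2)
      (fun i => (α i).2) (fun j c => isWeightedHomogeneous_leftField_height b he ord (α j) c)
      (fun j c => isWeightedHomogeneous_leftField_rootVal b he ord H (α j) c) P
    refine ⟨h2.1, fun σ => (h1 _).1, h2.2.trans (Finset.sum_congr rfl fun σ _ => ?_)⟩
    rw [(h1 _).2]
    simp only [scrOp_eq_mkDerivation]
  refine ⟨key, ?_⟩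
  intro E _ _ U q H z t F G p hU hUc hq hH hz ht hreg hF hG hp hd hFp hGp
  have hAt : ∀ {f : E → ℂ} {y : E}, DifferentiableOn ℂ f U → y ∈ U → DifferentiableAt ℂ f y :=
    fun hf hy => hf.differentiableAt (hU.mem_nhds hy)
  have ht' : ∀ i, DifferentiableOn ℂ (fun y => t y i) U := fun i y hy =>
    differentiableWithinAt_pi.1 (ht y hy) i
  have hdiff : DifferentiableOn ℂ (fun y => F y - ∑ σ : Equiv.Perm (Fin m),
      kernelChain (q y) (fun i => rootVal b (H y) (α i)) (t y) (z y) σ * G σ y) U := by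
    refine hF.sub (DifferentiableOn.fun_sum fun σ _ => DifferentiableOn.mul (fun y hy => ?_) (hG σ))
    obtain ⟨h1, h2, h3, h4⟩ := hreg y hy
    exact (differentiableAt_kernelChain (hAt hq hy) (fun i => hAt (hH (α i)) hy)
      (fun i => hAt (ht' i) hy) (hAt hz hy) h1 h2 h3 h4 σ).differentiableWithinAt
  -- The trace domain is open, so the identity of convergent traces holds on a whole neighbourhood
  -- of `p`.
  have hnear := eventually_traceDomain (hAt hq hp).continuousAt
    (fun a => (hAt (hH a) hp).continuousAt) (hAt hz hp).continuousAt
    (fun i => (hAt (ht' i) hp).continuousAt) hd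
  have h0 : ∀ᶠ y in 𝓝 p, F y - ∑ σ : Equiv.Perm (Fin m),
      kernelChain (q y) (fun i => rootVal b (H y) (α i)) (t y) (z y) σ * G σ y = 0 := by
    filter_upwards [hFp, Filter.eventually_all.2 hGp, hnear, hU.mem_nhds hp] with y h1 h2 h3 h4
    rw [h1, (key (q y) (H y) (z y) (t y) h3 (hreg y h4).2.2.2).2.2, sub_eq_zero]
    exact Finset.sum_congr rfl fun σ _ => by rw [h2 σ]
  intro y hy
  exact sub_eq_zero.1 (eqOn_zero_of_isPreconnected_of_differentiableOn hU hUc hdiff hp h0 y hy)
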